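/- **Setting.** Let $m,n\ge 1$, $d=m+n$, and let $\mathbf r\in\mathbb R^m_{>0}$, $\mathbf s\in\mathbb R^n_{>0}$ be weights with $r_1\ge\dots\ge r_m$, $s_1\ge\dots\ge s_n$, $\sum_i r_i=\sum_j s_j=1$. Put $\|x\|_{\mathbf r}=\max_i|x_i|^{1/r_i}$, $\|y\|_{\mathbf s}=\max_j|y_j|^{1/s_j}$, $\langle x\rangle_{\mathbf r}=\inf_{p\in\mathbb Z^m}\|x-p\|_{\mathbf r}$. For $A\in M_{m,n}(\mathbb R)$ and $\epsilon>0$ let $$\mathrm{Bad}_A(\epsilon)=\Big\{b\in\mathbb R^m:\ \liminf_{q\in\mathbb Z^n,\ \|q\|_{\mathbf s}\to\infty}\|q\|_{\mathbf s}\,\langle Aq-b\rangle_{\mathbf r}\ge\epsilon\Big\},$$ and call $(A,b)$ rational if $Aq-b+p=0$ for some $p\in\mathbb Z^m$, $q\in\mathbb Z^n$, irrational otherwise. Let $X=\mathrm{SL}_d(\mathbb R)/\mathrm{SL}_d(\mathbb Z)$, $Y=\mathrm{ASL}_d(\mathbb R)/\mathrm{ASL}_d(\mathbb Z)$ with $\mathrm{ASL}_d(\mathbb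 R)=\{\begin{pmatrix}g&v\\0&1\end{pmatrix}:g\in \mathrm{SL}_d(\mathbb R),v\in\mathbb R^d\}$ and $\mathrm{ASL}_d(\mathbb Z)$ its subgroup of integral elements; let $\pi:Y\to X$ be the projection, $\overline X,\overline Y$ the one-point compactifications, $a_t=\mathrm{diag}(e^{r_1t},\dots,e^{r_mt},e^{-s_1t},\dots,e^{-s_nt})$ and $a=a_1$. These act on $X$, $Y$, and on $\overline X$, $\overline Y$ fixing $\infty$; $\pi$ is extended by $\pi(\infty)=\infty$. For $y=\begin{pmatrix}g&v\\0&1\end{pmatrix}\mathrm{ASL}_d(\mathbb Z)$ let $\Lambda_y=g\mathbb Z^d+v$, and let $$\mathcal L_\epsilon=\{y\in Y:\ \max(\|x_1\|_{\mathbf r}^{d/m},\|x_2\|_{\mathbf s}^{d/n})\ge\epsilon\text{ for all }(x_1,x_2)\in\Lambda_y\subset\mathbb R^m\times\mathbb R^n\}.$$ Let $x_A=\begin{pmatrix}I_m&A\\0&I_n\end{pmatrix}\mathrm{SL}_d(\mathbb Z)$. A point $x\in X$ has $\delta$-escape of mass on average if $\liminf_N\frac1N|\{\ell\in\{1,\dots,N\}:a_\ell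 x\notin Q\}|\ge\delta$ for every compact $Q\subset X$; let $\eta_A=\sup\{\eta: x_A\text{ has }\eta\text{-escape of mass on average}\}$. A limit measure of $x_A$ is a probability measure on $\overline X$ that is the weak-* limit of $\frac1{k_i}\sum_{k=0}^{k_i-1}\delta_{a^kx_A}$ for some $k_1<k_2<\cdots$. Let $W=\{w(b):b\in\mathbb R^m\}\subset \mathrm{ASL}_d(\mathbb R)$ be the group of translations $w(b)$ by $(b,0)$. For an $a$-invariant probability measure $\mu$ on $Y$, a countably generated sub-$\sigma$-algebra $\mathcal A$ of the Borel $\sigma$-algebra of $Y$ is called $a^{-1}$-descending if $a\mathcal A\subseteq\mathcal A$, and $W$-subordinate modulo $\mu$ if for $\mu$-a.e. $y$ there is $\delta>0$ with $B^W_\delta y\subset[y]_{\mathcal A}\subset B^W_{1/\delta}y$, where $[y]_{\mathcal A}$ is the atom of $y$ and $B^W_\rho=\{w(b):\|b\|<\rho\}$. Put $\mathcal A_\infty=\bigcap_{k\ge1}a^k\mathcal A$, and let $\overline{\mathcal A_\infty}$ be the $\sigma$-algebra on $\overline Y$ generated by $\mathcal A_\infty$ and $\{\infty\}$. Finally $h_{\bar\mu}(a|\mathcal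 C)=\sup_\xi\inf_{N\ge1}\frac1NH_{\bar\mu}\big(\bigvee_{i=0}^{N-1}a^{-i}\xi\,\big|\,\mathcal C\big)$, over the countable Borel partitions $\xi$ of $\overline Y$ with $H_{\bar\mu}(\xi)<\infty$, is the conditional dynamical entropy. **Proposition.** Let $A\in M_{m,n}(\mathbb R)$. Then $\eta_A$ is the infimum of $\mu_A(\{\infty\})$ over the limit measures $\mu_A$ of $x_A$. Moreover, let $\mu_A$ be any limit measure of $x_A$ and put $\eta=\mu_A(\{\infty\})$, so that $\mu_A(X)=1-\eta$ (and $\eta=\eta_A$ if $\mu_A$ attains the infimum). Then for every $\epsilon>0$ such that $\mathrm{Bad}_A(\epsilon)$ contains some $b$ with $(A,b)$ irrational, there is an $a$-invariant probability measure $\overline\mu$ on $\overline Y$ such that: 1. $\mathrm{Supp}\,\overline\mu\subset\mathcal L_\epsilon\cup\{\infty\}$; 2. $\pi_*\overline\mu=\mu_A$, and there is an $a$-invariant probability measure $\mu$ on $Y$ with $\overline\mu=(1-\eta)\mu+\eta\,\delta_\infty$; 3. for every countably generated, $a^{-1}$-descending $\sigma$-algebra $\mathcal A^W$ that is $W$-subordinate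 modulo $\mu$, $$h_{\overline\mu}\big(a\,\big|\,\overline{\mathcal A^W_\infty}\big)\ \ge\ 1-\eta-r_1\big(m-\dim_H\mathrm{Bad}_A(\epsilon)\big).$$ -/

import Mathlib

open MeasureTheory Filter Topology Set
open scoped ENNReal

/-! ### Relative entropy

Countable measurable partitions of `Ω` are given by labelling maps `ξ : Ω → ι` into a countable
type; the atom of `x` is `ξ ⁻¹' {ξ x}`. -/

section Entropy

variable {Ω : Type*}

/-- The conditional static entropy `H_μ(ξ | 𝒜)`: the integral of the information function
`x ↦ - log μ_x^𝒜([x]_ξ)`. The conditional measure of the atom `P` of `x` is expressed by the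
conditional expectation of the indicator of `P`. -/
noncomputable def condEntropy {ι : Type*} {𝒜₀ : MeasurableSpace Ω} (μ : Measure[𝒜₀] Ω) (ξ : Ω → ι)
    (𝒜 : MeasurableSpace Ω) : ℝ≥0∞ :=
  ∫⁻ x, ENNReal.ofReal
    (-Real.log (condExp 𝒜 μ ((ξ ⁻¹' {ξ x}).indicator (fun _ => (1 : ℝ))) x)) ∂μ

/-- The static entropy `H_μ(ξ)`, i.e. the entropy given the trivial `σ`-algebra. -/
noncomputable def staticEntropy {ι : Type*} {𝒜₀ : MeasurableSpace Ω} (μ : Measure[𝒜₀] Ω)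
    (ξ : Ω → ι) : ℝ≥0∞ :=
  condEntropy μ ξ ⊥

/-- The refined partition `ξ_0^{N-1} = ξ ∨ T⁻¹ξ ∨ ⋯ ∨ T^{-(N-1)}ξ`. -/
def iteratedJoin {ι : Type*} (T : Ω → Ω) (ξ : Ω → ι) (N : ℕ) : Ω → (Fin N → ι) :=
  fun x i => ξ (T^[i] x)

/-- `h_μ(T, ξ | 𝒜) = inf_{N ≥ 1} (1/N) H_μ(ξ_0^{N-1} | 𝒜)`. -/
noncomputable def partitionEntropy {ι : Type*} {𝒜₀ : MeasurableSpace Ω} (μ : Measure[𝒜₀] Ω)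
    (T : Ω → Ω) (ξ : Ω → ι) (𝒜 : MeasurableSpace Ω) : ℝ≥0∞ :=
  ⨅ N : ℕ, condEntropy μ (iteratedJoin T ξ (N + 1)) 𝒜 / ((N + 1 : ℕ) : ℝ≥0∞)

/-- The conditional dynamical entropy `h_μ(T | 𝒜)`: the supremum of `h_μ(T, ξ | 𝒜)` over the
countable measurable partitions `ξ` of finite static entropy. -/
noncomputable def dynEntropy {𝒜₀ : MeasurableSpace Ω} (μ : Measure[𝒜₀] Ω) (T : Ω → Ω)
    (𝒜 : MeasurableSpace Ω) : ℝ≥0∞ :=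
  ⨆ (ξ : Ω → ℕ) (_ : Measurable[𝒜₀] ξ) (_ : staticEntropy μ ξ < ⊤), partitionEntropy μ T ξ 𝒜

end Entropy

/-! ### One-point compactifications -/

section OnePointCompactification

/-- One-point compactifications carry their Borel `σ`-algebra. -/
instance OnePoint.instMeasurableSpaceBorel (Z : Type*) [TopologicalSpace Z] :
    MeasurableSpace (OnePoint Z) := borel _

instance OnePoint.instBorelSpace (Z : Type*) [TopologicalSpace Z] : BorelSpace (OnePoint Z) :=
  ⟨rfl⟩

/-- The `σ`-algebra on the one-point compactification generated by a `σ`-algebra on the space and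
by `{∞}`. -/
@[reducible] def extendAlgebra {Z : Type*} (𝒜 : MeasurableSpace Z) : MeasurableSpace (OnePoint Z) :=
  MeasurableSpace.generateFrom
    ({S | ∃ R : Set Z, MeasurableSet[𝒜] R ∧ S = (fun z : Z => (z : OnePoint Z)) '' R} ∪
      {{OnePoint.infty}})

end OnePointCompactification

/-! ### Weights, quasinorms and badly approximable vectors -/

/-- Weights `r ∈ ℝ^m`, `s ∈ ℝ^n`: positive, in decreasing order, of sum one. -/
structure Weights (m n : ℕ) where
  r : Fin m → ℝ
  s : Fin n → ℝ
  r_pos : ∀ i, 0 < r i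
  s_pos : ∀ j, 0 < s j
  r_anti : Antitone r
  s_anti : Antitone s
  r_sum : ∑ i, r i = 1
  s_sum : ∑ j, s j = 1

/-- The weighted quasinorm `‖x‖_c = max_i |x_i|^(1/c_i)`. -/
noncomputable def quasinorm {k : ℕ} (c x : Fin k → ℝ) : ℝ :=
  ⨆ i, |x i| ^ (1 / c i)

/-- `⟨x⟩_c = inf_{p ∈ ℤ^k} ‖x - p‖_c`. -/
noncomputable def distToInt {k : ℕ} (c x : Fin k → ℝ) : ℝ :=
  ⨅ p : Fin k → ℤ, quasinorm c (fun i => x i - (p i : ℝ))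

namespace Weights

variable {m n : ℕ} (w : Weights m n)

/-- The set `Bad_A(ε)` of the `b ∈ ℝ^m` with
`liminf_{q ∈ ℤ^n, ‖q‖_s → ∞} ‖q‖_s ⟨A q - b⟩_r ≥ ε`; the lower limit is an extended real, as it
may be infinite. -/
def Bad (A : Matrix (Fin m) (Fin n) ℝ) (ε : ℝ) : Set (Fin m → ℝ) :=
  {b | (ε : EReal) ≤
    liminf
      (fun q : Fin n → ℤ =>
        ((quasinorm w.s (fun j => (q j : ℝ)) *
          distToInt w.r (A.mulVec (fun j => (q j : ℝ)) - b) : ℝ) : EReal))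
      (comap (fun q : Fin n → ℤ => quasinorm w.s (fun j => (q j : ℝ))) atTop)}

/-- The quasinorm `‖(x, y)‖_{r,s} = max (‖x‖_r^(d/m), ‖y‖_s^(d/n))` on `ℝ^d`, `d = m + n`. -/
noncomputable def gridQuasinorm (v : Fin m ⊕ Fin n → ℝ) : ℝ :=
  max (quasinorm w.r (fun i => v (Sum.inl i)) ^ (((m + n : ℕ) : ℝ) / (m : ℝ)))
    (quasinorm w.s (fun j => v (Sum.inr j)) ^ (((m + n : ℕ) : ℝ) / (n : ℝ)))

end Weights

/-- `(A, b)` is rational if `A q - b + p = 0` for some `p ∈ ℤ^m`, `q ∈ ℤ^n`. -/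
def IsRationalPair {m n : ℕ} (A : Matrix (Fin m) (Fin n) ℝ) (b : Fin m → ℝ) : Prop :=
  ∃ (p : Fin m → ℤ) (q : Fin n → ℤ),
    A.mulVec (fun j => (q j : ℝ)) - b + (fun i => (p i : ℝ)) = 0

/-! ### The groups and the homogeneous spaces

Indices of `ℝ^d`, `d = m + n`, are `Fin m ⊕ Fin n`; the extra coordinate of affine maps is
`Unit`. -/

section Spaces

variable (m n : ℕ)

/-- `SL_d(ℝ)`. -/
abbrev SLd : Type := Matrix.SpecialLinearGroup (Fin m ⊕ Fin n) ℝ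

/-- `SL_d(ℤ)` as a subgroup of `SL_d(ℝ)`. -/
def SLdInt : Subgroup (SLd m n) :=
  (Matrix.SpecialLinearGroup.map (n := Fin m ⊕ Fin n) (Int.castRingHom ℝ)).range

/-- `SL_{d+1}(ℝ)`. -/
abbrev SLd1 : Type := Matrix.SpecialLinearGroup ((Fin m ⊕ Fin n) ⊕ Unit) ℝ

/-- A matrix has last row `(0, 1)` iff it is of the form `(g v; 0 1)`. -/
theorem mem_lastRow_iff {m n : ℕ}
    (g : Matrix ((Fin m ⊕ Fin n) ⊕ Unit) ((Fin m ⊕ Fin n) ⊕ Unit) ℝ) :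
    (g.toBlocks₂₁ = 0 ∧ g.toBlocks₂₂ = 1) ↔
      g = Matrix.fromBlocks g.toBlocks₁₁ g.toBlocks₁₂ 0 1 := by
  constructor
  · rintro ⟨h1, h2⟩
    conv_lhs => rw [← Matrix.fromBlocks_toBlocks g, h1, h2]
  · intro h
    constructor
    · rw [h, Matrix.toBlocks_fromBlocks₂₁]
    · rw [h, Matrix.toBlocks_fromBlocks₂₂]

/-- `ASL_d(ℝ)`: the matrices `(g v; 0 1)` with `g ∈ SL_d(ℝ)` and `v ∈ ℝ^d`. -/
def ASLd : Subgroup (SLd1 m n) where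
  carrier := {g | g.1.toBlocks₂₁ = 0 ∧ g.1.toBlocks₂₂ = 1}
  one_mem' := by
    refine (mem_lastRow_iff _).2 ?_
    rw [Matrix.SpecialLinearGroup.coe_one, ← Matrix.fromBlocks_one,
      Matrix.toBlocks_fromBlocks₁₁, Matrix.toBlocks_fromBlocks₁₂]
  mul_mem' := by
    intro a b ha hb
    have ha' := (mem_lastRow_iff _).1 ha
    have hb' := (mem_lastRow_iff _).1 hb
    change (a * b).1.toBlocks₂₁ = 0 ∧ (a * b).1.toBlocks₂₂ = 1
    rw [Matrix.SpecialLinearGroup.coe_mul, ha', hb', Matrix.fromBlocks_multiply]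
    simp
  inv_mem' := by
    intro a ha
    have ha' := (mem_lastRow_iff _).1 ha
    have h : a.1 * (a⁻¹).1 = 1 := by
      rw [← Matrix.SpecialLinearGroup.coe_mul, mul_inv_cancel, Matrix.SpecialLinearGroup.coe_one]
    rw [ha', ← Matrix.fromBlocks_toBlocks (a⁻¹).1, Matrix.fromBlocks_multiply,
      ← Matrix.fromBlocks_one] at h
    have h' := Matrix.fromBlocks_inj.1 h
    exact ⟨by simpa using h'.2.2.1, by simpa using h'.2.2.2⟩

/-- `ASL_d(ℤ)` as a subgroup of `ASL_d(ℝ)`: the elements with integral entries. -/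
def ASLdInt : Subgroup (ASLd m n) :=
  ((Matrix.SpecialLinearGroup.map (n := (Fin m ⊕ Fin n) ⊕ Unit) (Int.castRingHom ℝ)).range).subgroupOf
    (ASLd m n)

/-- The space `X = SL_d(ℝ) / SL_d(ℤ)` of unimodular lattices. -/
def LatticeSpace : Type := SLd m n ⧸ SLdInt m n

/-- The space `Y = ASL_d(ℝ) / ASL_d(ℤ)` of unimodular grids. -/
def GridSpace : Type := ASLd m n ⧸ ASLdInt m n

instance : TopologicalSpace (LatticeSpace m n) :=
  inferInstanceAs (TopologicalSpace (SLd m n ⧸ SLdInt m n))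
instance : MulAction (SLd m n) (LatticeSpace m n) :=
  inferInstanceAs (MulAction (SLd m n) (SLd m n ⧸ SLdInt m n))
instance : MeasurableSpace (LatticeSpace m n) := borel _
instance : BorelSpace (LatticeSpace m n) := ⟨rfl⟩

instance : TopologicalSpace (GridSpace m n) :=
  inferInstanceAs (TopologicalSpace (ASLd m n ⧸ ASLdInt m n))
instance : MulAction (ASLd m n) (GridSpace m n) :=
  inferInstanceAs (MulAction (ASLd m n) (ASLd m n ⧸ ASLdInt m n))
instance : MeasurableSpace (GridSpace m n) := borel _
instance : BorelSpace (GridSpace m n) := ⟨rfl⟩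

variable {m n}

/-- The coset `g SL_d(ℤ)`. -/
def LatticeSpace.mk (g : SLd m n) : LatticeSpace m n := QuotientGroup.mk (s := SLdInt m n) g

/-- The coset `g ASL_d(ℤ)`. -/
def GridSpace.mk (g : ASLd m n) : GridSpace m n := QuotientGroup.mk (s := ASLdInt m n) g

/-- The linear part `g` of `(g v; 0 1)`. -/
def ASLd.linearPart (g : ASLd m n) : SLd m n :=
  ⟨g.1.1.toBlocks₁₁, by
    have h := g.1.2
    rw [(mem_lastRow_iff _).1 g.2, Matrix.det_fromBlocks_zero₂₁, Matrix.det_one, mul_one] at h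
    exact h⟩

/-- The translation part `v` of `(g v; 0 1)`. -/
def ASLd.translationPart (g : ASLd m n) : Fin m ⊕ Fin n → ℝ :=
  fun i => g.1.1 (Sum.inl i) (Sum.inr ())

/-- The affine map `(g v; 0 1)`. -/
def ASLd.ofParts (g : SLd m n) (v : Fin m ⊕ Fin n → ℝ) : ASLd m n :=
  ⟨⟨Matrix.fromBlocks g.1 (Matrix.of fun i _ => v i) 0 1, by
      rw [Matrix.det_fromBlocks_zero₂₁, g.2, Matrix.det_one, mul_one]⟩,
    ⟨Matrix.toBlocks_fromBlocks₂₁ _ _ _ _, Matrix.toBlocks_fromBlocks₂₂ _ _ _ _⟩⟩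

theorem ASLd.linearPart_mul (g h : ASLd m n) :
    ASLd.linearPart (g * h) = ASLd.linearPart g * ASLd.linearPart h := by
  apply Subtype.ext
  change (g.1.1 * h.1.1).toBlocks₁₁ = g.1.1.toBlocks₁₁ * h.1.1.toBlocks₁₁
  rw [(mem_lastRow_iff _).1 g.2, (mem_lastRow_iff _).1 h.2, Matrix.fromBlocks_multiply]
  simp

/-- Taking the linear part is a group homomorphism `ASL_d(ℝ) → SL_d(ℝ)`. -/
def ASLd.linearHom : ASLd m n →* SLd m n := MonoidHom.mk' ASLd.linearPart ASLd.linearPart_mul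

theorem ASLd.linearPart_mem {γ : ASLd m n} (h : γ ∈ ASLdInt m n) :
    ASLd.linearPart γ ∈ SLdInt m n := by
  obtain ⟨k, hk⟩ := h
  have hk' : γ.1.1 = k.1.map (Int.cast : ℤ → ℝ) := (congrArg Subtype.val hk).symm
  have hb : γ.1.1.toBlocks₁₁ = k.1.toBlocks₁₁.map (Int.castRingHom ℝ) := by
    rw [hk']; rfl
  have hdet : k.1.toBlocks₁₁.det = 1 := by
    have h1 : ((k.1.toBlocks₁₁.det : ℤ) : ℝ) = 1 := by
      have h2 := (ASLd.linearPart γ).2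
      change γ.1.1.toBlocks₁₁.det = 1 at h2
      rw [hb] at h2
      have h3 := RingHom.map_det (Int.castRingHom ℝ) k.1.toBlocks₁₁
      rw [RingHom.mapMatrix_apply, h2] at h3
      simpa using h3
    exact_mod_cast h1
  exact ⟨⟨k.1.toBlocks₁₁, hdet⟩, Subtype.ext hb.symm⟩

/-- The projection `π : Y → X`, `(g v; 0 1) ASL_d(ℤ) ↦ g SL_d(ℤ)`. -/
def gridProj : GridSpace m n → LatticeSpace m n :=
  Quotient.map' ASLd.linearPart (by
    intro g h hgh
    rw [QuotientGroup.leftRel_apply] at hgh ⊢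
    have := ASLd.linearPart_mem hgh
    rw [ASLd.linearPart_mul] at this
    have hinv : ASLd.linearPart g⁻¹ = (ASLd.linearPart g)⁻¹ := map_inv ASLd.linearHom g
    rwa [hinv] at this)

theorem gridProj_mk (g : ASLd m n) :
    gridProj (GridSpace.mk g) = LatticeSpace.mk (ASLd.linearPart g) := rfl

/-- The grid `g ℤ^d + v ⊆ ℝ^d` of a point `y = (g v; 0 1) ASL_d(ℤ)` of `Y`. -/
def GridSpace.grid (y : GridSpace m n) : Set (Fin m ⊕ Fin n → ℝ) :=
  {x | ∃ g : ASLd m n, GridSpace.mk g = y ∧ ∃ z : Fin m ⊕ Fin n → ℤ,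
    x = (ASLd.linearPart g).1.mulVec (fun i => (z i : ℝ)) + ASLd.translationPart g}

/-- The point `x_A = (I_m A; 0 I_n) SL_d(ℤ)` of `X`. -/
def latticeOf (A : Matrix (Fin m) (Fin n) ℝ) : LatticeSpace m n :=
  LatticeSpace.mk ⟨Matrix.fromBlocks 1 A 0 1, by simp⟩

/-- The element of the subgroup `W` given by `b ∈ ℝ^m`: the translation by `(b, 0)`. -/
def wElem (b : Fin m → ℝ) : ASLd m n := ASLd.ofParts 1 (Sum.elim b 0)

end Spaces

namespace Weights

variable {m n : ℕ} (w : Weights m n)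

/-- The target `L_ε = {y ∈ Y : ‖v‖_{r,s} ≥ ε for all v in the grid of y}`. -/
def target (ε : ℝ) : Set (GridSpace m n) :=
  {y | ∀ v ∈ y.grid, ε ≤ w.gridQuasinorm v}

/-- `a_t = diag(e^{r_1 t}, …, e^{r_m t}, e^{-s_1 t}, …, e^{-s_n t})`. -/
noncomputable def flow (t : ℝ) : SLd m n :=
  ⟨Matrix.diagonal (Sum.elim (fun i => Real.exp (w.r i * t)) (fun j => Real.exp (-(w.s j * t)))), by
    rw [Matrix.det_diagonal, Fintype.prod_sum_type]
    simp only [Sum.elim_inl, Sum.elim_inr]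
    rw [← Real.exp_sum, ← Real.exp_sum, ← Real.exp_add, Finset.sum_neg_distrib,
      ← Finset.sum_mul, ← Finset.sum_mul, w.r_sum, w.s_sum]
    simp⟩

/-- The time-one map `a = a_1`, as an element of `ASL_d(ℝ)`. -/
noncomputable def a : ASLd m n := ASLd.ofParts (w.flow 1) 0

/-- The action of `a` on the one-point compactification of `Y`, fixing `∞`. -/
noncomputable def aBar : OnePoint (GridSpace m n) → OnePoint (GridSpace m n) :=
  OnePoint.map (fun y => w.a • y)

/-- `x` has `δ`-escape of mass on average: for each compact `Q ⊆ X`,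
`liminf_N (1/N) #{ℓ ∈ {1,…,N} : a_ℓ x ∉ Q} ≥ δ`. -/
def HasEscape (x : LatticeSpace m n) (δ : ℝ) : Prop :=
  ∀ Q : Set (LatticeSpace m n), IsCompact Q →
    δ ≤ liminf
      (fun N : ℕ => ({ℓ : ℕ | 1 ≤ ℓ ∧ ℓ ≤ N ∧ w.flow ℓ • x ∉ Q}.ncard : ℝ) / (N : ℝ)) atTop

/-- `η_A`, the supremum of the `η` such that `x_A` has `η`-escape of mass on average. -/
noncomputable def maxEscape (A : Matrix (Fin m) (Fin n) ℝ) : ℝ :=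
  sSup {η : ℝ | w.HasEscape (latticeOf A) η}

/-- `μ` is a weak-* limit of the averages `(1/k_i) ∑_{k < k_i} δ_{a^k x_A}` on the one-point
compactification of `X` along some sequence `k_1 < k_2 < ⋯`. -/
def IsLimitMeasure (A : Matrix (Fin m) (Fin n) ℝ) (μ : Measure (OnePoint (LatticeSpace m n))) :
    Prop :=
  IsProbabilityMeasure μ ∧ ∃ k : ℕ → ℕ, StrictMono k ∧
    ∀ f : C(OnePoint (LatticeSpace m n), ℝ),
      Tendsto
        (fun i => (∑ l ∈ Finset.range (k i),
          f ((w.flow l • latticeOf A : LatticeSpace m n) : OnePoint (LatticeSpace m n)))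
            / (k i : ℝ))
        atTop (𝓝 (∫ x, f x ∂μ))

/-- The `σ`-algebra `g 𝒜 = {g S : S ∈ 𝒜}` on `Y`. -/
@[reducible] def translateAlgebra (g : ASLd m n) (𝒜 : MeasurableSpace (GridSpace m n)) :
    MeasurableSpace (GridSpace m n) :=
  𝒜.comap (fun y => g⁻¹ • y)

/-- A countably generated sub-`σ`-algebra of the Borel `σ`-algebra of `Y` which is
`a⁻¹`-descending (`a 𝒜 ⊆ 𝒜`) and subordinate to `W` modulo `μ`: for `μ`-almost every `y` there
is `δ > 0` with `B_δ^W y ⊆ [y]_𝒜 ⊆ B_{1/δ}^W y`. Balls in `W ≅ ℝ^m` are taken for the maximum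
norm; any proper invariant metric on `W` gives the same notion. -/
structure IsDescendingSubordinate (μ : Measure (GridSpace m n))
    (𝒜 : MeasurableSpace (GridSpace m n)) : Prop where
  le_borel : 𝒜 ≤ borel (GridSpace m n)
  countablyGenerated : @MeasurableSpace.CountablyGenerated (GridSpace m n) 𝒜
  descending : translateAlgebra w.a 𝒜 ≤ 𝒜
  subordinate : ∀ᵐ y ∂μ, ∃ δ : ℝ, 0 < δ ∧
    (∀ b : Fin m → ℝ, ‖b‖ < δ → (wElem b : ASLd m n) • y ∈ @measurableAtom _ 𝒜 y) ∧
    ∀ z ∈ @measurableAtom _ 𝒜 y, ∃ b : Fin m → ℝ, ‖b‖ < δ⁻¹ ∧ z = (wElem b : ASLd m n) • y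

/-- The tail `σ`-algebra `𝒜_∞ = ⋂_{k ≥ 1} a^k 𝒜`. -/
@[reducible] noncomputable def tailAlgebra (𝒜 : MeasurableSpace (GridSpace m n)) :
    MeasurableSpace (GridSpace m n) :=
  ⨅ k : ℕ, translateAlgebra (w.a ^ (k + 1)) 𝒜

end Weights

/-! ### Topology of one-point compactifications. -/

section OnePointTopology

variable {Z : Type*} [TopologicalSpace Z]

/-! The argument is that of the variational principle, in a form that survives escape of mass. Fix
times k along which the averages of x_A converge to μ_A. If b ∈ Bad_A(ε) and (A, b) is irrational,
then for each ε' < ε the orbit of the grid x_A - (b, 0) is in L_ε' from some time on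
(`exists_forall_mem_target`), and rational pairs are countably many. By countable stability of
dimension, a subset of Bad_A(ε) of dimension greater than any given s < dim Bad_A(ε) shares this
time. A maximal subset separated at scale e^(-r_i k) in coordinate i has about e^(k(1 - r_1(m - s)))
elements or more, because a box with these sides splits into about e^((m r_1 - 1)k) cubes of side
e^(-r_1 k) (`exists_large_separated`). The uniform measures on the orbit segments of length k of
these grids accumulate at an invariant measure carried by L_ε ∪ {∞}. It projects to μ_A because all
the grids lie over x_A.

Entropy: a finite partition P cuts the part of Y over a compact set K ⊂ X into cells smaller than
the injectivity radius and leaves the rest as one atom. If two vectors of the family have the same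
P-name, then whenever the orbit of x_A is in K their displacement is either tiny or at least about
the injectivity radius. Since a expands W by the total factor e per unit of time, at most C
e^(number of times outside K) vectors share a name (`card_le_of_good_times`). Hence the names carry
entropy at least log |S| minus that number. In the limit this gives the rate c - p, where c = 1 -
r_1(m - dim Bad_A(ε)) and p is the mass outside K, which tends to η as K grows. All the grids lie
over one point of X, so the bound persists given any partition pulled back from the compactification
of X (`le_finCondEntropy_cells`), and then given the past of P (`le_finCondEntropy_past`).

Tail algebra: a set of 𝒜_∞ is a^l R' with R' ∈ 𝒜 for every l ≥ 1, and the atoms of 𝒜 contain balls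
of W. By recurrence of backward orbits it is therefore almost invariant under all of W
(`ae_ae_mem_iff_of_tail`). Conversely, the base point together with the past of P, refined by cells
of size e^(-L) at the start of a long excursion of length L, determines the W-orbit
(`exists_eq_wElem_smul`). By Kac's inequality this refinement costs little entropy
(`exists_finEntropy_returnLabel_le`). Separation of analytic sets then places 𝒜_∞, modulo null sets,
in the algebra generated by the past and the base (`exists_ae_eq_of_tail`), and conditioning on a
larger algebra only lowers entropy (`le_condEntropy_of_approx`).

The formula for η_A compares the frequency of visits outside a compact set with the mass of a
neighbourhood of ∞. When η = 1 the measure μ may be any invariant probability measure on Y; one is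
produced from the bounded orbit of an order in a totally real field (`exists_bounded_orbit`). -/

instance OnePoint.secondCountableTopology [LocallyCompactSpace Z] [SecondCountableTopology Z]
    [T2Space Z] : SecondCountableTopology (OnePoint Z) := by
  let E : CompactExhaustion Z := default
  -- Every compact set lies in some `E n`, so the complements of the `E n` are a countable basis at
  -- ∞.
  let B : Set (Set (OnePoint Z)) :=
    (fun s => ((↑) : Z → OnePoint Z) '' s) '' TopologicalSpace.countableBasis Z ∪
      range (fun n : ℕ => (((↑) : Z → OnePoint Z) '' E n)ᶜ)
  have hB : TopologicalSpace.IsTopologicalBasis B := by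
    refine TopologicalSpace.isTopologicalBasis_of_isOpen_of_nhds ?_ ?_
    · rintro u (⟨s, hs, rfl⟩ | ⟨n, rfl⟩)
      · exact OnePoint.isOpen_image_coe.2
          ((TopologicalSpace.isBasis_countableBasis Z).isOpen hs)
      · exact OnePoint.isOpen_compl_image_coe.2 ⟨(E.isCompact n).isClosed, E.isCompact n⟩
    · intro x u hx hu
      induction x using OnePoint.rec with
      | infty =>
        obtain ⟨n, hn⟩ := E.exists_superset_of_isCompact ((OnePoint.isOpen_iff_of_mem hx).1 hu).2
        refine ⟨_, Or.inr ⟨n, rfl⟩, by simp, ?_⟩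
        intro z hz
        induction z using OnePoint.rec with
        | infty => exact hx
        | coe z =>
          by_contra h
          exact hz ⟨z, hn h, rfl⟩
      | coe x =>
        obtain ⟨s, hs, hxs, hsu⟩ := (TopologicalSpace.isBasis_countableBasis Z).exists_subset_of_mem_open
          (show x ∈ ((↑) : Z → OnePoint Z) ⁻¹' u from hx) (hu.preimage OnePoint.continuous_coe)
        exact ⟨_, Or.inl ⟨s, hs, rfl⟩, ⟨x, hxs, rfl⟩, image_subset_iff.2 hsu⟩
  exact hB.secondCountableTopology
    (((TopologicalSpace.countable_countableBasis Z).image _).union (countable_range _))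

end OnePointTopology

/-! ### Quotients by closed subgroups. -/

section QuotientTopology

theorem QuotientGroup.t2Space_of_isClosed {G : Type*} [Group G] [TopologicalSpace G]
    [IsTopologicalGroup G] (N : Subgroup G) (hN : IsClosed (N : Set G)) : T2Space (G ⧸ N) := by
  rw [t2Space_iff_of_isOpenQuotientMap (QuotientGroup.isOpenQuotientMap_mk (N := N))]
  have : {q : G × G | (QuotientGroup.mk q.1 : G ⧸ N) = QuotientGroup.mk q.2} =
      (fun q : G × G => q.1⁻¹ * q.2) ⁻¹' (N : Set G) := by
    ext q
    exact QuotientGroup.eq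
  rw [this]
  exact hN.preimage (by fun_prop)

end QuotientTopology

/-! ### X and Y as locally compact, second countable Hausdorff spaces. -/

section Spaces

variable {m n : ℕ}

theorem isClosed_SLdInt : IsClosed (SLdInt m n : Set (SLd m n)) := by
  have := (Int.isClosedEmbedding_coe_real.specialLinearGroup_map (f := Int.castRingHom ℝ)
    (n := Fin m ⊕ Fin n)).isClosed_range
  exact this

theorem isClosed_ASLdInt : IsClosed (ASLdInt m n : Set (ASLd m n)) := by
  have := (Int.isClosedEmbedding_coe_real.specialLinearGroup_map (f := Int.castRingHom ℝ)
    (n := (Fin m ⊕ Fin n) ⊕ Unit)).isClosed_range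
  exact this.preimage continuous_subtype_val

instance Matrix.SpecialLinearGroup.secondCountable {ι : Type*} [Fintype ι] [DecidableEq ι] :
    SecondCountableTopology (Matrix.SpecialLinearGroup ι ℝ) := by
  have : SecondCountableTopology (Matrix ι ι ℝ) :=
    inferInstanceAs (SecondCountableTopology (ι → ι → ℝ))
  exact Matrix.SpecialLinearGroup.isClosedEmbedding_val.isEmbedding.secondCountableTopology

instance Matrix.SpecialLinearGroup.locallyCompact {ι : Type*} [Fintype ι] [DecidableEq ι] :
    LocallyCompactSpace (Matrix.SpecialLinearGroup ι ℝ) := by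
  have : LocallyCompactSpace (Matrix ι ι ℝ) :=
    inferInstanceAs (LocallyCompactSpace (ι → ι → ℝ))
  exact Matrix.SpecialLinearGroup.isClosedEmbedding_val.locallyCompactSpace

theorem isClosed_ASLd : IsClosed (ASLd m n : Set (SLd1 m n)) := by
  have : (ASLd m n : Set (SLd1 m n)) =
      {g | g.1.toBlocks₂₁ = 0} ∩ {g | g.1.toBlocks₂₂ = 1} := rfl
  rw [this]
  have h1 : Continuous fun g : SLd1 m n => g.1.toBlocks₂₁ :=
    continuous_matrix fun i j => (continuous_subtype_val.matrix_elem _ _)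
  have h2 : Continuous fun g : SLd1 m n => g.1.toBlocks₂₂ :=
    continuous_matrix fun i j => (continuous_subtype_val.matrix_elem _ _)
  exact (isClosed_singleton.preimage h1).inter (isClosed_singleton.preimage h2)

instance : LocallyCompactSpace (ASLd m n) := isClosed_ASLd.isClosedEmbedding_subtypeVal.locallyCompactSpace

instance : PolishSpace (ASLd m n) := by
  have : PolishSpace (Matrix ((Fin m ⊕ Fin n) ⊕ Unit) ((Fin m ⊕ Fin n) ⊕ Unit) ℝ) :=
    inferInstanceAs (PolishSpace ((Fin m ⊕ Fin n) ⊕ Unit → (Fin m ⊕ Fin n) ⊕ Unit → ℝ))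
  exact (Matrix.SpecialLinearGroup.isClosedEmbedding_val.comp
    isClosed_ASLd.isClosedEmbedding_subtypeVal).polishSpace

instance : T2Space (LatticeSpace m n) := QuotientGroup.t2Space_of_isClosed _ isClosed_SLdInt
instance : T2Space (GridSpace m n) := QuotientGroup.t2Space_of_isClosed _ isClosed_ASLdInt
instance : LocallyCompactSpace (LatticeSpace m n) :=
  inferInstanceAs (LocallyCompactSpace (SLd m n ⧸ SLdInt m n))
instance : LocallyCompactSpace (GridSpace m n) :=
  inferInstanceAs (LocallyCompactSpace (ASLd m n ⧸ ASLdInt m n))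
instance : SecondCountableTopology (LatticeSpace m n) :=
  inferInstanceAs (SecondCountableTopology (SLd m n ⧸ SLdInt m n))
instance : SecondCountableTopology (GridSpace m n) :=
  inferInstanceAs (SecondCountableTopology (ASLd m n ⧸ ASLdInt m n))
instance : ContinuousSMul (ASLd m n) (GridSpace m n) :=
  inferInstanceAs (ContinuousSMul (ASLd m n) (ASLd m n ⧸ ASLdInt m n))

theorem LatticeSpace.isOpenQuotientMap_mk :
    IsOpenQuotientMap (LatticeSpace.mk : SLd m n → LatticeSpace m n) :=
  QuotientGroup.isOpenQuotientMap_mk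
theorem GridSpace.isOpenQuotientMap_mk :
    IsOpenQuotientMap (GridSpace.mk : ASLd m n → GridSpace m n) :=
  QuotientGroup.isOpenQuotientMap_mk

theorem LatticeSpace.smul_mk (g h : SLd m n) :
    g • LatticeSpace.mk h = LatticeSpace.mk (g * h) := rfl
theorem GridSpace.smul_mk (g h : ASLd m n) :
    g • GridSpace.mk h = GridSpace.mk (g * h) := rfl

theorem LatticeSpace.mk_eq_mk {g h : SLd m n} :
    LatticeSpace.mk g = LatticeSpace.mk h ↔ g⁻¹ * h ∈ SLdInt m n := QuotientGroup.eq
theorem GridSpace.mk_eq_mk {g h : ASLd m n} :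
    GridSpace.mk g = GridSpace.mk h ↔ g⁻¹ * h ∈ ASLdInt m n := QuotientGroup.eq

end Spaces

/-! ### The affine group, grids, and the proper projection Y → X. -/

section AffineGroup

variable {m n : ℕ}

namespace ASLd

theorem ext_parts {g h : ASLd m n} (h1 : linearPart g = linearPart h)
    (h2 : translationPart g = translationPart h) : g = h := by
  apply Subtype.ext
  apply Subtype.ext
  rw [(mem_lastRow_iff _).1 g.2, (mem_lastRow_iff _).1 h.2]
  have e1 : g.1.1.toBlocks₁₁ = h.1.1.toBlocks₁₁ := congrArg Subtype.val h1
  have e2 : g.1.1.toBlocks₁₂ = h.1.1.toBlocks₁₂ := by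
    ext i j
    exact congrFun h2 i
  rw [e1, e2]

@[simp] theorem linearPart_ofParts (g : SLd m n) (v : Fin m ⊕ Fin n → ℝ) :
    linearPart (ofParts g v) = g := Subtype.ext (Matrix.toBlocks_fromBlocks₁₁ _ _ _ _)

@[simp] theorem translationPart_ofParts (g : SLd m n) (v : Fin m ⊕ Fin n → ℝ) :
    translationPart (ofParts g v) = v := rfl

@[simp] theorem ofParts_parts (g : ASLd m n) : ofParts (linearPart g) (translationPart g) = g :=
  ext_parts (by simp) (by simp)

theorem translationPart_mul (g h : ASLd m n) :
    translationPart (g * h) =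
      (linearPart g).1.mulVec (translationPart h) + translationPart g := by
  ext i
  change (g.1.1 * h.1.1) (Sum.inl i) (Sum.inr ()) = _
  have h22 : h.1.1 (Sum.inr ()) (Sum.inr ()) = 1 := congrFun (congrFun h.2.2 ()) ()
  rw [Matrix.mul_apply, Fintype.sum_sum_type]
  simp only [Finset.univ_unique, PUnit.default_eq_unit, Finset.sum_singleton, h22, mul_one]
  rfl

theorem ofParts_mul (g h : SLd m n) (v u : Fin m ⊕ Fin n → ℝ) :
    ofParts g v * ofParts h u = ofParts (g * h) (g.1.mulVec u + v) :=
  ext_parts (by rw [linearPart_mul]; simp) (by rw [translationPart_mul]; simp)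

theorem continuous_val : Continuous fun g : ASLd m n => g.1.1 := by
  have h1 : Continuous fun g : ASLd m n => g.1 := continuous_subtype_val
  have h2 : Continuous fun g : SLd1 m n => g.1 := continuous_subtype_val
  exact h2.comp h1

theorem continuous_linearPart : Continuous (linearPart : ASLd m n → SLd m n) := by
  refine Continuous.subtype_mk ?_ _
  exact continuous_matrix fun i j => continuous_val.matrix_elem _ _

theorem continuous_translationPart :
    Continuous (translationPart : ASLd m n → Fin m ⊕ Fin n → ℝ) :=
  continuous_pi fun _ => continuous_val.matrix_elem _ _

theorem continuous_ofParts :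
    Continuous (fun p : SLd m n × (Fin m ⊕ Fin n → ℝ) => ofParts p.1 p.2) := by
  refine Continuous.subtype_mk (Continuous.subtype_mk ?_ _) _
  refine Continuous.matrix_fromBlocks (continuous_subtype_val.comp continuous_fst) ?_
    continuous_const continuous_const
  exact continuous_matrix fun i j => (continuous_apply i).comp continuous_snd

theorem mem_int_iff {γ : ASLd m n} : γ ∈ ASLdInt m n ↔
    linearPart γ ∈ SLdInt m n ∧ ∃ z : Fin m ⊕ Fin n → ℤ, translationPart γ = fun i => (z i : ℝ) := by
  constructor
  · intro h
    refine ⟨linearPart_mem h, ?_⟩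
    obtain ⟨k, hk⟩ := h
    have hk' : γ.1.1 = k.1.map (Int.cast : ℤ → ℝ) := (congrArg Subtype.val hk).symm
    refine ⟨fun i => k.1 (Sum.inl i) (Sum.inr ()), ?_⟩
    ext i
    change γ.1.1 _ _ = _
    rw [hk']
    rfl
  · rintro ⟨⟨k, hk⟩, z, hz⟩
    refine ⟨⟨Matrix.fromBlocks k.1 (Matrix.of fun i _ => z i) 0 1, ?_⟩, ?_⟩
    · rw [Matrix.det_fromBlocks_zero₂₁, k.2, Matrix.det_one, mul_one]
    · have h1 : γ = ofParts (linearPart γ) (translationPart γ) := (ofParts_parts γ).symm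
      rw [h1, ← hk, hz]
      apply Subtype.ext
      change Matrix.map (Matrix.fromBlocks k.1 (Matrix.of fun i _ => z i) 0 1) (Int.castRingHom ℝ) =
        Matrix.fromBlocks (k.1.map (Int.castRingHom ℝ)) _ 0 1
      rw [Matrix.fromBlocks_map]
      congr 1
      · ext i j; simp
      · ext i j; simp

/-- The affine action of `ASL_d(ℝ)` on `ℝ^d`. -/
def act (g : ASLd m n) (x : Fin m ⊕ Fin n → ℝ) : Fin m ⊕ Fin n → ℝ :=
  (linearPart g).1.mulVec x + translationPart g

theorem act_mul (g h : ASLd m n) (x : Fin m ⊕ Fin n → ℝ) : act (g * h) x = act g (act h x) := by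
  simp only [act, linearPart_mul, translationPart_mul, Matrix.SpecialLinearGroup.coe_mul,
    Matrix.mulVec_add, Matrix.mulVec_mulVec, add_assoc]

theorem act_one (x : Fin m ⊕ Fin n → ℝ) : act (1 : ASLd m n) x = x := by
  have h1 : linearPart (1 : ASLd m n) = 1 := map_one linearHom
  have h2 : translationPart (1 : ASLd m n) = 0 := by
    ext i
    exact Matrix.one_apply_ne (by simp)
  simp [act, h1, h2]

theorem act_int {γ : ASLd m n} (h : γ ∈ ASLdInt m n) (z : Fin m ⊕ Fin n → ℤ) :
    ∃ z' : Fin m ⊕ Fin n → ℤ, act γ (fun i => (z i : ℝ)) = fun i => (z' i : ℝ) := by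
  obtain ⟨⟨k, hk⟩, u, hu⟩ := mem_int_iff.1 h
  refine ⟨k.1.mulVec z + u, ?_⟩
  ext i
  simp only [act, hu, ← hk, Pi.add_apply, Int.cast_add, Matrix.mulVec, dotProduct, Int.cast_sum,
    Int.cast_mul]
  rfl

/-- The translation by `v`. -/
def trans (v : Fin m ⊕ Fin n → ℝ) : ASLd m n := ofParts 1 v

@[simp] theorem linearPart_trans (v : Fin m ⊕ Fin n → ℝ) : linearPart (trans v) = 1 :=
  linearPart_ofParts _ _

@[simp] theorem translationPart_trans (v : Fin m ⊕ Fin n → ℝ) : translationPart (trans v) = v := rfl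

theorem trans_mul_trans (u v : Fin m ⊕ Fin n → ℝ) : trans u * trans v = trans (u + v) :=
  ext_parts (by rw [linearPart_mul]; simp) (by rw [translationPart_mul]; simp [add_comm])

theorem trans_zero : trans (0 : Fin m ⊕ Fin n → ℝ) = 1 := by
  have := trans_mul_trans (m := m) (n := n) 0 0
  simpa using this

theorem act_trans (v x : Fin m ⊕ Fin n → ℝ) : act (trans v) x = x + v := by
  simp [act]

theorem mul_trans (g : ASLd m n) (v : Fin m ⊕ Fin n → ℝ) :
    g * trans v = trans ((linearPart g).1.mulVec v) * g :=
  ext_parts (by simp [linearPart_mul]) (by simp [translationPart_mul, add_comm])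

theorem continuous_trans : Continuous (trans : (Fin m ⊕ Fin n → ℝ) → ASLd m n) :=
  continuous_ofParts.comp (continuous_const.prodMk continuous_id)

end ASLd

open ASLd

theorem wElem_eq_trans (b : Fin m → ℝ) : (wElem b : ASLd m n) = trans (Sum.elim b 0) := rfl

namespace GridSpace

theorem exists_rep (y : GridSpace m n) : ∃ g : ASLd m n, mk g = y := isOpenQuotientMap_mk.surjective y

theorem grid_mk (g : ASLd m n) :
    (mk g).grid = range fun z : Fin m ⊕ Fin n → ℤ => act g (fun i => (z i : ℝ)) := by
  ext x
  constructor
  · rintro ⟨h, hh, z, rfl⟩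
    obtain ⟨z', hz'⟩ := act_int (GridSpace.mk_eq_mk.1 hh.symm) z
    refine ⟨z', ?_⟩
    change act g _ = act h _
    rw [← hz', ← act_mul, mul_inv_cancel_left]
  · rintro ⟨z, rfl⟩
    exact ⟨g, rfl, z, rfl⟩

theorem grid_smul (g : ASLd m n) (y : GridSpace m n) : (g • y).grid = act g '' y.grid := by
  obtain ⟨h, rfl⟩ := exists_rep y
  rw [smul_mk, grid_mk, grid_mk, ← range_comp]
  simp only [act_mul, Function.comp_def]

theorem grid_nonempty (y : GridSpace m n) : y.grid.Nonempty := by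
  obtain ⟨h, rfl⟩ := exists_rep y
  rw [grid_mk]
  exact range_nonempty _

end GridSpace

theorem gridProj_smul (g : ASLd m n) (y : GridSpace m n) :
    gridProj (g • y) = linearPart g • gridProj y := by
  obtain ⟨h, rfl⟩ := GridSpace.exists_rep y
  rw [GridSpace.smul_mk, gridProj_mk, gridProj_mk, linearPart_mul, LatticeSpace.smul_mk]

theorem continuous_gridProj : Continuous (gridProj : GridSpace m n → LatticeSpace m n) := by
  rw [GridSpace.isOpenQuotientMap_mk.isQuotientMap.continuous_iff]
  exact LatticeSpace.isOpenQuotientMap_mk.continuous.comp continuous_linearPart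

/-- The element γ relating the two representatives has an integral linear part and sends one
integral vector to another, so its translation part is integral too. The freedom in choosing u and v
is what later converts closeness of two grids into a small translation. -/
theorem eq_trans_smul_of_gridProj_eq {y z : GridSpace m n} (h : gridProj y = gridProj z)
    {u v : Fin m ⊕ Fin n → ℝ} (hu : u ∈ y.grid) (hv : v ∈ z.grid) :
    z = trans (v - u) • y := by
  obtain ⟨g, rfl⟩ := GridSpace.exists_rep y
  obtain ⟨k, rfl⟩ := GridSpace.exists_rep z
  rw [gridProj_mk, gridProj_mk, LatticeSpace.mk_eq_mk] at h
  rw [GridSpace.grid_mk] at hu hv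
  obtain ⟨p, rfl⟩ := hu
  obtain ⟨q, rfl⟩ := hv
  rw [GridSpace.smul_mk, eq_comm, GridSpace.mk_eq_mk]
  set γ : ASLd m n := (trans (act k (fun i => (q i : ℝ)) - act g (fun i => (p i : ℝ))) * g)⁻¹ * k
    with hγ
  have h1 : linearPart γ = (linearPart g)⁻¹ * linearPart k := by
    have hinv : ∀ g : ASLd m n, linearPart g⁻¹ = (linearPart g)⁻¹ := fun g => map_inv linearHom g
    rw [hγ, linearPart_mul, hinv, linearPart_mul, linearPart_trans, one_mul]
  rw [mem_int_iff, h1]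
  refine ⟨h, ?_⟩
  have h2 : act γ (fun i => (q i : ℝ)) = fun i => (p i : ℝ) := by
    rw [hγ, act_mul]
    have h3 : act k (fun i => (q i : ℝ)) = act (trans (act k (fun i => (q i : ℝ)) -
        act g (fun i => (p i : ℝ))) * g) (fun i => (p i : ℝ)) := by
      rw [act_mul, act_trans]
      abel
    generalize hT : trans (act k (fun i => (q i : ℝ)) - act g (fun i => (p i : ℝ))) * g = t at h3 ⊢
    rw [h3, ← act_mul, inv_mul_cancel, act_one]
  obtain ⟨c, hc⟩ := h
  rw [← h1] at hc
  refine ⟨p - c.1.mulVec q, ?_⟩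
  have h4 : translationPart γ = (fun i => (p i : ℝ)) -
      (linearPart γ).1.mulVec (fun i => (q i : ℝ)) := by
    rw [← h2]
    simp [act]
  rw [h4, ← hc]
  ext i
  simp only [Pi.sub_apply, Int.cast_sub, Matrix.mulVec, dotProduct, Int.cast_sum, Int.cast_mul]
  rfl

theorem LatticeSpace.exists_compact_lift {K : Set (LatticeSpace m n)} (hK : IsCompact K) :
    ∃ C : Set (SLd m n), IsCompact C ∧ K ⊆ LatticeSpace.mk '' C := by
  have hcov : ∀ x ∈ K, ∃ C : Set (SLd m n), IsCompact C ∧ LatticeSpace.mk '' C ∈ 𝓝 x := by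
    intro x _
    obtain ⟨g, rfl⟩ := LatticeSpace.isOpenQuotientMap_mk.surjective x
    obtain ⟨C, hC, hg⟩ := exists_compact_mem_nhds g
    exact ⟨C, hC, LatticeSpace.isOpenQuotientMap_mk.isOpenMap.image_mem_nhds hg⟩
  choose! C hC hCx using hcov
  obtain ⟨t, htK, ht⟩ := hK.elim_nhds_subcover (fun x => LatticeSpace.mk '' C x) hCx
  refine ⟨⋃ x ∈ t, C x, t.isCompact_biUnion fun x hx => hC x (htK x hx), ?_⟩
  rw [image_iUnion₂]
  exact ht

/-- Coordinates in the basis `g` are reduced modulo 1. The fibres of π over the image of C are thus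
covered by one cube, which is the source of the properness of π. -/
theorem GridSpace.exists_rep_cube {C : Set (SLd m n)} {y : GridSpace m n}
    (hy : gridProj y ∈ LatticeSpace.mk '' C) :
    ∃ g ∈ C, ∃ u : Fin m ⊕ Fin n → ℝ, (∀ i, u i ∈ Icc (0 : ℝ) 1) ∧
      y = GridSpace.mk (ofParts g (g.1.mulVec u)) := by
  obtain ⟨g, hg, hgy⟩ := hy
  obtain ⟨x, hx⟩ := y.grid_nonempty
  set u' := (g⁻¹).1.mulVec x with hu'
  refine ⟨g, hg, fun i => Int.fract (u' i), fun i => ⟨Int.fract_nonneg _, (Int.fract_lt_one _).le⟩, ?_⟩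
  set v := g.1.mulVec fun i => Int.fract (u' i) with hv
  have hx' : x = v + g.1.mulVec (fun i => ((⌊u' i⌋ : ℤ) : ℝ)) := by
    rw [hv, ← Matrix.mulVec_add]
    have : ((fun i => Int.fract (u' i)) + fun i => ((⌊u' i⌋ : ℤ) : ℝ)) = u' := by
      ext i
      exact Int.fract_add_floor _
    rw [this, hu', Matrix.mulVec_mulVec, ← Matrix.SpecialLinearGroup.coe_mul, mul_inv_cancel]
    simp
  have key := eq_trans_smul_of_gridProj_eq (y := GridSpace.mk (ofParts g v)) (z := y)
    (u := x) (v := x) (by rw [gridProj_mk, linearPart_ofParts, hgy])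
    (by
      rw [GridSpace.grid_mk]
      refine ⟨fun i => ⌊u' i⌋, ?_⟩
      simp only [act, linearPart_ofParts, translationPart_ofParts]
      rw [hx', add_comm]) hx
  rw [sub_self, trans_zero, one_smul] at key
  exact key

/-- Properness is what makes the extension of π by ∞ ↦ ∞ continuous. -/
theorem isCompact_gridProj_preimage {K : Set (LatticeSpace m n)} (hK : IsCompact K) :
    IsCompact (gridProj ⁻¹' K : Set (GridSpace m n)) := by
  obtain ⟨C, hC, hKC⟩ := LatticeSpace.exists_compact_lift hK
  have hcube : IsCompact (Set.pi univ fun _ : Fin m ⊕ Fin n => Icc (0 : ℝ) 1) :=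
    isCompact_univ_pi fun _ => isCompact_Icc
  have hcont : Continuous fun p : SLd m n × (Fin m ⊕ Fin n → ℝ) =>
      GridSpace.mk (ofParts p.1 (p.1.1.mulVec p.2)) := by
    have h1 : Continuous fun p : SLd m n × (Fin m ⊕ Fin n → ℝ) => (p.1, p.1.1.mulVec p.2) :=
      continuous_fst.prodMk
        ((continuous_subtype_val.comp continuous_fst).matrix_mulVec continuous_snd)
    exact GridSpace.isOpenQuotientMap_mk.continuous.comp (continuous_ofParts.comp h1)
  refine ((hC.prod hcube).image hcont).of_isClosed_subset (hK.isClosed.preimage continuous_gridProj) ?_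
  intro y hy
  obtain ⟨g, hg, u, hu, rfl⟩ := GridSpace.exists_rep_cube (hKC hy)
  exact ⟨(g, u), ⟨hg, fun i _ => hu i⟩, rfl⟩

/-- The extension of the projection to the one-point compactifications. -/
noncomputable abbrev gridProjBar : OnePoint (GridSpace m n) → OnePoint (LatticeSpace m n) :=
  OnePoint.map gridProj

theorem continuous_gridProjBar : Continuous (gridProjBar : OnePoint (GridSpace m n) → _) := by
  refine OnePoint.continuous_map continuous_gridProj ?_
  rw [coclosedCompact_eq_cocompact, coclosedCompact_eq_cocompact]
  refine (hasBasis_cocompact.tendsto_right_iff).2 fun K hK => ?_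
  exact mem_cocompact.2 ⟨_, isCompact_gridProj_preimage hK, subset_rfl⟩

namespace Weights

variable (w : Weights m n)

/-- The action of `a` on the one-point compactification of `Y`, as a homeomorphism. -/
noncomputable def aHomeo : OnePoint (GridSpace m n) ≃ₜ OnePoint (GridSpace m n) :=
  (Homeomorph.smul w.a).onePointCongr

theorem aHomeo_infty : w.aHomeo OnePoint.infty = OnePoint.infty := rfl

theorem aHomeo_eq : (w.aHomeo : OnePoint (GridSpace m n) → _) = w.aBar := by
  ext y
  induction y using OnePoint.rec <;> rfl

theorem flow_add (s t : ℝ) : w.flow (s + t) = w.flow s * w.flow t := by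
  apply Subtype.ext
  rw [Matrix.SpecialLinearGroup.coe_mul]
  simp only [flow, Matrix.diagonal_mul_diagonal]
  congr 1
  ext i
  rcases i with i | j
  · simp [← Real.exp_add, mul_add]
  · simp [← Real.exp_add, mul_add, add_comm]

theorem flow_zero : w.flow 0 = 1 := by
  have := w.flow_add 0 0
  simpa using this

theorem linearPart_a : linearPart w.a = w.flow 1 := linearPart_ofParts _ _

theorem linearPart_a_pow (l : ℕ) : linearPart (w.a ^ l) = w.flow l := by
  have h : linearPart (w.a ^ l) = (linearPart w.a) ^ l := map_pow linearHom w.a l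
  rw [h, linearPart_a]
  induction l with
  | zero => simp [flow_zero]
  | succ k ih => rw [pow_succ, ih (map_pow linearHom w.a k), ← flow_add]; push_cast; rfl

theorem flow_mulVec_inl (t : ℝ) (v : Fin m ⊕ Fin n → ℝ) (i : Fin m) :
    (w.flow t).1.mulVec v (Sum.inl i) = Real.exp (w.r i * t) * v (Sum.inl i) := by
  simp [flow, Matrix.mulVec_diagonal]

theorem flow_mulVec_inr (t : ℝ) (v : Fin m ⊕ Fin n → ℝ) (j : Fin n) :
    (w.flow t).1.mulVec v (Sum.inr j) = Real.exp (-(w.s j * t)) * v (Sum.inr j) := by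
  simp [flow, Matrix.mulVec_diagonal]

theorem translationPart_a_pow (l : ℕ) : translationPart (w.a ^ l) = 0 := by
  induction l with
  | zero =>
    rw [pow_zero, ← trans_zero]
    rfl
  | succ k ih => rw [pow_succ, translationPart_mul, ih]; simp [a]

theorem a_pow_smul_trans (l : ℕ) (v : Fin m ⊕ Fin n → ℝ) (y : GridSpace m n) :
    w.a ^ l • trans v • y = trans ((w.flow l).1.mulVec v) • w.a ^ l • y := by
  rw [smul_smul, mul_trans, linearPart_a_pow, smul_smul]

end Weights

end AffineGroup

/-! ### Entropy of finite partitions. -/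

section FiniteEntropy

variable {Ω : Type*} [MeasurableSpace Ω]

/-- Measurability of a labelling map: its atoms are measurable. -/
def LabelMeasurable {ι : Type*} (α : Ω → ι) : Prop := ∀ i, MeasurableSet (α ⁻¹' {i})

/-- The entropy of a finite partition. -/
noncomputable def finEntropy {ι : Type*} [Fintype ι] (μ : Measure Ω) (α : Ω → ι) : ℝ :=
  ∑ i, Real.negMulLog (μ.real (α ⁻¹' {i}))

/-- The join of two partitions. -/
def pairLabel {ι κ : Type*} (α : Ω → ι) (β : Ω → κ) : Ω → ι × κ := fun x => (α x, β x)

/-- The entropy of a finite partition given another one. -/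
noncomputable def finCondEntropy {ι κ : Type*} [Fintype ι] [Fintype κ] (μ : Measure Ω)
    (α : Ω → ι) (β : Ω → κ) : ℝ :=
  finEntropy μ (pairLabel α β) - finEntropy μ β

section Measurability
variable {ι κ : Type*} {α : Ω → ι} {β : Ω → κ}

theorem LabelMeasurable.pair (hα : LabelMeasurable α) (hβ : LabelMeasurable β) :
    LabelMeasurable (pairLabel α β) := by
  rintro ⟨i, j⟩
  have : pairLabel α β ⁻¹' {(i, j)} = α ⁻¹' {i} ∩ β ⁻¹' {j} := by
    ext x
    simp [pairLabel]
  rw [this]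
  exact (hα i).inter (hβ j)

theorem LabelMeasurable.comp {Ω' : Type*} [MeasurableSpace Ω'] (hα : LabelMeasurable α)
    {f : Ω' → Ω} (hf : Measurable f) : LabelMeasurable (α ∘ f) := fun i => hf (hα i)

theorem LabelMeasurable.pi {J : Type*} [Finite J] {κ : J → Type*} {γ : ∀ j, Ω → κ j}
    (h : ∀ j, LabelMeasurable (γ j)) : LabelMeasurable (fun x j => γ j x) := by
  intro c
  have : (fun x j => γ j x) ⁻¹' {c} = ⋂ j, γ j ⁻¹' {c j} := by
    ext x
    simp [funext_iff]
  rw [this]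
  exact MeasurableSet.iInter fun j => h j _

theorem LabelMeasurable.preimage [Finite ι] (hα : LabelMeasurable α) (s : Set ι) :
    MeasurableSet (α ⁻¹' s) := by
  have : α ⁻¹' s = ⋃ i ∈ s, α ⁻¹' {i} := by
    ext x
    simp
  rw [this]
  exact MeasurableSet.biUnion s.to_countable fun i _ => hα i

theorem LabelMeasurable.map [Finite ι] (hα : LabelMeasurable α) (f : ι → κ) :
    LabelMeasurable (f ∘ α) := fun i => by
  rw [preimage_comp]
  exact hα.preimage _

end Measurability

variable {μ : Measure Ω} [IsProbabilityMeasure μ]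
variable {ι κ l : Type*} [Fintype ι] [Fintype κ] [Fintype l]
variable {α : Ω → ι} {β : Ω → κ} {γ : Ω → l}

theorem sum_measureReal_inter_label (hα : LabelMeasurable α) {s : Set Ω} (hs : MeasurableSet s) :
    ∑ i, μ.real (s ∩ α ⁻¹' {i}) = μ.real s := by
  have hU : s = ⋃ i ∈ (Finset.univ : Finset ι), s ∩ α ⁻¹' {i} := by
    ext x
    simp
  conv_rhs => rw [hU]
  rw [measureReal_biUnion_finset]
  · intro i _ j _ hij
    refine Set.disjoint_left.2 ?_
    rintro x ⟨_, h1⟩ ⟨_, h2⟩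
    exact hij (h1.symm.trans h2)
  · exact fun i _ => hs.inter (hα i)

theorem sum_measureReal_label (hα : LabelMeasurable α) : ∑ i, μ.real (α ⁻¹' {i}) = 1 := by
  have := sum_measureReal_inter_label (μ := μ) hα MeasurableSet.univ
  simpa using this

theorem finEntropy_nonneg : 0 ≤ finEntropy μ α :=
  Finset.sum_nonneg fun _ _ => Real.negMulLog_nonneg measureReal_nonneg measureReal_le_one

theorem mul_log_le_of_le {p q : ℝ} (hp : 0 ≤ p) (hpq : p ≤ q) :
    -(p * Real.log q) ≤ Real.negMulLog p := by
  rcases hp.eq_or_lt with rfl | hp'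
  · simp
  · rw [Real.negMulLog, neg_mul]
    have := Real.log_le_log hp' hpq
    nlinarith

/-- An atom of β lies in an atom of α of at least the same measure, so each atom of β contributes at
least its share of the entropy of α. -/
theorem finEntropy_le_of_factorsThrough (hβ : LabelMeasurable β)
    (h : Function.FactorsThrough α β) : finEntropy μ α ≤ finEntropy μ β := by
  classical
  have hne : Nonempty Ω := by
    by_contra hne
    have := not_nonempty_iff.1 hne
    exact IsProbabilityMeasure.ne_zero μ (Measure.eq_zero_of_isEmpty μ)
  obtain ⟨x0⟩ := hne
  set f : κ → ι := Function.extend β α (fun _ => α x0)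
  have hf : ∀ x, f (β x) = α x := fun x => h.extend_apply _ x
  have hle : ∀ j, μ.real (β ⁻¹' {j}) ≤ μ.real (α ⁻¹' {f j}) := fun j =>
    measureReal_mono fun x (hx : β x = j) => show α x = f j by rw [← hx, hf]
  have hsum : ∀ i, μ.real (α ⁻¹' {i}) = ∑ j with f j = i, μ.real (β ⁻¹' {j}) := by
    intro i
    have hU : α ⁻¹' {i} = ⋃ j ∈ (Finset.univ.filter fun j => f j = i), β ⁻¹' {j} := by
      ext x
      simp [hf]
    rw [hU, measureReal_biUnion_finset]
    · intro i _ j _ hij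
      refine Set.disjoint_left.2 ?_
      rintro x h1 h2
      exact hij (h1.symm.trans h2)
    · exact fun i _ => hβ i
  calc finEntropy μ α = ∑ i, ∑ j with f j = i, -(μ.real (β ⁻¹' {j}) * Real.log (μ.real (α ⁻¹' {f j}))) := by
        refine Finset.sum_congr rfl fun i _ => ?_
        have : ∀ j ∈ Finset.univ.filter (fun j => f j = i),
            -(μ.real (β ⁻¹' {j}) * Real.log (μ.real (α ⁻¹' {f j}))) =
              μ.real (β ⁻¹' {j}) * -Real.log (μ.real (α ⁻¹' {i})) := by
          intro j hj
          rw [(Finset.mem_filter.1 hj).2]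
          ring
        rw [Finset.sum_congr rfl this, ← Finset.sum_mul, ← hsum, Real.negMulLog]
        ring
    _ = ∑ j, -(μ.real (β ⁻¹' {j}) * Real.log (μ.real (α ⁻¹' {f j}))) :=
        Finset.sum_fiberwise _ _ _
    _ ≤ finEntropy μ β := Finset.sum_le_sum fun j _ => mul_log_le_of_le measureReal_nonneg (hle j)

theorem finEntropy_congr_factors (hα : LabelMeasurable α) (hβ : LabelMeasurable β)
    (h1 : Function.FactorsThrough α β) (h2 : Function.FactorsThrough β α) :
    finEntropy μ α = finEntropy μ β :=
  le_antisymm (finEntropy_le_of_factorsThrough hβ h1) (finEntropy_le_of_factorsThrough hα h2)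

/-- Strong subadditivity of entropy. -/
theorem finEntropy_submodular (hα : LabelMeasurable α) (hβ : LabelMeasurable β)
    (hγ : LabelMeasurable γ) :
    finEntropy μ (pairLabel α (pairLabel β γ)) + finEntropy μ γ ≤
      finEntropy μ (pairLabel α γ) + finEntropy μ (pairLabel β γ) := by
  set A : ι → l → Set Ω := fun i k => α ⁻¹' {i} ∩ γ ⁻¹' {k} with hA
  set B : κ → l → Set Ω := fun j k => β ⁻¹' {j} ∩ γ ⁻¹' {k} with hB
  set C : l → Set Ω := fun k => γ ⁻¹' {k}
  set E : ι → κ → l → Set Ω := fun i j k => α ⁻¹' {i} ∩ (β ⁻¹' {j} ∩ γ ⁻¹' {k}) with hE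
  have mA : ∀ i k, MeasurableSet (A i k) := fun i k => (hα i).inter (hγ k)
  have mB : ∀ j k, MeasurableSet (B j k) := fun j k => (hβ j).inter (hγ k)
  have sA : ∀ i k, ∑ j, μ.real (E i j k) = μ.real (A i k) := by
    intro i k
    rw [← sum_measureReal_inter_label hβ (mA i k)]
    refine Finset.sum_congr rfl fun j _ => ?_
    congr 1
    simp only [hA, hE]
    ext x
    simp only [mem_inter_iff]
    tauto
  have sB : ∀ j k, ∑ i, μ.real (E i j k) = μ.real (B j k) := by
    intro j k
    rw [← sum_measureReal_inter_label hα (mB j k)]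
    refine Finset.sum_congr rfl fun i _ => ?_
    rw [inter_comm]
  have sBC : ∀ k, ∑ j, μ.real (B j k) = μ.real (C k) := by
    intro k
    rw [← sum_measureReal_inter_label hβ (hγ k)]
    refine Finset.sum_congr rfl fun i _ => ?_
    rw [inter_comm]
  have sAC : ∀ k, ∑ j, μ.real (A j k) = μ.real (C k) := by
    intro k
    rw [← sum_measureReal_inter_label hα (hγ k)]
    refine Finset.sum_congr rfl fun i _ => ?_
    rw [inter_comm]
  have e1 : finEntropy μ (pairLabel α (pairLabel β γ)) =
      ∑ k, ∑ i, ∑ j, Real.negMulLog (μ.real (E i j k)) := by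
    rw [finEntropy, Fintype.sum_prod_type]
    simp_rw [Fintype.sum_prod_type]
    rw [Finset.sum_congr rfl fun i _ => Finset.sum_comm, Finset.sum_comm]
    refine Finset.sum_congr rfl fun k _ => ?_
    refine Finset.sum_congr rfl fun i _ => Finset.sum_congr rfl fun j _ => ?_
    congr 2
    ext x
    simp [hE, pairLabel]
  have e2 : finEntropy μ (pairLabel α γ) =
      ∑ k, ∑ i, ∑ j, -(μ.real (E i j k) * Real.log (μ.real (A i k))) := by
    rw [finEntropy, Fintype.sum_prod_type, Finset.sum_comm]
    refine Finset.sum_congr rfl fun k _ => Finset.sum_congr rfl fun i _ => ?_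
    rw [Finset.sum_neg_distrib, ← Finset.sum_mul, sA, Real.negMulLog, neg_mul]
    have : pairLabel α γ ⁻¹' {(i, k)} = A i k := by ext x; simp [hA, pairLabel]
    rw [this]
  have e3 : finEntropy μ (pairLabel β γ) =
      ∑ k, ∑ i, ∑ j, -(μ.real (E i j k) * Real.log (μ.real (B j k))) := by
    rw [finEntropy, Fintype.sum_prod_type, Finset.sum_comm]
    refine Finset.sum_congr rfl fun k _ => ?_
    rw [Finset.sum_comm]
    refine Finset.sum_congr rfl fun j _ => ?_
    rw [Finset.sum_neg_distrib, ← Finset.sum_mul, sB, Real.negMulLog, neg_mul]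
    have : pairLabel β γ ⁻¹' {(j, k)} = B j k := by ext x; simp [hB, pairLabel]
    rw [this]
  have e4 : finEntropy μ γ =
      ∑ k, ∑ i, ∑ j, -(μ.real (E i j k) * Real.log (μ.real (C k))) := by
    refine Finset.sum_congr rfl fun k _ => ?_
    rw [Finset.sum_congr rfl fun i _ => show ∑ j, -(μ.real (E i j k) * Real.log (μ.real (C k))) =
      -(μ.real (A i k) * Real.log (μ.real (C k))) by
        rw [Finset.sum_neg_distrib, ← Finset.sum_mul, sA]]
    rw [Finset.sum_neg_distrib, ← Finset.sum_mul, sAC, Real.negMulLog, neg_mul]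
  -- The inequality log t ≤ t - 1 at t = μ(A)μ(B) / (μ(C)μ(E)) trades the logarithms for correction
  -- terms whose sum is at most zero by `tot`.
  have pointwise : ∀ i j k, Real.negMulLog (μ.real (E i j k)) +
      -(μ.real (E i j k) * Real.log (μ.real (C k))) ≤
      -(μ.real (E i j k) * Real.log (μ.real (A i k))) +
      -(μ.real (E i j k) * Real.log (μ.real (B j k))) +
      (μ.real (A i k) * μ.real (B j k) / μ.real (C k) - μ.real (E i j k)) := by
    intro i j k
    rcases (measureReal_nonneg (μ := μ) (s := E i j k)).eq_or_lt with h0 | hp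
    · rw [← h0]
      simp only [Real.negMulLog_zero, zero_mul, neg_zero, add_zero, sub_zero, zero_add]
      positivity
    · have ha : 0 < μ.real (A i k) := hp.trans_le (measureReal_mono fun x hx => ⟨hx.1, hx.2.2⟩)
      have hb : 0 < μ.real (B j k) := hp.trans_le (measureReal_mono fun x hx => hx.2)
      have hc : 0 < μ.real (C k) := hp.trans_le (measureReal_mono fun x hx => hx.2.2)
      have key := Real.log_le_sub_one_of_pos
        (show 0 < μ.real (A i k) * μ.real (B j k) / (μ.real (C k) * μ.real (E i j k)) by positivity)
      rw [Real.log_div (by positivity) (by positivity), Real.log_mul ha.ne' hb.ne',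
        Real.log_mul hc.ne' hp.ne'] at key
      have key2 := mul_le_mul_of_nonneg_left key hp.le
      have : μ.real (E i j k) * (μ.real (A i k) * μ.real (B j k) /
          (μ.real (C k) * μ.real (E i j k)) - 1) =
          μ.real (A i k) * μ.real (B j k) / μ.real (C k) - μ.real (E i j k) := by
        field_simp
      rw [this] at key2
      rw [Real.negMulLog]
      linarith
  have tot : ∑ k, ∑ i, ∑ j, (μ.real (A i k) * μ.real (B j k) / μ.real (C k) -
      μ.real (E i j k)) ≤ 0 := by
    refine Finset.sum_nonpos fun k _ => ?_
    have h1 : ∑ i, ∑ j, μ.real (A i k) * μ.real (B j k) / μ.real (C k) ≤ μ.real (C k) := by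
      simp_rw [mul_div_assoc]
      simp_rw [← Finset.mul_sum, ← Finset.sum_div, sBC, ← Finset.sum_mul, sAC]
      rcases (measureReal_nonneg (μ := μ) (s := C k)).eq_or_lt with h0 | hp
      · rw [← h0]; simp
      · rw [div_self hp.ne', mul_one]
    simp_rw [Finset.sum_sub_distrib, sA, sAC]
    linarith
  rw [e1, e2, e3, e4]
  simp only [← Finset.sum_add_distrib]
  have := Finset.sum_le_sum fun k (_ : k ∈ Finset.univ) => Finset.sum_le_sum
    fun i (_ : i ∈ Finset.univ) => Finset.sum_le_sum fun j (_ : j ∈ Finset.univ) => pointwise i j k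
  simp only [Finset.sum_add_distrib] at this tot ⊢
  linarith

theorem finEntropy_le_log_card (hα : LabelMeasurable α) :
    finEntropy μ α ≤ Real.log (Fintype.card ι) := by
  have h1 := sum_measureReal_label (μ := μ) hα
  have hne : Nonempty ι := by
    by_contra hne
    have := not_nonempty_iff.1 hne
    simp at h1
  have hc : (0 : ℝ) < Fintype.card ι := by exact_mod_cast Fintype.card_pos
  have hpt : ∀ i, Real.negMulLog (μ.real (α ⁻¹' {i})) ≤
      μ.real (α ⁻¹' {i}) * Real.log (Fintype.card ι) + (1 / (Fintype.card ι : ℝ) -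
        μ.real (α ⁻¹' {i})) := by
    intro i
    rcases (measureReal_nonneg (μ := μ) (s := α ⁻¹' {i})).eq_or_lt with h0 | hp
    · rw [← h0]
      simp
    · have key := Real.log_le_sub_one_of_pos
        (show 0 < 1 / (Fintype.card ι * μ.real (α ⁻¹' {i})) by positivity)
      rw [Real.log_div one_ne_zero (by positivity), Real.log_one,
        Real.log_mul hc.ne' hp.ne'] at key
      have key2 := mul_le_mul_of_nonneg_left key hp.le
      have : μ.real (α ⁻¹' {i}) * (1 / (Fintype.card ι * μ.real (α ⁻¹' {i})) - 1) =
          1 / (Fintype.card ι : ℝ) - μ.real (α ⁻¹' {i}) := by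
        field_simp
      rw [this] at key2
      rw [Real.negMulLog]
      linarith
  refine (Finset.sum_le_sum fun i _ => hpt i).trans ?_
  rw [Finset.sum_add_distrib, ← Finset.sum_mul, Finset.sum_sub_distrib, h1]
  simp [hc.ne']

theorem finEntropy_comp {Ω' : Type*} [MeasurableSpace Ω'] {ν : Measure Ω'} {T : Ω' → Ω}
    (hT : MeasurePreserving T ν μ) (hα : LabelMeasurable α) :
    finEntropy ν (α ∘ T) = finEntropy μ α := by
  refine Finset.sum_congr rfl fun i _ => ?_
  rw [preimage_comp, hT.measureReal_preimage (hα i).nullMeasurableSet]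

theorem finCondEntropy_comp {Ω' : Type*} [MeasurableSpace Ω'] {ν : Measure Ω'} {T : Ω' → Ω}
    (hT : MeasurePreserving T ν μ) (hα : LabelMeasurable α) (hβ : LabelMeasurable β) :
    finCondEntropy ν (α ∘ T) (β ∘ T) = finCondEntropy μ α β := by
  rw [finCondEntropy, finCondEntropy, ← finEntropy_comp hT (hα.pair hβ), ← finEntropy_comp hT hβ]
  rfl

theorem finCondEntropy_nonneg (hα : LabelMeasurable α) (hβ : LabelMeasurable β) :
    0 ≤ finCondEntropy μ α β :=
  sub_nonneg.2 (finEntropy_le_of_factorsThrough (hα.pair hβ) fun _ _ h => (Prod.ext_iff.1 h).2)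

/-- This is strong subadditivity for α, γ, β, since the join of γ with its factor β is γ again. -/
theorem finCondEntropy_anti (hα : LabelMeasurable α) (hβ : LabelMeasurable β)
    (hγ : LabelMeasurable γ) (h : Function.FactorsThrough β γ) :
    finCondEntropy μ α γ ≤ finCondEntropy μ α β := by
  have h1 := finEntropy_submodular (μ := μ) hα hγ hβ
  have h2 : finEntropy μ (pairLabel γ β) = finEntropy μ γ :=
    finEntropy_congr_factors (hγ.pair hβ) hγ (fun x y e => Prod.ext e (h e))
      (fun x y e => (Prod.ext_iff.1 e).1)
  have h3 : finEntropy μ (pairLabel α (pairLabel γ β)) = finEntropy μ (pairLabel α γ) :=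
    finEntropy_congr_factors (hα.pair (hγ.pair hβ)) (hα.pair hγ)
      (fun x y e => Prod.ext (Prod.ext_iff.1 e).1
        (Prod.ext (Prod.ext_iff.1 e).2 (h (Prod.ext_iff.1 e).2)))
      (fun x y e => Prod.ext (Prod.ext_iff.1 e).1 (Prod.ext_iff.1 (Prod.ext_iff.1 e).2).1)
  rw [finCondEntropy, finCondEntropy]
  linarith

theorem finCondEntropy_mono (hβ : LabelMeasurable β) (hγ : LabelMeasurable γ)
    (h : Function.FactorsThrough α γ) :
    finCondEntropy μ α β ≤ finCondEntropy μ γ β := by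
  have : finEntropy μ (pairLabel α β) ≤ finEntropy μ (pairLabel γ β) :=
    finEntropy_le_of_factorsThrough (hγ.pair hβ) fun _ _ e =>
      Prod.ext (h (Prod.ext_iff.1 e).1) (Prod.ext_iff.1 e).2
  exact sub_le_sub_right this _

theorem finCondEntropy_le_finEntropy (hα : LabelMeasurable α) (hβ : LabelMeasurable β) :
    finCondEntropy μ α β ≤ finEntropy μ α := by
  have hu : LabelMeasurable (fun _ : Ω => ()) := fun _ => by simp
  have h1 := finCondEntropy_anti (μ := μ) (β := fun _ => ()) hα hu hβ (fun _ _ _ => rfl)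
  have h2 : finEntropy μ (fun _ : Ω => ()) = 0 := by simp [finEntropy]
  have h3 : finEntropy μ (pairLabel α fun _ => ()) = finEntropy μ α :=
    finEntropy_congr_factors (hα.pair hu) hα (fun x y e => Prod.ext e rfl)
      (fun x y e => (Prod.ext_iff.1 e).1)
  refine h1.trans_eq ?_
  rw [finCondEntropy, h2, h3, sub_zero]

/-- The chain rule. -/
theorem finCondEntropy_pair (hα : LabelMeasurable α) (hβ : LabelMeasurable β)
    (hγ : LabelMeasurable γ) :
    finCondEntropy μ (pairLabel α β) γ =
      finCondEntropy μ α γ + finCondEntropy μ β (pairLabel α γ) := by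
  have h : finEntropy μ (pairLabel (pairLabel α β) γ) =
      finEntropy μ (pairLabel β (pairLabel α γ)) :=
    finEntropy_congr_factors ((hα.pair hβ).pair hγ) (hβ.pair (hα.pair hγ))
      (fun x y e => by
        simp only [pairLabel, Prod.mk.injEq] at e ⊢
        tauto)
      (fun x y e => by
        simp only [pairLabel, Prod.mk.injEq] at e ⊢
        tauto)
  simp only [finCondEntropy, h]
  ring

theorem finCondEntropy_pair_le (hα : LabelMeasurable α) (hβ : LabelMeasurable β)
    (hγ : LabelMeasurable γ) :
    finCondEntropy μ (pairLabel α β) γ ≤ finCondEntropy μ α γ + finCondEntropy μ β γ := by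
  rw [finCondEntropy_pair hα hβ hγ]
  gcongr
  exact finCondEntropy_anti hβ hγ (hα.pair hγ) fun _ _ e => (Prod.ext_iff.1 e).2

theorem finEntropy_pair_le (hα : LabelMeasurable α) (hβ : LabelMeasurable β) :
    finEntropy μ (pairLabel α β) ≤ finEntropy μ α + finEntropy μ β := by
  have := finCondEntropy_le_finEntropy (μ := μ) hα hβ
  rw [finCondEntropy] at this
  linarith

end FiniteEntropy

/-! ### Names along orbits. -/

section IteratedJoin

variable {Ω : Type*}

/-- The labels of the strict past `T'⁻¹P ∨ ⋯ ∨ T'⁻ᴹP`, where `T'` is the inverse of the dynamics. -/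
def pastJoin {ι : Type*} (T' : Ω → Ω) (P : Ω → ι) (M : ℕ) : Ω → (Fin M → ι) :=
  fun x i => P (T'^[(i : ℕ) + 1] x)

variable {ι κ : Type*} {T T' : Ω → Ω} {P : Ω → ι} {Q : Ω → κ}

theorem iteratedJoin_eq_iff {N : ℕ} {x y : Ω} :
    iteratedJoin T P N x = iteratedJoin T P N y ↔ ∀ i < N, P (T^[i] x) = P (T^[i] y) := by
  refine funext_iff.trans ⟨fun h i hi => h ⟨i, hi⟩, fun h i => h i i.2⟩

theorem pastJoin_eq_iff {N : ℕ} {x y : Ω} :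
    pastJoin T' P N x = pastJoin T' P N y ↔ ∀ i < N, P (T'^[i + 1] x) = P (T'^[i + 1] y) := by
  refine funext_iff.trans ⟨fun h i hi => h ⟨i, hi⟩, fun h i => h i i.2⟩

theorem iteratedJoin_factorsThrough_of_le {N N' : ℕ} (h : N ≤ N') :
    Function.FactorsThrough (iteratedJoin T P N) (iteratedJoin T P N') := fun _ _ e =>
  iteratedJoin_eq_iff.2 fun i hi => iteratedJoin_eq_iff.1 e i (hi.trans_le h)

theorem iteratedJoin_factorsThrough_of_factorsThrough {N : ℕ} (h : Function.FactorsThrough P Q) :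
    Function.FactorsThrough (iteratedJoin T P N) (iteratedJoin T Q N) := fun _ _ e =>
  iteratedJoin_eq_iff.2 fun i hi => h (iteratedJoin_eq_iff.1 e i hi)

theorem iteratedJoin_add_factorsThrough {a b : ℕ} :
    Function.FactorsThrough (iteratedJoin T P (a + b))
      (pairLabel (iteratedJoin T P a) (iteratedJoin T P b ∘ T^[a])) := fun x y e =>
  iteratedJoin_eq_iff.2 fun i hi => by
    obtain ⟨e1, e2⟩ := Prod.ext_iff.1 e
    rcases lt_or_ge i a with h | h
    · exact iteratedJoin_eq_iff.1 e1 i h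
    · have := iteratedJoin_eq_iff.1 e2 (i - a) (by omega)
      rwa [← Function.iterate_add_apply, ← Function.iterate_add_apply, Nat.sub_add_cancel h] at this

/-- Seen from time k, a past of depth M ≤ k consists of the symbols at the times k - M, …, k - 1. -/
theorem pastJoin_comp_factorsThrough (hT : Function.LeftInverse T' T) {M k : ℕ} (h : M ≤ k) :
    Function.FactorsThrough (pastJoin T' P M ∘ T^[k]) (iteratedJoin T P k) := fun x y e =>
  pastJoin_eq_iff.2 fun i hi => by
    have key : ∀ z, T'^[i + 1] (T^[k] z) = T^[k - (i + 1)] z := fun z => by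
      have h1 : T^[k] z = T^[i + 1] (T^[k - (i + 1)] z) := by
        rw [← Function.iterate_add_apply]
        congr 1
        omega
      rw [h1]
      exact hT.iterate (i + 1) _
    rw [key, key]
    exact iteratedJoin_eq_iff.1 e _ (by omega)

variable [MeasurableSpace Ω]

theorem LabelMeasurable.iteratedJoin (hP : LabelMeasurable P) (hT : Measurable T) (N : ℕ) :
    LabelMeasurable (iteratedJoin T P N) :=
  LabelMeasurable.pi fun i : Fin N => hP.comp (hT.iterate i)

theorem LabelMeasurable.pastJoin (hP : LabelMeasurable P) (hT : Measurable T') (N : ℕ) :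
    LabelMeasurable (pastJoin T' P N) :=
  LabelMeasurable.pi fun i : Fin N => hP.comp (hT.iterate ((i : ℕ) + 1))

end IteratedJoin

/-! ### From the entropy of long names to the entropy given the past. -/

section Increments

variable {Ω : Type*} [MeasurableSpace Ω] {μ : Measure Ω} [IsProbabilityMeasure μ]
variable {ι κ : Type*} [Fintype ι] [Fintype κ] {T T' : Ω → Ω} {P : Ω → ι} {β : Ω → κ}

theorem finEntropy_iteratedJoin_le (hT : MeasurePreserving T μ μ) (hP : LabelMeasurable P) (N : ℕ) :
    finEntropy μ (iteratedJoin T P N) ≤ N * finEntropy μ P := by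
  induction N with
  | zero =>
    have := finEntropy_le_log_card (μ := μ) (hP.iteratedJoin hT.measurable 0)
    simpa using this
  | succ N ih =>
    have h1 := hP.iteratedJoin hT.measurable
    have h2 : LabelMeasurable (P ∘ T^[N]) := hP.comp (hT.measurable.iterate N)
    have h3 : finEntropy μ (iteratedJoin T P (N + 1)) ≤
        finEntropy μ (pairLabel (iteratedJoin T P N) (P ∘ T^[N])) := by
      refine finEntropy_le_of_factorsThrough ((h1 N).pair h2) fun x y e => ?_
      obtain ⟨e1, e2⟩ := Prod.ext_iff.1 e
      refine iteratedJoin_eq_iff.2 fun i hi => ?_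
      rcases Nat.lt_succ_iff_lt_or_eq.1 hi with h | rfl
      · exact iteratedJoin_eq_iff.1 e1 i h
      · exact e2
    have h4 := finEntropy_pair_le (μ := μ) (h1 N) h2
    rw [finEntropy_comp (hT.iterate N) hP] at h4
    push_cast
    linarith

/-- If the names of `P` of length `n` given the names of `β` have entropy at least `n c`, for
every `n`, then the conditional entropy given the past is also at least `c` per unit of time. -/
theorem le_finCondEntropy_past (hT : MeasurePreserving T μ μ) (hT' : Measurable T')
    (hinv : Function.LeftInverse T' T) (hP : LabelMeasurable P) (hβ : LabelMeasurable β) {c : ℝ}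
    (hc : ∀ n : ℕ, n * c ≤ finCondEntropy μ (iteratedJoin T P n) (iteratedJoin T β n))
    (N M : ℕ) :
    N * c ≤ finCondEntropy μ (iteratedJoin T P N) (pairLabel (pastJoin T' P M) β) := by
  rcases N.eq_zero_or_pos with rfl | hN
  · rw [Nat.cast_zero, zero_mul]
    exact finCondEntropy_nonneg (hP.iteratedJoin hT.measurable _) ((hP.pastJoin hT' _).pair hβ)
  set h := finCondEntropy μ (iteratedJoin T P N) (pairLabel (pastJoin T' P M) β) with hh
  have h0 : 0 ≤ h :=
    finCondEntropy_nonneg (hP.iteratedJoin hT.measurable _) ((hP.pastJoin hT' _).pair hβ)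
  set C := finEntropy μ (iteratedJoin T P N) with hC
  have hC0 : 0 ≤ C := finEntropy_nonneg
  have hPm := hP.iteratedJoin hT.measurable
  have hβm := hβ.iteratedJoin hT.measurable
  -- A name of length L N is cut into L blocks of length N. A block of index at least M starts at a
  -- time at least M, so the earlier blocks contain its past of depth M and by invariance it adds at
  -- most h. The first M blocks are charged C + h each.
  have step : ∀ (n L : ℕ), L * N ≤ n →
      finCondEntropy μ (iteratedJoin T P (L * N)) (iteratedJoin T β n) ≤
        min L M * C + L * h := by
    intro n L
    induction L with
    | zero =>
      intro _
      refine (finCondEntropy_le_finEntropy (hPm _) (hβm _)).trans ?_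
      refine (finEntropy_iteratedJoin_le hT hP _).trans ?_
      simp
    | succ L ih =>
      intro hL
      have hL' : L * N + N ≤ n := by rwa [Nat.succ_mul] at hL
      have h1 : finCondEntropy μ (iteratedJoin T P ((L + 1) * N)) (iteratedJoin T β n) ≤
          finCondEntropy μ (pairLabel (iteratedJoin T P (L * N))
            (iteratedJoin T P N ∘ T^[L * N])) (iteratedJoin T β n) := by
        rw [Nat.succ_mul]
        exact finCondEntropy_mono (hβm _) ((hPm _).pair ((hPm _).comp (hT.measurable.iterate _)))
          iteratedJoin_add_factorsThrough
      rw [finCondEntropy_pair (hPm _) ((hPm _).comp (hT.measurable.iterate _)) (hβm _)] at h1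
      have h2 := ih (by omega)
      have h3 : finCondEntropy μ (iteratedJoin T P N ∘ T^[L * N])
          (pairLabel (iteratedJoin T P (L * N)) (iteratedJoin T β n)) ≤
          if L < M then C + h else h := by
        split_ifs with hLM
        · refine (finCondEntropy_le_finEntropy ((hPm _).comp (hT.measurable.iterate _))
            ((hPm _).pair (hβm _))).trans ?_
          rw [finEntropy_comp (hT.iterate _) (hPm _)]
          linarith
        · have hMN : M ≤ L * N := (not_lt.1 hLM).trans (Nat.le_mul_of_pos_right _ hN)
          rw [hh, ← finCondEntropy_comp (hT.iterate (L * N)) (hPm N) ((hP.pastJoin hT' M).pair hβ)]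
          refine finCondEntropy_anti ((hPm _).comp (hT.measurable.iterate _))
            (((hP.pastJoin hT' M).pair hβ).comp (hT.measurable.iterate _)) ((hPm _).pair (hβm _)) ?_
          intro x y e
          obtain ⟨e1, e2⟩ := Prod.ext_iff.1 e
          exact Prod.ext (pastJoin_comp_factorsThrough hinv hMN e1)
            (iteratedJoin_eq_iff.1 e2 (L * N) (by omega))
      have h4 : ((min (L + 1) M : ℕ) : ℝ) * C = (min L M : ℕ) * C + if L < M then C else 0 := by
        split_ifs with hLM
        · rw [min_eq_left (by omega), min_eq_left (by omega)]
          push_cast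
          ring
        · rw [min_eq_right (by omega), min_eq_right (by omega), add_zero]
      push_cast at h4 ⊢
      rw [h4]
      split_ifs at h3 h4 ⊢ <;> push_cast at h2 <;> linarith
  -- The right-hand side does not grow with the number L of blocks, which forces N c ≤ h.
  have final : ∀ L : ℕ, L * (N * c - h) ≤ M * C := by
    intro L
    have h1 := hc (L * N)
    have h2 := step (L * N) L le_rfl
    have h3 : (min (L : ℝ) M) * C ≤ M * C := by
      gcongr
      exact min_le_right _ _
    push_cast at h1 h2
    rw [mul_sub]
    linarith
  by_contra hlt
  push Not at hlt
  obtain ⟨L, hL⟩ := exists_nat_gt (M * C / (N * c - h))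
  have := final L
  rw [div_lt_iff₀ (by linarith)] at hL
  linarith

end Increments

/-! ### Uniform measures on finite families and on orbit segments. -/

section Averages

variable {Ω : Type*} [MeasurableSpace Ω]

/-- The uniform probability measure on a finite family of points. -/
noncomputable def uniformDirac {D : Type*} [Fintype D] (f : D → Ω) : Measure Ω :=
  (Fintype.card D : ℝ≥0∞)⁻¹ • ∑ a, Measure.dirac (f a)

variable {D : Type*} [Fintype D] {f : D → Ω}

theorem uniformDirac_real_apply {s : Set Ω} (hs : MeasurableSet s) [DecidablePred fun a => f a ∈ s] :
    (uniformDirac f).real s = ((Finset.univ.filter fun a => f a ∈ s).card : ℝ) / Fintype.card D := by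
  rw [Measure.real, uniformDirac, Measure.smul_apply, Measure.finsetSum_apply]
  simp only [Measure.dirac_apply' _ hs]
  rw [show ∑ a, s.indicator (1 : Ω → ℝ≥0∞) (f a) = ((Finset.univ.filter fun a => f a ∈ s).card : ℝ≥0∞) by
    rw [Finset.card_filter, Nat.cast_sum]
    refine Finset.sum_congr rfl fun a _ => ?_
    by_cases h : f a ∈ s <;> simp [h]]
  simp only [smul_eq_mul, ENNReal.toReal_mul, ENNReal.toReal_inv, ENNReal.toReal_natCast]
  rw [div_eq_inv_mul]

instance [Nonempty D] : IsProbabilityMeasure (uniformDirac f) := by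
  constructor
  rw [uniformDirac, Measure.smul_apply, Measure.finsetSum_apply]
  simp only [measure_univ, Finset.sum_const, Finset.card_univ, nsmul_eq_mul, mul_one, smul_eq_mul]
  exact ENNReal.inv_mul_cancel (by simp) (by simp)

theorem integral_uniformDirac {g : Ω → ℝ} (hg : StronglyMeasurable g) :
    ∫ x, g x ∂(uniformDirac f) = (∑ a, g (f a)) / Fintype.card D := by
  rw [uniformDirac, integral_smul_measure, integral_finsetSum_measure]
  · simp only [integral_dirac' g _ hg]
    rw [smul_eq_mul, ENNReal.toReal_inv, ENNReal.toReal_natCast, div_eq_inv_mul]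
  · intro a _
    exact (integrable_dirac' hg (by simp))

/-- The entropy of a labelling of a finite set with the uniform measure. -/
noncomputable def countEntropy {ι : Type*} [Fintype ι] (α : D → ι) : ℝ :=
  @finEntropy D ⊤ ι _ (@uniformDirac D ⊤ D _ id) α

theorem finEntropy_uniformDirac {ι : Type*} [Fintype ι] {α : Ω → ι} (hα : LabelMeasurable α) :
    finEntropy (uniformDirac f) α = countEntropy (α ∘ f) := by
  classical
  let _ : MeasurableSpace D := ⊤
  refine Finset.sum_congr rfl fun i _ => ?_
  rw [uniformDirac_real_apply (hα i), uniformDirac_real_apply (show MeasurableSet[⊤] _ from trivial)]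
  rfl

theorem labelMeasurable_top {ι : Type*} (α : D → ι) : @LabelMeasurable D ⊤ ι α := fun _ => trivial

theorem countEntropy_le_of_factorsThrough [Nonempty D] {ι κ : Type*} [Fintype ι] [Fintype κ]
    {α : D → ι} {β : D → κ} (h : Function.FactorsThrough α β) : countEntropy α ≤ countEntropy β :=
  @finEntropy_le_of_factorsThrough D ⊤ _ _ ι κ _ _ α β (labelMeasurable_top β) h

theorem countEntropy_pair_le [Nonempty D] {ι κ : Type*} [Fintype ι] [Fintype κ]
    {α : D → ι} {β : D → κ} : countEntropy (fun d => (α d, β d)) ≤ countEntropy α + countEntropy β :=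
  @finEntropy_pair_le D ⊤ _ _ ι κ _ _ α β (labelMeasurable_top α) (labelMeasurable_top β)

theorem countEntropy_le_log_card [Nonempty D] {ι : Type*} [Fintype ι] (α : D → ι) :
    countEntropy α ≤ Real.log (Fintype.card ι) :=
  @finEntropy_le_log_card D ⊤ _ _ ι _ α (labelMeasurable_top α)

theorem countEntropy_eq {ι : Type*} [Fintype ι] [DecidableEq ι] (α : D → ι) :
    countEntropy α = ∑ i, Real.negMulLog
      (((Finset.univ.filter fun a => α a = i).card : ℝ) / Fintype.card D) := by
  classical
  refine Finset.sum_congr rfl fun i _ => ?_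
  rw [@uniformDirac_real_apply D ⊤ D _ id _ trivial]
  congr!

/-- A labelling of a finite set all of whose atoms have at most `K` elements has entropy at least
`log (card / K)`. -/
theorem le_countEntropy [Nonempty D] {ι : Type*} [Fintype ι] [DecidableEq ι] (α : D → ι) {K : ℝ}
    (hK : ∀ i, ((Finset.univ.filter fun a => α a = i).card : ℝ) ≤ K) :
    Real.log (Fintype.card D) - Real.log K ≤ countEntropy α := by
  have hD : (0 : ℝ) < Fintype.card D := by exact_mod_cast Fintype.card_pos
  have hsum : ∑ i, (((Finset.univ.filter fun a => α a = i).card : ℝ) / Fintype.card D) = 1 := by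
    rw [← Finset.sum_div, ← Nat.cast_sum, ← Finset.card_eq_sum_card_fiberwise (by simp),
      Finset.card_univ, div_self hD.ne']
  rw [countEntropy_eq]
  calc Real.log (Fintype.card D) - Real.log K
      = ∑ i, (((Finset.univ.filter fun a => α a = i).card : ℝ) / Fintype.card D) *
          (Real.log (Fintype.card D) - Real.log K) := by rw [← Finset.sum_mul, hsum, one_mul]
    _ ≤ _ := by
      refine Finset.sum_le_sum fun i _ => ?_
      rcases Nat.eq_zero_or_pos (Finset.univ.filter fun a => α a = i).card with h0 | hp
      · rw [h0]; simp
      · have hp' : (0 : ℝ) < (Finset.univ.filter fun a => α a = i).card := by exact_mod_cast hp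
        rw [Real.negMulLog, neg_mul, Real.log_div hp'.ne' hD.ne', ← mul_neg, neg_sub]
        have := Real.log_le_log hp' (hK i)
        gcongr

/-- The entropy of a labelling of a product given the first factor. -/
theorem countEntropy_prod_fst {E : Type*} [Fintype E] [Nonempty D] [Nonempty E] {ι : Type*}
    [Fintype ι] (α : D × E → ι) [DecidableEq D] :
    countEntropy (fun p : D × E => (α p, p.1)) - countEntropy (fun p : D × E => p.1) =
      (∑ d, countEntropy fun e => α (d, e)) / Fintype.card D := by
  classical
  have hD : (0 : ℝ) < Fintype.card D := by exact_mod_cast Fintype.card_pos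
  have hE : (0 : ℝ) < Fintype.card E := by exact_mod_cast Fintype.card_pos
  have c1 : ∀ i d, ((Finset.univ.filter fun p : D × E => (α p, p.1) = (i, d)).card : ℝ) =
      (Finset.univ.filter fun e => α (d, e) = i).card := by
    intro i d
    norm_cast
    refine Finset.card_bij' (fun p _ => p.2) (fun e _ => (d, e)) ?_ ?_ ?_ ?_
    · rintro ⟨d', e⟩ h
      simp only [Finset.mem_filter, Finset.mem_univ, true_and, Prod.mk.injEq] at h ⊢
      rw [← h.2]; exact h.1
    · intro e h
      simpa using h
    · rintro ⟨d', e⟩ h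
      simp only [Finset.mem_filter, Finset.mem_univ, true_and, Prod.mk.injEq] at h ⊢
      exact ⟨h.2.symm, trivial⟩
    · intro e h; rfl
  have c2 : ∀ d, ((Finset.univ.filter fun p : D × E => p.1 = d).card : ℝ) = Fintype.card E := by
    intro d
    norm_cast
    rw [← Finset.card_univ]
    refine Finset.card_bij' (fun p _ => p.2) (fun e _ => (d, e)) ?_ ?_ ?_ ?_
    · intros; simp
    · intro e h
      simp
    · rintro ⟨d', e⟩ h
      simp only [Finset.mem_filter, Finset.mem_univ, true_and, Prod.mk.injEq] at h ⊢
      exact ⟨h.symm, trivial⟩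
    · intro e h; rfl
  have hsum : ∀ d, ∑ i, (((Finset.univ.filter fun e => α (d, e) = i).card : ℝ) / Fintype.card E) = 1 := by
    intro d
    rw [← Finset.sum_div, ← Nat.cast_sum, ← Finset.card_eq_sum_card_fiberwise
      (f := fun e => α (d, e)) (s := Finset.univ) (t := Finset.univ) (by simp),
      Finset.card_univ, div_self hE.ne']
  rw [countEntropy_eq, countEntropy_eq, Fintype.sum_prod_type, Finset.sum_comm,
    ← Finset.sum_sub_distrib, Finset.sum_div]
  refine Finset.sum_congr rfl fun d _ => ?_
  simp only [c1, c2, Fintype.card_prod, Nat.cast_mul]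
  rw [countEntropy_eq]
  have key : ∀ i, Real.negMulLog (((Finset.univ.filter fun e => α (d, e) = i).card : ℝ) /
      (Fintype.card D * Fintype.card E)) =
      Real.negMulLog (((Finset.univ.filter fun e => α (d, e) = i).card : ℝ) / Fintype.card E) /
        Fintype.card D +
      (((Finset.univ.filter fun e => α (d, e) = i).card : ℝ) / Fintype.card E) *
        Real.negMulLog (1 / Fintype.card D) := by
    intro i
    rw [show ((Finset.univ.filter fun e => α (d, e) = i).card : ℝ) /
      (Fintype.card D * Fintype.card E) = (((Finset.univ.filter fun e => α (d, e) = i).card : ℝ) /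
        Fintype.card E) * (1 / Fintype.card D) by field_simp, Real.negMulLog_mul]
    ring
  simp_rw [key]
  rw [Finset.sum_add_distrib, ← Finset.sum_mul, hsum, ← Finset.sum_div]
  rw [show (Fintype.card E : ℝ) / (Fintype.card D * Fintype.card E) = 1 / Fintype.card D by
    field_simp]
  ring

/-- Averaging over the time shifts of a window of length `q`. -/
theorem mul_countEntropy_iteratedJoin_le [Nonempty D] {ι : Type*} [Fintype ι] [Nonempty ι]
    {T : Ω → Ω} (P : Ω → ι) (y : D → Ω) (q k : ℕ) :
    q * countEntropy (iteratedJoin T P k ∘ y) ≤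
      (∑ l ∈ Finset.range k, countEntropy (iteratedJoin T P q ∘ T^[l] ∘ y)) +
        q * (q * Real.log (Fintype.card ι)) := by
  have hlog : 0 ≤ Real.log (Fintype.card ι) :=
    Real.log_natCast_nonneg _
  -- Passing from k to k + 1 exchanges the name of length k for the one of length k + q. Their
  -- entropies differ by at most that of the window of length q read from time k.
  have tele : ∀ k, ∑ s ∈ Finset.range q, countEntropy (iteratedJoin T P (k + s) ∘ y) ≤
      ∑ s ∈ Finset.range q, countEntropy (iteratedJoin T P s ∘ y) +
        ∑ l ∈ Finset.range k, countEntropy (iteratedJoin T P q ∘ T^[l] ∘ y) := by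
    intro k
    induction k with
    | zero =>
      rw [Finset.range_zero, Finset.sum_empty, add_zero]
      exact Finset.sum_le_sum fun s _ => countEntropy_le_of_factorsThrough fun d e h =>
        iteratedJoin_factorsThrough_of_le (T := T) (P := P) (Nat.zero_add s).le h
    | succ k ih =>
      rw [Finset.sum_range_succ]
      have h1 : ∑ s ∈ Finset.range q, countEntropy (iteratedJoin T P (k + 1 + s) ∘ y) +
          countEntropy (iteratedJoin T P k ∘ y) =
          ∑ s ∈ Finset.range q, countEntropy (iteratedJoin T P (k + s) ∘ y) +
            countEntropy (iteratedJoin T P (k + q) ∘ y) := by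
        rw [← Finset.sum_range_succ (fun s => countEntropy (iteratedJoin T P (k + s) ∘ y)),
          Finset.sum_range_succ', add_zero]
        congr 1
        refine Finset.sum_congr rfl fun s _ => ?_
        rw [show k + 1 + s = k + (s + 1) by omega]
      have h2 : countEntropy (iteratedJoin T P (k + q) ∘ y) ≤
          countEntropy (iteratedJoin T P k ∘ y) +
            countEntropy (iteratedJoin T P q ∘ T^[k] ∘ y) := by
        refine le_trans ?_ countEntropy_pair_le
        exact countEntropy_le_of_factorsThrough fun d e h =>
          iteratedJoin_add_factorsThrough (T := T) (P := P) h
      linarith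
  -- Boundary term of the telescoping: q names of length less than q.
  have h1 : ∑ s ∈ Finset.range q, countEntropy (iteratedJoin T P s ∘ y) ≤
      q * (q * Real.log (Fintype.card ι)) := by
    rw [← nsmul_eq_mul, ← Finset.card_range q, Finset.card_range]
    refine (Finset.sum_le_card_nsmul _ _ (q * Real.log (Fintype.card ι)) fun s hs => ?_).trans_eq
      (by simp)
    refine (countEntropy_le_log_card _).trans ?_
    rw [Fintype.card_fun, Nat.cast_pow, Real.log_pow, Fintype.card_fin]
    gcongr
    exact (Finset.mem_range.1 hs).le
  have h2 : q * countEntropy (iteratedJoin T P k ∘ y) ≤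
      ∑ s ∈ Finset.range q, countEntropy (iteratedJoin T P (k + s) ∘ y) := by
    have : ∀ s ∈ Finset.range q, countEntropy (iteratedJoin T P k ∘ y) ≤
        countEntropy (iteratedJoin T P (k + s) ∘ y) := fun s _ =>
      countEntropy_le_of_factorsThrough fun d e h =>
        iteratedJoin_factorsThrough_of_le (T := T) (P := P) (Nat.le_add_right k s) h
    have := Finset.card_nsmul_le_sum _ _ _ this
    simpa using this
  have := tele k
  linarith

/-- Lower bound for the entropy of the average of the orbits of finitely many points, given a
partition which depends only on the time. -/
theorem le_finCondEntropy_uniformDirac [Nonempty D] {ι κ : Type*} [Fintype ι] [Nonempty ι]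
    [Fintype κ] {T : Ω → Ω} (hT : Measurable T) {P : Ω → ι} (hP : LabelMeasurable P) {β : Ω → κ}
    (hβ : LabelMeasurable β) (y : D → Ω) (hy : ∀ l d d', β (T^[l] (y d)) = β (T^[l] (y d')))
    (q k : ℕ) [NeZero k] :
    (q / k : ℝ) * (countEntropy (iteratedJoin T P k ∘ y) - q * Real.log (Fintype.card ι)) ≤
      finCondEntropy (uniformDirac fun p : Fin k × D => T^[(p.1 : ℕ)] (y p.2))
        (iteratedJoin T P q) β := by
  have hPq := hP.iteratedJoin hT q
  set f : Fin k × D → Ω := fun p => T^[(p.1 : ℕ)] (y p.2) with hf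
  have hk : (0 : ℝ) < k := by exact_mod_cast Nat.pos_of_ne_zero (NeZero.ne k)
  rw [finCondEntropy, finEntropy_uniformDirac (hPq.pair hβ), finEntropy_uniformDirac hβ]
  -- On the index set the label β depends on the time alone, so conditioning on the time conditions
  -- on more. Given the time, the entropy is the average over l of the entropies of the windows
  -- starting at time l.
  have h1 := @finCondEntropy_anti (Fin k × D) ⊤ (@uniformDirac (Fin k × D) ⊤ _ _ id) inferInstance
    _ _ _ _ _ _ (iteratedJoin T P q ∘ f) (β ∘ f) (fun p => p.1) (labelMeasurable_top _)
    (labelMeasurable_top _) (labelMeasurable_top _) (by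
      rintro ⟨l, d⟩ ⟨l', d'⟩ h
      obtain rfl : l = l' := h
      exact hy l d d')
  have h2 := countEntropy_prod_fst (D := Fin k) (E := D) (iteratedJoin T P q ∘ f)
  have h3 := mul_countEntropy_iteratedJoin_le (T := T) P y q k
  rw [← Fin.sum_univ_eq_sum_range (fun l => countEntropy (iteratedJoin T P q ∘ T^[l] ∘ y))] at h3
  refine le_trans ?_ h1
  refine le_trans ?_ h2.ge
  rw [Fintype.card_fin, div_mul_eq_mul_div]
  gcongr
  have h4 : ∀ d : Fin k, countEntropy (fun e => (iteratedJoin T P q ∘ f) (d, e)) =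
      countEntropy (iteratedJoin T P q ∘ T^[(d : ℕ)] ∘ y) := fun d => rfl
  simp_rw [h4]
  linarith

end Averages

/-! ### Conditional entropy of a finite partition given a σ-algebra. -/

section CondEntropyBound

variable {Ω : Type*} {m m' C D : MeasurableSpace Ω} {𝒜₀ : MeasurableSpace Ω} {μ : Measure Ω} [IsProbabilityMeasure μ]
variable {ι : Type*} [Fintype ι] {ξ : Ω → ι}

/-- The conditional probability of the atom of label `i`. -/
noncomputable def condLabel (μ : Measure[𝒜₀] Ω) (ξ : Ω → ι) (m : MeasurableSpace Ω) (i : ι) : Ω → ℝ :=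
  condExp m μ ((ξ ⁻¹' {i}).indicator fun _ => (1 : ℝ))

theorem integrable_label (hξ : LabelMeasurable ξ) (i : ι) :
    Integrable ((ξ ⁻¹' {i}).indicator fun _ => (1 : ℝ)) μ :=
  (integrable_const (1 : ℝ)).indicator (hξ i)

theorem condLabel_nonneg (i : ι) : 0 ≤ᵐ[μ] condLabel μ ξ m i :=
  condExp_nonneg (ae_of_all _ fun _ => indicator_nonneg (fun _ _ => zero_le_one) _)

theorem condLabel_le_one (hξ : LabelMeasurable ξ) (hm : m ≤ 𝒜₀) (i : ι) :
    condLabel μ ξ m i ≤ᵐ[μ] 1 := by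
  have h := condExp_mono (m := m) (integrable_label (μ := μ) hξ i) (integrable_const (1 : ℝ))
    (ae_of_all _ fun x => indicator_le_self' (fun _ _ => zero_le_one) x)
  rw [condExp_const hm] at h
  exact h

theorem sum_condLabel (hξ : LabelMeasurable ξ) (hm : m ≤ 𝒜₀) :
    ∀ᵐ x ∂μ, ∑ i, condLabel μ ξ m i x = 1 := by
  have h := condExp_finsetSum (m := m) (s := Finset.univ) fun i _ => integrable_label (μ := μ) hξ i
  have e : (∑ i, (ξ ⁻¹' {i}).indicator fun _ => (1 : ℝ)) = fun _ => (1 : ℝ) := by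
    classical
    ext x
    simp [Finset.sum_apply, indicator_apply]
  rw [e, condExp_const hm] at h
  filter_upwards [h] with x hx
  rw [Finset.sum_apply] at hx
  exact hx.symm

theorem setIntegral_condLabel (hξ : LabelMeasurable ξ) (hm : m ≤ 𝒜₀) (i : ι)
    {s : Set Ω} (hs : MeasurableSet[m] s) :
    ∫ x in s, condLabel μ ξ m i x ∂μ = μ.real (ξ ⁻¹' {i} ∩ s) := by
  rw [condLabel, setIntegral_condExp hm (integrable_label hξ i) hs, integral_indicator (hξ i)]
  simp [Measure.restrict_restrict (hξ i)]

/-- Restricting μ to the atom, or weighting μ by the conditional probability of the atom, gives the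
same measure on `m`. Since φ takes values in [0, ∞], this applies to an unbounded information
function. -/
theorem setLIntegral_label (hξ : LabelMeasurable ξ) (hm : m ≤ 𝒜₀) (i : ι)
    {φ : Ω → ℝ≥0∞} (hφ : Measurable[m] φ) :
    ∫⁻ x in ξ ⁻¹' {i}, φ x ∂μ = ∫⁻ x, ENNReal.ofReal (condLabel μ ξ m i x) * φ x ∂μ := by
  have hmeas : Measurable[m] fun x => ENNReal.ofReal (condLabel μ ξ m i x) :=
    stronglyMeasurable_condExp.measurable.ennreal_ofReal
  have hmeas' : Measurable fun x => ENNReal.ofReal (condLabel μ ξ m i x) := hmeas.mono hm le_rfl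
  have key : (μ.restrict (ξ ⁻¹' {i})).trim hm =
      (μ.withDensity fun x => ENNReal.ofReal (condLabel μ ξ m i x)).trim hm := by
    refine @Measure.ext _ m _ _ fun s hs => ?_
    rw [trim_measurableSet_eq hm hs, trim_measurableSet_eq hm hs, Measure.restrict_apply (hm s hs),
      withDensity_apply _ (hm s hs), ← ofReal_integral_eq_lintegral_ofReal
        (f := condLabel μ ξ m i) integrable_condExp.integrableOn
        (ae_restrict_of_ae (condLabel_nonneg i)), setIntegral_condLabel hξ hm i hs, ofReal_measureReal, inter_comm]
  rw [← lintegral_trim hm hφ, key, lintegral_trim hm hφ,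
    lintegral_withDensity_eq_lintegral_mul _ hmeas' (hφ.mono hm le_rfl)]
  rfl

theorem condEntropy_eq_sum (hξ : LabelMeasurable ξ) :
    condEntropy μ ξ m =
      ∑ i, ∫⁻ x in ξ ⁻¹' {i}, ENNReal.ofReal (-Real.log (condLabel μ ξ m i x)) ∂μ := by
  have hU : (univ : Set Ω) = ⋃ i ∈ (Finset.univ : Finset ι), ξ ⁻¹' {i} := by
    ext x
    simp
  rw [condEntropy, ← setLIntegral_univ, hU, lintegral_biUnion_finset]
  · refine Finset.sum_congr rfl fun i _ => setLIntegral_congr_fun (hξ i) fun x hx => ?_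
    rw [show ξ x = i from hx]
    rfl
  · intro i _ j _ hij
    refine Set.disjoint_left.2 ?_
    rintro x h1 h2
    exact hij (h1.symm.trans h2)
  · exact fun i _ => hξ i

/-- Gibbs' inequality. As `Real.log 0 = 0`, an index with h i = 0 would contribute nothing instead
of ∞; `hz` excludes this for positive g i. -/
theorem sum_mul_neg_log_ge {g h : ι → ℝ} (hg : ∀ i, 0 ≤ g i) (hh : ∀ i, 0 ≤ h i)
    (hgs : ∑ i, g i = 1) (hhs : ∑ i, h i = 1) (hz : ∀ i, h i = 0 → g i = 0) :
    ∑ i, Real.negMulLog (g i) ≤ ∑ i, g i * -Real.log (h i) := by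
  have hpt : ∀ i, Real.negMulLog (g i) ≤ g i * -Real.log (h i) + (h i - g i) := by
    intro i
    rcases (hg i).eq_or_lt with h0 | hp
    · rw [← h0]
      simpa using hh i
    · have hhp : 0 < h i := (hh i).lt_of_ne fun e => hp.ne' (hz i e.symm)
      have key := Real.log_le_sub_one_of_pos (show 0 < h i / g i by positivity)
      rw [Real.log_div hhp.ne' hp.ne'] at key
      have key2 := mul_le_mul_of_nonneg_left key hp.le
      rw [show g i * (h i / g i - 1) = h i - g i by field_simp] at key2
      rw [Real.negMulLog]
      linarith
  have := Finset.sum_le_sum fun i (_ : i ∈ Finset.univ) => hpt i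
  rw [Finset.sum_add_distrib, Finset.sum_sub_distrib, hgs, hhs] at this
  linarith

theorem integrable_negMulLog_condLabel (hξ : LabelMeasurable ξ)
    (hm : m ≤ 𝒜₀) (i : ι) : Integrable (fun x => Real.negMulLog (condLabel μ ξ m i x)) μ := by
  refine Integrable.of_bound (C := 1)
    (Real.continuous_negMulLog.comp_aestronglyMeasurable
      integrable_condExp.aestronglyMeasurable) ?_
  filter_upwards [condLabel_nonneg (m := m) (μ := μ) (ξ := ξ) i, condLabel_le_one (μ := μ) hξ hm i] with x h0 h1
  have h1' : condLabel μ ξ m i x ≤ 1 := h1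
  have h0' : 0 ≤ condLabel μ ξ m i x := h0
  rw [Real.norm_eq_abs, abs_of_nonneg (Real.negMulLog_nonneg h0' h1')]
  have := Real.negMulLog_le_one_sub_self h0'
  linarith

/-- Refining the conditioning decreases the conditional entropy. -/
theorem ofReal_sum_integral_le_condEntropy (hξ : LabelMeasurable ξ)
    (hm : m ≤ m') (hm' : m' ≤ 𝒜₀) :
    ENNReal.ofReal (∑ i, ∫ x, Real.negMulLog (condLabel μ ξ m' i x) ∂μ) ≤ condEntropy μ ξ m := by
  have hmeas : ∀ i, Measurable[m'] fun x => ENNReal.ofReal (-Real.log (condLabel μ ξ m i x)) := by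
    intro i
    have : Measurable[m'] (condLabel μ ξ m i) := stronglyMeasurable_condExp.measurable.mono hm le_rfl
    exact (Real.measurable_log.comp this).neg.ennreal_ofReal
  -- The zero set of the coarser conditional probability belongs to `m` and meets the atom in a null
  -- set, so the finer conditional probability has integral zero over it.
  have hz : ∀ᵐ x ∂μ, ∀ i, condLabel μ ξ m i x = 0 → condLabel μ ξ m' i x = 0 := by
    rw [ae_all_iff]
    intro i
    set N := {x | condLabel μ ξ m i x = 0} with hN
    have hNm : MeasurableSet[m] N :=
      (stronglyMeasurable_condExp.measurable : Measurable[m] (condLabel μ ξ m i))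
        (measurableSet_singleton 0)
    have h1 : ∫ x in N, condLabel μ ξ m i x ∂μ = 0 :=
      setIntegral_eq_zero_of_forall_eq_zero fun x hx => hx
    rw [setIntegral_condLabel hξ (hm.trans hm') i hNm,
      ← setIntegral_condLabel hξ hm' i (hm _ hNm)] at h1
    rw [setIntegral_eq_zero_iff_of_nonneg_ae (ae_restrict_of_ae (condLabel_nonneg i))
      integrable_condExp.integrableOn] at h1
    rw [Filter.EventuallyEq, ae_restrict_iff' (hm' _ (hm _ hNm))] at h1
    exact h1
  rw [condEntropy_eq_sum hξ, Finset.sum_congr rfl fun i _ => setLIntegral_label hξ hm' i (hmeas i),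
    ← integral_finsetSum _ fun i _ => integrable_negMulLog_condLabel hξ hm' i,
    ofReal_integral_eq_lintegral_ofReal (integrable_finsetSum _ fun i _ =>
      integrable_negMulLog_condLabel hξ hm' i),
    ← lintegral_finsetSum]
  · refine lintegral_mono_ae ?_
    have a1 := ae_all_iff.2 fun i => condLabel_nonneg (m := m) (μ := μ) (ξ := ξ) i
    have a2 := ae_all_iff.2 fun i => condLabel_nonneg (m := m') (μ := μ) (ξ := ξ) i
    have a3 := ae_all_iff.2 fun i => condLabel_le_one (μ := μ) hξ (hm.trans hm') i
    filter_upwards [hz, a1, a2, a3, sum_condLabel (μ := μ) hξ hm',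
      sum_condLabel (μ := μ) hξ (hm.trans hm')] with x h1 h2 h3 h4 h5 h6
    have hlog : ∀ i, 0 ≤ -Real.log (condLabel μ ξ m i x) := fun i =>
      neg_nonneg.2 (Real.log_nonpos (h2 i) (h4 i))
    rw [Finset.sum_congr rfl fun i _ => (ENNReal.ofReal_mul (h3 i)).symm,
      ← ENNReal.ofReal_sum_of_nonneg fun i _ => mul_nonneg (h3 i) (hlog i)]
    exact ENNReal.ofReal_le_ofReal (sum_mul_neg_log_ge h3 h2 h5 h6 h1)
  · intro i _
    exact (stronglyMeasurable_condExp.measurable.mono hm' le_rfl).ennreal_ofReal.mul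
      ((hmeas i).mono hm' le_rfl)
  · have a2 := ae_all_iff.2 fun i => condLabel_nonneg (m := m') (μ := μ) (ξ := ξ) i
    have a3 := ae_all_iff.2 fun i => condLabel_le_one (μ := μ) hξ hm' i
    filter_upwards [a2, a3] with x h2 h3
    exact Finset.sum_nonneg fun i _ => Real.negMulLog_nonneg (h2 i) (h3 i)

/-- Conditional probabilities given a finite partition are functions F of its label with F i b · μ(γ
= b) = μ(ξ = i, γ = b); the product rule for `Real.negMulLog` then yields H(ξ ∨ γ) - H(γ). This
links the combinatorial conditional entropy to the measure-theoretic one. -/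
theorem finCondEntropy_eq_sum_integral {κ : Type*} [Fintype κ] {γ : Ω → κ}
    (hmγ : m = MeasurableSpace.comap γ ⊤) (hξ : LabelMeasurable ξ) (hγ : LabelMeasurable γ) :
    ∑ i, ∫ x, Real.negMulLog (condLabel μ ξ m i x) ∂μ = finCondEntropy μ ξ γ := by
  classical
  have hm : m ≤ 𝒜₀ := by
    rw [hmγ]
    rintro s ⟨t, _, rfl⟩
    exact hγ.preimage t
  have hconst : ∀ i x y, γ x = γ y → condLabel μ ξ m i x = condLabel μ ξ m i y := by
    intro i x y hxy
    have h1 : MeasurableSet[m] (condLabel μ ξ m i ⁻¹' {condLabel μ ξ m i x}) :=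
      (stronglyMeasurable_condExp.measurable : Measurable[m] (condLabel μ ξ m i))
        (measurableSet_singleton _)
    rw [hmγ] at h1
    obtain ⟨t, _, ht⟩ := h1
    rw [← hmγ] at ht
    have hx : x ∈ γ ⁻¹' t := by rw [ht]; rfl
    have hy : y ∈ γ ⁻¹' t := by
      change γ y ∈ t
      rw [← hxy]
      exact hx
    rw [ht] at hy
    exact hy.symm
  -- A label that is not attained has an empty atom, so its value 0 never matters.
  set F : ι → κ → ℝ := fun i b => if h : ∃ x, γ x = b then condLabel μ ξ m i h.choose else 0 with hF
  have hFγ : ∀ i x, condLabel μ ξ m i x = F i (γ x) := by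
    intro i x
    have h : ∃ y, γ y = γ x := ⟨x, rfl⟩
    simp only [hF, dif_pos h]
    exact hconst i _ _ h.choose_spec.symm
  have hint : ∀ φ : κ → ℝ, ∫ x, φ (γ x) ∂μ = ∑ b, μ.real (γ ⁻¹' {b}) * φ b := by
    intro φ
    have hU : (univ : Set Ω) = ⋃ b ∈ (Finset.univ : Finset κ), γ ⁻¹' {b} := by
      ext x
      simp
    have hval : ∀ b, ∀ x ∈ γ ⁻¹' {b}, φ (γ x) = φ b := fun b x hx => by
      rw [show γ x = b from hx]
    rw [← setIntegral_univ, hU, integral_biUnion_finset]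
    · refine Finset.sum_congr rfl fun b _ => ?_
      rw [setIntegral_congr_fun (hγ b) (hval b), setIntegral_const, smul_eq_mul]
    · exact fun b _ => hγ b
    · intro i _ j _ hij
      refine Set.disjoint_left.2 ?_
      rintro x h1 h2
      exact hij (h1.symm.trans h2)
    · intro b _
      exact (integrableOn_congr_fun (hval b) (hγ b)).2 (integrable_const _).integrableOn
  have hFμ : ∀ i b, F i b * μ.real (γ ⁻¹' {b}) = μ.real (ξ ⁻¹' {i} ∩ γ ⁻¹' {b}) := by
    intro i b
    have hb : MeasurableSet[m] (γ ⁻¹' {b}) := by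
      rw [hmγ]
      exact ⟨{b}, trivial, rfl⟩
    rw [← setIntegral_condLabel hξ hm i hb, setIntegral_congr_fun (g := fun _ => F i b) (hγ b),
      setIntegral_const, smul_eq_mul, mul_comm]
    intro x hx
    rw [hFγ, show γ x = b from hx]
  have hFs : ∀ b, μ.real (γ ⁻¹' {b}) * ∑ i, F i b = μ.real (γ ⁻¹' {b}) := by
    intro b
    rw [mul_comm, Finset.sum_mul, Finset.sum_congr rfl fun i _ => hFμ i b,
      ← sum_measureReal_inter_label hξ (hγ b)]
    exact Finset.sum_congr rfl fun i _ => by rw [inter_comm]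
  have e1 : finEntropy μ (pairLabel ξ γ) =
      ∑ b, ∑ i, (F i b * Real.negMulLog (μ.real (γ ⁻¹' {b})) +
        μ.real (γ ⁻¹' {b}) * Real.negMulLog (F i b)) := by
    rw [finEntropy, Fintype.sum_prod_type, Finset.sum_comm]
    refine Finset.sum_congr rfl fun b _ => Finset.sum_congr rfl fun i _ => ?_
    have : pairLabel ξ γ ⁻¹' {(i, b)} = ξ ⁻¹' {i} ∩ γ ⁻¹' {b} := by
      ext x
      simp [pairLabel]
    rw [this, ← hFμ, mul_comm, Real.negMulLog_mul]
  have e2 : ∀ b, (∑ i, F i b) * Real.negMulLog (μ.real (γ ⁻¹' {b})) =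
      Real.negMulLog (μ.real (γ ⁻¹' {b})) := by
    intro b
    rw [Real.negMulLog]
    have := hFs b
    linear_combination (-Real.log (μ.real (γ ⁻¹' {b}))) * this
  rw [finCondEntropy, e1]
  simp only [Finset.sum_add_distrib, ← Finset.sum_mul, e2]
  rw [finEntropy, add_sub_cancel_left, Finset.sum_comm]
  refine Finset.sum_congr rfl fun i _ => ?_
  simp only [hFγ]
  rw [hint fun b => Real.negMulLog (F i b)]

/-- The measurable sets whose trace on Z agrees, modulo null sets, with a set of `C` form a
σ-algebra. Taking it as `D` turns an inclusion of `m` in `C` that holds only on Z and modulo μ into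
a genuine inclusion m ≤ D. -/
theorem exists_algebra_ae_eq_on {Z : Set Ω} (hC : C ≤ 𝒜₀) (hm : m ≤ 𝒜₀)
    (hmZ : ∀ S, MeasurableSet[m] S → ∃ B, MeasurableSet[C] B ∧ (S ∩ Z : Set Ω) =ᵐ[μ] B) :
    ∃ D : MeasurableSpace Ω, D ≤ 𝒜₀ ∧ C ≤ D ∧ m ≤ D ∧
      ∀ S, MeasurableSet[D] S → ∃ B, MeasurableSet[C] B ∧ (S ∩ Z : Set Ω) =ᵐ[μ] B := by
  obtain ⟨BZ, hBZ, hZBZ⟩ := hmZ univ MeasurableSet.univ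
  rw [univ_inter] at hZBZ
  refine ⟨
    { MeasurableSet' := fun S => MeasurableSet[𝒜₀] S ∧ ∃ B, MeasurableSet[C] B ∧
        (S ∩ Z : Set Ω) =ᵐ[μ] B
      measurableSet_empty := ⟨MeasurableSet.empty, ∅, @MeasurableSet.empty _ C, by
        rw [empty_inter]
        exact ae_eq_refl _⟩
      measurableSet_compl := ?_
      measurableSet_iUnion := ?_ }, fun S hS => hS.1, fun B hB => ⟨hC B hB, B ∩ BZ,
        @MeasurableSet.inter _ C _ _ hB hBZ, (ae_eq_refl B).inter hZBZ⟩,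
      fun S hS => ⟨hm S hS, hmZ S hS⟩, fun S hS => hS.2⟩
  · rintro S ⟨hS, B, hB, hSB⟩
    refine ⟨hS.compl, BZ \ B, @MeasurableSet.diff _ C _ _ hBZ hB, ?_⟩
    have : Sᶜ ∩ Z = Z \ (S ∩ Z) := by
      ext x
      simp only [mem_inter_iff, mem_compl_iff, Set.mem_sdiff]
      tauto
    rw [this]
    exact hZBZ.diff hSB
  · intro f hf
    choose h1 B hB hfB using hf
    refine ⟨MeasurableSet.iUnion h1, ⋃ i, B i, @MeasurableSet.iUnion _ _ C _ _ hB, ?_⟩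
    rw [iUnion_inter]
    exact Filter.EventuallyEq.countable_iUnion hfB

/-- On Z the algebras D and C agree modulo null sets, and off Z the partition has a single atom, so
its conditional probabilities there are 0 or 1. Splitting a set of D along Z shows that the version
given C has the defining property of the version given D. -/
theorem condLabel_ae_eq_of_trivial_off {Z : Set Ω} (hDle : D ≤ 𝒜₀) (hCD : C ≤ D)
    (hZ : MeasurableSet Z) (hDZ : ∀ S, MeasurableSet[D] S → ∃ B, MeasurableSet[C] B ∧
      (S ∩ Z : Set Ω) =ᵐ[μ] B)
    (hξ : LabelMeasurable ξ) {i₀ : ι} (htriv : ∀ᵐ x ∂μ, x ∉ Z → ξ x = i₀) (i : ι) :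
    condLabel μ ξ D i =ᵐ[μ] condLabel μ ξ C i := by
  classical
  have hCle : C ≤ 𝒜₀ := hCD.trans hDle
  obtain ⟨BZ, hBZ, hZBZ⟩ := hDZ univ MeasurableSet.univ
  rw [univ_inter] at hZBZ
  symm
  have hBc : MeasurableSet[C] BZᶜ := @MeasurableSet.compl _ _ C hBZ
  have htr : ∀ᵐ x ∂μ, x ∉ Z → condLabel μ ξ C i x = (ξ ⁻¹' {i}).indicator (fun _ => (1 : ℝ)) x := by
    have h1 := condExp_indicator (m := C) (μ := μ) (integrable_label hξ i) hBc
    set v : ℝ := if i₀ = i then 1 else 0 with hv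
    have h2 : BZᶜ.indicator ((ξ ⁻¹' {i}).indicator fun _ => (1 : ℝ)) =ᵐ[μ]
        BZᶜ.indicator fun _ => v := by
      filter_upwards [htriv, hZBZ.mem_iff] with x hx hxZ
      by_cases hB : x ∈ BZᶜ
      · have := hx fun h => hB (hxZ.1 h)
        simp only [indicator_of_mem hB, indicator_apply, mem_preimage, this, mem_singleton_iff, hv]
      · simp only [indicator_of_notMem hB]
    have h3 := condExp_congr_ae (m := C) h2
    rw [condExp_of_stronglyMeasurable hCle
      ((@stronglyMeasurable_const _ _ C _ v).indicator hBc)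
      ((integrable_const v).indicator (hCle _ hBc))] at h3
    filter_upwards [h1, h2, h3, hZBZ.mem_iff] with x e1 e2 e3 hxZ hx
    have hB : x ∈ BZᶜ := fun h => hx (hxZ.2 h)
    rw [indicator_of_mem hB] at e1 e2
    rw [condLabel, ← e1, e3, e2]
  refine ae_eq_condExp_of_forall_setIntegral_eq hDle (integrable_label hξ i)
    (fun _ _ _ => integrable_condExp.integrableOn) ?_
    ((stronglyMeasurable_condExp.mono hCD).aestronglyMeasurable)
  intro S hS _
  obtain ⟨B, hB, hSB⟩ := hDZ S hS
  have hI : Integrable (condLabel μ ξ C i) μ := integrable_condExp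
  rw [← integral_inter_add_sdiff (s := S) (t := Z) hZ hI.integrableOn,
    ← integral_inter_add_sdiff (s := S) (t := Z) hZ (integrable_label hξ i).integrableOn]
  congr 1
  · rw [setIntegral_congr_set hSB, setIntegral_congr_set hSB]
    exact setIntegral_condExp hCle (integrable_label hξ i) hB
  · refine setIntegral_congr_ae ((hDle _ hS).diff hZ) ?_
    filter_upwards [htr] with x hx hxS
    exact hx hxS.2

/-- A conditional entropy is bounded below if its conditioning is, up to a set on which the
partition is trivial, contained in the limit of an increasing sequence of finite partitions given
which the entropy is bounded below. -/
theorem le_condEntropy_of_approx {κ : ℕ → Type*} [∀ j, Fintype (κ j)] {γ : ∀ j, Ω → κ j}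
    (hξ : LabelMeasurable ξ) (hγ : ∀ j, LabelMeasurable (γ j))
    (hγmono : ∀ i j, i ≤ j → Function.FactorsThrough (γ i) (γ j))
    {c : ℝ} (hc : ∀ j, c ≤ finCondEntropy μ ξ (γ j)) (hm : m ≤ 𝒜₀)
    {Z : Set Ω} (hZ : MeasurableSet Z)
    (hmZ : ∀ S, MeasurableSet[m] S → ∃ B, MeasurableSet[⨆ j, MeasurableSpace.comap (γ j) ⊤] B ∧
      (S ∩ Z : Set Ω) =ᵐ[μ] B)
    {i₀ : ι} (htriv : ∀ᵐ x ∂μ, x ∉ Z → ξ x = i₀) :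
    ENNReal.ofReal c ≤ condEntropy μ ξ m := by
  have hGle : ∀ j, MeasurableSpace.comap (γ j) ⊤ ≤ 𝒜₀ := by
    rintro j s ⟨t, _, rfl⟩
    exact (hγ j).preimage t
  have hGmono : Monotone fun j => MeasurableSpace.comap (γ j) ⊤ := by
    rintro i j hij s ⟨t, _, rfl⟩
    refine ⟨γ j '' (γ i ⁻¹' t), trivial, ?_⟩
    ext x
    constructor
    · rintro ⟨y, hy, hxy⟩
      change γ i x ∈ t
      rw [← hγmono i j hij hxy]
      exact hy
    · exact fun hx => ⟨x, hx, rfl⟩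
  have hCle : (⨆ j, MeasurableSpace.comap (γ j) ⊤) ≤ 𝒜₀ := iSup_le hGle
  obtain ⟨D, hDle, hCD, hmD, hDZ⟩ := exists_algebra_ae_eq_on hCle hm hmZ
  -- Conditioning on D ⊇ m lowers the entropy. The conditional probabilities given D are those given
  -- C, which by martingale convergence are the limits of those given the finite partitions `γ j`.
  refine le_trans (ENNReal.ofReal_le_ofReal ?_) (ofReal_sum_integral_le_condEntropy hξ hmD hDle)
  have hDC := condLabel_ae_eq_of_trivial_off hDle hCD hZ hDZ hξ htriv
  have hlim : Tendsto (fun j => ∑ i, ∫ x, Real.negMulLog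
      (condLabel μ ξ (MeasurableSpace.comap (γ j) ⊤) i x) ∂μ) atTop
      (𝓝 (∑ i, ∫ x, Real.negMulLog (condLabel μ ξ D i x) ∂μ)) := by
    refine tendsto_finsetSum _ fun i _ => ?_
    refine tendsto_integral_of_dominated_convergence (fun _ => (1 : ℝ))
      (fun j => (integrable_negMulLog_condLabel hξ (hGle j) i).aestronglyMeasurable)
      (integrable_const _) ?_ ?_
    · intro j
      filter_upwards [condLabel_nonneg (m := MeasurableSpace.comap (γ j) ⊤) (μ := μ) (ξ := ξ) i,
        condLabel_le_one (μ := μ) hξ (hGle j) i] with x h0 h1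
      have h1' : condLabel μ ξ (MeasurableSpace.comap (γ j) ⊤) i x ≤ 1 := h1
      have h0' : 0 ≤ condLabel μ ξ (MeasurableSpace.comap (γ j) ⊤) i x := h0
      rw [Real.norm_eq_abs, abs_of_nonneg (Real.negMulLog_nonneg h0' h1')]
      have := Real.negMulLog_le_one_sub_self h0'
      linarith
    · have := tendsto_ae_condExp (μ := μ) (ℱ := ⟨_, hGmono, hGle⟩)
        ((ξ ⁻¹' {i}).indicator fun _ => (1 : ℝ))
      filter_upwards [this, hDC i] with x hx hx'
      rw [hx']
      exact (Real.continuous_negMulLog.tendsto _).comp hx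
  refine ge_of_tendsto' hlim fun j => ?_
  rw [finCondEntropy_eq_sum_integral rfl hξ (hγ j)]
  exact hc j

end CondEntropyBound

/-! ### Counting separated points by boxes; Hausdorff dimension. -/

section Boxes

variable {m : ℕ}

/-- A finite set of vectors is covered by as many boxes as a surrounding box contains. -/
theorem card_le_mul_boxes (F : Finset (Fin m → ℝ)) {A δ : Fin m → ℝ} (hδ : ∀ i, 0 < δ i)
    (hF : ∀ b ∈ F, ∀ b' ∈ F, ∀ i, |b i - b' i| ≤ A i) {K : ℝ}
    (hK : ∀ F' ⊆ F, (∀ b ∈ F', ∀ b' ∈ F', ∀ i, |b i - b' i| < δ i) → (F'.card : ℝ) ≤ K) :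
    (F.card : ℝ) ≤ K * ∏ i, ((⌊A i / δ i⌋₊ : ℝ) + 1) := by
  classical
  have hK0 : 0 ≤ K := by simpa using hK ∅ (by simp) (by simp)
  rcases F.eq_empty_or_nonempty with rfl | hne
  · simp only [Finset.card_empty, Nat.cast_zero]
    positivity
  set lo : Fin m → ℝ := fun i => F.inf' hne fun b => b i
  have hlo : ∀ b ∈ F, ∀ i, lo i ≤ b i := fun b hb i => Finset.inf'_le _ hb
  have hlo' : ∀ b ∈ F, ∀ i, b i - lo i ≤ A i := by
    intro b hb i
    obtain ⟨b', hb', h⟩ := Finset.exists_mem_eq_inf' hne fun b : Fin m → ℝ => b i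
    rw [show lo i = b' i from h]
    exact (le_abs_self _).trans (hF b hb b' hb' i)
  set φ : (Fin m → ℝ) → Fin m → ℕ := fun b i => ⌊(b i - lo i) / δ i⌋₊
  have h1 : ∀ b ∈ F, φ b ∈ Fintype.piFinset fun i => Finset.range (⌊A i / δ i⌋₊ + 1) := by
    intro b hb
    rw [Fintype.mem_piFinset]
    intro i
    rw [Finset.mem_range, Nat.lt_succ_iff]
    exact Nat.floor_mono (div_le_div_of_nonneg_right (hlo' b hb i) (hδ i).le)
  have h2 : ∀ c ∈ Fintype.piFinset fun i => Finset.range (⌊A i / δ i⌋₊ + 1),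
      (F.filter fun b => φ b = c).card ≤ ⌊K⌋₊ := by
    intro c _
    refine Nat.le_floor (hK _ (Finset.filter_subset _ _) ?_)
    intro b hb b' hb' i
    obtain ⟨hbF, hb⟩ := Finset.mem_filter.1 hb
    obtain ⟨hbF', hb'⟩ := Finset.mem_filter.1 hb'
    have e : ⌊(b i - lo i) / δ i⌋₊ = ⌊(b' i - lo i) / δ i⌋₊ := by
      rw [show ⌊(b i - lo i) / δ i⌋₊ = c i from congrFun hb i,
        show ⌊(b' i - lo i) / δ i⌋₊ = c i from congrFun hb' i]
    have n1 : 0 ≤ (b i - lo i) / δ i := div_nonneg (sub_nonneg.2 (hlo b hbF i)) (hδ i).le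
    have n2 : 0 ≤ (b' i - lo i) / δ i := div_nonneg (sub_nonneg.2 (hlo b' hbF' i)) (hδ i).le
    have f1 := Nat.floor_le n1
    have f2 := Nat.lt_floor_add_one ((b i - lo i) / δ i)
    have f3 := Nat.floor_le n2
    have f4 := Nat.lt_floor_add_one ((b' i - lo i) / δ i)
    rw [e] at f1 f2
    have : |(b i - b' i) / δ i| < 1 := by
      rw [abs_lt]
      have : (b i - b' i) / δ i = (b i - lo i) / δ i - (b' i - lo i) / δ i := by ring
      rw [this]
      constructor <;> linarith
    rwa [abs_div, abs_of_pos (hδ i), div_lt_one (hδ i)] at this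
  have h3 := Finset.card_le_mul_card_image_of_maps_to h1 _ h2
  calc (F.card : ℝ) ≤ (⌊K⌋₊ * (Fintype.piFinset fun i => Finset.range (⌊A i / δ i⌋₊ + 1)).card : ℕ) :=
        by exact_mod_cast h3
    _ ≤ _ := by
      rw [Fintype.card_piFinset]
      push_cast
      simp only [Finset.card_range, Nat.cast_add, Nat.cast_one]
      gcongr
      exact Nat.floor_le hK0

theorem prod_exp_mul {r : Fin m → ℝ} (hr : ∑ i, r i = 1) (t : ℝ) :
    ∏ i, Real.exp (r i * t) = Real.exp t := by
  rw [← Real.exp_sum, ← Finset.sum_mul, hr, one_mul]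

/-- Counting points whose mutual displacements, at each good time, are either contracted or
expanded away. -/
theorem card_le_of_good_times {r : Fin m → ℝ} (hr0 : ∀ i, 0 < r i) (hr : ∑ i, r i = 1)
    {κ R : ℝ} (hκ : 0 < κ) (hR : 0 < R) (hκR : 6 * κ ≤ R) (G : ℕ → Prop) [DecidablePred G] (k : ℕ)
    (F : Finset (Fin m → ℝ)) (hF : ∀ b ∈ F, ∀ b' ∈ F, ∀ i, |b i - b' i| ≤ 1)
    (hsep : ∀ b ∈ F, ∀ b' ∈ F, b ≠ b' → ∃ i, 1 ≤ |b i - b' i| * Real.exp (r i * k))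
    (hG : ∀ l < k, G l → ∀ b ∈ F, ∀ b' ∈ F, (∀ i, |b i - b' i| * Real.exp (r i * l) < κ) ∨
      ∃ i, R ≤ |b i - b' i| * Real.exp (r i * l)) :
    (F.card : ℝ) ≤ (1 / R + 2) ^ m * ((κ + 1) ^ m * Real.exp 1) *
      Real.exp ((Finset.range k).filter fun l => ¬ G l).card := by
  classical
  have hri : ∀ i, r i ≤ 1 := fun i => hr ▸ Finset.single_le_sum (fun j _ => (hr0 j).le) (Finset.mem_univ i)
  have lt_exp : ∀ (x y c t : ℝ), |x - y| < c * Real.exp (-(t)) ↔ |x - y| * Real.exp t < c := by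
    intro x y c t
    rw [Real.exp_neg, ← div_eq_mul_inv, lt_div_iff₀ (Real.exp_pos _)]
  have sepcard : ∀ F' ⊆ F, (∀ b ∈ F', ∀ b' ∈ F', ∀ i, |b i - b' i| < 1 * Real.exp (-(r i * k))) →
      (F'.card : ℝ) ≤ 1 := by
    intro F' hF' h
    norm_cast
    rw [Finset.card_le_one]
    intro b hb b' hb'
    by_contra hne
    obtain ⟨i, hi⟩ := hsep b (hF' hb) b' (hF' hb') hne
    exact absurd ((lt_exp _ _ _ _).1 (h b hb b' hb' i)) (not_lt.2 hi)
  -- points in a common box at a good time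
  have main : ∀ d l : ℕ, l < k → k - l ≤ d → ∀ F' ⊆ F,
      (∀ b ∈ F', ∀ b' ∈ F', ∀ i, |b i - b' i| < κ * Real.exp (-(r i * l))) →
      (F'.card : ℝ) ≤ (κ + 1) ^ m * Real.exp 1 *
        Real.exp ((Finset.Ioo l k).filter fun l => ¬ G l).card := by
    intro d
    induction d with
    | zero => intro l h1 h2; omega
    | succ d ih =>
      intro l hl hd F' hF' hb
      by_cases hex : ∃ l', l < l' ∧ l' < k ∧ G l'
      · obtain ⟨hl1, hl2, hl3⟩ := Nat.find_spec hex
        set l' := Nat.find hex with hl'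
        have hmin : ∀ j, l < j → j < l' → ¬ G j := fun j h1 h2 h3 =>
          Nat.find_min hex h2 ⟨h1, h2.trans hl2, h3⟩
        have hcard : ((Finset.Ioo l k).filter fun l => ¬ G l).card =
            (l' - l - 1) + ((Finset.Ioo l' k).filter fun l => ¬ G l).card := by
          rw [show (Finset.Ioo l k).filter (fun l => ¬ G l) =
            Finset.Ioo l l' ∪ (Finset.Ioo l' k).filter fun l => ¬ G l by
              ext j
              simp only [Finset.mem_filter, Finset.mem_Ioo, Finset.mem_union]
              constructor
              · rintro ⟨⟨h1, h2⟩, h3⟩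
                rcases lt_trichotomy j l' with h | rfl | h
                · exact Or.inl ⟨h1, h⟩
                · exact absurd hl3 h3
                · exact Or.inr ⟨⟨h, h2⟩, h3⟩
              · rintro (⟨h1, h2⟩ | ⟨⟨h1, h2⟩, h3⟩)
                · exact ⟨⟨h1, h2.trans hl2⟩, hmin j h1 h2⟩
                · exact ⟨⟨hl1.trans h1, h2⟩, h3⟩]
          rw [Finset.card_union_of_disjoint, Nat.card_Ioo]
          rw [Finset.disjoint_left]
          intro j h1 h2
          simp only [Finset.mem_filter, Finset.mem_Ioo] at h1 h2
          omega
        -- Here l' is the next good time. In a box with sides R e^(-r_i l') the second alternative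
        -- of `hG` is impossible, so the points lie in a common small box at time l' and the
        -- induction hypothesis applies.
        have hsplit := card_le_mul_boxes F' (A := fun i => κ * Real.exp (-(r i * l)))
          (δ := fun i => R * Real.exp (-(r i * l'))) (fun i => by positivity)
          (fun b h b' h' i => (hb b h b' h' i).le)
          (K := (κ + 1) ^ m * Real.exp 1 * Real.exp ((Finset.Ioo l' k).filter fun l => ¬ G l).card) (by
            intro F'' hF'' h
            refine ih l' hl2 (by omega) F'' (hF''.trans hF') ?_
            intro b hb b' hb' i
            rcases hG l' hl2 hl3 b (hF' (hF'' hb)) b' (hF' (hF'' hb')) with h1 | ⟨j, hj⟩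
            · exact (lt_exp _ _ _ _).2 (h1 i)
            · exact absurd ((lt_exp _ _ _ _).1 (h b hb b' hb' j)) (not_lt.2 hj))
        -- Only l' - l - 1 bad times are charged. The remaining unit of time is absorbed by 2 (κ /
        -- R) e^(r_i) ≤ 2 · (1/6) · 3 = 1, which is the purpose of `hκR`; successive good times
        -- therefore cost nothing.
        have hprod : ∏ i, ((⌊κ * Real.exp (-(r i * l)) / (R * Real.exp (-(r i * l')))⌋₊ : ℝ) + 1) ≤
            Real.exp ((l' - l - 1 : ℕ) : ℝ) := by
          rw [← prod_exp_mul hr]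
          refine Finset.prod_le_prod (fun _ _ => by positivity) fun i _ => ?_
          have hcast : ((l' - l - 1 : ℕ) : ℝ) = l' - l - 1 := by
            rw [Nat.sub_sub, Nat.cast_sub (by omega)]
            push_cast
            ring
          have hge : (1 : ℝ) ≤ Real.exp (r i * ((l' - l - 1 : ℕ) : ℝ)) :=
            Real.one_le_exp (mul_nonneg (hr0 i).le (Nat.cast_nonneg _))
          set x := κ * Real.exp (-(r i * l)) / (R * Real.exp (-(r i * l'))) with hx
          have hxeq : x = κ / R * Real.exp (r i) * Real.exp (r i * ((l' - l - 1 : ℕ) : ℝ)) := by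
            rw [hx, hcast, mul_assoc, ← Real.exp_add, mul_div_mul_comm, ← Real.exp_sub]
            congr 2
            ring
          have hle : 2 * (κ / R * Real.exp (r i)) ≤ 1 := by
            have h3 : Real.exp (r i) ≤ 3 := by
              have := Real.exp_le_exp.2 (hri i)
              have := Real.exp_one_lt_d9
              linarith
            have h4 : κ / R ≤ 1 / 6 := by
              rw [div_le_div_iff₀ hR (by norm_num)]
              linarith
            have : 0 < κ / R := by positivity
            nlinarith [Real.exp_pos (r i)]
          rcases lt_or_ge x 1 with h1 | h1
          · rw [Nat.floor_eq_zero.2 h1]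
            simpa using hge
          · have := Nat.floor_le (show 0 ≤ x by positivity)
            calc (⌊x⌋₊ : ℝ) + 1 ≤ 2 * x := by linarith
              _ = 2 * (κ / R * Real.exp (r i)) * Real.exp (r i * ((l' - l - 1 : ℕ) : ℝ)) := by
                rw [hxeq]; ring
              _ ≤ 1 * Real.exp (r i * ((l' - l - 1 : ℕ) : ℝ)) := by gcongr
              _ = _ := one_mul _
        rw [hcard, Nat.cast_add, Real.exp_add]
        refine hsplit.trans ?_
        calc _ ≤ (κ + 1) ^ m * Real.exp 1 * Real.exp ((Finset.Ioo l' k).filter fun l => ¬ G l).card *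
              Real.exp ((l' - l - 1 : ℕ) : ℝ) := by gcongr
          _ = _ := by ring
      · push Not at hex
        have hcard : ((Finset.Ioo l k).filter fun l => ¬ G l).card = k - l - 1 := by
          rw [Finset.filter_true_of_mem, Nat.card_Ioo]
          intro j hj
          rw [Finset.mem_Ioo] at hj
          exact hex j hj.1 hj.2
        -- No good time remains. The box is cut down to the scale of separation, where each piece
        -- holds at most one point.
        have hsplit := card_le_mul_boxes F' (A := fun i => κ * Real.exp (-(r i * l)))
          (δ := fun i => 1 * Real.exp (-(r i * k))) (fun i => by positivity)
          (fun b h b' h' i => (hb b h b' h' i).le) (K := 1)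
          (fun F'' hF'' h => sepcard F'' (hF''.trans hF') h)
        refine hsplit.trans ?_
        rw [one_mul, hcard, mul_assoc, ← Real.exp_add]
        have hcast : 1 + ((k - l - 1 : ℕ) : ℝ) = k - l := by
          rw [Nat.sub_sub, Nat.cast_sub (by omega)]
          push_cast
          ring
        rw [hcast, ← prod_exp_mul hr]
        calc _ ≤ ∏ i, ((κ + 1) * Real.exp (r i * (k - l))) := by
              refine Finset.prod_le_prod (fun _ _ => by positivity) fun i _ => ?_
              have e1 : κ * Real.exp (-(r i * l)) / (1 * Real.exp (-(r i * k))) =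
                  κ * Real.exp (r i * (k - l)) := by
                rw [one_mul, mul_div_assoc, ← Real.exp_sub]
                congr 2
                ring
              rw [e1]
              have h1 := Nat.floor_le (show 0 ≤ κ * Real.exp (r i * (k - l)) by positivity)
              have h2 : 1 ≤ Real.exp (r i * (k - l)) :=
                Real.one_le_exp (mul_nonneg (hr0 i).le (sub_nonneg.2 (by exact_mod_cast hl.le)))
              linarith
          _ = _ := by
              rw [Finset.prod_mul_distrib, Finset.prod_const, Finset.card_univ, Fintype.card_fin]
  have hC1 : 1 ≤ (κ + 1) ^ m * Real.exp 1 :=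
    one_le_mul_of_one_le_of_one_le (one_le_pow₀ (by linarith)) (Real.one_le_exp zero_le_one)
  -- The initial box has side 1. Cutting it into boxes with sides R e^(-r_i l), for the first good
  -- time l, costs about e^l, one factor e for each bad time before l.
  by_cases hex : ∃ l, l < k ∧ G l
  · obtain ⟨hl1, hl2⟩ := Nat.find_spec hex
    set l := Nat.find hex with hl
    have hmin : ∀ j, j < l → ¬ G j := fun j h1 h3 => Nat.find_min hex h1 ⟨h1.trans hl1, h3⟩
    have hcard : ((Finset.range k).filter fun l => ¬ G l).card =
        l + ((Finset.Ioo l k).filter fun l => ¬ G l).card := by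
      rw [show (Finset.range k).filter (fun l => ¬ G l) =
        Finset.range l ∪ (Finset.Ioo l k).filter fun l => ¬ G l by
          ext j
          simp only [Finset.mem_filter, Finset.mem_Ioo, Finset.mem_union, Finset.mem_range]
          constructor
          · rintro ⟨h2, h3⟩
            rcases lt_trichotomy j l with h | rfl | h
            · exact Or.inl h
            · exact absurd hl2 h3
            · exact Or.inr ⟨⟨h, h2⟩, h3⟩
          · rintro (h2 | ⟨⟨h1, h2⟩, h3⟩)
            · exact ⟨h2.trans hl1, hmin j h2⟩
            · exact ⟨h2, h3⟩]
      rw [Finset.card_union_of_disjoint, Finset.card_range]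
      rw [Finset.disjoint_left]
      intro j h1 h2
      simp only [Finset.mem_filter, Finset.mem_Ioo, Finset.mem_range] at h1 h2
      omega
    have hsplit := card_le_mul_boxes F (A := fun i => 1)
      (δ := fun i => R * Real.exp (-(r i * l))) (fun i => by positivity) hF
      (K := (κ + 1) ^ m * Real.exp 1 * Real.exp ((Finset.Ioo l k).filter fun l => ¬ G l).card) (by
        intro F'' hF'' h
        refine main _ l hl1 le_rfl F'' hF'' ?_
        intro b hb b' hb' i
        rcases hG l hl1 hl2 b (hF'' hb) b' (hF'' hb') with h1 | ⟨j, hj⟩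
        · exact (lt_exp _ _ _ _).2 (h1 i)
        · exact absurd ((lt_exp _ _ _ _).1 (h b hb b' hb' j)) (not_lt.2 hj))
    have hprod : ∏ i, ((⌊1 / (R * Real.exp (-(r i * l)))⌋₊ : ℝ) + 1) ≤
        (1 / R + 2) ^ m * Real.exp l := by
      rw [← prod_exp_mul hr]
      calc _ ≤ ∏ i, ((1 / R + 2) * Real.exp (r i * l)) := by
            refine Finset.prod_le_prod (fun _ _ => by positivity) fun i _ => ?_
            have e1 : 1 / (R * Real.exp (-(r i * l))) = 1 / R * Real.exp (r i * l) := by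
              rw [Real.exp_neg]
              field_simp
            rw [e1]
            have h1 := Nat.floor_le (show 0 ≤ 1 / R * Real.exp (r i * l) by positivity)
            have h2 : 1 ≤ Real.exp (r i * l) :=
              Real.one_le_exp (mul_nonneg (hr0 i).le (Nat.cast_nonneg _))
            linarith
        _ = _ := by
            rw [Finset.prod_mul_distrib, Finset.prod_const, Finset.card_univ, Fintype.card_fin]
    rw [hcard, Nat.cast_add, Real.exp_add]
    refine hsplit.trans ?_
    calc _ ≤ (κ + 1) ^ m * Real.exp 1 * Real.exp ((Finset.Ioo l k).filter fun l => ¬ G l).card *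
          ((1 / R + 2) ^ m * Real.exp l) := by gcongr
      _ = _ := by ring
  · push Not at hex
    have hcard : ((Finset.range k).filter fun l => ¬ G l).card = k := by
      rw [Finset.filter_true_of_mem, Finset.card_range]
      intro j hj
      exact hex j (Finset.mem_range.1 hj)
    have hsplit := card_le_mul_boxes F (A := fun i => 1)
      (δ := fun i => 1 * Real.exp (-(r i * k))) (fun i => by positivity) hF (K := 1)
      (fun F'' hF'' h => sepcard F'' hF'' h)
    have hprod : ∏ i, ((⌊1 / (1 * Real.exp (-(r i * k)))⌋₊ : ℝ) + 1) ≤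
        (1 / R + 2) ^ m * Real.exp k := by
      rw [← prod_exp_mul hr]
      calc _ ≤ ∏ i, ((1 / R + 2) * Real.exp (r i * k)) := by
            refine Finset.prod_le_prod (fun _ _ => by positivity) fun i _ => ?_
            have e1 : 1 / (1 * Real.exp (-(r i * k))) = Real.exp (r i * k) := by
              rw [Real.exp_neg]
              field_simp
            rw [e1]
            have h1 := Nat.floor_le (show 0 ≤ Real.exp (r i * k) by positivity)
            have h2 : 1 ≤ Real.exp (r i * k) :=
              Real.one_le_exp (mul_nonneg (hr0 i).le (Nat.cast_nonneg _))
            have h3 : 0 < 1 / R := by positivity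
            nlinarith
        _ = _ := by
            rw [Finset.prod_mul_distrib, Finset.prod_const, Finset.card_univ, Fintype.card_fin]
    rw [hcard]
    refine hsplit.trans ?_
    rw [one_mul]
    refine hprod.trans ?_
    have : 0 ≤ (1 / R + 2) ^ m := by positivity
    have := mul_le_mul_of_nonneg_left hC1 this
    nlinarith [Real.exp_pos (k : ℝ)]

/-- The number of boxes with sides e^(-r_i k) in a unit box bounds the size of separated sets, so a
largest one exists. A point far from all its elements could be added to it, hence it is a net. -/
theorem exists_maximal_separated {r : Fin m → ℝ} (E : Set (Fin m → ℝ))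
    (hE : ∀ b ∈ E, ∀ b' ∈ E, ∀ i, |b i - b' i| ≤ 1) (k : ℕ) :
    ∃ S : Finset (Fin m → ℝ), ↑S ⊆ E ∧
      (∀ b ∈ S, ∀ b' ∈ S, b ≠ b' → ∃ i, 1 ≤ |b i - b' i| * Real.exp (r i * k)) ∧
      ∀ b ∈ E, ∃ b' ∈ S, ∀ i, |b i - b' i| * Real.exp (r i * k) < 1 := by
  classical
  set Sep : Finset (Fin m → ℝ) → Prop := fun S => ↑S ⊆ E ∧
      (∀ b ∈ S, ∀ b' ∈ S, b ≠ b' → ∃ i, 1 ≤ |b i - b' i| * Real.exp (r i * k)) with hSep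
  have hbound : ∀ S, Sep S → S.card ≤ ⌊∏ i, ((⌊1 / Real.exp (-(r i * k))⌋₊ : ℝ) + 1)⌋₊ := by
    rintro S ⟨hSE, hS⟩
    refine Nat.le_floor ?_
    refine (card_le_mul_boxes S (A := fun _ => 1) (δ := fun i => Real.exp (-(r i * k)))
      (fun i => Real.exp_pos _) (fun b hb b' hb' => hE b (hSE hb) b' (hSE hb')) (K := 1) ?_).trans_eq
      (one_mul _)
    intro F' hF' h
    norm_cast
    rw [Finset.card_le_one]
    intro b hb b' hb'
    by_contra hne
    obtain ⟨i, hi⟩ := hS b (hF' hb) b' (hF' hb') hne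
    have := h b hb b' hb' i
    rw [Real.exp_neg, ← one_div, lt_div_iff₀ (Real.exp_pos _)] at this
    linarith
  have hex : ∃ N, ∃ S, Sep S ∧ S.card = N := ⟨0, ∅, ⟨by simp, by simp⟩, rfl⟩
  obtain ⟨S, hS, hcard⟩ := Nat.findGreatest_spec (P := fun N => ∃ S, Sep S ∧ S.card = N)
    (Nat.zero_le ⌊∏ i, ((⌊1 / Real.exp (-(r i * k))⌋₊ : ℝ) + 1)⌋₊)
    ⟨∅, ⟨by simp, by simp⟩, rfl⟩
  refine ⟨S, hS.1, hS.2, fun b hb => ?_⟩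
  by_contra! hcon
  have hbS : b ∉ S := fun h => by
    obtain ⟨i, hi⟩ := hcon b h
    simp at hi
    linarith
  have hS' : Sep (insert b S) := by
    refine ⟨by
      rw [Finset.coe_insert, insert_subset_iff]
      exact ⟨hb, hS.1⟩, ?_⟩
    intro c hc c' hc' hne
    rcases Finset.mem_insert.1 hc with hc1 | hc1 <;>
      rcases Finset.mem_insert.1 hc' with hc2 | hc2
    · exact absurd (hc1.trans hc2.symm) hne
    · rw [hc1]
      exact hcon _ hc2
    · obtain ⟨i, hi⟩ := hcon _ hc1
      exact ⟨i, by rwa [hc2, abs_sub_comm]⟩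
    · exact hS.2 c hc1 c' hc2 hne
  have := Nat.le_findGreatest (P := fun N => ∃ S, Sep S ∧ S.card = N) (hbound _ hS') ⟨_, hS', rfl⟩
  rw [← hcard, Finset.card_insert_of_notMem hbS] at this
  omega

/-- Separated subsets of a set of large Hausdorff dimension are large. -/
theorem exists_large_separated {r : Fin m → ℝ} (hr : ∑ i, r i = 1) {ρ : ℝ}
    (hρ : ∀ i, r i ≤ ρ) (hρ0 : 0 < ρ) {E : Set (Fin m → ℝ)}
    (hE : ∀ b ∈ E, ∀ b' ∈ E, ∀ i, |b i - b' i| ≤ 1) {s : NNReal} (hs : (s : ℝ≥0∞) < dimH E) :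
    ∀ᶠ k : ℕ in atTop, ∃ S : Finset (Fin m → ℝ), ↑S ⊆ E ∧
      (∀ b ∈ S, ∀ b' ∈ S, b ≠ b' → ∃ i, 1 ≤ |b i - b' i| * Real.exp (r i * k)) ∧
      Real.exp (k * (1 - ρ * (m - s))) ≤ S.card := by
  classical
  choose S hSE hSsep hScov using exists_maximal_separated (r := r) E hE
  by_contra hcon
  -- If `S k` is too small for infinitely many k, the boxes around its points are cut into cubes of
  -- side e^(-ρk), about e^((mρ - 1)k) per box. These cover E with the sum of the s-th powers of
  -- their diameters at most 3^m, so the s-dimensional measure is finite, against s < dim E.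
  have hfreq : ∃ᶠ k : ℕ in atTop, ((S k).card : ℝ) < Real.exp (k * (1 - ρ * (m - s))) := by
    intro h
    refine hcon ?_
    filter_upwards [h] with k hk
    exact ⟨S k, hSE k, hSsep k, not_lt.1 hk⟩
  set L : Filter ℕ := atTop ⊓ 𝓟 {k | ((S k).card : ℝ) < Real.exp (k * (1 - ρ * (m - s)))} with hL
  have hLne : L.NeBot := frequently_mem_iff_neBot.1 hfreq
  have hLS : ∀ᶠ k in L, ((S k).card : ℝ) < Real.exp (k * (1 - ρ * (m - s))) :=
    mem_inf_of_right (mem_principal_self _)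
  set N : ℕ → Fin m → ℕ := fun k i => ⌊2 * Real.exp ((ρ - r i) * k)⌋₊ + 1 with hN
  set t : ∀ k : ℕ, (↥(S k) × (∀ i, Fin (N k i))) → Set (Fin m → ℝ) := fun k p =>
    {x | ∀ i, p.1.1 i - Real.exp (-(r i * k)) + (p.2 i : ℕ) * Real.exp (-(ρ * k)) ≤ x i ∧
      x i ≤ p.1.1 i - Real.exp (-(r i * k)) + ((p.2 i : ℕ) + 1) * Real.exp (-(ρ * k))} with ht
  have hdiam : ∀ k p, Metric.ediam (t k p) ≤ ENNReal.ofReal (Real.exp (-(ρ * k))) := by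
    intro k p
    refine Metric.ediam_le fun x hx y hy => ?_
    rw [edist_pi_le_iff]
    intro i
    rw [edist_dist, Real.dist_eq]
    refine ENNReal.ofReal_le_ofReal (abs_le.2 ?_)
    have h1 := hx i
    have h2 := hy i
    constructor <;> linarith [h1.1, h1.2, h2.1, h2.2]
  have hcov : ∀ k, E ⊆ ⋃ p, t k p := by
    intro k b hb
    obtain ⟨b', hb', h⟩ := hScov k b hb
    set x : Fin m → ℝ := fun i => (b i - b' i + Real.exp (-(r i * k))) / Real.exp (-(ρ * k)) with hx
    have h' : ∀ i, |b i - b' i| < Real.exp (-(r i * k)) := by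
      intro i
      rw [Real.exp_neg, ← one_div, lt_div_iff₀ (Real.exp_pos _)]
      exact h i
    have hx0 : ∀ i, 0 ≤ x i := fun i =>
      div_nonneg (by linarith [(abs_lt.1 (h' i)).1]) (Real.exp_pos _).le
    have hx2 : ∀ i, x i ≤ 2 * Real.exp ((ρ - r i) * k) := by
      intro i
      rw [hx, div_le_iff₀ (Real.exp_pos _), mul_assoc, ← Real.exp_add]
      rw [show (ρ - r i) * k + -(ρ * k) = -(r i * k) by ring]
      linarith [(abs_lt.1 (h' i)).2]
    refine mem_iUnion.2 ⟨(⟨b', hb'⟩, fun i => ⟨⌊x i⌋₊, Nat.lt_succ_iff.2 (Nat.floor_mono (hx2 i))⟩), ?_⟩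
    intro i
    have f1 := Nat.floor_le (hx0 i)
    have f2 := (Nat.lt_floor_add_one (x i)).le
    have e : x i * Real.exp (-(ρ * k)) = b i - b' i + Real.exp (-(r i * k)) := by
      rw [hx, div_mul_cancel₀ _ (Real.exp_pos _).ne']
    have g1 := mul_le_mul_of_nonneg_right f1 (Real.exp_pos (-(ρ * k))).le
    have g2 := mul_le_mul_of_nonneg_right f2 (Real.exp_pos (-(ρ * k))).le
    rw [e] at g1 g2
    constructor
    · change b' i - _ + (⌊x i⌋₊ : ℝ) * _ ≤ b i
      linarith
    · change b i ≤ b' i - _ + ((⌊x i⌋₊ : ℝ) + 1) * _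
      linarith
  have hr' : Tendsto (fun k : ℕ => ENNReal.ofReal (Real.exp (-(ρ * k)))) L (𝓝 0) := by
    refine Tendsto.mono_left ?_ inf_le_left
    rw [← ENNReal.ofReal_zero]
    refine ENNReal.tendsto_ofReal (Real.tendsto_exp_neg_atTop_nhds_zero.comp ?_)
    exact (tendsto_natCast_atTop_atTop).const_mul_atTop hρ0
  have hH := Measure.hausdorffMeasure_le_liminf_sum (s : ℝ) E
    (l := L) (fun k : ℕ => ENNReal.ofReal (Real.exp (-(ρ * k)))) hr' t
    (Eventually.of_forall hdiam) (Eventually.of_forall hcov)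
  have hbd : ∀ᶠ k in L, ∑ p, Metric.ediam (t k p) ^ (s : ℝ) ≤ ENNReal.ofReal (3 ^ m) := by
    filter_upwards [hLS] with k hk
    have h1 : ∑ p, Metric.ediam (t k p) ^ (s : ℝ) ≤
        ∑ p : (↥(S k) × (∀ i, Fin (N k i))), ENNReal.ofReal (Real.exp (-(ρ * k * s))) := by
      refine Finset.sum_le_sum fun p _ => ?_
      refine (ENNReal.rpow_le_rpow (hdiam k p) s.2).trans_eq ?_
      rw [ENNReal.ofReal_rpow_of_pos (Real.exp_pos _), ← Real.exp_mul]
      congr 2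
      rw [neg_mul]
      rfl
    refine h1.trans ?_
    rw [Finset.sum_const, Finset.card_univ, Fintype.card_prod, Fintype.card_coe, Fintype.card_pi,
      nsmul_eq_mul, ← ENNReal.ofReal_natCast, ← ENNReal.ofReal_mul (Nat.cast_nonneg _)]
    refine ENNReal.ofReal_le_ofReal ?_
    push_cast
    simp only [Fintype.card_fin]
    have hNle : ∏ i, (N k i : ℝ) ≤ 3 ^ m * Real.exp ((m * ρ - 1) * k) := by
      have : ∏ i, (3 * Real.exp ((ρ - r i) * k)) = 3 ^ m * Real.exp ((m * ρ - 1) * k) := by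
        rw [Finset.prod_mul_distrib, Finset.prod_const, Finset.card_univ, Fintype.card_fin,
          ← Real.exp_sum, ← Finset.sum_mul, Finset.sum_sub_distrib, hr]
        simp
      rw [← this]
      refine Finset.prod_le_prod (fun _ _ => by positivity) fun i _ => ?_
      rw [hN]
      push_cast
      have h1 := Nat.floor_le (show 0 ≤ 2 * Real.exp ((ρ - r i) * k) by positivity)
      have h2 : 1 ≤ Real.exp ((ρ - r i) * k) :=
        Real.one_le_exp (mul_nonneg (sub_nonneg.2 (hρ i)) (Nat.cast_nonneg _))
      linarith
    calc ((S k).card : ℝ) * (∏ i, (N k i : ℝ)) * Real.exp (-(ρ * k * s))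
        ≤ Real.exp (k * (1 - ρ * (m - s))) * (3 ^ m * Real.exp ((m * ρ - 1) * k)) *
          Real.exp (-(ρ * k * s)) := by gcongr
      _ = 3 ^ m * (Real.exp (k * (1 - ρ * (m - s))) * Real.exp ((m * ρ - 1) * k) *
          Real.exp (-(ρ * k * s))) := by ring
      _ = 3 ^ m := by
          rw [← Real.exp_add, ← Real.exp_add,
            show (k : ℝ) * (1 - ρ * (m - s)) + (m * ρ - 1) * k + -(ρ * k * s) = 0 by ring,
            Real.exp_zero, mul_one]
  have hfin : Measure.hausdorffMeasure (s : ℝ) E ≠ ⊤ := by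
    have h3 : Measure.hausdorffMeasure (s : ℝ) E ≤ ENNReal.ofReal (3 ^ m) :=
      hH.trans ((liminf_le_liminf hbd).trans_eq (liminf_const _))
    exact ne_top_of_le_ne_top ENNReal.ofReal_ne_top h3
  exact absurd (dimH_le_of_hausdorffMeasure_ne_top hfin) (not_le.2 hs)

end Boxes

/-! ### The weighted quasinorms. -/

section Quasinorm

variable {k : ℕ}

theorem le_quasinorm (c x : Fin k → ℝ) (i : Fin k) : |x i| ^ (1 / c i) ≤ quasinorm c x :=
  le_ciSup (f := fun i => |x i| ^ (1 / c i)) (Set.finite_range _).bddAbove i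

theorem quasinorm_nonneg (c x : Fin k → ℝ) : 0 ≤ quasinorm c x :=
  Real.iSup_nonneg fun _ => Real.rpow_nonneg (abs_nonneg _) _

theorem abs_le_rpow_quasinorm {c : Fin k → ℝ} (hc : ∀ i, 0 < c i) (x : Fin k → ℝ) (i : Fin k) :
    |x i| ≤ quasinorm c x ^ c i := by
  have h := Real.rpow_le_rpow (Real.rpow_nonneg (abs_nonneg _) _) (le_quasinorm c x i) (hc i).le
  rwa [← Real.rpow_mul (abs_nonneg _), one_div, inv_mul_cancel₀ (hc i).ne', Real.rpow_one] at h

theorem quasinorm_exp_mul {c : Fin k → ℝ} (hc : ∀ i, 0 < c i) (t : ℝ) (x : Fin k → ℝ) :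
    quasinorm c (fun i => Real.exp (c i * t) * x i) = Real.exp t * quasinorm c x := by
  rw [quasinorm, quasinorm, Real.mul_iSup_of_nonneg (Real.exp_pos _).le]
  congr 1
  ext i
  rw [abs_mul, abs_of_pos (Real.exp_pos _), Real.mul_rpow (Real.exp_pos _).le (abs_nonneg _),
    ← Real.exp_mul]
  congr 2
  field_simp [(hc i).ne']

theorem quasinorm_pos {c : Fin k → ℝ} (x : Fin k → ℝ) (hx : x ≠ 0) :
    0 < quasinorm c x := by
  obtain ⟨i, hi⟩ := Function.ne_iff.1 hx
  exact (Real.rpow_pos_of_pos (abs_pos.2 hi) _).trans_le (le_quasinorm c x i)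

theorem continuous_quasinorm {c : Fin k → ℝ} (hc : ∀ i, 0 < c i) : Continuous (quasinorm c) := by
  rcases isEmpty_or_nonempty (Fin k) with h | h
  · exact continuous_of_const fun x y => by simp [quasinorm]
  · have : quasinorm c = fun x => Finset.univ.sup' Finset.univ_nonempty fun i => |x i| ^ (1 / c i) := by
      ext x
      rw [Finset.sup'_univ_eq_ciSup]
      rfl
    rw [this]
    refine Continuous.finset_sup'_apply _ fun i _ => ?_
    exact (continuous_abs.comp (continuous_apply i)).rpow_const
      fun _ => Or.inr (one_div_nonneg.2 (hc i).le)

theorem distToInt_le (c x : Fin k → ℝ) (p : Fin k → ℤ) :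
    distToInt c x ≤ quasinorm c fun i => x i - (p i : ℝ) :=
  ciInf_le (f := fun p : Fin k → ℤ => quasinorm c fun i => x i - (p i : ℝ))
    ⟨0, by rintro _ ⟨p, rfl⟩; exact quasinorm_nonneg _ _⟩ p

/-- Integral translates of a vector of bounded quasinorm form a finite set. -/
theorem finite_int_quasinorm_le {c : Fin k → ℝ} (hc : ∀ i, 0 < c i) (x : Fin k → ℝ) (M : ℝ) :
    {p : Fin k → ℤ | quasinorm c (fun i => x i + (p i : ℝ)) ≤ M}.Finite := by
  refine (Set.Finite.pi (t := fun i => {z : ℤ | |x i + z| ≤ M ^ c i}) fun i => ?_).subset ?_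
  · refine (Set.finite_Icc ⌈-M ^ c i - x i⌉ ⌊M ^ c i - x i⌋).subset fun z hz => ?_
    obtain ⟨h1, h2⟩ := abs_le.1 (show |x i + z| ≤ M ^ c i from hz)
    exact ⟨Int.ceil_le.2 (by linarith), Int.le_floor.2 (by linarith)⟩
  · intro p hp i _
    exact (abs_le_rpow_quasinorm hc _ i).trans
      (Real.rpow_le_rpow (quasinorm_nonneg _ _) hp (hc i).le)

end Quasinorm

/-! ### Badly approximable vectors and grids avoiding the origin. -/

section BadVectors

variable {m n : ℕ}

open ASLd

/-- Upstairs this is the union over integral vectors z of the open conditions g z ∈ U, and the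
quotient map is open. Applied to the region of small quasinorm it shows that the target is closed.
-/
theorem GridSpace.isOpen_grid_inter_nonempty {U : Set (Fin m ⊕ Fin n → ℝ)} (hU : IsOpen U) :
    IsOpen {y : GridSpace m n | (y.grid ∩ U).Nonempty} := by
  have : {y : GridSpace m n | (y.grid ∩ U).Nonempty} =
      ⋃ z : Fin m ⊕ Fin n → ℤ, GridSpace.mk '' {g | act g (fun i => (z i : ℝ)) ∈ U} := by
    ext y
    simp only [mem_ofPred_eq, mem_iUnion, mem_image]
    constructor
    · rintro ⟨x, hx, hxU⟩
      obtain ⟨g, rfl⟩ := y.exists_rep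
      rw [GridSpace.grid_mk] at hx
      obtain ⟨z, rfl⟩ := hx
      exact ⟨z, g, hxU, rfl⟩
    · rintro ⟨z, g, hg, rfl⟩
      exact ⟨_, by rw [GridSpace.grid_mk]; exact ⟨z, rfl⟩, hg⟩
  rw [this]
  refine isOpen_iUnion fun z => GridSpace.isOpenQuotientMap_mk.isOpenMap _ (hU.preimage ?_)
  have h1 : Continuous fun g : ASLd m n => (linearPart g).1 :=
    continuous_subtype_val.comp continuous_linearPart
  exact (h1.matrix_mulVec continuous_const).add continuous_translationPart

namespace Weights

variable (w : Weights m n)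

theorem continuous_gridQuasinorm : Continuous w.gridQuasinorm := by
  refine Continuous.max ?_ ?_
  · exact ((continuous_quasinorm w.r_pos).comp (by fun_prop)).rpow_const
      fun _ => Or.inr (by positivity)
  · exact ((continuous_quasinorm w.s_pos).comp (by fun_prop)).rpow_const
      fun _ => Or.inr (by positivity)

theorem isClosed_target (ε : ℝ) : IsClosed (w.target ε) := by
  have : (w.target ε)ᶜ = {y : GridSpace m n | (y.grid ∩ {v | w.gridQuasinorm v < ε}).Nonempty} := by
    ext y
    simp only [target, mem_compl_iff, mem_ofPred_eq, not_forall, not_le]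
    exact ⟨fun ⟨v, h1, h2⟩ => ⟨v, h1, h2⟩, fun ⟨v, h1, h2⟩ => ⟨v, h1, h2⟩⟩
  rw [← isOpen_compl_iff, this]
  exact GridSpace.isOpen_grid_inter_nonempty (isOpen_lt w.continuous_gridQuasinorm continuous_const)

theorem target_eq_iInter (ε : ℝ) : (⋂ ε' < ε, w.target ε') ⊆ w.target ε := by
  intro y hy v hv
  refine le_of_forall_lt fun ε' hε' => ?_
  obtain ⟨e, h1, h2⟩ := exists_between hε'
  exact h1.trans_le (mem_iInter₂.1 hy e h2 v hv)

/-- A point whose quasinorms have a large product has large grid quasinorm. -/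
theorem le_gridQuasinorm_of_mul [NeZero m] [NeZero n] {ε : ℝ} (hε : 0 < ε) (v : Fin m ⊕ Fin n → ℝ)
    (h : ε ≤ quasinorm w.r (fun i => v (Sum.inl i)) * quasinorm w.s (fun j => v (Sum.inr j))) :
    ε ≤ w.gridQuasinorm v := by
  have hm : (0 : ℝ) < m := Nat.cast_pos.2 (NeZero.pos m)
  have hn : (0 : ℝ) < n := Nat.cast_pos.2 (NeZero.pos n)
  have key : ∀ {X : ℝ} {k : ℝ}, 0 < k → 0 ≤ X → X ^ (((m + n : ℕ) : ℝ) / k) < ε →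
      X < ε ^ (k / ((m + n : ℕ) : ℝ)) := by
    intro X k hk hX h
    have hd : (0 : ℝ) < ((m + n : ℕ) : ℝ) := by push_cast; linarith
    have := Real.rpow_lt_rpow (Real.rpow_nonneg hX _) h (div_pos hk hd)
    rwa [← Real.rpow_mul hX, div_mul_div_cancel₀' hd.ne' , div_self hk.ne', Real.rpow_one] at this
  -- The exponents m/d and n/d add up to 1, so the two upper bounds multiply to a product below ε.
  by_contra! hlt
  obtain ⟨h1, h2⟩ := max_lt_iff.1 hlt
  have h1 := key hm (quasinorm_nonneg _ _) h1
  have h2 := key hn (quasinorm_nonneg _ _) h2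
  have := mul_lt_mul'' h1 h2 (quasinorm_nonneg _ _) (quasinorm_nonneg _ _)
  rw [← Real.rpow_add hε, ← add_div, Nat.cast_add, div_self (by positivity), Real.rpow_one] at this
  linarith

theorem le_gridQuasinorm_of_inl [NeZero m] {ε : ℝ} (hε : 0 < ε)
    (v : Fin m ⊕ Fin n → ℝ)
    (h : ε ^ ((m : ℝ) / ((m + n : ℕ) : ℝ)) ≤ quasinorm w.r (fun i => v (Sum.inl i))) :
    ε ≤ w.gridQuasinorm v := by
  have hm : (0 : ℝ) < m := Nat.cast_pos.2 (NeZero.pos m)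
  have hd : (0 : ℝ) < ((m + n : ℕ) : ℝ) := by push_cast; positivity
  refine le_max_of_le_left ?_
  have := Real.rpow_le_rpow (Real.rpow_nonneg hε.le _) h (div_pos hd hm).le
  rwa [← Real.rpow_mul hε.le, div_mul_div_cancel₀' hm.ne', div_self hd.ne', Real.rpow_one] at this

end Weights

/-- The matrix `(I_m A; 0 I_n)`. -/
def unipotent (A : Matrix (Fin m) (Fin n) ℝ) : SLd m n :=
  ⟨Matrix.fromBlocks 1 A 0 1, by simp⟩

/-- The grid `x_A - (b, 0)`, with vectors `(A q + p - b, q)`. -/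
def shiftedGrid (A : Matrix (Fin m) (Fin n) ℝ) (b : Fin m → ℝ) : GridSpace m n :=
  GridSpace.mk (ofParts (unipotent A) (Sum.elim (-b) 0))

theorem gridProj_shiftedGrid (A : Matrix (Fin m) (Fin n) ℝ) (b : Fin m → ℝ) :
    gridProj (shiftedGrid A b) = latticeOf A := by
  rw [shiftedGrid, gridProj_mk, linearPart_ofParts]
  rfl

theorem shiftedGrid_eq_trans_smul (A : Matrix (Fin m) (Fin n) ℝ) (b b' : Fin m → ℝ) :
    shiftedGrid A b' = (trans (Sum.elim (b - b') 0) : ASLd m n) • shiftedGrid A b := by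
  rw [shiftedGrid, shiftedGrid, GridSpace.smul_mk, ASLd.trans, ofParts_mul, one_mul]
  congr 2
  ext i
  rcases i with i | j
  · simp
    ring
  · simp

theorem mem_grid_shiftedGrid {A : Matrix (Fin m) (Fin n) ℝ} {b : Fin m → ℝ}
    {v : Fin m ⊕ Fin n → ℝ} : v ∈ (shiftedGrid A b).grid ↔ ∃ (p : Fin m → ℤ) (q : Fin n → ℤ),
      v = Sum.elim (fun i => (A.mulVec (fun j => (q j : ℝ)) - b) i + (p i : ℝ))
        fun j => (q j : ℝ) := by
  have key : ∀ z : Fin m ⊕ Fin n → ℤ, act (ofParts (unipotent A)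
      (Sum.elim (-b) 0)) (fun i => (z i : ℝ)) =
      Sum.elim (fun i => (A.mulVec (fun j => (z (Sum.inr j) : ℝ)) - b) i + (z (Sum.inl i) : ℝ))
        fun j => (z (Sum.inr j) : ℝ) := by
    intro z
    rw [act, linearPart_ofParts, translationPart_ofParts]
    change (Matrix.fromBlocks 1 A 0 1).mulVec _ + _ = _
    rw [Matrix.fromBlocks_mulVec]
    ext i
    rcases i with i | j
    · simp [Function.comp_def]
      ring
    · simp
  rw [shiftedGrid, GridSpace.grid_mk]
  constructor
  · rintro ⟨z, rfl⟩
    exact ⟨fun i => z (Sum.inl i), fun j => z (Sum.inr j), key z⟩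
  · rintro ⟨p, q, rfl⟩
    exact ⟨Sum.elim p q, key _⟩

namespace Weights

variable (w : Weights m n)

/-- Badly approximable vectors give grids whose forward orbit ends up in the target. -/
theorem exists_forall_mem_target [NeZero m] [NeZero n] {A : Matrix (Fin m) (Fin n) ℝ}
    {b : Fin m → ℝ} {ε ε' : ℝ} (hb : b ∈ w.Bad A ε) (hirr : ¬ IsRationalPair A b) (hε' : 0 < ε')
    (hlt : ε' < ε) : ∃ T : ℕ, ∀ l ≥ T, w.a ^ l • shiftedGrid A b ∈ w.target ε' := by
  have h1 := eventually_lt_of_lt_liminf (lt_of_lt_of_le (EReal.coe_lt_coe_iff.2 hlt) hb)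
  rw [eventually_comap] at h1
  obtain ⟨N, hN⟩ := eventually_atTop.1 h1
  have hfin : {z : (Fin m → ℤ) × (Fin n → ℤ) | quasinorm w.s (fun j => (z.2 j : ℝ)) ≤ N ∧
      quasinorm w.r (fun i => (A.mulVec (fun j => (z.2 j : ℝ)) - b) i + (z.1 i : ℝ)) ≤ 1}.Finite := by
    have hq : {q : Fin n → ℤ | quasinorm w.s (fun j => (q j : ℝ)) ≤ N}.Finite := by
      simpa using finite_int_quasinorm_le w.s_pos 0 N
    refine (hq.biUnion fun q _ => ((finite_int_quasinorm_le w.r_pos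
      (A.mulVec (fun j => (q j : ℝ)) - b) 1).image fun p => (p, q))).subset ?_
    rintro ⟨p, q⟩ ⟨h2, h3⟩
    exact mem_biUnion (show q ∈ {q : Fin n → ℤ | quasinorm w.s (fun j => (q j : ℝ)) ≤ N} from h2)
      ⟨p, h3, rfl⟩
  -- Among the q with quasinorm at most N only finitely many grid vectors have a first component of
  -- quasinorm at most 1. Irrationality keeps all of these away from zero.
  have hc : ∃ c : ℝ, 0 < c ∧ ∀ (p : Fin m → ℤ) (q : Fin n → ℤ),
      quasinorm w.s (fun j => (q j : ℝ)) ≤ N →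
      c ≤ quasinorm w.r (fun i => (A.mulVec (fun j => (q j : ℝ)) - b) i + (p i : ℝ)) := by
    have hpos : ∀ (p : Fin m → ℤ) (q : Fin n → ℤ),
        0 < quasinorm w.r (fun i => (A.mulVec (fun j => (q j : ℝ)) - b) i + (p i : ℝ)) := by
      intro p q
      refine quasinorm_pos _ fun h => hirr ⟨p, q, ?_⟩
      ext i
      exact congrFun h i
    rcases (hfin.toFinset).eq_empty_or_nonempty with he | hne
    · refine ⟨1, one_pos, fun p q hq => ?_⟩
      by_contra! hlt
      have : (p, q) ∈ hfin.toFinset := hfin.mem_toFinset.2 ⟨hq, hlt.le⟩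
      simp [he] at this
    · obtain ⟨z, _, hz⟩ := Finset.exists_min_image hfin.toFinset
        (fun z => quasinorm w.r (fun i => (A.mulVec (fun j => (z.2 j : ℝ)) - b) i + (z.1 i : ℝ))) hne
      refine ⟨min 1 (quasinorm w.r
        (fun i => (A.mulVec (fun j => (z.2 j : ℝ)) - b) i + (z.1 i : ℝ))),
        lt_min one_pos (hpos _ _), fun p q hq => ?_⟩
      rcases le_or_gt (quasinorm w.r
        (fun i => (A.mulVec (fun j => (q j : ℝ)) - b) i + (p i : ℝ))) 1 with h | h
      · exact (min_le_right _ _).trans (hz (p, q) (hfin.mem_toFinset.2 ⟨hq, h⟩))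
      · exact (min_le_left _ _).trans h.le
  obtain ⟨c, hc0, hc⟩ := hc
  have hT : ∀ᶠ l : ℕ in atTop, ε' ^ ((m : ℝ) / ((m + n : ℕ) : ℝ)) / c ≤ Real.exp l :=
    (Real.tendsto_exp_atTop.comp tendsto_natCast_atTop_atTop).eventually_ge_atTop _
  obtain ⟨T, hT⟩ := eventually_atTop.1 hT
  refine ⟨T, fun l hl v hv => ?_⟩
  rw [GridSpace.grid_smul] at hv
  obtain ⟨u, hu, rfl⟩ := hv
  obtain ⟨p, q, rfl⟩ := mem_grid_shiftedGrid.1 hu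
  have e1 : ∀ i, act (w.a ^ l) (Sum.elim
      (fun i => (A.mulVec (fun j => (q j : ℝ)) - b) i + (p i : ℝ)) fun j => (q j : ℝ)) (Sum.inl i) =
      Real.exp (w.r i * l) * ((A.mulVec (fun j => (q j : ℝ)) - b) i + (p i : ℝ)) := by
    intro i
    rw [act, linearPart_a_pow, translationPart_a_pow, add_zero, flow_mulVec_inl, Sum.elim_inl]
  have e2 : ∀ j, act (w.a ^ l) (Sum.elim
      (fun i => (A.mulVec (fun j => (q j : ℝ)) - b) i + (p i : ℝ)) fun j => (q j : ℝ)) (Sum.inr j) =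
      Real.exp (w.s j * (-l)) * (q j : ℝ) := by
    intro j
    rw [act, linearPart_a_pow, translationPart_a_pow, add_zero, flow_mulVec_inr, Sum.elim_inr,
      mul_neg]
  -- For small q the first component has grown to at least e^l c, which is large enough from time T
  -- on. For large q the product of the two quasinorms is invariant under the flow and exceeds ε' by
  -- badness.
  rcases le_or_gt (quasinorm w.s (fun j => (q j : ℝ))) N with hq | hq
  · refine w.le_gridQuasinorm_of_inl hε' _ ?_
    simp only [e1]
    rw [quasinorm_exp_mul w.r_pos]
    have := (div_le_iff₀ hc0).1 (hT l hl)
    exact this.trans (mul_le_mul_of_nonneg_left (hc p q hq) (Real.exp_pos _).le)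
  · refine w.le_gridQuasinorm_of_mul hε' _ ?_
    simp only [e1, e2]
    rw [quasinorm_exp_mul w.r_pos, quasinorm_exp_mul w.s_pos]
    have h2 := EReal.coe_lt_coe_iff.1 (hN _ hq.le q rfl)
    have h3 := distToInt_le w.r (A.mulVec (fun j => (q j : ℝ)) - b) (fun i => - p i)
    simp only [Int.cast_neg, sub_neg_eq_add] at h3
    calc ε' ≤ _ := h2.le
      _ ≤ _ := mul_le_mul_of_nonneg_left h3 (quasinorm_nonneg _ _)
      _ = _ := by
        rw [mul_mul_mul_comm, ← Real.exp_add, add_neg_cancel, Real.exp_zero, one_mul, mul_comm]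

theorem countable_isRationalPair (A : Matrix (Fin m) (Fin n) ℝ) :
    {b : Fin m → ℝ | IsRationalPair A b}.Countable := by
  have : {b : Fin m → ℝ | IsRationalPair A b} ⊆
      range fun z : (Fin m → ℤ) × (Fin n → ℤ) =>
        A.mulVec (fun j => (z.2 j : ℝ)) + fun i => (z.1 i : ℝ) := by
    rintro b ⟨p, q, h⟩
    refine ⟨(p, q), ?_⟩
    rw [sub_add_eq_add_sub, sub_eq_zero] at h
    exact h
  exact (countable_range _).mono this

/-- Large separated families of vectors whose grids stay in the target from a fixed time on. -/
theorem exists_separated_bad [NeZero m] [NeZero n] {A : Matrix (Fin m) (Fin n) ℝ} {ε ε' : ℝ}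
    (hirr : ∃ b ∈ w.Bad A ε, ¬ IsRationalPair A b) (hε' : 0 < ε') (hlt : ε' < ε) {c : ℝ}
    (hc : c < 1 - w.r 0 * ((m : ℝ) - (dimH (w.Bad A ε)).toReal)) :
    ∃ T : ℕ, ∀ᶠ k : ℕ in atTop, ∃ S : Finset (Fin m → ℝ), S.Nonempty ∧
      (∀ b ∈ S, ∀ b' ∈ S, ∀ i, |b i - b' i| ≤ 1) ∧
      (∀ b ∈ S, ∀ b' ∈ S, b ≠ b' → ∃ i, 1 ≤ |b i - b' i| * Real.exp (w.r i * k)) ∧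
      (∀ b ∈ S, ∀ l ≥ T, w.a ^ l • shiftedGrid A b ∈ w.target ε') ∧
      k * c ≤ Real.log S.card := by
  have hr0 := w.r_pos 0
  -- If c ≤ 0 a single irrational vector suffices. Positivity of c in the other case is what makes
  -- the exponent s below nonnegative.
  rcases le_or_gt c 0 with hc0 | hc0
  · obtain ⟨b, hb, hirr⟩ := hirr
    obtain ⟨T, hT⟩ := w.exists_forall_mem_target hb hirr hε' hlt
    refine ⟨T, Eventually.of_forall fun k => ⟨{b}, by simp, by simp, by simp, by simpa using hT, ?_⟩⟩
    simpa using mul_nonpos_of_nonneg_of_nonpos (Nat.cast_nonneg k) hc0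
  -- The pieces are indexed by a time from which the orbit stays in the target and by the unit cube
  -- containing b. Together with the countably many rational vectors they cover `Bad`, so one of
  -- them has dimension larger than s.
  · set E : ℕ × (Fin m → ℤ) → Set (Fin m → ℝ) := fun z =>
      {b | (∀ l ≥ z.1, w.a ^ l • shiftedGrid A b ∈ w.target ε') ∧ ∀ i, ⌊b i⌋ = z.2 i} with hE
    have hcov : w.Bad A ε ⊆ {b | IsRationalPair A b} ∪ ⋃ z, E z := by
      intro b hb
      by_cases h : IsRationalPair A b
      · exact Or.inl h
      · obtain ⟨T, hT⟩ := w.exists_forall_mem_target hb h hε' hlt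
        exact Or.inr (mem_iUnion.2 ⟨(T, fun i => ⌊b i⌋), hT, fun i => rfl⟩)
    have hmr : 1 ≤ m * w.r 0 := by
      rw [← w.r_sum]
      refine (Finset.sum_le_sum fun i _ => w.r_anti (Fin.zero_le i)).trans_eq ?_
      simp
    have hs0 : 0 ≤ (m : ℝ) - (1 - c) / w.r 0 := by
      rw [sub_nonneg, div_le_iff₀ hr0]
      linarith
    have hfin : dimH (w.Bad A ε) ≠ ⊤ := by
      refine ne_top_of_le_ne_top ?_ (dimH_mono (subset_univ _))
      rw [Real.dimH_univ_pi_fin]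
      exact ENNReal.natCast_ne_top m
    -- Solution of 1 - r_1 (m - s) = c, where r_1 is `w.r 0`.
    set s : NNReal := ⟨(m : ℝ) - (1 - c) / w.r 0, hs0⟩ with hs
    have hsD : (s : ℝ≥0∞) < dimH (w.Bad A ε) := by
      rw [← ENNReal.ofReal_toReal hfin, ← ENNReal.ofReal_coe_nnreal]
      refine (ENNReal.ofReal_lt_ofReal_iff_of_nonneg hs0).2 ?_
      rw [sub_lt_comm, lt_div_iff₀ hr0]
      linarith
    have : ∃ z, (s : ℝ≥0∞) < dimH (E z) := by
      by_contra! hcon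
      have := (dimH_mono hcov).trans_eq (dimH_union _ _)
      rw [dimH_iUnion, (countable_isRationalPair A).dimH_zero] at this
      exact absurd (this.trans (max_le zero_le (iSup_le hcon))) (not_le.2 hsD)
    obtain ⟨z, hz⟩ := this
    refine ⟨z.1, ?_⟩
    have hunit : ∀ b ∈ E z, ∀ b' ∈ E z, ∀ i, |b i - b' i| ≤ 1 := by
      intro b hb b' hb' i
      refine (Int.abs_sub_lt_one_of_floor_eq_floor ?_).le
      rw [hb.2 i, hb'.2 i]
    filter_upwards [exists_large_separated w.r_sum (fun i => w.r_anti (Fin.zero_le i)) hr0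
      hunit hz] with k hk
    obtain ⟨S, hSE, hsep, hcard⟩ := hk
    have hexp : (k : ℝ) * (1 - w.r 0 * (m - (s : ℝ))) = k * c := by
      change (k : ℝ) * (1 - w.r 0 * (m - ((m : ℝ) - (1 - c) / w.r 0))) = k * c
      field_simp
      ring
    rw [hexp] at hcard
    have hpos : (0 : ℝ) < S.card := (Real.exp_pos _).trans_le hcard
    refine ⟨S, Finset.card_pos.1 (by exact_mod_cast hpos), fun b hb b' hb' => hunit b (hSE hb) b' (hSE hb'),
      hsep, fun b hb => (hSE hb).1, ?_⟩
    rwa [Real.le_log_iff_exp_le hpos]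

end Weights

end BadVectors

/-! ### Partitions with null boundary. -/

section ContinuousLabels

variable {Ω : Type*} [TopologicalSpace Ω] [MeasurableSpace Ω]

/-- A labelling map is almost everywhere locally constant. -/
def AELocallyConstant {ι : Type*} (μ : Measure Ω) (α : Ω → ι) : Prop :=
  ∀ᵐ y ∂μ, ∀ᶠ z in 𝓝 y, α z = α y

variable {ι κ : Type*} {μ : Measure Ω} {α : Ω → ι} {β : Ω → κ}

theorem AELocallyConstant.pair (hα : AELocallyConstant μ α) (hβ : AELocallyConstant μ β) :
    AELocallyConstant μ (pairLabel α β) := by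
  filter_upwards [hα, hβ] with y h1 h2
  filter_upwards [h1, h2] with z h3 h4
  exact Prod.ext h3 h4

theorem AELocallyConstant.map (hα : AELocallyConstant μ α) (f : ι → κ) :
    AELocallyConstant μ (f ∘ α) := by
  filter_upwards [hα] with y h1
  filter_upwards [h1] with z h3
  exact congrArg f h3

theorem AELocallyConstant.pi {J : Type*} [Finite J] {κ : J → Type*} {γ : ∀ j, Ω → κ j}
    (h : ∀ j, AELocallyConstant μ (γ j)) : AELocallyConstant μ fun x j => γ j x := by
  filter_upwards [ae_all_iff.2 h] with y hy
  filter_upwards [eventually_all.2 hy] with z hz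
  exact funext hz

theorem AELocallyConstant.comp {Ω' : Type*} [TopologicalSpace Ω'] [MeasurableSpace Ω']
    {ν : Measure Ω'} {f : Ω' → Ω} (hα : AELocallyConstant μ α) (hf : Continuous f)
    (h : MeasurePreserving f ν μ) : AELocallyConstant ν (α ∘ f) := by
  filter_upwards [h.quasiMeasurePreserving.ae hα] with y hy
  exact hf.continuousAt.eventually hy

theorem aelocallyConstant_lt [OpensMeasurableSpace Ω] {f : Ω → ℝ} (hf : Continuous f) {ρ : ℝ} (hρ : μ {x | f x = ρ} = 0) :
    AELocallyConstant μ fun x => decide (f x < ρ) := by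
  have : ∀ᵐ x ∂μ, f x ≠ ρ := by
    rw [ae_iff]
    simpa using hρ
  filter_upwards [this] with y hy
  rcases lt_or_gt_of_ne hy with h | h
  · filter_upwards [hf.continuousAt.eventually (gt_mem_nhds h)] with z hz
    rw [decide_eq_true hz, decide_eq_true h]
  · filter_upwards [hf.continuousAt.eventually (lt_mem_nhds h)] with z hz
    rw [decide_eq_false (not_lt.2 h.le), decide_eq_false (not_lt.2 (le_of_lt hz))]

/-- Distinct levels are disjoint, so only countably many carry positive mass, while the interval is
uncountable. -/
theorem exists_null_level [SFinite μ] {f : Ω → ℝ} (hf : Measurable f) {a b : ℝ} (hab : a < b) :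
    ∃ ρ ∈ Ioo a b, μ {x | f x = ρ} = 0 := by
  by_contra! hcon
  have hc := Measure.countable_meas_level_set_pos (μ := μ) hf
  have : (Ioo a b).Countable := hc.mono fun ρ hρ => pos_iff_ne_zero.2 (hcon ρ hρ)
  have h0 := this.measure_zero volume
  rw [Real.volume_Ioo, ENNReal.ofReal_eq_zero] at h0
  linarith

/-- Countably many almost everywhere locally constant labels separate points. -/
theorem exists_separating_labels {Ω : Type*} [TopologicalSpace Ω] [MeasurableSpace Ω] [BorelSpace Ω]
    [TopologicalSpace.MetrizableSpace Ω] [SecondCountableTopology Ω] (μ : Measure Ω) [SFinite μ] :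
    ∃ β : ℕ → Ω → Bool, (∀ j, Measurable (β j)) ∧ (∀ j, AELocallyConstant μ (β j)) ∧
      ∀ x x', (∀ j, β j x = β j x') → x = x' := by
  let := TopologicalSpace.metrizableSpaceMetric Ω
  rcases isEmpty_or_nonempty Ω with hΩ | hΩ
  · exact ⟨fun _ x => isEmptyElim x, fun _ => measurable_of_empty _,
      fun _ => Eventually.of_forall fun x => isEmptyElim x, fun x => isEmptyElim x⟩
  -- Balls around a dense sequence separate points; the radii are adjusted so that the spheres are
  -- null.
  have hgen : ∀ i n : ℕ, ∃ ρ ∈ Ioo (1 / ((n : ℝ) + 2)) (1 / ((n : ℝ) + 1)),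
      μ {x | dist x (TopologicalSpace.denseSeq Ω i) = ρ} = 0 := fun i n =>
    exists_null_level (continuous_id.dist continuous_const).measurable
      (one_div_lt_one_div_of_lt (by positivity) (by linarith))
  choose ρ hρ hρ0 using hgen
  refine ⟨fun j x => decide (dist x (TopologicalSpace.denseSeq Ω j.unpair.1) <
    ρ j.unpair.1 j.unpair.2), fun j => ?_, fun j => ?_, fun x x' h => ?_⟩
  · exact measurable_to_bool (by
      have : (fun x => decide (dist x (TopologicalSpace.denseSeq Ω j.unpair.1) <
        ρ j.unpair.1 j.unpair.2)) ⁻¹' {true} = Metric.ball (TopologicalSpace.denseSeq Ω j.unpair.1)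
          (ρ j.unpair.1 j.unpair.2) := by
        ext x
        simp [Metric.mem_ball]
      rw [this]
      exact measurableSet_ball)
  · exact aelocallyConstant_lt (continuous_id.dist continuous_const) (hρ0 _ _)
  · by_contra hne
    have hd : 0 < dist x x' := dist_pos.2 hne
    obtain ⟨n, hn⟩ := exists_nat_one_div_lt (half_pos hd)
    obtain ⟨i, hi⟩ := (TopologicalSpace.denseRange_denseSeq Ω).exists_dist_lt x
      (show (0 : ℝ) < 1 / ((n : ℝ) + 2) by positivity)
    have hj := h (Nat.pair i n)
    simp only [Nat.unpair_pair] at hj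
    have h1 : dist x (TopologicalSpace.denseSeq Ω i) < ρ i n := hi.trans (hρ i n).1
    rw [decide_eq_true h1, eq_comm, decide_eq_true_iff] at hj
    have h2 := dist_triangle_right x x' (TopologicalSpace.denseSeq Ω i)
    have h3 := (hρ i n).2
    linarith

end ContinuousLabels

/-! ### Weak limits of orbit measures: invariance, support, entropy. -/

section WeakLimits

variable {Ω : Type*} [TopologicalSpace Ω] [MeasurableSpace Ω] [BorelSpace Ω]

/-- At a point where the label is locally constant no atom has a frontier point, so the frontiers
are null and the portmanteau theorem applies. -/
theorem tendsto_measureReal_label [HasOuterApproxClosed Ω] {J : Type*} {L : Filter J}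
    {μs : J → ProbabilityMeasure Ω} {μ : ProbabilityMeasure Ω} (h : Tendsto μs L (𝓝 μ))
    {ι : Type*} {α : Ω → ι} (hα : AELocallyConstant (μ : Measure Ω) α) (i : ι) :
    Tendsto (fun j => (μs j : Measure Ω).real (α ⁻¹' {i})) L
      (𝓝 ((μ : Measure Ω).real (α ⁻¹' {i}))) := by
  refine (ENNReal.tendsto_toReal (measure_ne_top _ _)).comp
    (ProbabilityMeasure.tendsto_measure_of_null_frontier_of_tendsto' h ?_)
  refine measure_mono_null ?_ hα
  intro y hy hloc
  obtain ⟨h1, h2⟩ := hy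
  by_cases h3 : α y = i
  · refine h2 (mem_interior_iff_mem_nhds.2 ?_)
    filter_upwards [hloc] with z hz
    exact hz.trans h3
  · obtain ⟨z, hz1, hz2⟩ := mem_closure_iff_nhds.1 h1 _ hloc
    exact h3 ((show α z = α y from hz1) ▸ hz2)

theorem tendsto_finCondEntropy [HasOuterApproxClosed Ω] {J : Type*} {L : Filter J}
    {μs : J → ProbabilityMeasure Ω} {μ : ProbabilityMeasure Ω} (h : Tendsto μs L (𝓝 μ))
    {ι κ : Type*} [Fintype ι] [Fintype κ] {α : Ω → ι} {β : Ω → κ}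
    (hα : AELocallyConstant (μ : Measure Ω) α) (hβ : AELocallyConstant (μ : Measure Ω) β) :
    Tendsto (fun j => finCondEntropy (μs j : Measure Ω) α β) L
      (𝓝 (finCondEntropy (μ : Measure Ω) α β)) := by
  -- Stated twice, since a local statement has a fixed universe and the label types of the two
  -- entropies may lie in different ones.
  have key : ∀ {ι : Type _} [Fintype ι] {α : Ω → ι} (_ : AELocallyConstant (μ : Measure Ω) α),
      Tendsto (fun j => finEntropy (μs j : Measure Ω) α) L (𝓝 (finEntropy (μ : Measure Ω) α)) :=
    fun hα => tendsto_finsetSum _ fun i _ =>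
      (Real.continuous_negMulLog.tendsto _).comp (tendsto_measureReal_label h hα i)
  have key' : ∀ {ι : Type _} [Fintype ι] {α : Ω → ι} (_ : AELocallyConstant (μ : Measure Ω) α),
      Tendsto (fun j => finEntropy (μs j : Measure Ω) α) L (𝓝 (finEntropy (μ : Measure Ω) α)) :=
    fun hα => tendsto_finsetSum _ fun i _ =>
      (Real.continuous_negMulLog.tendsto _).comp (tendsto_measureReal_label h hα i)
  exact (key (hα.pair hβ)).sub (key' hβ)

theorem AELocallyConstant.iteratedJoin {ι : Type*} {α : Ω → ι} {μ : Measure Ω}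
    (hα : AELocallyConstant μ α) {T : Ω → Ω} (hT : Continuous T) (h : MeasurePreserving T μ μ)
    (N : ℕ) : AELocallyConstant μ (_root_.iteratedJoin T α N) :=
  AELocallyConstant.pi fun i => hα.comp (hT.iterate i) (h.iterate i)

/-- The uniform measure on the orbit segments of length `K` of a finite family of points. -/
noncomputable def orbitMeasure (T : Ω → Ω) (K : ℕ) {D : Type*} [Fintype D] (y : D → Ω) :
    Measure Ω :=
  uniformDirac fun p : Fin K × D => T^[(p.1 : ℕ)] (y p.2)

instance (T : Ω → Ω) (K : ℕ) [NeZero K] {D : Type*} [Fintype D] [Nonempty D] (y : D → Ω) :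
    IsProbabilityMeasure (orbitMeasure T K y) := by
  unfold orbitMeasure
  infer_instance

/-- The orbit measure as a bundled probability measure. -/
noncomputable def orbitProbability (T : Ω → Ω) (K : ℕ) [NeZero K] {D : Type*} [Fintype D]
    [Nonempty D] (y : D → Ω) : ProbabilityMeasure Ω :=
  ⟨orbitMeasure T K y, inferInstance⟩

theorem integral_orbitMeasure {T : Ω → Ω} {K : ℕ} {D : Type*} [Fintype D] {y : D → Ω}
    [TopologicalSpace.PseudoMetrizableSpace Ω] {f : Ω → ℝ} (hf : Continuous f) :
    ∫ x, f x ∂(orbitMeasure T K y) =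
      (∑ d, ∑ l ∈ Finset.range K, f (T^[l] (y d))) / (K * Fintype.card D : ℝ) := by
  rw [orbitMeasure, integral_uniformDirac hf.measurable.stronglyMeasurable, Fintype.card_prod,
    Fintype.card_fin, Nat.cast_mul, Fintype.sum_prod_type_right]
  congr 1
  refine Finset.sum_congr rfl fun d _ => ?_
  exact Fin.sum_univ_eq_sum_range (fun l => f (T^[l] (y d))) K

variable {L : Filter ℕ} {K : ℕ → ℕ} [∀ j, NeZero (K j)] {D : ℕ → Type*}
  [∀ j, Fintype (D j)] [∀ j, Nonempty (D j)] {y : ∀ j, D j → Ω} {T : Ω → Ω}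

/-- Weak limits of orbit measures of growing length are invariant. -/
theorem measurePreserving_of_tendsto_orbitMeasure [CompactSpace Ω] [TopologicalSpace.MetrizableSpace Ω]
    [SecondCountableTopology Ω] [L.NeBot] (hT : Continuous T) (hK : Tendsto K L atTop)
    {μ : ProbabilityMeasure Ω}
    (h : Tendsto (fun j => orbitProbability T (K j) (y j)) L
      (𝓝 μ)) : MeasurePreserving T (μ : Measure Ω) μ := by
  refine ⟨hT.measurable, ?_⟩
  have : IsProbabilityMeasure ((μ : Measure Ω).map T) :=
    Measure.isProbabilityMeasure_map hT.measurable.aemeasurable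
  refine ext_of_forall_integral_eq_of_IsFiniteMeasure fun f => ?_
  rw [integral_map hT.measurable.aemeasurable f.continuous.aestronglyMeasurable]
  rw [ProbabilityMeasure.tendsto_iff_forall_integral_tendsto] at h
  have h1 := h (f.compContinuous ⟨T, hT⟩)
  have h2 := h f
  refine tendsto_nhds_unique h1 ?_
  have h3 : Tendsto (fun j => ∫ x, f (T x) ∂(orbitMeasure T (K j) (y j)) -
      ∫ x, f x ∂(orbitMeasure T (K j) (y j))) L (𝓝 0) := by
    have hb : Tendsto (fun j => (2 * ‖f‖) / (K j : ℝ)) L (𝓝 0) :=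
      (tendsto_const_nhds.div_atTop (tendsto_natCast_atTop_atTop.comp hK))
    refine squeeze_zero_norm (fun j => ?_) hb
    have hKj : (0 : ℝ) < K j := Nat.cast_pos.2 (NeZero.pos (K j))
    have hD : (0 : ℝ) < Fintype.card (D j) := Nat.cast_pos.2 Fintype.card_pos
    rw [integral_orbitMeasure (f := fun x => f (T x)) (f.continuous.comp hT),
      integral_orbitMeasure f.continuous,
      ← sub_div, ← Finset.sum_sub_distrib, norm_div, Real.norm_eq_abs, Real.norm_eq_abs,
      abs_of_pos (mul_pos hKj hD), div_le_div_iff₀ (mul_pos hKj hD) hKj]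
    have h4 : |∑ d, (∑ l ∈ Finset.range (K j), f (T (T^[l] (y j d))) -
        ∑ l ∈ Finset.range (K j), f (T^[l] (y j d)))| ≤ ∑ _d : D j, 2 * ‖f‖ := by
      refine (Finset.abs_sum_le_sum_abs _ _).trans (Finset.sum_le_sum fun d _ => ?_)
      simp only [← Function.iterate_succ_apply' T]
      rw [← Finset.sum_sub_distrib, Finset.sum_range_sub fun l => f (T^[l] (y j d))]
      refine (abs_sub _ _).trans ?_
      have a1 := f.norm_coe_le_norm (T^[K j] (y j d))
      have a2 := f.norm_coe_le_norm (T^[0] (y j d))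
      rw [Real.norm_eq_abs] at a1 a2
      linarith
    rw [Finset.sum_const, Finset.card_univ, nsmul_eq_mul] at h4
    calc _ ≤ (Fintype.card (D j) * (2 * ‖f‖)) * K j := mul_le_mul_of_nonneg_right h4 hKj.le
      _ = _ := by ring
  have h5 := h2.add h3
  simp only [add_zero] at h5
  refine h5.congr fun j => ?_
  change ∫ x, f x ∂(orbitMeasure T (K j) (y j)) + _ = ∫ x, f (T x) ∂(orbitMeasure T (K j) (y j))
  ring

/-- Closed sets containing the late parts of the orbit segments have full measure in the limit. -/
theorem measure_compl_eq_zero_of_tendsto_orbitMeasure [CompactSpace Ω] [TopologicalSpace.MetrizableSpace Ω]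
    [SecondCountableTopology Ω] [L.NeBot] {t : ℕ → ℕ} (ht : ∀ᶠ j in L, j * t j ≤ K j)
    (hL : L ≤ atTop) {F : Set Ω} (hF : IsClosed F)
    (hyF : ∀ᶠ j in L, ∀ d, ∀ l ≥ t j, T^[l] (y j d) ∈ F) {μ : ProbabilityMeasure Ω}
    (h : Tendsto (fun j => orbitProbability T (K j) (y j)) L
      (𝓝 μ)) : (μ : Measure Ω) Fᶜ = 0 := by
  classical
  refine le_antisymm ?_ zero_le
  refine (ProbabilityMeasure.le_liminf_measure_open_of_tendsto h hF.isOpen_compl).trans ?_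
  have hz : Tendsto (fun j : ℕ => ENNReal.ofReal (1 / (j : ℝ))) L (𝓝 0) := by
    rw [← ENNReal.ofReal_zero]
    exact (ENNReal.tendsto_ofReal (tendsto_one_div_atTop_nhds_zero_nat (𝕜 := ℝ))).mono_left hL
  rw [← hz.liminf_eq]
  refine liminf_le_liminf ?_
  filter_upwards [ht, hyF, hL (eventually_gt_atTop 0)] with j hj hjF hj0
  change orbitMeasure T (K j) (y j) Fᶜ ≤ _
  rw [← ofReal_measureReal]
  refine ENNReal.ofReal_le_ofReal ?_
  rw [orbitMeasure, uniformDirac_real_apply hF.isOpen_compl.measurableSet]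
  have hKj : (0 : ℝ) < K j := Nat.cast_pos.2 (NeZero.pos (K j))
  have hD : (0 : ℝ) < Fintype.card (D j) := Nat.cast_pos.2 Fintype.card_pos
  have hj0' : (0 : ℝ) < j := Nat.cast_pos.2 hj0
  rw [Fintype.card_prod, Fintype.card_fin, Nat.cast_mul, div_le_div_iff₀ (mul_pos hKj hD) hj0']
  -- Only the first `t j` times of each segment can be outside F, a proportion of at most t j / K j
  -- ≤ 1 / j.
  have hcard : (Finset.univ.filter fun p : Fin (K j) × D j => T^[(p.1 : ℕ)] (y j p.2) ∈ Fᶜ).card ≤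
      t j * Fintype.card (D j) := by
    have hinj : Set.InjOn (fun p : Fin (K j) × D j => ((p.1 : ℕ), p.2))
        (Finset.univ.filter fun p : Fin (K j) × D j => T^[(p.1 : ℕ)] (y j p.2) ∈ Fᶜ) := by
      rintro ⟨a, b⟩ _ ⟨c, d⟩ _ e
      simp only [Prod.mk.injEq] at e ⊢
      exact ⟨Fin.ext e.1, e.2⟩
    rw [← Finset.card_image_of_injOn hinj]
    refine (Finset.card_le_card (t := Finset.range (t j) ×ˢ Finset.univ) ?_).trans_eq ?_
    · intro p hp
      obtain ⟨q, hq, rfl⟩ := Finset.mem_image.1 hp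
      simp only [Finset.mem_product, Finset.mem_range, Finset.mem_univ, and_true]
      by_contra! hle
      exact (Finset.mem_filter.1 hq).2 (hjF q.2 _ hle)
    · rw [Finset.card_product, Finset.card_range, Finset.card_univ]
  have h1 : ((Finset.univ.filter fun p : Fin (K j) × D j =>
      T^[(p.1 : ℕ)] (y j p.2) ∈ Fᶜ).card : ℝ) ≤ t j * Fintype.card (D j) := by exact_mod_cast hcard
  have h2 : (j : ℝ) * t j ≤ K j := by exact_mod_cast hj
  calc _ ≤ (t j * Fintype.card (D j) : ℝ) * j := mul_le_mul_of_nonneg_right h1 hj0'.le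
    _ = (j * t j) * Fintype.card (D j) := by ring
    _ ≤ _ := by rw [one_mul]; exact mul_le_mul_of_nonneg_right h2 hD.le

/-- Entropy of a limit of orbit measures, relative to labels that are constant on the family. -/
theorem le_finCondEntropy_of_tendsto_orbitMeasure [CompactSpace Ω] [TopologicalSpace.MetrizableSpace Ω]
    [SecondCountableTopology Ω] [L.NeBot] (hT : Continuous T) (hK : Tendsto K L atTop)
    {μ : ProbabilityMeasure Ω}
    (h : Tendsto (fun j => orbitProbability T (K j) (y j)) L
      (𝓝 μ)) {ι κ : Type*} [Fintype ι] [Nonempty ι] [Fintype κ] {P : Ω → ι} (hP : LabelMeasurable P)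
    (hPc : AELocallyConstant (μ : Measure Ω) P) {β : Ω → κ} (hβ : LabelMeasurable β)
    (hβc : AELocallyConstant (μ : Measure Ω) β)
    (hy : ∀ j l d d', β (T^[l] (y j d)) = β (T^[l] (y j d'))) {c : ℝ}
    (hc : ∀ c' < c, ∀ᶠ j in L, K j * c' ≤ countEntropy (_root_.iteratedJoin T P (K j) ∘ y j)) (q : ℕ) :
    q * c ≤ finCondEntropy (μ : Measure Ω) (_root_.iteratedJoin T P q) β := by
  have hinv := measurePreserving_of_tendsto_orbitMeasure hT hK h
  -- Invariance of the limit makes the boundaries of the iterated join null as well, so the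
  -- inequality for orbit measures passes to the limit; its boundary term is O(1 / K j).
  have hlim := tendsto_finCondEntropy h (hPc.iteratedJoin hT hinv q) hβc
  refine le_of_forall_lt_imp_le_of_dense fun z hz => ?_
  rcases q.eq_zero_or_pos with rfl | hq
  · simp only [CharP.cast_eq_zero, zero_mul] at hz
    exact hz.le.trans (finCondEntropy_nonneg (hP.iteratedJoin hT.measurable 0) hβ)
  have hq' : (0 : ℝ) < q := Nat.cast_pos.2 hq
  have hzc : z / q < c := by rwa [div_lt_iff₀ hq', mul_comm]
  obtain ⟨c', hc'1, hc'2⟩ := exists_between hzc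
  have hsmall : ∀ᶠ j in L, q * (q * Real.log (Fintype.card ι)) / (K j : ℝ) < q * c' - z := by
    have h0 : (0 : ℝ) < q * c' - z := by
      rw [div_lt_iff₀ hq'] at hc'1
      linarith
    exact (tendsto_const_nhds.div_atTop
      (tendsto_natCast_atTop_atTop.comp hK)).eventually_lt_const h0
  refine ge_of_tendsto hlim ?_
  filter_upwards [hsmall, hc c' hc'2] with j h1 h2
  have h3 := le_finCondEntropy_uniformDirac hT.measurable hP hβ (y j) (hy j) q (K j)
  refine le_trans ?_ h3
  have hKj : (0 : ℝ) < K j := Nat.cast_pos.2 (NeZero.pos (K j))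
  have h4 : (q / K j : ℝ) * (K j * c' - q * Real.log (Fintype.card ι)) ≤
      (q / K j : ℝ) * (countEntropy (_root_.iteratedJoin T P (K j) ∘ y j) -
        q * Real.log (Fintype.card ι)) := by
    refine mul_le_mul_of_nonneg_left ?_ (by positivity)
    linarith
  refine le_trans ?_ h4
  have h5 : (q / K j : ℝ) * (K j * c' - q * Real.log (Fintype.card ι)) =
      q * c' - q * (q * Real.log (Fintype.card ι)) / (K j : ℝ) := by
    field_simp
  rw [h5]
  linarith

end WeakLimits

/-! ### Small cells in the space of grids over a compact set. -/

section Cells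

variable {m n : ℕ}

open ASLd

theorem finite_int_mem_of_isCompact {ι : Type*} [Finite ι] {B : Set (ι → ℝ)} (hB : IsCompact B) :
    {z : ι → ℤ | (fun i => (z i : ℝ)) ∈ B}.Finite := by
  have := Fintype.ofFinite ι
  obtain ⟨M, hM⟩ := hB.isBounded.exists_norm_le
  refine (Set.Finite.pi (t := fun _ : ι => Icc (-⌈M⌉) ⌈M⌉) fun _ => Set.finite_Icc _ _).subset ?_
  intro z hz i _
  have h1 : |(z i : ℝ)| ≤ M := (norm_le_pi_norm (fun i => (z i : ℝ)) i).trans (hM _ hz)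
  have h2 := abs_le.1 (h1.trans (Int.le_ceil M))
  exact ⟨by exact_mod_cast h2.1, by exact_mod_cast h2.2⟩

theorem ASLd.continuous_act : Continuous fun p : ASLd m n × (Fin m ⊕ Fin n → ℝ) => act p.1 p.2 := by
  have h1 : Continuous fun p : ASLd m n × (Fin m ⊕ Fin n → ℝ) => (linearPart p.1).1 :=
    continuous_subtype_val.comp (continuous_linearPart.comp continuous_fst)
  exact (h1.matrix_mulVec continuous_snd).add (continuous_translationPart.comp continuous_fst)

/-- For g in a compact neighbourhood only finitely many integral vectors can be sent into B, so the
condition is locally a finite union of closed ones. -/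
theorem GridSpace.isClosed_grid_inter_nonempty {B : Set (Fin m ⊕ Fin n → ℝ)} (hB : IsCompact B) :
    IsClosed {y : GridSpace m n | (y.grid ∩ B).Nonempty} := by
  rw [← isOpen_compl_iff, ← GridSpace.isOpenQuotientMap_mk.isQuotientMap.isOpen_preimage,
    isOpen_iff_mem_nhds]
  intro g hg
  obtain ⟨N, hN, hgN⟩ := exists_compact_mem_nhds g
  have hfin := finite_int_mem_of_isCompact (((hN.inv).prod hB).image continuous_act)
  have hclosed : IsClosed (⋃ z ∈ {z : Fin m ⊕ Fin n → ℤ | (fun i => (z i : ℝ)) ∈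
      (fun p : ASLd m n × (Fin m ⊕ Fin n → ℝ) => act p.1 p.2) '' (N⁻¹ ×ˢ B)},
      {h : ASLd m n | act h (fun i => (z i : ℝ)) ∈ B}) := by
    refine hfin.isClosed_biUnion fun z _ => hB.isClosed.preimage ?_
    exact continuous_act.comp (continuous_id.prodMk continuous_const)
  have hnot : g ∈ (⋃ z ∈ {z : Fin m ⊕ Fin n → ℤ | (fun i => (z i : ℝ)) ∈
      (fun p : ASLd m n × (Fin m ⊕ Fin n → ℝ) => act p.1 p.2) '' (N⁻¹ ×ˢ B)},
      {h : ASLd m n | act h (fun i => (z i : ℝ)) ∈ B})ᶜ := by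
    simp only [mem_compl_iff, mem_iUnion, not_exists]
    intro z _ h
    exact hg ⟨_, by rw [GridSpace.grid_mk]; exact ⟨z, rfl⟩, h⟩
  filter_upwards [hclosed.isOpen_compl.mem_nhds hnot, hgN] with h h1 h2
  rintro ⟨x, hx, hxB⟩
  rw [GridSpace.grid_mk] at hx
  obtain ⟨z, rfl⟩ := hx
  refine h1 (mem_biUnion (x := z) ?_ hxB)
  refine ⟨(h⁻¹, act h fun i => (z i : ℝ)), ⟨inv_mem_inv.2 h2, hxB⟩, ?_⟩
  change act h⁻¹ (act h _) = _
  rw [← act_mul, inv_mul_cancel, act_one]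

/-- The distance from a given vector to the grid depends continuously on the grid. -/
theorem GridSpace.continuous_infDist_grid (c : Fin m ⊕ Fin n → ℝ) :
    Continuous fun y : GridSpace m n => Metric.infDist c y.grid := by
  rw [OrderTopology.continuous_iff]
  intro a
  constructor
  · rw [isOpen_iff_mem_nhds]
    intro y hy
    obtain ⟨b, hab, hb⟩ := exists_between (show a < Metric.infDist c y.grid from hy)
    have hmem : y ∈ {y : GridSpace m n | (y.grid ∩ Metric.closedBall c b).Nonempty}ᶜ := by
      rintro ⟨x, hx, hxc⟩
      have := Metric.infDist_le_dist_of_mem (x := c) hx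
      rw [Metric.mem_closedBall, dist_comm] at hxc
      linarith
    filter_upwards [(GridSpace.isClosed_grid_inter_nonempty
      (isCompact_closedBall c b)).isOpen_compl.mem_nhds hmem] with z hz
    refine hab.trans_le ((Metric.le_infDist z.grid_nonempty).2 fun x hx => ?_)
    by_contra! hlt
    exact hz ⟨x, hx, by rw [Metric.mem_closedBall, dist_comm]; exact hlt.le⟩
  · convert GridSpace.isOpen_grid_inter_nonempty (m := m) (n := n) (Metric.isOpen_ball (x := c) (ε := a))
      using 1
    ext y
    simp only [mem_preimage, mem_Iio, mem_ofPred_eq, Metric.infDist_lt_iff y.grid_nonempty]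
    exact ⟨fun ⟨x, h1, h2⟩ => ⟨x, h1, by rwa [Metric.mem_ball, dist_comm]⟩,
      fun ⟨x, h1, h2⟩ => ⟨x, h1, by rwa [Metric.mem_ball, dist_comm] at h2⟩⟩

/-- Translations fixing a point over a compact set are trivial or not small. -/
theorem exists_le_norm_of_trans_smul_eq {K : Set (LatticeSpace m n)} (hK : IsCompact K) :
    ∃ R : ℝ, 0 < R ∧ ∀ y : GridSpace m n, gridProj y ∈ K → ∀ t : Fin m ⊕ Fin n → ℝ,
      (trans t : ASLd m n) • y = y → t = 0 ∨ R ≤ ‖t‖ := by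
  obtain ⟨C, hC, hKC⟩ := LatticeSpace.exists_compact_lift hK
  have hcpt : IsCompact ((fun p : SLd m n × (Fin m ⊕ Fin n → ℝ) => (p.1⁻¹).1.mulVec p.2) ''
      (C ×ˢ Metric.closedBall 0 1)) := by
    refine (hC.prod (isCompact_closedBall (0 : Fin m ⊕ Fin n → ℝ) 1)).image ?_
    have h1 : Continuous fun p : SLd m n × (Fin m ⊕ Fin n → ℝ) => (p.1⁻¹).1 := by
      have h2 : Continuous fun p : SLd m n × (Fin m ⊕ Fin n → ℝ) => p.1⁻¹ := continuous_fst.inv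
      have h3 : Continuous fun g : SLd m n => g.1 := continuous_subtype_val
      exact h3.comp h2
    exact h1.matrix_mulVec continuous_snd
  obtain ⟨M, hM⟩ := hcpt.isBounded.exists_norm_le
  -- If the translation by t fixes a grid with basis g ∈ C, then g⁻¹ t is integral. M bounds g⁻¹ on
  -- the unit ball, so below this radius g⁻¹ t has norm less than 1 and vanishes.
  refine ⟨1 / (|M| + 1), by positivity, fun y hy t ht => ?_⟩
  obtain ⟨g, hg, u, hu, rfl⟩ := GridSpace.exists_rep_cube (hKC hy)
  by_contra! hcon
  obtain ⟨ht0, htR⟩ := hcon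
  rw [GridSpace.smul_mk, eq_comm, GridSpace.mk_eq_mk, mem_int_iff] at ht
  obtain ⟨-, z, hz⟩ := ht
  have hz' : (fun i => (z i : ℝ)) = (g⁻¹).1.mulVec t := by
    rw [← hz]
    have e : (ofParts g (g.1.mulVec u))⁻¹ * (ASLd.trans t * ofParts g (g.1.mulVec u)) =
        ASLd.trans ((g⁻¹).1.mulVec t) := by
      rw [inv_mul_eq_iff_eq_mul, mul_trans, linearPart_ofParts, Matrix.mulVec_mulVec,
        ← Matrix.SpecialLinearGroup.coe_mul, mul_inv_cancel, Matrix.SpecialLinearGroup.coe_one,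
        Matrix.one_mulVec]
    rw [e, translationPart_trans]
  have hM0 : 0 < |M| + 1 := by positivity
  have hzlt : ‖(fun i => (z i : ℝ))‖ < 1 := by
    have hmem : (g⁻¹).1.mulVec ((|M| + 1) • t) ∈
        (fun p : SLd m n × (Fin m ⊕ Fin n → ℝ) => (p.1⁻¹).1.mulVec p.2) ''
          (C ×ˢ Metric.closedBall 0 1) := by
      refine ⟨(g, (|M| + 1) • t), ⟨hg, ?_⟩, rfl⟩
      rw [mem_closedBall_zero_iff, norm_smul, Real.norm_of_nonneg hM0.le]
      rw [lt_div_iff₀ hM0] at htR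
      linarith
    have h1 := hM _ hmem
    rw [Matrix.mulVec_smul, ← hz', norm_smul, Real.norm_of_nonneg hM0.le] at h1
    by_contra! hge
    have := le_abs_self M
    nlinarith
  have hz0 : ∀ i, z i = 0 := by
    intro i
    have h1 := (norm_le_pi_norm (fun i => (z i : ℝ)) i).trans_lt hzlt
    rw [Real.norm_eq_abs] at h1
    rw [← Int.abs_lt_one_iff]
    exact_mod_cast h1
  apply ht0
  have h2 : (g⁻¹).1.mulVec t = 0 := by
    rw [← hz']
    ext i
    simp [hz0 i]
  have h3 := congrArg g.1.mulVec h2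
  rwa [Matrix.mulVec_mulVec, ← Matrix.SpecialLinearGroup.coe_mul, mul_inv_cancel,
    Matrix.SpecialLinearGroup.coe_one, Matrix.one_mulVec, Matrix.mulVec_zero] at h3

theorem GridSpace.measurableEmbedding_coe :
    MeasurableEmbedding ((↑) : GridSpace m n → OnePoint (GridSpace m n)) :=
  OnePoint.isOpenEmbedding_coe.measurableEmbedding

/-- Fine partitions of the part of the space of grids lying over a compact set. -/
theorem exists_cells {K : Set (LatticeSpace m n)} (hK : IsCompact K)
    (μ : Measure (OnePoint (GridSpace m n))) [IsProbabilityMeasure μ]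
    {G : OnePoint (GridSpace m n) → Bool} (hGm : LabelMeasurable G) (hG : AELocallyConstant μ G)
    (hGK : ∀ y, G y = true → ∃ z : GridSpace m n, y = z ∧ gridProj z ∈ K) :
    ∃ C : ℝ, 0 < C ∧ ∀ σ : ℝ, 0 < σ → σ ≤ 1 → ∃ (J : ℕ) (cell : OnePoint (GridSpace m n) → Option (Fin J)),
      (J : ℝ) ≤ C * (1 / σ) ^ (m + n) ∧ LabelMeasurable cell ∧ AELocallyConstant μ cell ∧
      (∀ y, cell y = none ↔ G y = false) ∧
      ∀ y z : GridSpace m n, cell y = cell z → cell y ≠ none → gridProj y = gridProj z →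
        ∃ v, ‖v‖ < 2 * σ ∧ z = (trans v : ASLd m n) • y := by
  classical
  obtain ⟨C, hC, hKC⟩ := LatticeSpace.exists_compact_lift hK
  have hcpt : IsCompact ((fun p : SLd m n × (Fin m ⊕ Fin n → ℝ) => p.1.1.mulVec p.2) ''
      (C ×ˢ Set.pi univ fun _ => Icc (0 : ℝ) 1)) := by
    refine (hC.prod (isCompact_univ_pi fun _ => isCompact_Icc)).image ?_
    exact (continuous_subtype_val.comp continuous_fst).matrix_mulVec continuous_snd
  obtain ⟨M', hM'⟩ := hcpt.isBounded.exists_norm_le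
  set M : ℝ := |M'| with hMdef
  have hM0 : 0 ≤ M := abs_nonneg _
  have hvec : ∀ y : GridSpace m n, gridProj y ∈ K → ∃ v ∈ y.grid, ‖v‖ ≤ M := by
    intro y hy
    obtain ⟨g, hg, u, hu, rfl⟩ := GridSpace.exists_rep_cube (hKC hy)
    refine ⟨g.1.mulVec u, ?_, (hM' _ ⟨(g, u), ⟨hg, fun i _ => hu i⟩, rfl⟩).trans (le_abs_self _)⟩
    rw [GridSpace.grid_mk]
    refine ⟨0, ?_⟩
    simp only [act, linearPart_ofParts, translationPart_ofParts, Pi.zero_apply, Int.cast_zero]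
    rw [show (fun _ : Fin m ⊕ Fin n => (0 : ℝ)) = 0 from rfl, Matrix.mulVec_zero, zero_add]
  -- Each grid over K has a vector of norm at most M. The centres form a net of mesh σ/2 in the cube
  -- of side 2M, with at most 4M/σ + 1 ≤ (4M + 1)/σ values per coordinate.
  refine ⟨(4 * M + 1) ^ (m + n), by positivity, fun σ hσ hσ1 => ?_⟩
  set N : ℕ := ⌊4 * M / σ⌋₊ + 1 with hN
  set center : (Fin m ⊕ Fin n → Fin N) → (Fin m ⊕ Fin n → ℝ) := fun k i => -M + σ / 2 * (k i : ℕ)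
    with hcenter
  have hcov : ∀ v : Fin m ⊕ Fin n → ℝ, ‖v‖ ≤ M → ∃ k, dist (center k) v ≤ σ / 2 := by
    intro v hv
    have hvi : ∀ i, |v i| ≤ M := fun i => (norm_le_pi_norm v i).trans hv
    refine ⟨fun i => ⟨⌊(v i + M) / (σ / 2)⌋₊, ?_⟩, ?_⟩
    · rw [hN, Nat.lt_succ_iff]
      refine Nat.floor_le_floor ?_
      rw [div_le_div_iff₀ (by positivity) hσ]
      nlinarith [(abs_le.1 (hvi i)).2]
    · refine (dist_pi_le_iff (by positivity)).2 fun i => ?_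
      have h1 : 0 ≤ (v i + M) / (σ / 2) :=
        div_nonneg (by linarith [(abs_le.1 (hvi i)).1]) (by positivity)
      have h2 := Nat.floor_le h1
      have h3 := (Nat.lt_floor_add_one ((v i + M) / (σ / 2))).le
      rw [le_div_iff₀ (by positivity)] at h2
      rw [div_le_iff₀ (by positivity)] at h3
      rw [Real.dist_eq, abs_le]
      simp only [hcenter]
      constructor <;> linarith
  -- A radius above σ/2 lets the neighbourhoods of the centres cover the part over K; a radius below
  -- σ keeps the cells small; a null level makes their boundaries null.
  have hgen : ∀ k, ∃ ρ ∈ Ioo (σ / 2) σ,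
      (μ.comap (↑)) {y : GridSpace m n | Metric.infDist (center k) y.grid = ρ} = 0 := fun k =>
    have : IsFiniteMeasure (μ.comap ((↑) : GridSpace m n → OnePoint (GridSpace m n))) :=
      ⟨by
        rw [GridSpace.measurableEmbedding_coe.comap_apply]
        exact measure_lt_top _ _⟩
    exists_null_level (GridSpace.continuous_infDist_grid _).measurable (by linarith)
  choose ρ hρ hρ0 using hgen
  set near : (Fin m ⊕ Fin n → Fin N) → OnePoint (GridSpace m n) → Bool := fun k y =>
    decide (G y = true ∧ ∃ z : GridSpace m n, y = z ∧ Metric.infDist (center k) z.grid < ρ k)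
    with hnear
  have hnear_coe : ∀ k (z : GridSpace m n), near k z =
      (G z && decide (Metric.infDist (center k) z.grid < ρ k)) := by
    intro k z
    simp only [hnear, OnePoint.coe_eq_coe, exists_eq_left']
    by_cases h : G z = true <;> simp [h]
  have hnear_infty : ∀ k, near k OnePoint.infty = false := by
    intro k
    simp [hnear]
  have hGmeas : ∀ b, MeasurableSet (G ⁻¹' {b}) := hGm
  have hnear_m : ∀ k, LabelMeasurable (near k) := by
    intro k
    have htrue : MeasurableSet (near k ⁻¹' {true}) := by
      have : near k ⁻¹' {true} = G ⁻¹' {true} ∩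
          (↑) '' {z : GridSpace m n | Metric.infDist (center k) z.grid < ρ k} := by
        ext y
        simp only [hnear, mem_preimage, mem_singleton_iff, decide_eq_true_eq, mem_inter_iff,
          mem_image, mem_ofPred_eq]
        exact ⟨fun ⟨h1, z, h2, h3⟩ => ⟨h1, z, h3, h2.symm⟩, fun ⟨h1, z, h2, h3⟩ => ⟨h1, z, h3.symm, h2⟩⟩
      rw [this]
      refine (hGmeas _).inter (GridSpace.measurableEmbedding_coe.measurableSet_image.2 ?_)
      exact (isOpen_lt (GridSpace.continuous_infDist_grid _) continuous_const).measurableSet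
    intro b
    cases b with
    | true => exact htrue
    | false =>
      have : near k ⁻¹' {false} = (near k ⁻¹' {true})ᶜ := by
        ext y
        simp
      rw [this]
      exact htrue.compl
  have hnear_c : ∀ k, AELocallyConstant μ (near k) := by
    intro k
    have hnull : ∀ᵐ y ∂μ, y ∉ ((↑) : GridSpace m n → OnePoint (GridSpace m n)) ''
        {z | Metric.infDist (center k) z.grid = ρ k} := by
      have h := hρ0 k
      rw [GridSpace.measurableEmbedding_coe.comap_apply] at h
      exact measure_eq_zero_iff_ae_notMem.1 h
    filter_upwards [hG, hnull] with y h1 h2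
    induction y using OnePoint.rec with
    | infty =>
      have hGi : G OnePoint.infty = false := by
        by_contra h
        obtain ⟨z, hz, -⟩ := hGK _ (by simpa using h)
        exact OnePoint.infty_ne_coe z hz
      filter_upwards [h1] with z hz
      rw [hnear_infty]
      simp [hnear, hz, hGi]
    | coe y =>
      rw [OnePoint.nhds_coe_eq, eventually_map] at h1 ⊢
      have hne : Metric.infDist (center k) y.grid ≠ ρ k := fun h => h2 ⟨y, h, rfl⟩
      have hcont := (GridSpace.continuous_infDist_grid (m := m) (n := n) (center k)).continuousAt (x := y)
      have h3 : ∀ᶠ z : GridSpace m n in 𝓝 y, decide (Metric.infDist (center k) z.grid < ρ k) =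
          decide (Metric.infDist (center k) y.grid < ρ k) := by
        rcases lt_or_gt_of_ne hne with h | h
        · filter_upwards [hcont.eventually (gt_mem_nhds h)] with z hz
          rw [decide_eq_true hz, decide_eq_true h]
        · filter_upwards [hcont.eventually (lt_mem_nhds h)] with z hz
          rw [decide_eq_false (not_lt.2 h.le), decide_eq_false (not_lt.2 (le_of_lt hz))]
      filter_upwards [h1, h3] with z hz1 hz2
      rw [hnear_coe, hnear_coe, hz1, hz2]
  -- The cell is one centre chosen from the set of all near centres. As the choice depends only on
  -- that set, measurability and local constancy are inherited from `near`.
  set pick : ((Fin m ⊕ Fin n → Fin N) → Bool) → Option (Fin (Fintype.card (Fin m ⊕ Fin n → Fin N))) :=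
    fun v => if h : ∃ k, v k = true then some (Fintype.equivFin _ h.choose) else none with hpick
  have hpick_none : ∀ v, pick v = none ↔ ∀ k, v k = false := by
    intro v
    simp only [hpick]
    split_ifs with h
    · simp only [false_iff, not_forall]
      exact ⟨h.choose, by simp [h.choose_spec]⟩
    · simpa using h
  have hpick_some : ∀ v k, pick v = some (Fintype.equivFin _ k) → v k = true := by
    intro v k h
    simp only [hpick] at h
    split_ifs at h with h'
    have := (Fintype.equivFin _).injective (Option.some_injective _ h)
    rw [← this]
    exact h'.choose_spec
  refine ⟨_, pick ∘ fun y k => near k y, ?_, (LabelMeasurable.pi hnear_m).map pick,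
    (AELocallyConstant.pi hnear_c).map pick, ?_, ?_⟩
  · rw [Fintype.card_fun, Fintype.card_fin, Fintype.card_sum, Fintype.card_fin, Fintype.card_fin,
      Nat.cast_pow, ← mul_pow]
    refine pow_le_pow_left₀ (Nat.cast_nonneg _) ?_ _
    rw [hN]
    push_cast
    have h1 := Nat.floor_le (show 0 ≤ 4 * M / σ by positivity)
    have h2 : 1 ≤ 1 / σ := by rwa [le_div_iff₀ hσ, one_mul]
    calc _ ≤ 4 * M / σ + 1 / σ := by linarith
      _ = _ := by ring
  · intro y
    rw [Function.comp_apply, hpick_none]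
    constructor
    · intro h
      by_contra hGy
      have hGy' : G y = true := by simpa using hGy
      obtain ⟨z, rfl, hz⟩ := hGK y hGy'
      obtain ⟨v, hv, hvM⟩ := hvec z hz
      obtain ⟨k, hk⟩ := hcov v hvM
      have := h k
      rw [hnear_coe, hGy', Bool.true_and, decide_eq_false_iff_not] at this
      exact this ((Metric.infDist_le_dist_of_mem hv).trans_lt (hk.trans_lt (hρ k).1))
    · intro h k
      simp [hnear, h]
  · intro y z hyz hne hproj
    obtain ⟨j, hj⟩ := Option.ne_none_iff_exists'.1 hne
    obtain ⟨k, rfl⟩ := (Fintype.equivFin _).surjective j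
    have h1 := hpick_some _ _ hj
    have h2 := hpick_some _ _ (hyz ▸ hj)
    simp only [hnear_coe, Bool.and_eq_true, decide_eq_true_eq] at h1 h2
    obtain ⟨u, hu, hud⟩ := (Metric.infDist_lt_iff y.grid_nonempty).1 h1.2
    obtain ⟨v, hv, hvd⟩ := (Metric.infDist_lt_iff z.grid_nonempty).1 h2.2
    refine ⟨v - u, ?_, eq_trans_smul_of_gridProj_eq hproj hu hv⟩
    rw [← dist_eq_norm]
    have h3 := dist_triangle_left v u (center k)
    have h4 := (hρ k).2
    linarith

end Cells

/-! ### Entropy of the cell names of separated families. -/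

section CellEntropy

variable {m n : ℕ} (w : Weights m n)

open ASLd

namespace Weights

theorem aBar_iterate_coe (l : ℕ) (y : GridSpace m n) :
    w.aBar^[l] (y : OnePoint (GridSpace m n)) = ((w.a ^ l • y : GridSpace m n) : OnePoint _) := by
  induction l with
  | zero => simp
  | succ l ih =>
    rw [Function.iterate_succ_apply', ih, pow_succ', mul_smul]
    rfl

theorem continuous_aBar : Continuous w.aBar := w.aHomeo_eq ▸ w.aHomeo.continuous

theorem gridProj_a_pow_smul_shiftedGrid (A : Matrix (Fin m) (Fin n) ℝ) (b : Fin m → ℝ) (l : ℕ) :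
    gridProj (w.a ^ l • shiftedGrid A b) = w.flow l • latticeOf A := by
  rw [gridProj_smul, linearPart_a_pow, gridProj_shiftedGrid]

theorem gridProjBar_aBar_iterate_shiftedGrid (A : Matrix (Fin m) (Fin n) ℝ) (b : Fin m → ℝ) (l : ℕ) :
    gridProjBar (w.aBar^[l] (shiftedGrid A b : OnePoint (GridSpace m n))) =
      ((w.flow l • latticeOf A : LatticeSpace m n) : OnePoint (LatticeSpace m n)) := by
  rw [aBar_iterate_coe, ← gridProj_a_pow_smul_shiftedGrid w A b l]
  rfl

/-- Two grids of one family lying in the same small cell at a time when the lattice is in a compact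
set are displaced by a very small or by a not so small vector. -/
theorem displacement_of_same_cell {A : Matrix (Fin m) (Fin n) ℝ} {b b' : Fin m → ℝ} {l : ℕ}
    {K : Set (LatticeSpace m n)} {R τ : ℝ} (hτ : 4 * τ ≤ R) (hτ0 : 0 < τ)
    (hR : ∀ y : GridSpace m n, gridProj y ∈ K → ∀ t : Fin m ⊕ Fin n → ℝ,
      (trans t : ASLd m n) • y = y → t = 0 ∨ R ≤ ‖t‖)
    (hl : w.flow l • latticeOf A ∈ K) {v : Fin m ⊕ Fin n → ℝ} (hv : ‖v‖ < 2 * τ)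
    (h : w.a ^ l • shiftedGrid A b' = (trans v : ASLd m n) • w.a ^ l • shiftedGrid A b) :
    (∀ i, |b i - b' i| * Real.exp (w.r i * l) < 2 * τ) ∨
      ∃ i, R / 2 ≤ |b i - b' i| * Real.exp (w.r i * l) := by
  set u : Fin m ⊕ Fin n → ℝ := (w.flow l).1.mulVec (Sum.elim (b - b') 0) with hu
  have hinl : ∀ i, |u (Sum.inl i)| = |b i - b' i| * Real.exp (w.r i * l) := by
    intro i
    rw [hu, flow_mulVec_inl, abs_mul, abs_of_pos (Real.exp_pos _), mul_comm]
    rfl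
  have hinr : ∀ j, u (Sum.inr j) = 0 := by
    intro j
    rw [hu, flow_mulVec_inr]
    simp
  rw [shiftedGrid_eq_trans_smul A b b', a_pow_smul_trans, ← hu] at h
  -- Both u and v carry one grid to the other, so u - v fixes a grid over K and is zero or at least
  -- R long. In the second case u itself has norm at least R/2, attained in the first m coordinates,
  -- the others being zero.
  have h2 : (trans (u - v) : ASLd m n) • w.a ^ l • shiftedGrid A b = w.a ^ l • shiftedGrid A b := by
    rw [show u - v = -v + u by ring, ← trans_mul_trans, mul_smul, h, smul_smul, trans_mul_trans,
      neg_add_cancel, trans_zero, one_smul]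
  rcases hR _ (by rwa [gridProj_a_pow_smul_shiftedGrid]) _ h2 with h3 | h3
  · left
    intro i
    rw [← hinl, sub_eq_zero.1 h3]
    exact (norm_le_pi_norm v _).trans_lt hv
  · right
    have h4 : R / 2 ≤ ‖u‖ := by
      have := norm_sub_le u v
      linarith
    by_contra! hcon
    refine absurd h4 (not_le.2 ((pi_norm_lt_iff (by linarith)).2 ?_))
    rintro (i | j)
    · rw [Real.norm_eq_abs, hinl]
      exact hcon i
    · rw [hinr, norm_zero]
      linarith

end Weights

/-- The orbit measure of a set that does not distinguish between the orbits. -/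
theorem orbitMeasure_real_of_forall {Ω : Type*} [TopologicalSpace Ω] [MeasurableSpace Ω]
    {T : Ω → Ω} {N : ℕ} [NeZero N] {D : Type*} [Fintype D] [Nonempty D] {y : D → Ω} {U : Set Ω}
    (hU : MeasurableSet U) {p : ℕ → Prop} [DecidablePred p] (h : ∀ l d, T^[l] (y d) ∈ U ↔ p l) :
    (orbitMeasure T N y).real U = (((Finset.range N).filter p).card : ℝ) / N := by
  classical
  rw [orbitMeasure, uniformDirac_real_apply hU]
  have hS : (0 : ℝ) < Fintype.card D := Nat.cast_pos.2 Fintype.card_pos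
  have hN : (0 : ℝ) < N := Nat.cast_pos.2 (NeZero.pos N)
  have h1 : (Finset.univ.filter fun q : Fin N × D => T^[(q.1 : ℕ)] (y q.2) ∈ U) =
      (Finset.univ.filter fun i : Fin N => p i) ×ˢ (Finset.univ : Finset D) := by
    ext q
    simp only [Finset.mem_filter, Finset.mem_univ, true_and, Finset.mem_product, and_true, h]
  have h2 : (Finset.univ.filter fun i : Fin N => p i).card = ((Finset.range N).filter p).card := by
    rw [← Finset.card_image_of_injective _ Fin.val_injective]
    congr 1
    ext l
    simp only [Finset.mem_image, Finset.mem_filter, Finset.mem_univ, true_and, Finset.mem_range]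
    exact ⟨fun ⟨i, hi, e⟩ => e ▸ ⟨i.2, hi⟩, fun ⟨h1, h2⟩ => ⟨⟨l, h1⟩, h2, rfl⟩⟩
  rw [h1, Finset.card_product, Finset.card_univ, h2, Fintype.card_prod, Fintype.card_fin]
  push_cast
  field_simp

namespace Weights

/-- Few vectors of a separated family have orbits in the same cells. -/
theorem le_countEntropy_cells {A : Matrix (Fin m) (Fin n) ℝ} {N : ℕ} {S : Finset (Fin m → ℝ)}
    [Nonempty S] (hunit : ∀ b ∈ S, ∀ b' ∈ S, ∀ i, |b i - b' i| ≤ 1)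
    (hsep : ∀ b ∈ S, ∀ b' ∈ S, b ≠ b' → ∃ i, 1 ≤ |b i - b' i| * Real.exp (w.r i * N))
    {K : Set (LatticeSpace m n)} {p : ℕ → Prop} [DecidablePred p]
    (hpK : ∀ l, p l → w.flow l • latticeOf A ∈ K) {R τ : ℝ} (hτ : 24 * τ ≤ R) (hτ0 : 0 < τ)
    (hR : ∀ y : GridSpace m n, gridProj y ∈ K → ∀ t : Fin m ⊕ Fin n → ℝ,
      (trans t : ASLd m n) • y = y → t = 0 ∨ R ≤ ‖t‖)
    {J : ℕ} {P : OnePoint (GridSpace m n) → Option (Fin J)}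
    (hPp : ∀ l, p l → ∀ b, P (w.a ^ l • shiftedGrid A b : GridSpace m n) ≠ none)
    (hPcell : ∀ y z : GridSpace m n, P y = P z → P y ≠ none → gridProj y = gridProj z →
        ∃ v, ‖v‖ < 2 * τ ∧ z = (trans v : ASLd m n) • y) :
    Real.log S.card -
      (Real.log ((1 / (R / 2) + 2) ^ m * ((2 * τ + 1) ^ m * Real.exp 1)) +
        ((Finset.range N).filter fun l => ¬ p l).card) ≤
      countEntropy (iteratedJoin w.aBar P N ∘
        fun b : S => (shiftedGrid A b.1 : OnePoint (GridSpace m n))) := by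
  classical
  have hR0 : 0 < R := by linarith
  set C : ℝ := (1 / (R / 2) + 2) ^ m * ((2 * τ + 1) ^ m * Real.exp 1) with hC
  have hC0 : 0 < C := by positivity
  have h1 := le_countEntropy (iteratedJoin w.aBar P N ∘
      fun b : S => (shiftedGrid A b.1 : OnePoint (GridSpace m n)))
    (K := C * Real.exp ((Finset.range N).filter fun l => ¬ p l).card) (by
    intro i
    set F : Finset (Fin m → ℝ) := (Finset.univ.filter fun b : S =>
      (iteratedJoin w.aBar P N ∘
        fun b : S => (shiftedGrid A b.1 : OnePoint (GridSpace m n))) b = i).image Subtype.val with hF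
    have hFS : F ⊆ S := by
      intro b hb
      obtain ⟨b', -, rfl⟩ := Finset.mem_image.1 hb
      exact b'.2
    have hFP : ∀ b ∈ F, ∀ l, ∀ hl : l < N,
        P (w.a ^ l • shiftedGrid A b : GridSpace m n) = i ⟨l, hl⟩ := by
      intro b hb l hl
      obtain ⟨b', hb', rfl⟩ := Finset.mem_image.1 hb
      rw [← aBar_iterate_coe]
      exact congrFun (Finset.mem_filter.1 hb').2 ⟨l, hl⟩
    -- With these constants the requirement 6 κ ≤ R of the counting lemma reads 24 τ ≤ R.
    have hcardF := card_le_of_good_times w.r_pos w.r_sum (κ := 2 * τ) (R := R / 2) (by linarith)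
      (by linarith) (by linarith) p N F
      (fun b hb b' hb' => hunit b (hFS hb) b' (hFS hb'))
      (fun b hb b' hb' => hsep b (hFS hb) b' (hFS hb')) (by
        intro l hl hGl b hb b' hb'
        obtain ⟨v, hv, hvz⟩ := hPcell _ _ ((hFP b hb l hl).trans (hFP b' hb' l hl).symm)
          (hPp l hGl b) (by rw [gridProj_a_pow_smul_shiftedGrid, gridProj_a_pow_smul_shiftedGrid])
        exact w.displacement_of_same_cell (by linarith) hτ0 hR (hpK l hGl) hv hvz)
    rwa [hF, Finset.card_image_of_injective _ Subtype.val_injective] at hcardF)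
  rwa [Real.log_mul hC0.ne' (Real.exp_pos _).ne', Real.log_exp, Fintype.card_coe] at h1

/-- Entropy of fine cells for limits of orbit measures of large separated families. -/
theorem le_finCondEntropy_cells {A : Matrix (Fin m) (Fin n) ℝ} {L : Filter ℕ} [L.NeBot]
    {N : ℕ → ℕ} [∀ j, NeZero (N j)] (hN : Tendsto N L atTop) {S : ℕ → Finset (Fin m → ℝ)}
    [∀ j, Nonempty (S j)] (hunit : ∀ j, ∀ b ∈ S j, ∀ b' ∈ S j, ∀ i, |b i - b' i| ≤ 1)
    (hsep : ∀ j, ∀ b ∈ S j, ∀ b' ∈ S j, b ≠ b' → ∃ i, 1 ≤ |b i - b' i| * Real.exp (w.r i * N j))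
    {c : ℝ} (hcard : ∀ c' < c, ∀ᶠ j in L, N j * c' ≤ Real.log (S j).card)
    {μ : ProbabilityMeasure (OnePoint (GridSpace m n))}
    (hμ : Tendsto (fun j => orbitProbability w.aBar (N j)
      fun b : S j => (shiftedGrid A b.1 : OnePoint (GridSpace m n))) L (𝓝 μ))
    {K : Set (LatticeSpace m n)} {G : OnePoint (LatticeSpace m n) → Bool}
    (hGm : LabelMeasurable (G ∘ gridProjBar (m := m) (n := n)))
    (hGc : AELocallyConstant (μ : Measure _) (G ∘ gridProjBar (m := m) (n := n)))
    (hGK : ∀ x : LatticeSpace m n, G x = true → x ∈ K) {R τ : ℝ} (hτ : 24 * τ ≤ R) (hτ0 : 0 < τ)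
    (hR : ∀ y : GridSpace m n, gridProj y ∈ K → ∀ t : Fin m ⊕ Fin n → ℝ,
      (trans t : ASLd m n) • y = y → t = 0 ∨ R ≤ ‖t‖)
    {J : ℕ} {P : OnePoint (GridSpace m n) → Option (Fin J)} (hPm : LabelMeasurable P)
    (hPc : AELocallyConstant (μ : Measure _) P)
    (hPnone : ∀ y, P y = none ↔ G (gridProjBar y) = false)
    (hPcell : ∀ y z : GridSpace m n, P y = P z → P y ≠ none → gridProj y = gridProj z →
        ∃ v, ‖v‖ < 2 * τ ∧ z = (trans v : ASLd m n) • y)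
    {κ : Type*} [Fintype κ] {β : OnePoint (LatticeSpace m n) → κ}
    (hβ : LabelMeasurable (β ∘ gridProjBar (m := m) (n := n)))
    (hβc : AELocallyConstant (μ : Measure _) (β ∘ gridProjBar (m := m) (n := n))) (q : ℕ) :
    q * (c - (μ : Measure _).real ((G ∘ gridProjBar (m := m) (n := n)) ⁻¹' {false})) ≤
      finCondEntropy (μ : Measure _) (iteratedJoin w.aBar P q) (β ∘ gridProjBar) := by
  classical
  have hGx : ∀ l (b : Fin m → ℝ), w.aBar^[l] (shiftedGrid A b : OnePoint (GridSpace m n)) ∈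
      (G ∘ gridProjBar (m := m) (n := n)) ⁻¹' {false} ↔
      ¬ G (w.flow l • latticeOf A : LatticeSpace m n) = true := by
    intro l b
    rw [mem_preimage, mem_singleton_iff, Function.comp_apply, gridProjBar_aBar_iterate_shiftedGrid,
      Bool.not_eq_true]
  -- The bad times depend only on the orbit of x_A and so are common to the whole family; their
  -- frequency tends to the mass of {G = false}.
  set bad : ℕ → ℕ := fun j => ((Finset.range (N j)).filter fun l : ℕ =>
    ¬ G (w.flow l • latticeOf A : LatticeSpace m n) = true).card with hbad
  have hbadlim : Tendsto (fun j => (bad j : ℝ) / N j) L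
      (𝓝 ((μ : Measure _).real ((G ∘ gridProjBar (m := m) (n := n)) ⁻¹' {false}))) := by
    refine (tendsto_measureReal_label hμ hGc false).congr fun j => ?_
    have h := orbitMeasure_real_of_forall (T := w.aBar) (N := N j)
      (y := fun b : S j => (shiftedGrid A b.1 : OnePoint (GridSpace m n))) (hGm false)
      (p := fun l : ℕ => ¬ G (w.flow l • latticeOf A : LatticeSpace m n) = true)
      fun l d => hGx l d.1
    exact h
  have hcount := fun j => w.le_countEntropy_cells (hunit j) (hsep j)
    (p := fun l => G (w.flow l • latticeOf A : LatticeSpace m n) = true) (fun l hl => hGK _ hl)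
    hτ hτ0 hR (P := P) (by
      intro l hl b
      rw [Ne, hPnone, ← aBar_iterate_coe, gridProjBar_aBar_iterate_shiftedGrid, hl]
      decide) hPcell
  refine le_finCondEntropy_of_tendsto_orbitMeasure w.continuous_aBar hN hμ hPm hPc hβ hβc ?_ ?_ q
  · intro j l d d'
    simp only [Function.comp_apply, gridProjBar_aBar_iterate_shiftedGrid]
  intro c' hc'
  obtain ⟨c'', h1, h2⟩ := exists_between (show c' + (μ : Measure _).real
    ((G ∘ gridProjBar (m := m) (n := n)) ⁻¹' {false}) < c by linarith)
  have hlim := hbadlim.add (tendsto_const_nhds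
    (x := Real.log ((1 / (R / 2) + 2) ^ m * ((2 * τ + 1) ^ m * Real.exp 1))).div_atTop
    (tendsto_natCast_atTop_atTop.comp hN))
  filter_upwards [hcard c'' h2, hlim.eventually_lt_const (show _ < c'' - c' by linarith)] with j h3 h4
  have hNj : (0 : ℝ) < N j := Nat.cast_pos.2 (NeZero.pos (N j))
  rw [Function.comp_apply, ← add_div, div_lt_iff₀ hNj] at h4
  have := hcount j
  linarith

end Weights

end CellEntropy

/-! ### Return times and refining labels of small entropy. -/

section ReturnTimes

variable {Ω : Type*} {T T' : Ω → Ω} {G : Ω → Bool}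

/-- The points of the set described by `G` that first return to it at time `L`. -/
def returnSet (T : Ω → Ω) (G : Ω → Bool) (L : ℕ) : Set Ω :=
  {y | 0 < L ∧ G y = true ∧ G (T^[L] y) = true ∧ ∀ i, 0 < i → i < L → G (T^[i] y) = false}

theorem returnSet_unique {L L' : ℕ} {y : Ω} (h : y ∈ returnSet T G L) (h' : y ∈ returnSet T G L') :
    L = L' := by
  obtain ⟨h1, h2, h3, h4⟩ := h
  obtain ⟨h1', h2', h3', h4'⟩ := h'
  rcases lt_trichotomy L L' with h | h | h
  · simp [h4' L h1 h] at h3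
  · exact h
  · simp [h4 L' h1' h] at h3'

open Classical in
/-- The label recording the first return time, if it exceeds `L₀` and is at most `R`, together with
a label depending on the return time. -/
noncomputable def returnLabel {κ : ℕ → Type*} (T : Ω → Ω) (G : Ω → Bool) (cell : ∀ L, Ω → κ L)
    (L₀ R : ℕ) (y : Ω) : Option (Σ L : Fin (R + 1), κ L) :=
  if h : ∃ L : Fin (R + 1), L₀ < (L : ℕ) ∧ y ∈ returnSet T G L then
    some ⟨h.choose, cell h.choose y⟩ else none

variable {κ : ℕ → Type*} {cell : ∀ L, Ω → κ L} {L₀ R : ℕ}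

theorem returnLabel_eq_some {y : Ω} {L : Fin (R + 1)} {c : κ L} :
    returnLabel T G cell L₀ R y = some ⟨L, c⟩ ↔
      L₀ < (L : ℕ) ∧ y ∈ returnSet T G L ∧ cell L y = c := by
  unfold returnLabel
  split_ifs with h
  · have hs := h.choose_spec
    constructor
    · intro e
      have e1 := Option.some_injective _ e
      obtain ⟨e2, e3⟩ := Sigma.mk.inj_iff.1 e1
      subst e2
      exact ⟨hs.1, hs.2, eq_of_heq e3⟩
    · rintro ⟨h1, h2, rfl⟩
      have : h.choose = L := Fin.ext (returnSet_unique hs.2 h2)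
      rw [this]
  · simp only [false_iff]
    rintro ⟨h1, h2, -⟩
    exact h ⟨L, h1, h2⟩

theorem returnLabel_eq_none {y : Ω} : returnLabel T G cell L₀ R y = none ↔
    ∀ L : Fin (R + 1), L₀ < (L : ℕ) → y ∉ returnSet T G L := by
  unfold returnLabel
  split_ifs with h
  · simp only [false_iff, not_forall, not_not]
    obtain ⟨L, h1, h2⟩ := h
    exact ⟨L, h1, h2⟩
  · simp only [true_iff]
    intro L h1 h2
    exact h ⟨L, h1, h2⟩

theorem cell_eq_of_returnLabel_eq {y z : Ω}
    (h : returnLabel T G cell L₀ R y = returnLabel T G cell L₀ R z) {L : ℕ} (hL : L₀ < L) (hR : L ≤ R)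
    (hy : y ∈ returnSet T G L) : z ∈ returnSet T G L ∧ cell L y = cell L z := by
  have h1 : returnLabel T G cell L₀ R y = some ⟨⟨L, Nat.lt_succ_of_le hR⟩, cell L y⟩ :=
    returnLabel_eq_some.2 ⟨hL, hy, rfl⟩
  rw [h1, eq_comm, returnLabel_eq_some] at h
  exact ⟨h.2.1, h.2.2.symm⟩

theorem returnLabel_factorsThrough {R' : ℕ} (h : R ≤ R') :
    Function.FactorsThrough (returnLabel T G cell L₀ R) (returnLabel T G cell L₀ R') := by
  intro y z e
  cases hy : returnLabel T G cell L₀ R y with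
  | none =>
    rw [eq_comm, returnLabel_eq_none]
    intro L hL hz
    have := cell_eq_of_returnLabel_eq e.symm hL (by omega) hz
    exact returnLabel_eq_none.1 hy L hL this.1
  | some p =>
    obtain ⟨L, c⟩ := p
    obtain ⟨h1, h2, h3⟩ := returnLabel_eq_some.1 hy
    obtain ⟨h4, h5⟩ := cell_eq_of_returnLabel_eq e h1 (by omega) h2
    exact (returnLabel_eq_some.2 ⟨h1, h4, h5 ▸ h3⟩).symm

variable [MeasurableSpace Ω]

theorem measurableSet_returnSet (hT : Measurable T) (hG : LabelMeasurable G) (L : ℕ) :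
    MeasurableSet (returnSet T G L) := by
  have h : returnSet T G L = {_y : Ω | 0 < L} ∩ (G ⁻¹' {true} ∩ ((G ∘ T^[L]) ⁻¹' {true} ∩
      ⋂ (i : ℕ) (_ : 0 < i) (_ : i < L), (G ∘ T^[i]) ⁻¹' {false})) := by
    ext y
    simp [returnSet]
  rw [h]
  refine (MeasurableSet.const _).inter ((hG _).inter (((hG.comp (hT.iterate L)) _).inter ?_))
  exact MeasurableSet.iInter fun i => MeasurableSet.iInter fun _ => MeasurableSet.iInter fun _ =>
    hG.comp (hT.iterate i) _

theorem LabelMeasurable.returnLabel (hT : Measurable T) (hG : LabelMeasurable G)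
    (hcell : ∀ L, LabelMeasurable (cell L)) : LabelMeasurable (_root_.returnLabel T G cell L₀ R) := by
  intro o
  cases o with
  | none =>
    have h : _root_.returnLabel T G cell L₀ R ⁻¹' {none} =
        ⋂ (L : Fin (R + 1)) (_ : L₀ < (L : ℕ)), (returnSet T G L)ᶜ := by
      ext y
      simp only [mem_preimage, mem_singleton_iff, returnLabel_eq_none, mem_iInter, mem_compl_iff]
    rw [h]
    exact MeasurableSet.iInter fun L => MeasurableSet.iInter fun _ =>
      (measurableSet_returnSet hT hG L).compl
  | some p =>
    obtain ⟨L, c⟩ := p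
    have h : _root_.returnLabel T G cell L₀ R ⁻¹' {some ⟨L, c⟩} =
        {_y : Ω | L₀ < (L : ℕ)} ∩ (returnSet T G L ∩ cell L ⁻¹' {c}) := by
      ext y
      simp only [mem_preimage, mem_singleton_iff, returnLabel_eq_some, mem_inter_iff, mem_ofPred_eq]
    rw [h]
    exact (MeasurableSet.const _).inter ((measurableSet_returnSet hT hG L).inter (hcell L c))

variable {μ : Measure Ω} [IsProbabilityMeasure μ]

/-- Kac's inequality for first return times. -/
theorem sum_mul_measureReal_returnSet_le (hT : Measurable T) (hG : LabelMeasurable G)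
    (hT' : MeasurePreserving T' μ μ)
    (hinv' : Function.RightInverse T' T) (s : Finset ℕ) :
    ∑ L ∈ s, (L : ℝ) * μ.real (returnSet T G L) ≤ 1 := by
  -- Tower over the set {G = true}: the i-th images of the points with return time L, for i < L, are
  -- pairwise disjoint and have the measure of the base level.
  set A : (Σ _ : ℕ, ℕ) → Set Ω := fun p => T'^[p.2] ⁻¹' returnSet T G p.1 with hA
  have hmeas : ∀ p, MeasurableSet (A p) := fun p =>
    (hT'.measurable.iterate p.2) (measurableSet_returnSet hT hG p.1)
  have hshift : ∀ (y : Ω) (i j : ℕ), i ≤ j → T^[j - i] (T'^[j] y) = T'^[i] y := by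
    intro y i j hij
    have : T'^[j] y = T'^[j - i] (T'^[i] y) := by
      rw [← Function.iterate_add_apply, Nat.sub_add_cancel hij]
    rw [this]
    exact (hinv'.iterate (j - i)) _
  have key : ∀ (y : Ω) (L L' i j : ℕ), i < j → j < L' → T'^[i] y ∈ returnSet T G L →
      T'^[j] y ∈ returnSet T G L' → False := by
    intro y L L' i j hij hj h1 h2
    have := h2.2.2.2 (j - i) (by omega) (by omega)
    rw [hshift y i j hij.le, h1.2.1] at this
    exact absurd this (by decide)
  have hdisj : Set.PairwiseDisjoint (↑(s.sigma fun L => Finset.range L)) A := by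
    rintro ⟨L, i⟩ hp ⟨L', j⟩ hq hne
    simp only [Finset.coe_sigma, Set.mem_sigma_iff, Finset.mem_coe, Finset.mem_range] at hp hq
    refine Set.disjoint_left.2 fun y hy1 hy2 => hne ?_
    have h1 : T'^[i] y ∈ returnSet T G L := hy1
    have h2 : T'^[j] y ∈ returnSet T G L' := hy2
    rcases lt_trichotomy i j with h | h | h
    · exact (key y L L' i j h hq.2 h1 h2).elim
    · subst h
      rw [returnSet_unique h1 h2]
    · exact (key y L' L j i h hp.2 h2 h1).elim
  have h1 := measureReal_biUnion_finset (μ := μ) hdisj fun p _ => hmeas p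
  have h2 : ∑ p ∈ s.sigma fun L => Finset.range L, μ.real (A p) =
      ∑ L ∈ s, (L : ℝ) * μ.real (returnSet T G L) := by
    rw [Finset.sum_sigma]
    refine Finset.sum_congr rfl fun L _ => ?_
    have : ∀ i ∈ Finset.range L, μ.real (A ⟨L, i⟩) = μ.real (returnSet T G L) := fun i _ =>
      (hT'.iterate i).measureReal_preimage (measurableSet_returnSet hT hG L).nullMeasurableSet
    rw [Finset.sum_congr rfl this, Finset.sum_const, Finset.card_range, nsmul_eq_mul]
  rw [← h2, ← h1]
  exact measureReal_le_one

/-- By concavity, among vectors of given total mass the uniform one has the largest entropy. -/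
theorem sum_negMulLog_le {ι : Type*} [Fintype ι] {q : ι → ℝ} (hq : ∀ i, 0 ≤ q i) :
    ∑ i, Real.negMulLog (q i) ≤
      Real.negMulLog (∑ i, q i) + (∑ i, q i) * Real.log (Fintype.card ι) := by
  set p := ∑ i, q i with hp
  rcases (Finset.sum_nonneg fun i _ => hq i : 0 ≤ ∑ i, q i).eq_or_lt with h0 | h0
  · have hz : ∀ i, q i = 0 := fun i =>
      (Finset.sum_eq_zero_iff_of_nonneg fun i _ => hq i).1 h0.symm i (Finset.mem_univ i)
    have hp0 : p = 0 := h0.symm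
    simp [hz, hp0]
  · have hne : Nonempty ι := by
      by_contra h
      rw [not_nonempty_iff] at h
      simp at h0
    have hN : (0 : ℝ) < Fintype.card ι := Nat.cast_pos.2 Fintype.card_pos
    have hpt : ∀ i, Real.negMulLog (q i) ≤
        -(q i * Real.log (p / Fintype.card ι)) + (p / Fintype.card ι - q i) := by
      intro i
      rcases (hq i).eq_or_lt with h | h
      · rw [← h, Real.negMulLog_zero, zero_mul, neg_zero, zero_add, sub_zero]
        positivity
      · have h1 := Real.log_le_sub_one_of_pos (show 0 < p / Fintype.card ι / q i by positivity)
        rw [Real.log_div (by positivity) h.ne'] at h1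
        have h2 := mul_le_mul_of_nonneg_left h1 h.le
        have h3 : q i * (p / Fintype.card ι / q i - 1) = p / Fintype.card ι - q i := by
          field_simp
        rw [h3] at h2
        rw [Real.negMulLog]
        linarith
    refine (Finset.sum_le_sum fun i _ => hpt i).trans_eq ?_
    rw [Finset.sum_add_distrib, Finset.sum_neg_distrib, ← Finset.sum_mul, Finset.sum_sub_distrib,
      ← hp, Finset.sum_const, Finset.card_univ, nsmul_eq_mul, mul_div_cancel₀ _ hN.ne',
      Real.log_div h0.ne' hN.ne', Real.negMulLog]
    ring

/-- Kac's inequality controls the sum of L p_L but not that of -p_L log p_L. With t = L the excess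
is the summable error e^(-L), also when p_L is tiny. -/
theorem negMulLog_le_mul_add_exp {p : ℝ} (hp : 0 ≤ p) (t : ℝ) :
    Real.negMulLog p ≤ p * t + Real.exp (-t) := by
  rcases hp.eq_or_lt with h | h
  · rw [← h, Real.negMulLog_zero, zero_mul, zero_add]
    exact (Real.exp_pos _).le
  · have h1 := Real.log_le_sub_one_of_pos (show 0 < Real.exp (-t) / p by positivity)
    rw [Real.log_div (Real.exp_pos _).ne' h.ne', Real.log_exp] at h1
    have h2 := mul_le_mul_of_nonneg_left h1 h.le
    have h3 : p * (Real.exp (-t) / p - 1) = Real.exp (-t) - p := by field_simp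
    rw [h3] at h2
    rw [Real.negMulLog]
    linarith

/-- Recording a return time L of probability p_L costs at most L p_L + e^(-L), and choosing among
the e^(C + D L) cells costs (C + D L) p_L. The absent label costs at most the total mass of the
others, because -x log x ≤ 1 - x; this is the extra summand 1. -/
theorem finEntropy_returnLabel_le [∀ L, Fintype (κ L)] (hT : Measurable T) (hG : LabelMeasurable G)
    (hcell : ∀ L, LabelMeasurable (cell L)) {C D : ℝ}
    (hcard : ∀ L, Real.log (Fintype.card (κ L)) ≤ C + D * L) (L₀ R : ℕ) :
    finEntropy μ (returnLabel T G cell L₀ R) ≤ ∑ L ∈ Finset.Ioc L₀ R,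
      ((1 + C + (D + 1) * L) * μ.real (returnSet T G L) + Real.exp (-L)) := by
  have hE : LabelMeasurable (returnLabel T G cell L₀ R) := LabelMeasurable.returnLabel hT hG hcell
  set p : ℕ → ℝ := fun L => μ.real (returnSet T G L) with hp
  have hp0 : ∀ L, 0 ≤ p L := fun L => measureReal_nonneg
  set q : ∀ L : Fin (R + 1), κ L → ℝ := fun L c =>
    μ.real (returnLabel T G cell L₀ R ⁻¹' {some ⟨L, c⟩}) with hq
  have hq0 : ∀ L c, 0 ≤ q L c := fun L c => measureReal_nonneg
  have hqsum : ∀ L : Fin (R + 1), ∑ c, q L c = if L₀ < (L : ℕ) then p L else 0 := by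
    intro L
    split_ifs with h
    · have h1 := sum_measureReal_inter_label (μ := μ) (hcell L) (measurableSet_returnSet hT hG L)
      change _ = μ.real (returnSet T G L)
      rw [← h1]
      refine Finset.sum_congr rfl fun c _ => ?_
      change μ.real (returnLabel T G cell L₀ R ⁻¹' {some ⟨L, c⟩}) = _
      congr 1
      ext y
      simp only [mem_preimage, mem_singleton_iff, returnLabel_eq_some, mem_inter_iff, h, true_and]
    · refine Finset.sum_eq_zero fun c _ => ?_
      have : returnLabel T G cell L₀ R ⁻¹' {some ⟨L, c⟩} = ∅ := by
        ext y
        simp [returnLabel_eq_some, h]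
      rw [hq]
      simp only [this, measureReal_empty]
  have hsum : ∀ f : ℕ → ℝ, ∑ L : Fin (R + 1), (if L₀ < (L : ℕ) then f L else 0) =
      ∑ L ∈ Finset.Ioc L₀ R, f L := by
    intro f
    rw [Fin.sum_univ_eq_sum_range (fun L => if L₀ < L then f L else 0) (R + 1), ← Finset.sum_filter]
    congr 1
    ext L
    simp only [Finset.mem_filter, Finset.mem_range, Finset.mem_Ioc]
    omega
  have htot := sum_measureReal_label (μ := μ) hE
  rw [Fintype.sum_option, Fintype.sum_sigma] at htot
  have htot' : μ.real (returnLabel T G cell L₀ R ⁻¹' {none}) + ∑ L ∈ Finset.Ioc L₀ R, p L = 1 := by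
    rw [← htot, ← hsum p]
    congr 1
    exact Finset.sum_congr rfl fun L _ => (hqsum L).symm
  rw [finEntropy, Fintype.sum_option, Fintype.sum_sigma]
  have hnone : Real.negMulLog (μ.real (returnLabel T G cell L₀ R ⁻¹' {none})) ≤
      ∑ L ∈ Finset.Ioc L₀ R, p L := by
    have h1 : ∀ x : ℝ, 0 ≤ x → Real.negMulLog x ≤ 1 - x := by
      intro x hx
      rcases hx.eq_or_lt with h | h
      · rw [← h]
        simp
      · have h1 := Real.log_le_sub_one_of_pos (inv_pos.2 h)
        rw [Real.log_inv] at h1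
        have h2 := mul_le_mul_of_nonneg_left h1 h.le
        rw [mul_sub, mul_inv_cancel₀ h.ne', mul_one] at h2
        rw [Real.negMulLog]
        linarith
    refine (h1 _ measureReal_nonneg).trans ?_
    linarith
  have hsome : ∀ L : Fin (R + 1), ∑ c, Real.negMulLog (q L c) ≤
      if L₀ < (L : ℕ) then (C + (D + 1) * (L : ℕ)) * p L + Real.exp (-(L : ℕ)) else 0 := by
    intro L
    have h1 := sum_negMulLog_le (hq0 L)
    rw [hqsum L] at h1
    split_ifs with h
    · rw [if_pos h] at h1
      have h2 := negMulLog_le_mul_add_exp (hp0 L) (L : ℕ)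
      have h3 := mul_le_mul_of_nonneg_left (hcard L) (hp0 L)
      linarith
    · rw [if_neg h] at h1
      simpa using h1
  have hfin := add_le_add hnone (Finset.sum_le_sum fun L (_ : L ∈ Finset.univ) => hsome L)
  rw [hsum fun L => (C + (D + 1) * L) * p L + Real.exp (-L), ← Finset.sum_add_distrib] at hfin
  refine hfin.trans_eq (Finset.sum_congr rfl fun L _ => ?_)
  ring

/-- Return labels with long return times have small entropy. -/
theorem exists_finEntropy_returnLabel_le [∀ L, Fintype (κ L)] (hT : Measurable T)
    (hG : LabelMeasurable G) (hT' : MeasurePreserving T' μ μ)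
    (hinv' : Function.RightInverse T' T) (hcell : ∀ L, LabelMeasurable (cell L)) {C D : ℝ}
    (hC : 0 ≤ C) (hcard : ∀ L, Real.log (Fintype.card (κ L)) ≤ C + D * L) {δ : ℝ}
    (hδ : 0 < δ) : ∃ L₀, ∀ R, finEntropy μ (returnLabel T G cell L₀ R) ≤ δ := by
  have h1 : Summable fun L : ℕ => (L : ℝ) * μ.real (returnSet T G L) :=
    summable_of_sum_le (fun L => mul_nonneg (Nat.cast_nonneg _) measureReal_nonneg)
      (sum_mul_measureReal_returnSet_le hT hG hT' hinv')
  have h2 : Summable fun L : ℕ => Real.exp (-(L : ℝ)) := Real.summable_exp_neg_nat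
  have h3 := (h1.mul_left (1 + C + (D + 1))).add h2
  obtain ⟨s, hs⟩ := summable_iff_vanishing_norm.1 h3 δ hδ
  -- The series converges by Kac's inequality, and every L above this threshold lies outside the
  -- finite set s, so only a tail of the series occurs.
  refine ⟨s.sup id, fun R => (finEntropy_returnLabel_le hT hG hcell hcard _ R).trans ?_⟩
  have hdisj : Disjoint (Finset.Ioc (s.sup id) R) s := by
    rw [Finset.disjoint_left]
    intro L hL hLs
    have := Finset.le_sup (f := id) hLs
    simp only [Finset.mem_Ioc, id] at hL this
    omega
  refine le_trans (Finset.sum_le_sum fun L hL => ?_) ((le_abs_self _).trans (hs _ hdisj).le)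
  have hL1 : (1 : ℝ) ≤ L := by
    have := (Finset.mem_Ioc.1 hL).1
    exact_mod_cast Nat.one_le_of_lt this
  have hp := measureReal_nonneg (μ := μ) (s := returnSet T G L)
  have h4 : (1 + C + (D + 1) * L) ≤ (1 + C + (D + 1)) * L := by nlinarith
  have h5 := mul_le_mul_of_nonneg_right h4 hp
  linarith

end ReturnTimes

/-! ### Grids with close backward orbits lie on one orbit of W. -/

section Saturation

variable {m n : ℕ} (w : Weights m n)

open ASLd

namespace Weights

theorem r_le_one (i : Fin m) : w.r i ≤ 1 :=
  w.r_sum ▸ Finset.single_le_sum (fun j _ => (w.r_pos j).le) (Finset.mem_univ i)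

theorem norm_flow_mulVec_le {t : ℝ} (ht : 0 ≤ t) (v : Fin m ⊕ Fin n → ℝ) :
    ‖(w.flow t).1.mulVec v‖ ≤ Real.exp t * ‖v‖ := by
  refine (pi_norm_le_iff_of_nonneg (by positivity)).2 ?_
  rintro (i | j)
  · rw [flow_mulVec_inl, norm_mul, Real.norm_of_nonneg (Real.exp_pos _).le]
    refine mul_le_mul (Real.exp_le_exp.2 ?_) (norm_le_pi_norm v _) (norm_nonneg _) (Real.exp_pos _).le
    nlinarith [w.r_le_one i]
  · rw [flow_mulVec_inr, norm_mul, Real.norm_of_nonneg (Real.exp_pos _).le]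
    refine mul_le_mul (Real.exp_le_exp.2 ?_) (norm_le_pi_norm v _) (norm_nonneg _) (Real.exp_pos _).le
    nlinarith [w.s_pos j]

theorem flow_mulVec_add (s t : ℝ) (v : Fin m ⊕ Fin n → ℝ) :
    (w.flow (s + t)).1.mulVec v = (w.flow s).1.mulVec ((w.flow t).1.mulVec v) := by
  rw [flow_add, Matrix.SpecialLinearGroup.coe_mul, Matrix.mulVec_mulVec]

theorem a_pow_smul_inv_smul {i l : ℕ} (h : l ≤ i) (y : GridSpace m n) :
    w.a ^ l • (w.a ^ i)⁻¹ • y = (w.a ^ (i - l))⁻¹ • y := by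
  rw [smul_smul]
  congr 1
  rw [← Nat.sub_add_cancel h, pow_add, mul_inv_rev, mul_inv_cancel_left, Nat.add_sub_cancel]

/-- Grids over the same lattice whose backward orbits are close whenever the lattice is in a compact
set differ by an expanded translation. -/
theorem exists_eq_wElem_smul {y z : GridSpace m n} {good : ℕ → Prop}
    (hinf : ∀ M, ∃ i > M, good i) {K : Set (LatticeSpace m n)} {R τ : ℝ} (hτ : 4 * τ ≤ R)
    (hR : ∀ y : GridSpace m n, gridProj y ∈ K → ∀ t : Fin m ⊕ Fin n → ℝ,
      (trans t : ASLd m n) • y = y → t = 0 ∨ R ≤ ‖t‖)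
    (hK : ∀ i, good i → gridProj ((w.a ^ i)⁻¹ • y) ∈ K)
    (hv : ∀ i, 0 < i → good i → ∃ v, ‖v‖ < 2 * τ ∧
      (∀ l, 0 < l → l < i → good (i - l) → (∀ k, 0 < k → k < l → ¬ good (i - k)) →
        ‖v‖ < 2 * τ * Real.exp (-l)) ∧
      (w.a ^ i)⁻¹ • z = (trans v : ASLd m n) • (w.a ^ i)⁻¹ • y) :
    ∃ b : Fin m → ℝ, z = (wElem b : ASLd m n) • y := by
  classical
  choose! v hv1 hv2 hv3 using hv
  -- The flow moves forward from backward time i to the next good time i - l. The bound 2τ e^(-l)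
  -- pays for the expansion on the way, so a^l v_i and v_(i - l) are both shorter than 2τ ≤ R/2.
  -- They differ by a translation fixing a grid over K, hence coincide.
  have step : ∀ i l, 0 < l → l < i → good i → good (i - l) →
      (∀ k, 0 < k → k < l → ¬ good (i - k)) → v (i - l) = (w.flow l).1.mulVec (v i) := by
    intro i l hl hli hi hil hk
    have h1 : ‖(w.flow l).1.mulVec (v i)‖ < 2 * τ := by
      refine (w.norm_flow_mulVec_le (Nat.cast_nonneg l) _).trans_lt ?_
      have := mul_lt_mul_of_pos_left (hv2 i (by omega) hi l hl hli hil hk) (Real.exp_pos (l : ℝ))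
      rwa [mul_comm (2 * τ), ← mul_assoc, ← Real.exp_add, add_neg_cancel, Real.exp_zero,
        one_mul] at this
    have h2 := hv1 (i - l) (by omega) hil
    have e1 := congrArg (fun x => w.a ^ l • x) (hv3 i (by omega) hi)
    simp only [a_pow_smul_trans, w.a_pow_smul_inv_smul hli.le] at e1
    have e2 := hv3 (i - l) (by omega) hil
    rw [e1] at e2
    have e3 : (trans (v (i - l) - (w.flow l).1.mulVec (v i)) : ASLd m n) • (w.a ^ (i - l))⁻¹ • y =
        (w.a ^ (i - l))⁻¹ • y := by
      rw [show v (i - l) - (w.flow l).1.mulVec (v i) = -(w.flow l).1.mulVec (v i) + v (i - l) by ring,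
        ← trans_mul_trans, mul_smul, ← e2, smul_smul, trans_mul_trans, neg_add_cancel, trans_zero,
        one_smul]
    rcases hR _ (hK _ hil) _ e3 with h | h
    · exact sub_eq_zero.1 h
    · have := norm_sub_le (v (i - l)) ((w.flow l).1.mulVec (v i))
      linarith
  have main : ∀ i, 0 < i → good i → ∀ k, 0 < k → good (i + k) →
      v i = (w.flow k).1.mulVec (v (i + k)) := by
    intro i hi0 hi k
    induction k using Nat.strong_induction_on with
    | _ k ih =>
      intro hk hik
      have hex : ∃ l, 0 < l ∧ good (i + k - l) := ⟨k, hk, by rwa [Nat.add_sub_cancel]⟩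
      obtain ⟨hl0, hlg⟩ := Nat.find_spec hex
      have hlk : Nat.find hex ≤ k := Nat.find_min' hex ⟨hk, by rwa [Nat.add_sub_cancel]⟩
      set l := Nat.find hex with hl
      have hs := step (i + k) l hl0 (by omega) hik hlg
        fun j hj0 hj hg => Nat.find_min hex hj ⟨hj0, hg⟩
      rcases hlk.eq_or_lt with h | h
      · rw [show i + k - l = i by omega] at hs
        rw [hs, h]
      · have e : i + k - l = i + (k - l) := by omega
        rw [e] at hs hlg
        rw [ih (k - l) (by omega) (by omega) hlg, hs, ← flow_mulVec_add]
        congr 3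
        rw [← Nat.cast_add, Nat.sub_add_cancel hlk]
  obtain ⟨i, hi0, hi⟩ := hinf 0
  -- These coordinates of v_i are those of the bounded vector v_(i + k) contracted by e^(-s_j k),
  -- for arbitrarily large k.
  have hstable : ∀ j, v i (Sum.inr j) = 0 := by
    intro j
    by_contra hne
    have hlim : Tendsto (fun k : ℕ => Real.exp (-(w.s j * k)) * (2 * τ)) atTop (𝓝 (0 * (2 * τ))) := by
      refine Tendsto.mul_const _ (Real.tendsto_exp_neg_atTop_nhds_zero.comp ?_)
      exact tendsto_natCast_atTop_atTop.const_mul_atTop (w.s_pos j)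
    rw [zero_mul] at hlim
    obtain ⟨M, hM⟩ := eventually_atTop.1 (hlim.eventually_lt_const (abs_pos.2 hne))
    obtain ⟨i', hi', hg⟩ := hinf (i + M)
    obtain ⟨k, rfl⟩ := Nat.exists_eq_add_of_le (show i ≤ i' by omega)
    have h1 := main i hi0 hi k (by omega) hg
    have h2 := hM k (by omega)
    have h3 : |v i (Sum.inr j)| ≤ Real.exp (-(w.s j * k)) * (2 * τ) := by
      rw [h1, flow_mulVec_inr, abs_mul, abs_of_pos (Real.exp_pos _)]
      refine mul_le_mul_of_nonneg_left ?_ (Real.exp_pos _).le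
      exact (norm_le_pi_norm (v (i + k)) (Sum.inr j)).trans (hv1 _ (by omega) hg).le
    linarith
  refine ⟨fun k => (w.flow i).1.mulVec (v i) (Sum.inl k), ?_⟩
  have e1 := congrArg (fun x => w.a ^ i • x) (hv3 i hi0 hi)
  simp only [a_pow_smul_trans, smul_inv_smul] at e1
  rw [e1, wElem_eq_trans]
  congr 2
  ext k
  rcases k with k | j
  · rfl
  · rw [flow_mulVec_inr, hstable, mul_zero]
    rfl

end Weights

end Saturation

/-! ### Almost invariance of tail sets under W. -/

section TailSets

variable {m n : ℕ} (w : Weights m n)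

open ASLd

theorem continuous_wElem_smul :
    Continuous fun p : GridSpace m n × (Fin m → ℝ) => (wElem p.2 : ASLd m n) • p.1 := by
  have h1 : Continuous fun c : Fin m → ℝ => (Sum.elim c 0 : Fin m ⊕ Fin n → ℝ) := by
    refine continuous_pi ?_
    rintro (i | j)
    · exact continuous_apply i
    · exact continuous_const
  exact ((continuous_trans.comp h1).comp continuous_snd).smul continuous_fst

theorem wElem_smul_wElem_smul (b c : Fin m → ℝ) (y : GridSpace m n) :
    (wElem b : ASLd m n) • (wElem c : ASLd m n) • y = (wElem (b + c) : ASLd m n) • y := by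
  rw [smul_smul, wElem_eq_trans, wElem_eq_trans, trans_mul_trans, wElem_eq_trans]
  congr 2
  ext i
  rcases i with i | j <;> simp

theorem mem_iff_of_measurableSet_generateFrom {Ω : Type*} {b : Set (Set Ω)} {y z : Ω}
    (h : ∀ s ∈ b, (y ∈ s ↔ z ∈ s)) {s : Set Ω}
    (hs : MeasurableSet[MeasurableSpace.generateFrom b] s) : y ∈ s ↔ z ∈ s := by
  induction s, hs using MeasurableSpace.generateFrom_induction with
  | hC s hs _ => exact h s hs
  | empty => simp
  | compl s _ ih => exact not_congr ih
  | iUnion f _ ih => simp only [mem_iUnion, ih]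

namespace Weights

theorem a_pow_smul_wElem_smul (k : ℕ) (b : Fin m → ℝ) (y : GridSpace m n) :
    w.a ^ k • (wElem b : ASLd m n) • y =
      (wElem fun i => Real.exp (w.r i * k) * b i : ASLd m n) • w.a ^ k • y := by
  rw [wElem_eq_trans, a_pow_smul_trans, wElem_eq_trans]
  congr 2
  ext i
  rcases i with i | j
  · rw [flow_mulVec_inl]
    rfl
  · rw [flow_mulVec_inr]
    simp

theorem quasiMeasurePreserving_contract (k : ℕ) :
    Measure.QuasiMeasurePreserving (fun (c : Fin m → ℝ) i => Real.exp (-(w.r i * k)) * c i)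
      volume volume := by
  classical
  refine ⟨by fun_prop, fun s hs => ?_⟩
  have hdet : (Matrix.diagonal fun i : Fin m => Real.exp (-(w.r i * k))).det ≠ 0 := by
    rw [Matrix.det_diagonal]
    exact Finset.prod_ne_zero_iff.2 fun i _ => (Real.exp_pos _).ne'
  have h := Real.smul_map_diagonal_volume_pi hdet
  have e : (Matrix.toLin' (Matrix.diagonal fun i : Fin m => Real.exp (-(w.r i * k))) :
      (Fin m → ℝ) → Fin m → ℝ) = fun c i => Real.exp (-(w.r i * k)) * c i := by
    ext c i
    simp [Matrix.mulVec_diagonal]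
  rw [e] at h
  rw [← h, Measure.smul_apply, smul_eq_mul, mul_eq_zero] at hs
  refine hs.resolve_left ?_
  rw [ENNReal.ofReal_eq_zero, not_le]
  exact abs_pos.2 hdet

/-- Sets that are saturated for all expansions of a family of sets adapted to the orbits do not
separate almost every point from almost every point of its orbit. -/
theorem ae_ae_mem_iff_of_saturated {μ : Measure (GridSpace m n)} [IsProbabilityMeasure μ]
    (hinv : MeasurePreserving (fun y => w.a • y) μ μ) {b : Set (Set (GridSpace m n))}
    (hb : b.Countable) (hb' : ∀ s ∈ b, MeasurableSet s)
    (hsub : ∀ᵐ y ∂μ, ∃ δ : ℝ, 0 < δ ∧ ∀ c : Fin m → ℝ, ‖c‖ < δ →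
      ∀ s ∈ b, (y ∈ s ↔ (wElem c : ASLd m n) • y ∈ s)) {R : Set (GridSpace m n)}
    (hR : ∀ l : ℕ, ∃ R', (fun y => (w.a ^ (l + 1))⁻¹ • y) ⁻¹' R' = R ∧
      ∀ y z, (∀ s ∈ b, (y ∈ s ↔ z ∈ s)) → (y ∈ R' ↔ z ∈ R')) :
    ∀ᵐ y ∂μ, ∀ᵐ c : Fin m → ℝ, (y ∈ R ↔ (wElem c : ASLd m n) • y ∈ R) := by
  set agree : GridSpace m n → GridSpace m n → Prop := fun y z => ∀ s ∈ b, (y ∈ s ↔ z ∈ s) with hagree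
  -- Points with a uniform radius of agreement. Asking for almost every c, rather than every c, in
  -- the ball makes D k measurable by Fubini.
  set D : ℕ → Set (GridSpace m n) := fun k =>
    {y | ∀ᵐ c ∂(volume.restrict (Metric.ball (0 : Fin m → ℝ) (1 / ((k : ℝ) + 1)))),
      agree y ((wElem c : ASLd m n) • y)} with hD
  have hDm : ∀ k, MeasurableSet (D k) := by
    intro k
    have hE : MeasurableSet {p : GridSpace m n × (Fin m → ℝ) |
        agree p.1 ((wElem p.2 : ASLd m n) • p.1)} := by
      have : {p : GridSpace m n × (Fin m → ℝ) | agree p.1 ((wElem p.2 : ASLd m n) • p.1)} =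
          ⋂ s ∈ b, ((Prod.fst ⁻¹' s ∩
            (fun p : GridSpace m n × (Fin m → ℝ) => (wElem p.2 : ASLd m n) • p.1) ⁻¹' s) ∪
            ((Prod.fst ⁻¹' s)ᶜ ∩
            ((fun p : GridSpace m n × (Fin m → ℝ) => (wElem p.2 : ASLd m n) • p.1) ⁻¹' s)ᶜ)) := by
        ext p
        simp only [hagree, mem_ofPred_eq, mem_iInter, mem_union, mem_inter_iff, mem_preimage,
          mem_compl_iff, iff_iff_and_or_not_and_not]
      rw [this]
      refine MeasurableSet.biInter hb fun s hs => ?_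
      have h1 : MeasurableSet (Prod.fst ⁻¹' s : Set (GridSpace m n × (Fin m → ℝ))) :=
        measurable_fst (hb' s hs)
      have h2 := continuous_wElem_smul.measurable (hb' s hs)
      exact (h1.inter h2).union (h1.compl.inter h2.compl)
    have h := measurable_measure_prodMk_left
      (ν := volume.restrict (Metric.ball (0 : Fin m → ℝ) (1 / ((k : ℝ) + 1)))) hE.compl
    exact h (measurableSet_singleton 0)
  have h1 : ∀ᵐ y ∂μ, ∃ k, y ∈ D k := by
    filter_upwards [hsub] with y hy
    obtain ⟨δ, hδ, hball⟩ := hy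
    obtain ⟨k, hk⟩ := exists_nat_one_div_lt hδ
    refine ⟨k, (ae_restrict_iff' measurableSet_ball).2 (Eventually.of_forall fun c hc => ?_)⟩
    rw [mem_ball_zero_iff] at hc
    exact hball c (hc.trans hk)
  have hinv' : MeasurePreserving (fun y => w.a⁻¹ • y) μ μ := by
    refine MeasurePreserving.symm (MeasurableEquiv.smul w.a) ?_
    exact hinv
  -- Poincaré recurrence for a⁻¹.
  have h2 : ∀ k, ∀ᵐ y ∂μ, y ∈ D k → ∃ᶠ l in atTop, (fun y => w.a⁻¹ • y)^[l] y ∈ D k := fun k =>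
    hinv'.conservative.ae_mem_imp_frequently_image_mem (hDm k).nullMeasurableSet
  filter_upwards [h1, ae_all_iff.2 h2] with y hy1 hy2
  obtain ⟨k, hk⟩ := hy1
  have hfreq := hy2 k hk
  simp only [smul_iterate, inv_pow] at hfreq
  -- Membership of y in R is membership of a^(-l) y in R'. Pulled back by a^l, the translation by c
  -- becomes the contracted one, which lies in the ball of radius 1/(k + 1) for large l.
  have hstep : ∀ l : ℕ, 0 < l → (w.a ^ l)⁻¹ • y ∈ D k → ∀ᵐ c : Fin m → ℝ,
      (fun i => Real.exp (-(w.r i * l)) * c i) ∈ Metric.ball (0 : Fin m → ℝ) (1 / ((k : ℝ) + 1)) →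
        (y ∈ R ↔ (wElem c : ASLd m n) • y ∈ R) := by
    intro l hl hlD
    have h3 := (w.quasiMeasurePreserving_contract l).ae
      ((ae_restrict_iff' measurableSet_ball).1 hlD)
    obtain ⟨l, rfl⟩ := Nat.exists_eq_succ_of_ne_zero hl.ne'
    obtain ⟨R', rfl, hR'⟩ := hR l
    filter_upwards [h3] with c hc hball
    have h4 := hR' _ _ (hc hball)
    rw [mem_preimage, mem_preimage]
    have e : (w.a ^ (l + 1))⁻¹ • (wElem c : ASLd m n) • y =
        (wElem fun i => Real.exp (-(w.r i * (l.succ : ℕ))) * c i : ASLd m n) •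
          (w.a ^ (l + 1))⁻¹ • y := by
      rw [inv_smul_eq_iff, a_pow_smul_wElem_smul, smul_inv_smul]
      congr 2
      ext i
      rw [← mul_assoc, ← Real.exp_add, add_neg_cancel, Real.exp_zero, one_mul]
    rw [e]
    exact h4
  have hall : ∀ᵐ c : Fin m → ℝ, ∀ l : ℕ, 0 < l → (w.a ^ l)⁻¹ • y ∈ D k →
      (fun i => Real.exp (-(w.r i * l)) * c i) ∈ Metric.ball (0 : Fin m → ℝ) (1 / ((k : ℝ) + 1)) →
        (y ∈ R ↔ (wElem c : ASLd m n) • y ∈ R) := by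
    refine ae_all_iff.2 fun l => ?_
    by_cases h : 0 < l ∧ (w.a ^ l)⁻¹ • y ∈ D k
    · filter_upwards [hstep l h.1 h.2] with c hc _ _
      exact hc
    · exact Eventually.of_forall fun c h3 h4 => absurd ⟨h3, h4⟩ h
  filter_upwards [hall] with c hc
  have hlim : Tendsto (fun l : ℕ => fun i => Real.exp (-(w.r i * l)) * c i) atTop (𝓝 0) := by
    refine tendsto_pi_nhds.2 fun i => ?_
    have := (Real.tendsto_exp_neg_atTop_nhds_zero.comp
      (tendsto_natCast_atTop_atTop.const_mul_atTop (w.r_pos i))).mul_const (c i)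
    simpa using this
  have hev := hlim.eventually (Metric.ball_mem_nhds 0 (show (0 : ℝ) < 1 / ((k : ℝ) + 1) by positivity))
  obtain ⟨l, hl1, hl2, hl3⟩ := (hfreq.and_eventually (hev.and (eventually_gt_atTop 0))).exists
  exact hc l hl3 hl1 hl2

/-- Tail sets do not separate almost every point from almost every point of its orbit. -/
theorem ae_ae_mem_iff_of_tail {μ : Measure (GridSpace m n)} [IsProbabilityMeasure μ]
    (hinv : MeasurePreserving (fun y => w.a • y) μ μ) {𝒜 : MeasurableSpace (GridSpace m n)}
    (h𝒜 : w.IsDescendingSubordinate μ 𝒜) {R : Set (GridSpace m n)}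
    (hR : MeasurableSet[w.tailAlgebra 𝒜] R) :
    ∀ᵐ y ∂μ, ∀ᵐ c : Fin m → ℝ, (y ∈ R ↔ (wElem c : ASLd m n) • y ∈ R) := by
  obtain ⟨b, hb, hgen⟩ := h𝒜.countablyGenerated.isCountablyGenerated
  have hbm : ∀ s ∈ b, MeasurableSet[𝒜] s := fun s hs => by
    rw [hgen]
    exact MeasurableSpace.measurableSet_generateFrom hs
  refine w.ae_ae_mem_iff_of_saturated hinv hb (fun s hs => h𝒜.le_borel s (hbm s hs)) ?_ fun l => ?_
  · filter_upwards [h𝒜.subordinate] with y hy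
    obtain ⟨δ, hδ, hball, -⟩ := hy
    refine ⟨δ, hδ, fun c hc s hs => ?_⟩
    constructor
    · exact fun h => @mem_of_mem_measurableAtom _ 𝒜 _ _ (hball c hc) s (hbm s hs) h
    · intro h
      by_contra hn
      exact @mem_of_mem_measurableAtom _ 𝒜 _ _ (hball c hc) sᶜ
        (@MeasurableSet.compl _ _ 𝒜 (hbm s hs)) hn h
  · obtain ⟨R', hR', h⟩ := (MeasurableSpace.measurableSet_iInf.1 hR) l
    refine ⟨R', h, ?_⟩
    intro y z hyz
    rw [hgen] at hR'
    exact mem_iff_of_measurableSet_generateFrom hyz hR'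

/-- Lebesgue measure is translation invariant, so almost every c leads both points to one common
third point of the orbit with which each of them agrees. -/
theorem mem_iff_of_ae_mem_iff {R : Set (GridSpace m n)} {y : GridSpace m n} {b : Fin m → ℝ}
    (h1 : ∀ᵐ c : Fin m → ℝ, (y ∈ R ↔ (wElem c : ASLd m n) • y ∈ R))
    (h2 : ∀ᵐ c : Fin m → ℝ, ((wElem b : ASLd m n) • y ∈ R ↔
      (wElem c : ASLd m n) • (wElem b : ASLd m n) • y ∈ R)) :
    y ∈ R ↔ (wElem b : ASLd m n) • y ∈ R := by
  have h3 := (measurePreserving_add_right volume b).quasiMeasurePreserving.ae h1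
  obtain ⟨c, hc1, hc2⟩ := (h2.and h3).exists
  rw [hc2, hc1, wElem_smul_wElem_smul]

end Weights

end TailSets

/-! ### Separation by analytic sets. -/

section Separation

variable {Ω : Type*} [MeasurableSpace Ω] [StandardBorelSpace Ω]

/-- Measurable sets not meeting the same atoms of a countably generated algebra are separated by a
set of that algebra. -/
theorem exists_measurableSet_separating {κ : ℕ → Type*} [∀ j, Fintype (κ j)] {γ : ∀ j, Ω → κ j}
    (hγ : ∀ j, LabelMeasurable (γ j)) {S₁ S₂ : Set Ω} (h₁ : MeasurableSet S₁) (h₂ : MeasurableSet S₂)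
    (h : ∀ x ∈ S₁, ∀ y ∈ S₂, ∃ j, γ j x ≠ γ j y) :
    ∃ B, MeasurableSet[⨆ j, MeasurableSpace.comap (γ j) ⊤] B ∧ S₁ ⊆ B ∧ Disjoint B S₂ := by
  classical
  -- All the labels together map Ω to a sequence space. The images of S₁ and S₂ are disjoint
  -- analytic sets, and Lusin's theorem separates them by a Borel set, whose preimage lies in the
  -- algebra of the labels.
  set Φ : Ω → ℕ → ℕ := fun x j => (Fintype.equivFin (κ j) (γ j x) : ℕ) with hΦ
  have hΦm : Measurable[⨆ j, MeasurableSpace.comap (γ j) ⊤] Φ := by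
    refine @measurable_pi_lambda _ _ _ (⨆ j, MeasurableSpace.comap (γ j) ⊤) _ _ fun j => ?_
    have h1 : Measurable[MeasurableSpace.comap (γ j) ⊤] fun x => Φ x j :=
      fun s _ => ⟨(fun c => (Fintype.equivFin (κ j) c : ℕ)) ⁻¹' s, trivial, rfl⟩
    exact h1.mono (le_iSup (fun j => MeasurableSpace.comap (γ j) ⊤) j) le_rfl
  have hle : (⨆ j, MeasurableSpace.comap (γ j) ⊤) ≤ ‹MeasurableSpace Ω› := by
    refine iSup_le fun j => ?_
    rintro _ ⟨s, -, rfl⟩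
    exact (hγ j).preimage s
  have hΦm' : Measurable Φ := hΦm.mono hle le_rfl
  have hdisj : Disjoint (Φ '' S₁) (Φ '' S₂) := by
    rw [Set.disjoint_left]
    rintro _ ⟨x, hx, rfl⟩ ⟨y, hy, hxy⟩
    obtain ⟨j, hj⟩ := h x hx y hy
    have := congrFun hxy j
    simp only [hΦ] at this
    exact hj ((Fintype.equivFin (κ j)).injective (Fin.ext this)).symm
  obtain ⟨u, hu1, hu2, hu⟩ := (h₁.analyticSet_image hΦm').measurablySeparable
    (h₂.analyticSet_image hΦm') hdisj
  refine ⟨Φ ⁻¹' u, hΦm hu, fun x hx => hu1 ⟨x, hx, rfl⟩, ?_⟩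
  rw [Set.disjoint_left]
  intro x hx1 hx2
  exact Set.disjoint_left.1 hu2 ⟨x, hx2, rfl⟩ hx1

end Separation

/-! ### Dynamical entropy bounded below by a finite partition. -/

section DynamicalEntropy

variable {Ω : Type*} [𝒜₀ : MeasurableSpace Ω] {μ : Measure Ω}

/-- Entropy depends only on the atoms; this allows a partition with arbitrary finite labels to be
used in `dynEntropy`, where labels are natural numbers. -/
theorem condEntropy_comp_injective {ι κ : Type*} (ξ : Ω → ι) {e : ι → κ} (he : Function.Injective e)
    (𝒜 : MeasurableSpace Ω) : condEntropy (𝒜₀ := 𝒜₀) μ (e ∘ ξ) 𝒜 = condEntropy (𝒜₀ := 𝒜₀) μ ξ 𝒜 := by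
  unfold condEntropy
  have h : ∀ x, (e ∘ ξ) ⁻¹' {(e ∘ ξ) x} = ξ ⁻¹' {ξ x} := by
    intro x
    ext y
    simp [he.eq_iff]
  simp only [h]

theorem staticEntropy_lt_top [IsProbabilityMeasure μ] {ι : Type*} [Fintype ι] (ξ : Ω → ι) :
    staticEntropy (𝒜₀ := 𝒜₀) μ ξ < ⊤ := by
  unfold staticEntropy condEntropy
  set f : ι → ℝ≥0∞ := fun i => ENNReal.ofReal
    (-Real.log (∫ x, (ξ ⁻¹' {i}).indicator (fun _ => (1 : ℝ)) x ∂μ)) with hf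
  have h : ∀ x, ENNReal.ofReal
      (-Real.log (condExp ⊥ μ ((ξ ⁻¹' {ξ x}).indicator (fun _ => (1 : ℝ))) x)) ≤ ∑ i, f i := by
    intro x
    rw [condExp_bot]
    exact Finset.single_le_sum (f := f) (fun _ _ => zero_le) (Finset.mem_univ (ξ x))
  refine (lintegral_mono h).trans_lt ?_
  rw [lintegral_const, measure_univ, mul_one]
  exact ENNReal.sum_lt_top.2 fun i _ => ENNReal.ofReal_lt_top

theorem LabelMeasurable.measurable_comp {ι κ : Type*} [Countable κ] [MeasurableSpace κ]
    [MeasurableSingletonClass κ] [Fintype ι] {P : Ω → ι} (hP : LabelMeasurable P) (e : ι → κ) :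
    Measurable (e ∘ P) := by
  refine measurable_to_countable' fun k => ?_
  rw [preimage_comp]
  exact hP.preimage _

theorem le_partitionEntropy {ι κ : Type*} {T : Ω → Ω} {P : Ω → ι} {e : ι → κ}
    (hinj : Function.Injective e) (𝒜 : MeasurableSpace Ω) {c : ℝ}
    (h : ∀ N : ℕ, ENNReal.ofReal (N * c) ≤ condEntropy (𝒜₀ := 𝒜₀) μ (iteratedJoin T P N) 𝒜) :
    ENNReal.ofReal c ≤ partitionEntropy (𝒜₀ := 𝒜₀) μ T (e ∘ P) 𝒜 := by
  refine le_iInf fun N => ?_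
  have e1 : iteratedJoin T (e ∘ P) (N + 1) = (fun c i => e (c i)) ∘ iteratedJoin T P (N + 1) := rfl
  have hinj' : Function.Injective fun (c : Fin (N + 1) → ι) i => e (c i) :=
    fun a b hab => funext fun i => hinj (congrFun hab i)
  have e2 := condEntropy_comp_injective (𝒜₀ := 𝒜₀) (μ := μ) (iteratedJoin T P (N + 1)) hinj' 𝒜
  rw [e1, e2]
  rw [ENNReal.le_div_iff_mul_le (Or.inl (by simp)) (Or.inl (by simp)), mul_comm,
    ← ENNReal.ofReal_natCast, ← ENNReal.ofReal_mul (Nat.cast_nonneg _)]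
  exact h (N + 1)

/-- Lower bounds for the conditional entropies of the iterated joins of a finite partition bound the
dynamical entropy. -/
theorem le_dynEntropy_of_finite [IsProbabilityMeasure μ] {ι : Type*} [Fintype ι] {T : Ω → Ω}
    {P : Ω → ι} (hP : LabelMeasurable P) : ∀ (𝒜 : MeasurableSpace Ω) {c : ℝ}
    (_ : ∀ N : ℕ, ENNReal.ofReal (N * c) ≤ condEntropy (𝒜₀ := 𝒜₀) μ (iteratedJoin T P N) 𝒜),
    ENNReal.ofReal c ≤ dynEntropy (𝒜₀ := 𝒜₀) μ T 𝒜 := by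
  classical
  set e : ι → ℕ := fun i => (Fintype.equivFin ι i : ℕ) with he
  have hinj : Function.Injective e := fun i j h => (Fintype.equivFin ι).injective (Fin.ext h)
  have hm : Measurable (e ∘ P) := hP.measurable_comp e
  have hs : staticEntropy μ (e ∘ P) < ⊤ := by
    rw [staticEntropy, condEntropy_comp_injective _ hinj]
    exact staticEntropy_lt_top P
  exact fun 𝒜 c h => (le_partitionEntropy (𝒜₀ := 𝒜₀) hinj 𝒜 h).trans
    (le_iSup₂_of_le (e ∘ P) hm (le_iSup_of_le hs le_rfl))

end DynamicalEntropy

/-! ### Entropy given a refined past. -/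

section PastAlgebra

variable {Ω : Type*} [MeasurableSpace Ω]

/-- The finite labels generating the past of two labels, the second of which is refined with time,
and a countable family of labels. -/
def pastLabel {ι : Type*} {κ : ℕ → Type*} {l : Type*} (T' : Ω → Ω) (P : Ω → ι) (E : ∀ j, Ω → κ j)
    (β : ℕ → Ω → l) (j : ℕ) : Ω → (Fin j → ι × κ j) × (Fin j → l) :=
  pairLabel (pastJoin T' (pairLabel P (E j)) j) fun y i => β i y

variable {ι : Type*} {κ : ℕ → Type*} {l : Type*} {T T' : Ω → Ω} {P : Ω → ι} {E : ∀ j, Ω → κ j}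
  {β : ℕ → Ω → l}

theorem pastLabel_eq_iff {j : ℕ} {x y : Ω} :
    pastLabel T' P E β j x = pastLabel T' P E β j y ↔
      (∀ i < j, P (T'^[i + 1] x) = P (T'^[i + 1] y) ∧ E j (T'^[i + 1] x) = E j (T'^[i + 1] y)) ∧
      ∀ i < j, β i x = β i y := by
  rw [pastLabel, pairLabel, pairLabel, Prod.mk.injEq, pastJoin_eq_iff]
  refine and_congr ?_ ?_
  · simp only [pairLabel, Prod.mk.injEq]
  · rw [funext_iff]
    exact ⟨fun h i hi => h ⟨i, hi⟩, fun h i => h i i.2⟩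

theorem pastLabel_mono (hE : ∀ j j', j ≤ j' → Function.FactorsThrough (E j) (E j')) {j j' : ℕ}
    (h : j ≤ j') : Function.FactorsThrough (pastLabel T' P E β j) (pastLabel T' P E β j') := by
  intro x y e
  rw [pastLabel_eq_iff] at e ⊢
  exact ⟨fun i hi => ⟨(e.1 i (by omega)).1, hE j j' h (e.1 i (by omega)).2⟩,
    fun i hi => e.2 i (by omega)⟩

theorem LabelMeasurable.pastLabel (hT' : Measurable T') (hP : LabelMeasurable P)
    (hE : ∀ j, LabelMeasurable (E j)) (hβ : ∀ j, LabelMeasurable (β j)) (j : ℕ) :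
    LabelMeasurable (_root_.pastLabel T' P E β j) :=
  ((hP.pair (hE j)).pastJoin hT' j).pair (LabelMeasurable.pi fun i => hβ i)

/-- Entropy of a label given the past, when the past is refined by labels of small entropy. -/
theorem le_finCondEntropy_pastLabel {μ : Measure Ω} [IsProbabilityMeasure μ] [Fintype ι]
    [∀ j, Fintype (κ j)] [Fintype l] (hT : MeasurePreserving T μ μ) (hT' : Measurable T')
    (hinv : Function.LeftInverse T' T) (hP : LabelMeasurable P) (hE : ∀ j, LabelMeasurable (E j))
    (hβ : ∀ j, LabelMeasurable (β j)) {c δ : ℝ} (hEδ : ∀ j, finEntropy μ (E j) ≤ δ)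
    (hc : ∀ j n : ℕ, n * c ≤ finCondEntropy μ (iteratedJoin T P n)
      (iteratedJoin T (fun y (i : Fin j) => β i y) n)) (N j : ℕ) :
    N * (c - δ) ≤ finCondEntropy μ (iteratedJoin T P N) (pastLabel T' P E β j) := by
  have hβj : LabelMeasurable fun y (i : Fin j) => β i y := LabelMeasurable.pi fun i => hβ i
  have hQ := hP.pair (hE j)
  -- The bound is applied to the joint label P ∨ E j, whose past is the one in the conditioning.
  -- Dropping E j from the N coming symbols afterwards costs at most N δ.
  have h1 := le_finCondEntropy_past hT hT' hinv hQ hβj (c := c) (fun n => (hc j n).trans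
    (finCondEntropy_mono (hβj.iteratedJoin hT.measurable n) (hQ.iteratedJoin hT.measurable n)
      (iteratedJoin_factorsThrough_of_factorsThrough fun x y e => congrArg Prod.fst e))) N j
  have hpast := LabelMeasurable.pastLabel hT' hP hE hβ j
  have hPN := hP.iteratedJoin hT.measurable N
  have hEN := (hE j).iteratedJoin hT.measurable N
  have h2 : finCondEntropy μ (iteratedJoin T (pairLabel P (E j)) N) (pastLabel T' P E β j) ≤
      finCondEntropy μ (pairLabel (iteratedJoin T P N) (iteratedJoin T (E j) N))
        (pastLabel T' P E β j) := by
    refine finCondEntropy_mono hpast (hPN.pair hEN) fun x y e => ?_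
    obtain ⟨e1, e2⟩ := Prod.ext_iff.1 e
    exact iteratedJoin_eq_iff.2 fun i hi =>
      Prod.ext (iteratedJoin_eq_iff.1 e1 i hi) (iteratedJoin_eq_iff.1 e2 i hi)
  have h3 := finCondEntropy_pair_le (μ := μ) hPN hEN hpast
  have h4 := finCondEntropy_le_finEntropy (μ := μ) hEN hpast
  have h5 := finEntropy_iteratedJoin_le hT (hE j) N
  have h6 := mul_le_mul_of_nonneg_left (hEδ j) (Nat.cast_nonneg (α := ℝ) N)
  have h1' : N * c ≤ finCondEntropy μ (iteratedJoin T (pairLabel P (E j)) N)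
      (pastLabel T' P E β j) := h1
  linarith

end PastAlgebra

/-! ### The tail algebra inside the algebra of the labels. -/

section TailApproximation

variable {m n : ℕ} (w : Weights m n)

open ASLd

instance : PolishSpace (OnePoint (GridSpace m n)) := by
  let _ := TopologicalSpace.metrizableSpaceMetric (OnePoint (GridSpace m n))
  infer_instance

theorem extendAlgebra_le_map {Z : Type*} (𝒜 : MeasurableSpace Z) :
    extendAlgebra 𝒜 ≤ 𝒜.map ((↑) : Z → OnePoint Z) := by
  refine MeasurableSpace.generateFrom_le ?_
  rintro S (⟨R, hR, rfl⟩ | rfl)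
  · change MeasurableSet[𝒜] (((↑) : Z → OnePoint Z) ⁻¹' (((↑) : Z → OnePoint Z) '' R))
    rwa [preimage_image_eq _ OnePoint.coe_injective]
  · change MeasurableSet[𝒜] (((↑) : Z → OnePoint Z) ⁻¹' {OnePoint.infty})
    rw [show ((↑) : Z → OnePoint Z) ⁻¹' {OnePoint.infty} = ∅ by ext; simp]
    exact MeasurableSet.empty

theorem extendAlgebra_le_borel {𝒜 : MeasurableSpace (GridSpace m n)}
    (h : 𝒜 ≤ borel (GridSpace m n)) :
    extendAlgebra 𝒜 ≤ OnePoint.instMeasurableSpaceBorel (GridSpace m n) := by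
  refine MeasurableSpace.generateFrom_le ?_
  rintro S (⟨R, hR, rfl⟩ | rfl)
  · exact GridSpace.measurableEmbedding_coe.measurableSet_image.2 (h _ hR)
  · exact measurableSet_singleton _

theorem Weights.tailAlgebra_le_borel {𝒜 : MeasurableSpace (GridSpace m n)}
    (h : 𝒜 ≤ borel (GridSpace m n)) : w.tailAlgebra 𝒜 ≤ borel (GridSpace m n) := by
  refine (iInf_le _ 0).trans ?_
  rintro S ⟨R, hR, rfl⟩
  exact (measurable_const_smul (w.a ^ (0 + 1))⁻¹) (h _ hR)

theorem exists_measurableSet_null_of_ae {Ω : Type*} {_ : MeasurableSpace Ω} {μ : Measure Ω}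
    {p : Ω → Prop} (h : ∀ᵐ y ∂μ, p y) : ∃ N, MeasurableSet N ∧ μ N = 0 ∧ ∀ y ∉ N, p y := by
  obtain ⟨N, hNsub, hNm, hN0⟩ := exists_measurable_superset_of_null (ae_iff.1 h)
  exact ⟨N, hNm, hN0, fun y hy => not_not.1 fun h => hy (hNsub h)⟩

/-- On a set of points which are determined up to `W` by finite labels, the tail algebra is
contained in the algebra of the labels modulo null sets. -/
theorem Weights.exists_ae_eq_of_tail {μbar : Measure (OnePoint (GridSpace m n))}
    {μ : Measure (GridSpace m n)} [IsProbabilityMeasure μ]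
    (hinv : MeasurePreserving (fun y => w.a • y) μ μ)
    (hnull : ∀ N : Set (GridSpace m n), MeasurableSet N → μ N = 0 →
      μbar (((↑) : GridSpace m n → OnePoint (GridSpace m n)) '' N) = 0)
    {𝒜 : MeasurableSpace (GridSpace m n)} (h𝒜 : w.IsDescendingSubordinate μ 𝒜)
    {κ : ℕ → Type*} [∀ j, Fintype (κ j)] {γ : ∀ j, OnePoint (GridSpace m n) → κ j}
    (hγ : ∀ j, LabelMeasurable (γ j)) {Z : Set (OnePoint (GridSpace m n))}
    (hZ : MeasurableSet[⨆ j, MeasurableSpace.comap (γ j) ⊤] Z) (hZm : MeasurableSet Z)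
    (hZinf : OnePoint.infty ∉ Z)
    (hsep : ∀ y z : GridSpace m n, (y : OnePoint (GridSpace m n)) ∈ Z →
      (∀ j, γ j y = γ j z) → ∃ b : Fin m → ℝ, z = (wElem b : ASLd m n) • y)
    {S : Set (OnePoint (GridSpace m n))}
    (hS : MeasurableSet[extendAlgebra (w.tailAlgebra 𝒜)] S) :
    ∃ B, MeasurableSet[⨆ j, MeasurableSpace.comap (γ j) ⊤] B ∧
      (S ∩ Z : Set (OnePoint (GridSpace m n))) =ᵐ[μbar] B := by
  have hSm : MeasurableSet S :=
    extendAlgebra_le_borel (w.tailAlgebra_le_borel h𝒜.le_borel) _ hS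
  have hR := extendAlgebra_le_map _ _ hS
  have hae := w.ae_ae_mem_iff_of_tail hinv h𝒜 hR
  obtain ⟨N, hNm, hN0, hNsub⟩ := exists_measurableSet_null_of_ae hae
  set N' : Set (OnePoint (GridSpace m n)) := (↑) '' N with hN'
  have hN'm : MeasurableSet N' := GridSpace.measurableEmbedding_coe.measurableSet_image.2 hNm
  -- Two points of Z with equal labels lie on one W-orbit, and off the null set N' a tail set
  -- contains both or neither; so the labels separate S ∩ Z from Z \ S.
  obtain ⟨B, hB, hB1, hB2⟩ := exists_measurableSet_separating hγ (S₁ := (S ∩ Z) \ N')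
    (S₂ := (Z \ S) \ N') ((hSm.inter hZm).diff hN'm) ((hZm.diff hSm).diff hN'm) (by
      rintro x ⟨⟨hxS, hxZ⟩, hxN⟩ y ⟨⟨hyZ, hyS⟩, hyN⟩
      by_contra! hcon
      induction x using OnePoint.rec with
      | infty => exact hZinf hxZ
      | coe x =>
        induction y using OnePoint.rec with
        | infty => exact hZinf hyZ
        | coe y =>
          obtain ⟨b, rfl⟩ := hsep x y hxZ hcon
          have hx : x ∉ N := fun h => hxN (mem_image_of_mem _ h)
          have hy : (wElem b : ASLd m n) • x ∉ N := fun h => hyN (mem_image_of_mem _ h)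
          exact hyS ((mem_iff_of_ae_mem_iff (hNsub _ hx) (hNsub _ hy)).1 hxS))
  refine ⟨B ∩ Z, MeasurableSet.inter hB hZ, ?_⟩
  have h0 : μbar N' = 0 := hnull N hNm hN0
  refine (ae_iff.2 (measure_mono_null ?_ h0))
  intro x hx
  by_contra hxN
  refine hx (propext ⟨fun h => ⟨hB1 ⟨h, hxN⟩, h.2⟩, fun h => ⟨?_, h.2⟩⟩)
  by_contra hxS
  exact disjoint_left.1 hB2 h.1 ⟨⟨h.2, hxS⟩, hxN⟩

end TailApproximation

/-! ### Labels of the past determine the orbit of W. -/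

section Cells

variable {m n : ℕ} (w : Weights m n)

open ASLd

namespace Weights

theorem aHomeo_symm_iterate_coe (i : ℕ) (y : GridSpace m n) :
    w.aHomeo.symm^[i] (y : OnePoint (GridSpace m n)) =
      (((w.a ^ i)⁻¹ • y : GridSpace m n) : OnePoint (GridSpace m n)) := by
  have h : Function.LeftInverse (w.aHomeo.symm^[i]) (w.aHomeo^[i]) :=
    Function.LeftInverse.iterate w.aHomeo.symm_apply_apply i
  have e := w.aBar_iterate_coe i ((w.a ^ i)⁻¹ • y)
  rw [smul_inv_smul, ← aHomeo_eq] at e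
  rw [← e, h]

theorem aHomeo_symm_iterate_infty (i : ℕ) :
    w.aHomeo.symm^[i] (OnePoint.infty : OnePoint (GridSpace m n)) = OnePoint.infty := by
  have h : w.aHomeo.symm (OnePoint.infty : OnePoint (GridSpace m n)) = OnePoint.infty := by
    rw [Homeomorph.symm_apply_eq, aHomeo_infty]
  exact Function.iterate_fixed h i

/-- Points of the same fibre whose labels along the past agree differ by an element of `W`. -/
theorem exists_eq_wElem_smul_of_labels {K : Set (LatticeSpace m n)} {R τ : ℝ} (hτ0 : 0 < τ)
    (hτ : 4 * τ ≤ R)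
    (hR : ∀ y : GridSpace m n, gridProj y ∈ K → ∀ t : Fin m ⊕ Fin n → ℝ,
      (trans t : ASLd m n) • y = y → t = 0 ∨ R ≤ ‖t‖)
    {G : OnePoint (GridSpace m n) → Bool}
    (hGK : ∀ y : GridSpace m n, G y = true → gridProj y ∈ K) {J : ℕ → ℕ}
    {cell : ∀ L, OnePoint (GridSpace m n) → Option (Fin (J L))}
    (hnone : ∀ L y, cell L y = none ↔ G y = false)
    (hcell : ∀ L, ∀ y z : GridSpace m n, cell L y = cell L z → cell L y ≠ none →
      gridProj y = gridProj z → ∃ v, ‖v‖ < 2 * (τ * Real.exp (-L)) ∧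
        z = (trans v : ASLd m n) • y) {L₀ : ℕ} {y z : GridSpace m n}
    (hinf : ∃ᶠ i in atTop, G (w.aHomeo.symm^[i] y) = true) (hproj : gridProj y = gridProj z)
    (hP : ∀ i, 0 < i → cell L₀ (w.aHomeo.symm^[i] y) = cell L₀ (w.aHomeo.symm^[i] z))
    (hE : ∀ i, 0 < i → ∀ j, i ≤ j → returnLabel w.aBar G cell L₀ j (w.aHomeo.symm^[i] y) =
      returnLabel w.aBar G cell L₀ j (w.aHomeo.symm^[i] z)) :
    ∃ b : Fin m → ℝ, z = (wElem b : ASLd m n) • y := by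
  have hproj' : ∀ i, gridProj ((w.a ^ i)⁻¹ • y) = gridProj ((w.a ^ i)⁻¹ • z) := fun i => by
    rw [gridProj_smul, gridProj_smul, hproj]
  have hG : ∀ i, G (w.aHomeo.symm^[i] y) = true → ∀ L, cell L (w.aHomeo.symm^[i] y) ≠ none :=
    fun i hi L h => by simp [(hnone L _).1 h] at hi
  have hback : ∀ i l, l ≤ i → w.aBar^[l] (w.aHomeo.symm^[i] (y : OnePoint (GridSpace m n))) =
      w.aHomeo.symm^[i - l] y := fun i l hl => by
    rw [aHomeo_symm_iterate_coe, aBar_iterate_coe, w.a_pow_smul_inv_smul hl,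
      aHomeo_symm_iterate_coe]
  have hle : ∀ L : ℕ, 2 * (τ * Real.exp (-L)) ≤ 2 * τ := fun L => by
    have : Real.exp (-L) ≤ 1 := Real.exp_le_one_iff.2 (by simp)
    nlinarith
  refine w.exists_eq_wElem_smul (good := fun i => G (w.aHomeo.symm^[i] y) = true)
    (fun M => ?_) hτ hR (fun i hi => hGK _ ?_) fun i hi hgood => ?_
  · obtain ⟨i, hi, h⟩ := (hinf.and_eventually (eventually_gt_atTop M)).exists
    exact ⟨i, h, hi⟩
  · rw [← aHomeo_symm_iterate_coe]; exact hi
  -- A return time L > L₀ comes with a recorded cell of size τ e^(-L). A return after l ≤ L₀ steps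
  -- is already covered by the cell of size τ e^(-L₀) in P.
  by_cases hret : ∃ L, L₀ < L ∧ L < i ∧
      w.aHomeo.symm^[i] (y : OnePoint (GridSpace m n)) ∈ returnSet w.aBar G L
  · obtain ⟨L, hL, hLi, hmem⟩ := hret
    have hc := (cell_eq_of_returnLabel_eq (hE i hi i le_rfl) hL hLi.le hmem).2
    have hne := hG i hgood L
    rw [aHomeo_symm_iterate_coe] at hc hne
    rw [aHomeo_symm_iterate_coe] at hc
    obtain ⟨v, hv, hz⟩ := hcell L _ _ hc hne (hproj' i)
    refine ⟨v, hv.trans_le (hle L), fun l hl hli hgl hbad => ?_, hz⟩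
    have hll : l = L := by
      refine returnSet_unique ⟨hl, hgood, ?_, fun k hk hkl => ?_⟩ hmem
      · rw [hback i l hli.le]; exact hgl
      · rw [hback i k (by omega)]; simpa using hbad k hk hkl
    subst hll
    rw [mul_assoc]; exact hv
  · have hc := hP i hi
    have hne := hG i hgood L₀
    rw [aHomeo_symm_iterate_coe] at hc hne
    rw [aHomeo_symm_iterate_coe] at hc
    obtain ⟨v, hv, hz⟩ := hcell L₀ _ _ hc hne (hproj' i)
    refine ⟨v, hv.trans_le (hle L₀), fun l hl hli hgl hbad => ?_, hz⟩
    have hl0 : l ≤ L₀ := by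
      by_contra! hlt
      refine hret ⟨l, hlt, hli, hl, hgood, ?_, fun k hk hkl => ?_⟩
      · rw [hback i l hli.le]; exact hgl
      · rw [hback i k (by omega)]; simpa using hbad k hk hkl
    have : Real.exp (-L₀) ≤ Real.exp (-l) := Real.exp_le_exp.2 (by simpa using hl0)
    nlinarith

end Weights

end Cells

/-! ### Entropy given the tail algebra, at one compact level. -/

section LevelEntropy

variable {m n : ℕ} (w : Weights m n)

open ASLd

theorem gridProjBar_aBar_iterate (i : ℕ) (y : OnePoint (GridSpace m n)) :
    gridProjBar (w.aBar^[i] y) =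
      (OnePoint.map fun x : LatticeSpace m n => w.flow 1 • x)^[i] (gridProjBar y) := by
  have h : Function.Semiconj gridProjBar w.aBar
      (OnePoint.map fun x : LatticeSpace m n => w.flow 1 • x) := by
    intro y
    induction y using OnePoint.rec with
    | infty => rfl
    | coe y =>
      change ((gridProj (w.a • y) : LatticeSpace m n) : OnePoint (LatticeSpace m n)) =
        ((w.flow 1 • gridProj y : LatticeSpace m n) : OnePoint (LatticeSpace m n))
      rw [gridProj_smul, Weights.linearPart_a]
  exact (h.iterate_right i) y

namespace Weights

theorem leftInverse_aHomeo_symm : Function.LeftInverse w.aHomeo.symm w.aBar := by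
  rw [← aHomeo_eq]; exact w.aHomeo.symm_apply_apply

theorem rightInverse_aHomeo_symm : Function.RightInverse w.aHomeo.symm w.aBar := by
  rw [← aHomeo_eq]; exact w.aHomeo.apply_symm_apply

theorem measurePreserving_aHomeo_symm {μ : Measure (OnePoint (GridSpace m n))}
    (h : MeasurePreserving w.aBar μ μ) : MeasurePreserving w.aHomeo.symm μ μ :=
  MeasurePreserving.symm w.aHomeo.toMeasurableEquiv (by
    change MeasurePreserving w.aHomeo μ μ
    rw [aHomeo_eq]; exact h)

/-- Almost every point which never visits `G` in the past does not visit `G` in the future. -/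
theorem ae_eq_false_of_not_frequently {μ : Measure (OnePoint (GridSpace m n))}
    [IsProbabilityMeasure μ] (hT : MeasurePreserving w.aBar μ μ)
    {G : OnePoint (GridSpace m n) → Bool} (hG : LabelMeasurable G) :
    ∀ᵐ y ∂μ, (¬ ∃ᶠ i in atTop, G (w.aHomeo.symm^[i] y) = true) →
      ∀ i, G (w.aBar^[i] y) = false := by
  have hT' := w.measurePreserving_aHomeo_symm hT
  have h1 := hT'.conservative.ae_mem_imp_frequently_image_mem (hG true).nullMeasurableSet
  have h2 : ∀ i, ∀ᵐ y ∂μ, G (w.aBar^[i] y) = true →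
      ∃ᶠ k in atTop, G (w.aHomeo.symm^[k] (w.aBar^[i] y)) = true := fun i =>
    (hT.iterate i).quasiMeasurePreserving.ae h1
  filter_upwards [ae_all_iff.2 h2] with y hy hno i
  by_contra hi
  rw [Bool.not_eq_false] at hi
  refine hno ?_
  have h3 := hy i hi
  rw [frequently_atTop] at h3 ⊢
  intro M
  obtain ⟨k, hk, hGk⟩ := h3 (M + i)
  refine ⟨k - i, by omega, ?_⟩
  obtain ⟨l, rfl⟩ : ∃ l, k = l + i := ⟨k - i, by omega⟩
  rw [Function.iterate_add_apply, w.leftInverse_aHomeo_symm.iterate i] at hGk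
  rwa [Nat.add_sub_cancel]

end Weights

/-- Cells of size τ e^(-L) number about e^(d L). A logarithm linear in L is exactly what Kac's
inequality can absorb in the refining labels. -/
theorem log_card_cells_le {J d : ℕ} {C τ L : ℝ} (hC : 0 < C) (hτ : 0 < τ) (hL : 0 ≤ L)
    (h : (J : ℝ) ≤ C * (1 / (τ * Real.exp (-L))) ^ d) :
    Real.log (Fintype.card (Option (Fin J))) ≤ Real.log (C * (1 / τ) ^ d + 1) + d * L := by
  have h0 : 0 < C * (1 / τ) ^ d := by positivity
  have h1 : Real.exp (d * L) = Real.exp L ^ d := Real.exp_nat_mul _ _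
  have h2 : (1 / (τ * Real.exp (-L))) ^ d = (1 / τ) ^ d * Real.exp (d * L) := by
    rw [h1, Real.exp_neg, ← mul_pow]
    congr 1
    field_simp
  rw [h2] at h
  have h3 : 1 ≤ Real.exp (d * L) := Real.one_le_exp (by positivity)
  rw [Fintype.card_option, Fintype.card_fin, ← Real.log_exp (d * L),
    ← Real.log_mul (by positivity) (by positivity)]
  refine Real.log_le_log (by positivity) ?_
  push_cast
  nlinarith

end LevelEntropy

section LevelEntropy

variable {m n : ℕ} (w : Weights m n)

open ASLd

namespace Weights

/-- P consists of cells of size τ e^(-L₀), the labels E refine it at the start of excursions longer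
than L₀, and the labels β' separate the points of the compactification of X. Given the past of P ∨ E
and β', P has entropy at least c - p - δ per unit of time, and on Z this conditioning contains the
tail algebra modulo null sets. Off Z the orbit almost surely never meets {G = true}, so the P-name
is constant there. -/
theorem ofReal_le_dynEntropy_of_level {A : Matrix (Fin m) (Fin n) ℝ} {L : Filter ℕ} [L.NeBot]
    {N : ℕ → ℕ} [∀ j, NeZero (N j)] (hN : Tendsto N L atTop) {S : ℕ → Finset (Fin m → ℝ)}
    [∀ j, Nonempty (S j)] (hunit : ∀ j, ∀ b ∈ S j, ∀ b' ∈ S j, ∀ i, |b i - b' i| ≤ 1)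
    (hsep : ∀ j, ∀ b ∈ S j, ∀ b' ∈ S j, b ≠ b' → ∃ i, 1 ≤ |b i - b' i| * Real.exp (w.r i * N j))
    {c : ℝ} (hcard : ∀ c' < c, ∀ᶠ j in L, N j * c' ≤ Real.log (S j).card)
    {μ : ProbabilityMeasure (OnePoint (GridSpace m n))}
    (hμ : Tendsto (fun j => orbitProbability w.aBar (N j)
      fun b : S j => (shiftedGrid A b.1 : OnePoint (GridSpace m n))) L (𝓝 μ))
    {μ' : Measure (GridSpace m n)} [IsProbabilityMeasure μ']
    (hinv : MeasurePreserving (fun y => w.a • y) μ' μ')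
    (hnull : ∀ N : Set (GridSpace m n), MeasurableSet N → μ' N = 0 →
      (μ : Measure _) (((↑) : GridSpace m n → OnePoint (GridSpace m n)) '' N) = 0)
    {K : Set (LatticeSpace m n)} (hK : IsCompact K) {G : OnePoint (LatticeSpace m n) → Bool}
    (hGm : LabelMeasurable G)
    (hGc : AELocallyConstant (μ : Measure _) (G ∘ gridProjBar (m := m) (n := n)))
    (hGK : ∀ x : LatticeSpace m n, G x = true → x ∈ K) (hGinf : G OnePoint.infty = false)
    {𝒜 : MeasurableSpace (GridSpace m n)} (h𝒜 : w.IsDescendingSubordinate μ' 𝒜) {δ : ℝ}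
    (hδ : 0 < δ) :
    ENNReal.ofReal (c - (μ : Measure _).real ((G ∘ gridProjBar (m := m) (n := n)) ⁻¹' {false}) - δ) ≤
      dynEntropy (μ : Measure _) w.aBar (extendAlgebra (w.tailAlgebra 𝒜)) := by
  classical
  set G' : OnePoint (GridSpace m n) → Bool := G ∘ gridProjBar with hG'
  have hGm' : LabelMeasurable G' := hGm.comp continuous_gridProjBar.measurable
  have hT : MeasurePreserving w.aBar (μ : Measure _) μ :=
    measurePreserving_of_tendsto_orbitMeasure w.continuous_aBar hN hμ
  have hT' := w.measurePreserving_aHomeo_symm hT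
  have hGK' : ∀ y, G' y = true → ∃ z : GridSpace m n, y = z ∧ gridProj z ∈ K := by
    intro y hy
    induction y using OnePoint.rec with
    | infty =>
      have : G OnePoint.infty = true := hy
      rw [hGinf] at this
      exact absurd this (by simp)
    | coe y => exact ⟨y, rfl, hGK _ hy⟩
  have hGK'' : ∀ y : GridSpace m n, G' y = true → gridProj y ∈ K := fun y hy => hGK _ hy
  obtain ⟨R, hR0, hR⟩ := exists_le_norm_of_trans_smul_eq (m := m) (n := n) hK
  obtain ⟨C, hC, hcells⟩ := exists_cells hK (μ : Measure _) hGm' hGc hGK'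
  -- R/24 serves the counting of names; 1 keeps the cell sizes in the range where their number is
  -- bounded.
  set τ := min (R / 24) 1 with hτ
  have hτ0 : 0 < τ := lt_min (by linarith) one_pos
  have hτR : 24 * τ ≤ R := by
    have := min_le_left (R / 24) 1
    linarith
  have hexp : ∀ L : ℕ, τ * Real.exp (-L) ≤ τ := fun L =>
    mul_le_of_le_one_right hτ0.le (Real.exp_le_one_iff.2 (by simp))
  choose J cell hJ hcm hcc hnone hcell using fun L : ℕ =>
    hcells (τ * Real.exp (-L)) (by positivity) ((hexp L).trans (min_le_right _ _))
  obtain ⟨L₀, hL₀⟩ := exists_finEntropy_returnLabel_le (μ := (μ : Measure _))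
    w.continuous_aBar.measurable hGm' hT' w.rightInverse_aHomeo_symm hcm
    (C := Real.log (C * (1 / τ) ^ (m + n) + 1)) (D := ((m + n : ℕ) : ℝ))
    (Real.log_nonneg (by have : 0 < C * (1 / τ) ^ (m + n) := by positivity
                         linarith))
    (fun L => log_card_cells_le hC hτ0 (Nat.cast_nonneg L) (hJ L)) hδ
  set P := cell L₀ with hP
  set E : ∀ j, OnePoint (GridSpace m n) → _ := fun j => returnLabel w.aBar G' cell L₀ j with hE
  have hEm : ∀ j, LabelMeasurable (E j) := fun j =>
    LabelMeasurable.returnLabel w.continuous_aBar.measurable hGm' hcm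
  have hπ : Measurable (gridProjBar (m := m) (n := n)) := continuous_gridProjBar.measurable
  obtain ⟨β, hβm, hβc, hβsep⟩ := exists_separating_labels
    ((μ : Measure _).map (gridProjBar (m := m) (n := n)))
  have hβc' : ∀ j, AELocallyConstant (μ : Measure _) (β j ∘ gridProjBar (m := m) (n := n)) :=
    fun j => (hβc j).comp continuous_gridProjBar (hπ.measurePreserving _)
  have hβm' : ∀ j, LabelMeasurable (β j ∘ gridProjBar (m := m) (n := n)) :=
    fun j i => hπ (hβm j (measurableSet_singleton i))
  set β' : ℕ → OnePoint (GridSpace m n) → Bool := fun j => β j ∘ gridProjBar with hβ'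
  set p := (μ : Measure _).real (G' ⁻¹' {false}) with hp
  have hPcell : ∀ y z : GridSpace m n, P y = P z → P y ≠ none → gridProj y = gridProj z →
      ∃ v, ‖v‖ < 2 * τ ∧ z = (trans v : ASLd m n) • y := by
    intro y z h1 h2 h3
    obtain ⟨v, hv, e⟩ := hcell L₀ y z h1 h2 h3
    exact ⟨v, hv.trans_le (by have := hexp L₀; linarith), e⟩
  have hbase : ∀ j q : ℕ, q * (c - p) ≤ finCondEntropy (μ : Measure _) (iteratedJoin w.aBar P q)
      (iteratedJoin w.aBar (fun y (i : Fin j) => β' i y) q) := by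
    intro j q
    -- The base labels along the orbit are a function of the base point alone, so they do not
    -- distinguish the grids of the family.
    have e : iteratedJoin w.aBar (fun y (i : Fin j) => β' i y) q =
        iteratedJoin (OnePoint.map fun x : LatticeSpace m n => w.flow 1 • x)
          (fun x (i : Fin j) => β i x) q ∘ gridProjBar := by
      funext y i
      funext k
      exact congrArg (β k) (gridProjBar_aBar_iterate w i y)
    rw [e]
    refine w.le_finCondEntropy_cells hN hunit hsep hcard hμ hGm' hGc hGK hτR hτ0 hR (hcm L₀)
      (hcc L₀) (hnone L₀) hPcell ?_ ?_ q
    · rw [← e]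
      exact (LabelMeasurable.pi fun i : Fin j => hβm' i).iteratedJoin w.continuous_aBar.measurable q
    · rw [← e]
      exact AELocallyConstant.iteratedJoin (AELocallyConstant.pi fun i : Fin j => hβc' i)
        w.continuous_aBar hT q
  have hpast := fun q j => le_finCondEntropy_pastLabel hT hT'.measurable w.leftInverse_aHomeo_symm
    (hcm L₀) hEm hβm' hL₀ hbase q j
  have hγ := LabelMeasurable.pastLabel hT'.measurable (hcm L₀) hEm hβm'
  set γ := pastLabel w.aHomeo.symm P E β' with hγdef
  set Z : Set (OnePoint (GridSpace m n)) := {y | ∃ᶠ i in atTop, G' (w.aHomeo.symm^[i] y) = true}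
    with hZdef
  -- P is `none` exactly where G is false, so the strict past of P records the backward visits; the
  -- missing time 0 does not affect whether they are infinitely many.
  have hZγ : MeasurableSet[⨆ j, MeasurableSpace.comap (γ j) ⊤] Z := by
    have e : Z = ⋂ M : ℕ, ⋃ i : ℕ, ⋃ _ : M ≤ i, {y | P (w.aHomeo.symm^[i + 1] y) ≠ none} := by
      ext y
      simp only [hZdef, mem_iInter, mem_iUnion, Set.mem_ofPred_eq, frequently_atTop, exists_prop]
      constructor
      · intro h M
        obtain ⟨i, hi, hG⟩ := h (M + 1)
        refine ⟨i - 1, by omega, fun h0 => ?_⟩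
        rw [Nat.sub_add_cancel (by omega)] at h0
        have := (hnone L₀ _).1 h0
        rw [hG] at this
        exact absurd this (by simp)
      · intro h M
        obtain ⟨i, hi, hG⟩ := h M
        refine ⟨i + 1, by omega, ?_⟩
        by_contra h0
        exact hG ((hnone L₀ _).2 (by simpa using h0))
    rw [e]
    refine MeasurableSet.iInter fun M => MeasurableSet.iUnion fun i => MeasurableSet.iUnion fun _ => ?_
    refine le_iSup (fun j => MeasurableSpace.comap (γ j) ⊤) (i + 1) _
      ⟨{u | (u.1 ⟨i, by omega⟩).1 ≠ none}, trivial, rfl⟩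
  have hγle : (⨆ j, MeasurableSpace.comap (γ j) ⊤) ≤
      OnePoint.instMeasurableSpaceBorel (GridSpace m n) := by
    refine iSup_le fun j => ?_
    rintro _ ⟨s, -, rfl⟩
    exact (hγ j).preimage s
  have hZm : MeasurableSet Z := hγle _ hZγ
  have hZinf : OnePoint.infty ∉ Z := by
    simp only [hZdef, Set.mem_ofPred_eq, aHomeo_symm_iterate_infty]
    intro h
    obtain ⟨i, hi⟩ := h.exists
    have : G OnePoint.infty = true := hi
    rw [hGinf] at this
    exact absurd this (by simp)
  have hW : ∀ y z : GridSpace m n, (y : OnePoint (GridSpace m n)) ∈ Z →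
      (∀ j, γ j y = γ j z) → ∃ b : Fin m → ℝ, z = (wElem b : ASLd m n) • y := by
    intro y z hy hyz
    simp only [hγdef, pastLabel_eq_iff] at hyz
    refine w.exists_eq_wElem_smul_of_labels (L₀ := L₀) hτ0 (by linarith) hR hGK'' hnone hcell hy ?_ ?_ ?_
    · exact OnePoint.coe_injective (hβsep _ _ fun i => (hyz (i + 1)).2 i (by omega))
    · intro i hi
      have := ((hyz i).1 (i - 1) (by omega)).1
      rwa [Nat.sub_add_cancel hi] at this
    · intro i hi j hij
      have := ((hyz j).1 (i - 1) (by omega)).2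
      rwa [Nat.sub_add_cancel hi] at this
  have hmle : extendAlgebra (w.tailAlgebra 𝒜) ≤ OnePoint.instMeasurableSpaceBorel (GridSpace m n) :=
    extendAlgebra_le_borel (w.tailAlgebra_le_borel h𝒜.le_borel)
  refine le_dynEntropy_of_finite (hcm L₀) _ fun q => ?_
  refine le_condEntropy_of_approx (γ := γ) ((hcm L₀).iteratedJoin w.continuous_aBar.measurable q)
    hγ (fun i j hij => pastLabel_mono (fun j j' h => returnLabel_factorsThrough h) hij)
    (hpast q) hmle hZm
    (fun S hS => w.exists_ae_eq_of_tail hinv hnull h𝒜 hγ hZγ hZm hZinf hW hS)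
    (i₀ := fun _ => none) ?_
  filter_upwards [w.ae_eq_false_of_not_frequently hT hGm'] with y hy hyZ
  funext i
  exact (hnone L₀ _).2 (hy hyZ i)

end Weights

end LevelEntropy

/-! ### Exhausting X by compact sets. -/

section GlobalEntropy

variable {m n : ℕ} (w : Weights m n)

open ASLd

theorem gridProjBar_eq_infty_iff {y : OnePoint (GridSpace m n)} :
    gridProjBar y = OnePoint.infty ↔ y = OnePoint.infty := by
  induction y using OnePoint.rec with
  | infty => exact ⟨fun _ => rfl, fun _ => rfl⟩
  | coe y =>
    change ((gridProj y : LatticeSpace m n) : OnePoint (LatticeSpace m n)) = OnePoint.infty ↔ _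
    simp

/-- Neighbourhoods of infinity of almost minimal measure, with null boundary. -/
theorem exists_small_neighborhood (μ : Measure (OnePoint (GridSpace m n))) [IsProbabilityMeasure μ]
    {δ : ℝ} (hδ : 0 < δ) : ∃ (K : Set (LatticeSpace m n)) (G : OnePoint (LatticeSpace m n) → Bool),
      IsCompact K ∧ LabelMeasurable G ∧
      AELocallyConstant μ (G ∘ gridProjBar (m := m) (n := n)) ∧
      (∀ x : LatticeSpace m n, G x = true → x ∈ K) ∧ G OnePoint.infty = false ∧
      μ.real ((G ∘ gridProjBar (m := m) (n := n)) ⁻¹' {false}) < μ.real {OnePoint.infty} + δ := by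
  let _ := TopologicalSpace.metrizableSpaceMetric (OnePoint (LatticeSpace m n))
  -- In a metric on the compactification, K is the set of points at distance at least ρ from ∞. A
  -- small ρ makes the mass outside it nearly that of ∞, and a null level ρ makes its boundary null.
  set ψ : OnePoint (LatticeSpace m n) → ℝ := fun x => dist x OnePoint.infty with hψ
  have hψc : Continuous ψ := continuous_id.dist continuous_const
  set f : OnePoint (GridSpace m n) → ℝ := fun y => ψ (gridProjBar y) with hf
  have hfc : Continuous f := hψc.comp continuous_gridProjBar
  have hf0 : ∀ y, f y ≤ 0 ↔ y = OnePoint.infty := fun y => by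
    rw [hf, hψ, dist_le_zero, gridProjBar_eq_infty_iff]
  have hlim : Tendsto (fun k : ℕ => μ.real {y | f y < 1 / ((k : ℝ) + 1)}) atTop
      (𝓝 (μ.real {OnePoint.infty})) := by
    have hI : ⋂ k : ℕ, {y | f y < 1 / ((k : ℝ) + 1)} = {OnePoint.infty} := by
      ext y
      simp only [mem_iInter, Set.mem_ofPred_eq, mem_singleton_iff, ← hf0]
      constructor
      · intro h
        exact ge_of_tendsto' tendsto_one_div_add_atTop_nhds_zero_nat fun k => (h k).le
      · intro h k
        exact h.trans_lt (by positivity)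
    rw [← hI]
    refine (ENNReal.tendsto_toReal (measure_ne_top _ _)).comp
      (tendsto_measure_iInter_atTop (fun k => ?_) (fun k l hkl y hy => ?_) ⟨0, measure_ne_top _ _⟩)
    · exact (measurableSet_lt hfc.measurable measurable_const).nullMeasurableSet
    · refine lt_of_lt_of_le (b := 1 / ((l : ℝ) + 1)) hy ?_
      gcongr
  obtain ⟨k, hk⟩ := (hlim.eventually_lt_const (lt_add_of_pos_right _ hδ)).exists
  obtain ⟨ρ, hρ, hρ0⟩ := exists_null_level (μ := μ) hfc.measurable
    (show (0 : ℝ) < 1 / ((k : ℝ) + 1) by positivity)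
  have hclosed : IsClosed {x | ρ ≤ ψ x} := isClosed_le continuous_const hψc
  refine ⟨(↑) ⁻¹' {x | ρ ≤ ψ x}, fun x => !decide (ψ x < ρ), ?_, ?_, ?_, ?_, ?_, ?_⟩
  · refine (OnePoint.isOpenEmbedding_coe.toIsInducing.isCompact_preimage_iff ?_).2
      hclosed.isCompact
    intro x hx
    induction x using OnePoint.rec with
    | infty =>
      have h1 : ρ ≤ ψ OnePoint.infty := hx
      have h2 : ψ OnePoint.infty = 0 := dist_self _
      exact absurd (h2 ▸ h1) (not_le.2 hρ.1)
    | coe x => exact mem_range_self x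
  · have hm : MeasurableSet {x | ψ x < ρ} := measurableSet_lt hψc.measurable measurable_const
    intro b
    cases b
    · convert hm using 1
      ext x; simp
    · convert hm.compl using 1
      ext x; simp
  · exact (aelocallyConstant_lt hfc hρ0).map fun b => !b
  · intro x hx
    change ρ ≤ ψ x
    simpa using hx
  · have h2 : ψ OnePoint.infty = 0 := dist_self _
    simp [h2, hρ.1]
  · refine lt_of_le_of_lt (measureReal_mono fun y hy => ?_) hk
    have : f y < ρ := by simpa using hy
    exact this.trans hρ.2

namespace Weights

/-- The loss 2δ at a single level has two sources, the mass near ∞ beyond that of ∞ itself and the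
entropy of the refining labels; both can be made arbitrarily small. -/
theorem ofReal_sub_measureReal_infty_le_dynEntropy {A : Matrix (Fin m) (Fin n) ℝ} {L : Filter ℕ}
    [L.NeBot]
    {N : ℕ → ℕ} [∀ j, NeZero (N j)] (hN : Tendsto N L atTop) {S : ℕ → Finset (Fin m → ℝ)}
    [∀ j, Nonempty (S j)] (hunit : ∀ j, ∀ b ∈ S j, ∀ b' ∈ S j, ∀ i, |b i - b' i| ≤ 1)
    (hsep : ∀ j, ∀ b ∈ S j, ∀ b' ∈ S j, b ≠ b' → ∃ i, 1 ≤ |b i - b' i| * Real.exp (w.r i * N j))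
    {c : ℝ} (hcard : ∀ c' < c, ∀ᶠ j in L, N j * c' ≤ Real.log (S j).card)
    {μ : ProbabilityMeasure (OnePoint (GridSpace m n))}
    (hμ : Tendsto (fun j => orbitProbability w.aBar (N j)
      fun b : S j => (shiftedGrid A b.1 : OnePoint (GridSpace m n))) L (𝓝 μ))
    {μ' : Measure (GridSpace m n)} [IsProbabilityMeasure μ']
    (hinv : MeasurePreserving (fun y => w.a • y) μ' μ')
    (hnull : ∀ N : Set (GridSpace m n), MeasurableSet N → μ' N = 0 →
      (μ : Measure _) (((↑) : GridSpace m n → OnePoint (GridSpace m n)) '' N) = 0)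
    {𝒜 : MeasurableSpace (GridSpace m n)} (h𝒜 : w.IsDescendingSubordinate μ' 𝒜) :
    ENNReal.ofReal (c - (μ : Measure (OnePoint (GridSpace m n))).real {OnePoint.infty}) ≤
      dynEntropy (μ : Measure _) w.aBar (extendAlgebra (w.tailAlgebra 𝒜)) := by
  have key : ∀ δ : ℝ, 0 < δ →
      ENNReal.ofReal (c - (μ : Measure (OnePoint (GridSpace m n))).real {OnePoint.infty} - 2 * δ) ≤
        dynEntropy (μ : Measure _) w.aBar (extendAlgebra (w.tailAlgebra 𝒜)) := by
    intro δ hδ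
    obtain ⟨K, G, hK, hGm, hGc, hGK, hGinf, hlt⟩ := exists_small_neighborhood (m := m) (n := n) (μ : Measure _) hδ
    refine le_trans (ENNReal.ofReal_le_ofReal ?_) (w.ofReal_le_dynEntropy_of_level hN hunit hsep
      hcard hμ hinv hnull hK hGm hGc hGK hGinf h𝒜 hδ)
    linarith
  have hlim : Tendsto (fun k : ℕ => ENNReal.ofReal
      (c - (μ : Measure (OnePoint (GridSpace m n))).real {OnePoint.infty} - 2 * (1 / ((k : ℝ) + 1)))) atTop
      (𝓝 (ENNReal.ofReal (c - (μ : Measure (OnePoint (GridSpace m n))).real {OnePoint.infty} - 2 * 0))) :=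
    (ENNReal.continuous_ofReal.tendsto _).comp
      (tendsto_const_nhds.sub (tendsto_one_div_add_atTop_nhds_zero_nat.const_mul 2))
  rw [mul_zero, sub_zero] at hlim
  exact le_of_tendsto' hlim fun k => key _ (by positivity)

end Weights

end GlobalEntropy

/-! ### Support and projection of the limit measures. -/

section GridLimits

variable {m n : ℕ} (w : Weights m n)

open ASLd

theorem isClosed_coe_image_union_infty {Z : Type*} [TopologicalSpace Z] {F : Set Z}
    (hF : IsClosed F) : IsClosed (((↑) : Z → OnePoint Z) '' F ∪ {OnePoint.infty}) := by
  rw [← isOpen_compl_iff]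
  have e : (((↑) : Z → OnePoint Z) '' F ∪ {OnePoint.infty})ᶜ = ((↑) : Z → OnePoint Z) '' Fᶜ := by
    ext x
    induction x using OnePoint.rec with
    | infty => simp
    | coe x => simp
  rw [e]
  exact OnePoint.isOpenMap_coe _ hF.isOpen_compl

namespace Weights

theorem target_anti {ε ε' : ℝ} (h : ε' ≤ ε) : w.target ε ⊆ w.target ε' :=
  fun _ hy v hv => h.trans (hy v hv)

/-- Bad vectors give orbits only in L_ε' with ε' < ε; the closed sets L_ε' ∪ {∞} intersect in L_ε ∪
{∞}. -/
theorem support_subset_of_forall_lt {ε : ℝ} {μ : Measure (OnePoint (GridSpace m n))}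
    (h : ∀ ε' < ε, μ (((↑) : GridSpace m n → OnePoint (GridSpace m n)) '' w.target ε' ∪
      {OnePoint.infty})ᶜ = 0) :
    μ.support ⊆ ((↑) : GridSpace m n → OnePoint (GridSpace m n)) '' w.target ε ∪
      {OnePoint.infty} := by
  have h1 : ∀ ε' < ε, μ.support ⊆ ((↑) : GridSpace m n → OnePoint (GridSpace m n)) '' w.target ε' ∪
      {OnePoint.infty} := fun ε' hε' =>
    Measure.support_subset_of_isClosed (isClosed_coe_image_union_infty (w.isClosed_target ε'))
      (h ε' hε')
  intro y hy
  induction y using OnePoint.rec with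
  | infty => exact Or.inr rfl
  | coe y =>
    refine Or.inl ⟨y, w.target_eq_iInter ε (mem_iInter₂.2 fun ε' hε' => ?_), rfl⟩
    rcases h1 ε' hε' hy with ⟨z, hz, e⟩ | h2
    · rwa [← OnePoint.coe_injective e]
    · exact absurd h2 (OnePoint.coe_ne_infty y)

/-- The choice of separated sets of bad vectors along a subsequence of times. -/
theorem exists_separated_bad_along [NeZero m] [NeZero n] {A : Matrix (Fin m) (Fin n) ℝ} {ε : ℝ}
    (hε : 0 < ε) (hirr : ∃ b ∈ w.Bad A ε, ¬ IsRationalPair A b) {k : ℕ → ℕ} (hk : StrictMono k)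
    (j : ℕ) : ∃ (i T : ℕ) (S : Finset (Fin m → ℝ)), j ≤ i ∧ 0 < k i ∧ j * T ≤ k i ∧ S.Nonempty ∧
      (∀ b ∈ S, ∀ b' ∈ S, ∀ i, |b i - b' i| ≤ 1) ∧
      (∀ b ∈ S, ∀ b' ∈ S, b ≠ b' → ∃ i', 1 ≤ |b i' - b' i'| * Real.exp (w.r i' * k i)) ∧
      (∀ b ∈ S, ∀ l ≥ T, w.a ^ l • shiftedGrid A b ∈ w.target (ε * (1 - 1 / ((j : ℝ) + 2)))) ∧
      k i * (1 - w.r 0 * ((m : ℝ) - (dimH (w.Bad A ε)).toReal) - 1 / ((j : ℝ) + 1)) ≤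
        Real.log S.card := by
  have h0 : 0 < 1 / ((j : ℝ) + 2) := by positivity
  have h1 : 1 / ((j : ℝ) + 2) < 1 := by rw [div_lt_one (by positivity)]; linarith [j.cast_nonneg (α := ℝ)]
  obtain ⟨T, hT⟩ := w.exists_separated_bad hirr (ε' := ε * (1 - 1 / ((j : ℝ) + 2)))
    (mul_pos hε (by linarith)) (by nlinarith)
    (c := 1 - w.r 0 * ((m : ℝ) - (dimH (w.Bad A ε)).toReal) - 1 / ((j : ℝ) + 1))
    (sub_lt_self _ (by positivity))
  -- The time k i is taken after T is known, with j T ≤ k i, so that the part of each orbit segment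
  -- before time T is negligible.
  have h2 := (hk.tendsto_atTop.eventually hT).and ((eventually_ge_atTop j).and
    ((hk.tendsto_atTop.eventually_gt_atTop 0).and (hk.tendsto_atTop.eventually_ge_atTop (j * T))))
  obtain ⟨i, ⟨S, hS⟩, hji, hi0, hiT⟩ := h2.exists
  exact ⟨i, T, S, hji, hi0, hiT, hS⟩

/-- All the grids lie over x_A, so every orbit measure projects to the average over the orbit of
x_A, whatever the finite family is. -/
theorem map_gridProjBar_eq_of_tendsto {A : Matrix (Fin m) (Fin n) ℝ} {L : Filter ℕ} [L.NeBot]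
    {N : ℕ → ℕ} [∀ j, NeZero (N j)] {S : ℕ → Finset (Fin m → ℝ)} [∀ j, Nonempty (S j)]
    {μ : ProbabilityMeasure (OnePoint (GridSpace m n))}
    (hμ : Tendsto (fun j => orbitProbability w.aBar (N j)
      fun b : S j => (shiftedGrid A b.1 : OnePoint (GridSpace m n))) L (𝓝 μ))
    {μA : Measure (OnePoint (LatticeSpace m n))} [IsProbabilityMeasure μA]
    (h : ∀ f : C(OnePoint (LatticeSpace m n), ℝ),
      Tendsto (fun i => (∑ l ∈ Finset.range (N i),
          f ((w.flow l • latticeOf A : LatticeSpace m n) : OnePoint (LatticeSpace m n))) / (N i : ℝ))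
        L (𝓝 (∫ x, f x ∂μA))) :
    (μ : Measure _).map (gridProjBar (m := m) (n := n)) = μA := by
  have hπ := continuous_gridProjBar (m := m) (n := n)
  have : IsProbabilityMeasure ((μ : Measure _).map (gridProjBar (m := m) (n := n))) :=
    Measure.isProbabilityMeasure_map hπ.measurable.aemeasurable
  refine ext_of_forall_integral_eq_of_IsFiniteMeasure fun f => ?_
  rw [integral_map hπ.measurable.aemeasurable f.continuous.aestronglyMeasurable]
  have h1 := (ProbabilityMeasure.tendsto_iff_forall_integral_tendsto.1 hμ)
    (f.compContinuous ⟨_, hπ⟩)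
  refine tendsto_nhds_unique h1 ((h f.toContinuousMap).congr fun j => ?_)
  change _ = ∫ x, f (gridProjBar x) ∂(orbitMeasure w.aBar (N j)
      fun b : S j => (shiftedGrid A b.1 : OnePoint (GridSpace m n)))
  rw [integral_orbitMeasure (f := fun y => f (gridProjBar y)) (f.continuous.comp hπ)]
  simp only [gridProjBar_aBar_iterate_shiftedGrid, Finset.sum_const, Finset.card_univ, nsmul_eq_mul]
  have hc : ((Fintype.card (S j) : ℕ) : ℝ) ≠ 0 := Nat.cast_ne_zero.2 Fintype.card_ne_zero
  rw [mul_comm (N j : ℝ), mul_div_mul_left _ _ hc]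
  rfl

end Weights

end GridLimits

/-! ### Splitting off the mass at infinity. -/

section Decomposition

variable {m n : ℕ} (w : Weights m n)

open ASLd

/-- A probability measure on the one-point compactification splits off its mass at infinity. -/
theorem eq_map_coe_comap_add_dirac (μ : Measure (OnePoint (GridSpace m n))) :
    μ = (μ.comap ((↑) : GridSpace m n → OnePoint (GridSpace m n))).map (↑) +
      μ {OnePoint.infty} • Measure.dirac OnePoint.infty := by
  ext s hs
  have hc := GridSpace.measurableEmbedding_coe (m := m) (n := n)
  rw [Measure.add_apply, hc.map_comap, Measure.restrict_apply hs, Measure.smul_apply,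
    Measure.dirac_apply' _ hs, smul_eq_mul]
  have hdiff : s \ range ((↑) : GridSpace m n → OnePoint (GridSpace m n)) = s ∩ {OnePoint.infty} := by
    rw [sdiff_eq, OnePoint.compl_range_coe]
  rw [← measure_inter_add_sdiff s hc.measurableSet_range, hdiff]
  congr 1
  by_cases h : OnePoint.infty ∈ s
  · rw [inter_eq_right.2 (singleton_subset_iff.2 h)]; simp [h]
  · rw [inter_singleton_eq_empty.2 h]; simp [h]

namespace Weights

theorem aBar_preimage_image_coe (s : Set (GridSpace m n)) :
    w.aBar ⁻¹' (((↑) : GridSpace m n → OnePoint (GridSpace m n)) '' s) =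
      (↑) '' ((fun y => w.a • y) ⁻¹' s) := by
  ext y
  induction y using OnePoint.rec with
  | infty => simp [aBar]
  | coe y => simp [aBar]

theorem measurePreserving_comap_coe {μ : Measure (OnePoint (GridSpace m n))}
    (h : MeasurePreserving w.aBar μ μ) :
    MeasurePreserving (fun y => w.a • y)
      (μ.comap ((↑) : GridSpace m n → OnePoint (GridSpace m n)))
      (μ.comap ((↑) : GridSpace m n → OnePoint (GridSpace m n))) := by
  have hc := GridSpace.measurableEmbedding_coe (m := m) (n := n)
  have hm : Measurable fun y : GridSpace m n => w.a • y := measurable_const_smul w.a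
  refine ⟨hm, ?_⟩
  ext s hs
  rw [Measure.map_apply hm hs, hc.comap_apply, hc.comap_apply, ← aBar_preimage_image_coe,
    h.measure_preimage (hc.measurableSet_image.2 hs).nullMeasurableSet]

/-- The part on `Y` of an invariant measure on the compactification, normalised. -/
theorem exists_invariant_part {μ : Measure (OnePoint (GridSpace m n))} [IsProbabilityMeasure μ]
    (h : MeasurePreserving w.aBar μ μ)
    (hex : ∃ ν : Measure (GridSpace m n), IsProbabilityMeasure ν ∧
      MeasurePreserving (fun y => w.a • y) ν ν) :
    ∃ μ' : Measure (GridSpace m n), IsProbabilityMeasure μ' ∧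
      MeasurePreserving (fun y => w.a • y) μ' μ' ∧
      μ = ENNReal.ofReal (1 - μ.real {OnePoint.infty}) • μ'.map (↑) +
        ENNReal.ofReal (μ.real {OnePoint.infty}) • Measure.dirac OnePoint.infty := by
  have hc := GridSpace.measurableEmbedding_coe (m := m) (n := n)
  have hdec := eq_map_coe_comap_add_dirac μ
  set ν := μ.comap ((↑) : GridSpace m n → OnePoint (GridSpace m n)) with hν
  have hmass : ν univ = ENNReal.ofReal (1 - μ.real {OnePoint.infty}) := by
    rw [hν, hc.comap_apply, image_univ, ← OnePoint.compl_infty, ← ofReal_measureReal,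
      probReal_compl_eq_one_sub (measurableSet_singleton _)]
  have hinf : μ {OnePoint.infty} = ENNReal.ofReal (μ.real {OnePoint.infty}) :=
    (ofReal_measureReal (measure_ne_top μ _)).symm
  rw [hinf] at hdec
  -- When all the mass sits at ∞ the coefficient of μ' is zero, and any invariant probability
  -- measure on Y will do.
  by_cases h0 : ν univ = 0
  · obtain ⟨ν', hν', hinv⟩ := hex
    refine ⟨ν', hν', hinv, ?_⟩
    rw [← hmass, h0, zero_smul]
    rwa [Measure.measure_univ_eq_zero.1 h0, Measure.map_zero] at hdec
  · have hfin : ν univ ≠ ⊤ := by rw [hmass]; exact ENNReal.ofReal_ne_top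
    refine ⟨(ν univ)⁻¹ • ν, ⟨?_⟩, ?_, ?_⟩
    · rw [Measure.smul_apply, smul_eq_mul, ENNReal.inv_mul_cancel h0 hfin]
    · have hp := w.measurePreserving_comap_coe h
      exact ⟨hp.measurable, by rw [Measure.map_smul, hp.map_eq]⟩
    · rw [← hmass, Measure.map_smul, smul_smul, ENNReal.mul_inv_cancel h0 hfin, one_smul]
      exact hdec

end Weights

end Decomposition

/-! ### Construction of the limit measure on the compactification of Y. -/

section ExistsMeasure

variable {m n : ℕ} (w : Weights m n)

open ASLd

namespace Weights

theorem exists_grid_measure [NeZero m] [NeZero n]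
    (hex : ∃ ν : Measure (GridSpace m n), IsProbabilityMeasure ν ∧
      MeasurePreserving (fun y => w.a • y) ν ν)
    {A : Matrix (Fin m) (Fin n) ℝ} {μA : Measure (OnePoint (LatticeSpace m n))}
    (hμA : w.IsLimitMeasure A μA) {ε : ℝ} (hε : 0 < ε)
    (hirr : ∃ b ∈ w.Bad A ε, ¬ IsRationalPair A b) :
    ∃ μbar : Measure (OnePoint (GridSpace m n)),
      IsProbabilityMeasure μbar ∧
      MeasurePreserving w.aBar μbar μbar ∧
      μbar.support ⊆ (fun y : GridSpace m n => (y : OnePoint (GridSpace m n))) '' w.target ε ∪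
          {OnePoint.infty} ∧
      μbar.map (OnePoint.map gridProj) = μA ∧
      ∃ μ : Measure (GridSpace m n),
        IsProbabilityMeasure μ ∧
        MeasurePreserving (fun y => w.a • y) μ μ ∧
        μbar = ENNReal.ofReal (1 - μA.real {OnePoint.infty}) •
            μ.map (fun y : GridSpace m n => (y : OnePoint (GridSpace m n))) +
          ENNReal.ofReal (μA.real {OnePoint.infty}) • Measure.dirac OnePoint.infty ∧
        ∀ 𝒜 : MeasurableSpace (GridSpace m n), w.IsDescendingSubordinate μ 𝒜 →
          ENNReal.ofReal (1 - μA.real {OnePoint.infty} -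
            w.r 0 * ((m : ℝ) - (dimH (w.Bad A ε)).toReal)) ≤
            dynEntropy μbar w.aBar (extendAlgebra (w.tailAlgebra 𝒜)) := by
  obtain ⟨hprob, k, hk, hlim⟩ := hμA
  choose i T S hij hpos hT hS hunit hsep htarget hcard using
    w.exists_separated_bad_along hε hirr hk
  set N : ℕ → ℕ := fun j => k (i j) with hN
  have hi : Tendsto i atTop atTop := tendsto_atTop_mono hij tendsto_id
  have hNt : Tendsto N atTop atTop := hk.tendsto_atTop.comp hi
  have hN0 : ∀ j, NeZero (N j) := fun j => ⟨(hpos j).ne'⟩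
  have hS0 : ∀ j, Nonempty (S j) := fun j => (hS j).to_subtype
  -- Along an ultrafilter every sequence of probability measures on a compact space converges, so no
  -- subsequence has to be extracted.
  set L : Filter ℕ := (hyperfilter ℕ : Filter ℕ) with hL
  have hLle : L ≤ atTop := Nat.hyperfilter_le_atTop
  obtain ⟨μ, hμ⟩ : ∃ μ : ProbabilityMeasure (OnePoint (GridSpace m n)),
      Tendsto (fun j => orbitProbability w.aBar (N j)
        fun b : S j => (shiftedGrid A b.1 : OnePoint (GridSpace m n))) L (𝓝 μ) := by
    obtain ⟨μ, -, hμ⟩ := isCompact_univ.ultrafilter_le_nhds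
      ((hyperfilter ℕ).map fun j => orbitProbability w.aBar (N j)
        fun b : S j => (shiftedGrid A b.1 : OnePoint (GridSpace m n))) (by simp)
    exact ⟨μ, hμ⟩
  have hNL := hNt.mono_left hLle
  have hTinv : MeasurePreserving w.aBar (μ : Measure _) μ :=
    measurePreserving_of_tendsto_orbitMeasure w.continuous_aBar hNL hμ
  have hmap : (μ : Measure _).map (gridProjBar (m := m) (n := n)) = μA :=
    w.map_gridProjBar_eq_of_tendsto hμ fun f => ((hlim f).comp hi).mono_left hLle
  have hη : μA.real {OnePoint.infty} =
      (μ : Measure (OnePoint (GridSpace m n))).real {OnePoint.infty} := by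
    rw [← hmap, map_measureReal_apply continuous_gridProjBar.measurable (measurableSet_singleton _)]
    congr 1
    ext y
    exact gridProjBar_eq_infty_iff
  obtain ⟨μ', hμ', hinv, hdec⟩ := w.exists_invariant_part hTinv hex
  have hsupp := w.support_subset_of_forall_lt (ε := ε) (μ := (μ : Measure _)) (fun ε' hε' => by
    refine measure_compl_eq_zero_of_tendsto_orbitMeasure (t := T) (Eventually.of_forall hT) hLle
      (isClosed_coe_image_union_infty (w.isClosed_target ε')) ?_ hμ
    have h1 : Tendsto (fun j : ℕ => ε * (1 - 1 / ((j : ℝ) + 2))) atTop (𝓝 (ε * (1 - 0))) := by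
      refine (tendsto_const_nhds.sub ?_).const_mul ε
      have := (tendsto_one_div_add_atTop_nhds_zero_nat (𝕜 := ℝ)).comp (tendsto_add_atTop_nat 1)
      refine this.congr fun j => ?_
      simp only [Function.comp_apply]
      push_cast
      ring
    rw [sub_zero, mul_one] at h1
    filter_upwards [hLle (h1.eventually_const_lt hε')] with j hj b l hl
    rw [aBar_iterate_coe]
    exact Or.inl (mem_image_of_mem _ (w.target_anti hj.le (htarget j b b.2 l hl))))
  refine ⟨μ, inferInstance, hTinv, hsupp, hmap, μ', hμ', hinv, by rw [hη]; exact hdec,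
    fun 𝒜 h𝒜 => ?_⟩
  rw [hη]
  have hcard' : ∀ c' < 1 - w.r 0 * ((m : ℝ) - (dimH (w.Bad A ε)).toReal),
      ∀ᶠ j in L, N j * c' ≤ Real.log (S j).card := by
    intro c' hc'
    have h1 : ∀ᶠ j : ℕ in atTop, 1 / ((j : ℝ) + 1) <
        1 - w.r 0 * ((m : ℝ) - (dimH (w.Bad A ε)).toReal) - c' :=
      tendsto_one_div_add_atTop_nhds_zero_nat.eventually_lt_const (by linarith)
    filter_upwards [hLle h1] with j hj
    refine le_trans ?_ (hcard j)
    exact mul_le_mul_of_nonneg_left (by linarith) (Nat.cast_nonneg _)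
  refine le_trans (ENNReal.ofReal_le_ofReal ?_) (w.ofReal_sub_measureReal_infty_le_dynEntropy hNL
    hunit hsep hcard' hμ hinv (fun M hM hM0 => ?_) h𝒜)
  · linarith
  · rw [hdec, Measure.add_apply, Measure.smul_apply, Measure.smul_apply,
      (GridSpace.measurableEmbedding_coe (m := m) (n := n)).map_apply,
      preimage_image_eq _ OnePoint.coe_injective, hM0,
      Measure.dirac_apply' _ (GridSpace.measurableEmbedding_coe.measurableSet_image.2 hM)]
    simp

end Weights

end ExistsMeasure

/-! ### Escape of mass and the masses of limit measures at infinity. -/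

section Escape

variable {m n : ℕ} (w : Weights m n)

namespace Weights

/-- The time-one map on the one-point compactification of `X`. -/
noncomputable def latticeMap : OnePoint (LatticeSpace m n) → OnePoint (LatticeSpace m n) :=
  OnePoint.map fun x => w.flow 1 • x

theorem latticeMap_iterate_coe (l : ℕ) (x : LatticeSpace m n) :
    w.latticeMap^[l] (x : OnePoint (LatticeSpace m n)) =
      ((w.flow l • x : LatticeSpace m n) : OnePoint (LatticeSpace m n)) := by
  induction l with
  | zero => simp [flow_zero]
  | succ l ih =>
    rw [Function.iterate_succ_apply', ih]
    change ((w.flow 1 • w.flow l • x : LatticeSpace m n) : OnePoint (LatticeSpace m n)) = _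
    rw [smul_smul, ← flow_add, Nat.cast_succ, add_comm (1 : ℝ)]

/-- The empirical measures of the orbit of `x_A`. -/
noncomputable def empirical (A : Matrix (Fin m) (Fin n) ℝ) (N : ℕ) :
    ProbabilityMeasure (OnePoint (LatticeSpace m n)) :=
  orbitProbability w.latticeMap (N + 1) fun _ : Unit => (latticeOf A : OnePoint (LatticeSpace m n))

theorem coe_empirical (A : Matrix (Fin m) (Fin n) ℝ) (N : ℕ) :
    (w.empirical A N : Measure _) = orbitMeasure w.latticeMap (N + 1)
      fun _ : Unit => (latticeOf A : OnePoint (LatticeSpace m n)) := rfl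

theorem integral_empirical (A : Matrix (Fin m) (Fin n) ℝ) (N : ℕ)
    (f : C(OnePoint (LatticeSpace m n), ℝ)) : ∫ x, f x ∂(w.empirical A N : Measure _) =
      (∑ l ∈ Finset.range (N + 1), f ((w.flow l • latticeOf A : LatticeSpace m n) :
        OnePoint (LatticeSpace m n))) / ((N + 1 : ℕ) : ℝ) := by
  rw [coe_empirical, integral_orbitMeasure f.continuous]
  simp only [latticeMap_iterate_coe, Finset.univ_unique, Finset.sum_singleton, Fintype.card_unit,
    Nat.cast_one, mul_one]

theorem isLimitMeasure_of_tendsto {A : Matrix (Fin m) (Fin n) ℝ}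
    {ν : ProbabilityMeasure (OnePoint (LatticeSpace m n))} {k : ℕ → ℕ} (hk : StrictMono k)
    (h : Tendsto (fun i => w.empirical A (k i)) atTop (𝓝 ν)) : w.IsLimitMeasure A ν := by
  refine ⟨inferInstance, fun i => k i + 1, fun i j hij => Nat.succ_lt_succ (hk hij), fun f => ?_⟩
  have := ProbabilityMeasure.tendsto_iff_forall_integral_tendsto.1 h
    (BoundedContinuousFunction.mkOfCompact f)
  refine this.congr fun i => ?_
  exact w.integral_empirical A (k i) f

theorem IsLimitMeasure.exists_tendsto {A : Matrix (Fin m) (Fin n) ℝ}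
    {ν : Measure (OnePoint (LatticeSpace m n))} (h : w.IsLimitMeasure A ν) :
    ∃ (ν' : ProbabilityMeasure (OnePoint (LatticeSpace m n))) (k : ℕ → ℕ), (ν' : Measure _) = ν ∧
      Tendsto k atTop atTop ∧ Tendsto (fun i => w.empirical A (k i)) atTop (𝓝 ν') := by
  obtain ⟨hp, k, hk, hlim⟩ := h
  -- `empirical A N` averages over N + 1 times, and k (i + 1) ≥ 1 because k is strictly increasing.
  refine ⟨⟨ν, hp⟩, fun i => k (i + 1) - 1, rfl, ?_, ?_⟩
  · exact (tendsto_sub_atTop_nat 1).comp (hk.tendsto_atTop.comp (tendsto_add_atTop_nat 1))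
  · refine ProbabilityMeasure.tendsto_iff_forall_integral_tendsto.2 fun f => ?_
    refine ((hlim f.toContinuousMap).comp (tendsto_add_atTop_nat 1)).congr fun i => ?_
    have hpos : 0 < k (i + 1) := (Nat.zero_le _).trans_lt (hk (Nat.succ_pos i))
    have e := w.integral_empirical A (k (i + 1) - 1) f.toContinuousMap
    rw [Nat.sub_add_cancel hpos] at e
    exact e.symm

theorem empirical_real {A : Matrix (Fin m) (Fin n) ℝ} {N : ℕ}
    {U : Set (OnePoint (LatticeSpace m n))} (hU : MeasurableSet U)
    [DecidablePred fun l : ℕ => ((w.flow l • latticeOf A : LatticeSpace m n) :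
      OnePoint (LatticeSpace m n)) ∈ U] :
    (w.empirical A N : Measure _).real U = (((Finset.range (N + 1)).filter fun l : ℕ =>
      ((w.flow l • latticeOf A : LatticeSpace m n) : OnePoint (LatticeSpace m n)) ∈ U).card : ℝ) /
        ((N + 1 : ℕ) : ℝ) := by
  rw [coe_empirical]
  exact orbitMeasure_real_of_forall hU fun l _ => by rw [latticeMap_iterate_coe]

/-- The number of the times up to `N` outside `Q`. -/
noncomputable def escapeCount (x : LatticeSpace m n) (Q : Set (LatticeSpace m n)) (N : ℕ) : ℕ :=
  {ℓ : ℕ | 1 ≤ ℓ ∧ ℓ ≤ N ∧ w.flow ℓ • x ∉ Q}.ncard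

open Classical in
theorem escapeCount_eq (x : LatticeSpace m n) (Q : Set (LatticeSpace m n)) (N : ℕ) :
    w.escapeCount x Q N = ((Finset.Icc 1 N).filter fun ℓ : ℕ => w.flow ℓ • x ∉ Q).card := by
  rw [escapeCount, ← ncard_coe_finset]
  congr 1
  ext ℓ
  simp [and_assoc]

theorem escapeCount_le (x : LatticeSpace m n) (Q : Set (LatticeSpace m n)) (N : ℕ) :
    w.escapeCount x Q N ≤ N := by
  classical
  rw [escapeCount_eq]
  exact (Finset.card_filter_le _ _).trans (by simp)

theorem escapeCount_div_mem (x : LatticeSpace m n) (Q : Set (LatticeSpace m n)) (N : ℕ) :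
    (w.escapeCount x Q N : ℝ) / N ∈ Icc (0 : ℝ) 1 :=
  ⟨by positivity, div_le_one_of_le₀ (by exact_mod_cast w.escapeCount_le x Q N) (by positivity)⟩

open Classical in
theorem escapeCount_le_filter (x : LatticeSpace m n) (Q : Set (LatticeSpace m n)) (N : ℕ) :
    w.escapeCount x Q N ≤ ((Finset.range N).filter fun ℓ : ℕ => w.flow ℓ • x ∉ Q).card + 1 := by
  rw [escapeCount_eq]
  have h : (Finset.Icc 1 N).filter (fun ℓ : ℕ => w.flow ℓ • x ∉ Q) ⊆
      insert N ((Finset.range N).filter fun ℓ : ℕ => w.flow ℓ • x ∉ Q) := by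
    intro l
    simp only [Finset.mem_filter, Finset.mem_Icc, Finset.mem_insert, Finset.mem_range]
    rintro ⟨⟨h1, h2⟩, h3⟩
    rcases h2.eq_or_lt with h | h
    · exact Or.inl h
    · exact Or.inr ⟨h, h3⟩
  exact (Finset.card_le_card h).trans (Finset.card_insert_le _ _)

open Classical in
theorem filter_le_escapeCount (x : LatticeSpace m n) (Q : Set (LatticeSpace m n)) (N : ℕ) :
    ((Finset.range N).filter fun ℓ : ℕ => w.flow ℓ • x ∉ Q).card ≤ w.escapeCount x Q N + 1 := by
  rw [escapeCount_eq]
  have h : (Finset.range N).filter (fun ℓ : ℕ => w.flow ℓ • x ∉ Q) ⊆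
      insert 0 ((Finset.Icc 1 N).filter fun ℓ : ℕ => w.flow ℓ • x ∉ Q) := by
    intro l
    simp only [Finset.mem_filter, Finset.mem_Icc, Finset.mem_insert, Finset.mem_range]
    rintro ⟨h1, h2⟩
    rcases Nat.eq_zero_or_pos l with h | h
    · exact Or.inl h
    · exact Or.inr ⟨⟨h, h1.le⟩, h2⟩
  exact (Finset.card_le_card h).trans (Finset.card_insert_le _ _)

end Weights

/-- Q is the complement of a small ball around ∞ whose bounding sphere is null, so that visit
frequencies outside Q converge to the mass of the ball. -/
theorem exists_compact_level (ν : Measure (OnePoint (LatticeSpace m n))) [IsProbabilityMeasure ν]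
    {V : Set (OnePoint (LatticeSpace m n))} (hV : V ∈ 𝓝 OnePoint.infty) :
    ∃ (Q : Set (LatticeSpace m n)) (U : Set (OnePoint (LatticeSpace m n))), IsCompact Q ∧
      MeasurableSet U ∧ AELocallyConstant ν (fun x => x ∈ U) ∧ U ⊆ V ∧ OnePoint.infty ∈ U ∧
      ∀ x : LatticeSpace m n, (x : OnePoint (LatticeSpace m n)) ∈ U ↔ x ∉ Q := by
  let _ := TopologicalSpace.metrizableSpaceMetric (OnePoint (LatticeSpace m n))
  obtain ⟨r, hr, hrV⟩ := Metric.mem_nhds_iff.1 hV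
  set ψ : OnePoint (LatticeSpace m n) → ℝ := fun x => dist x OnePoint.infty with hψ
  have hψc : Continuous ψ := continuous_id.dist continuous_const
  have hψ0 : ψ OnePoint.infty = 0 := dist_self _
  obtain ⟨ρ, hρ, hρ0⟩ := exists_null_level (μ := ν) hψc.measurable hr
  refine ⟨(↑) ⁻¹' {x | ρ ≤ ψ x}, {x | ψ x < ρ}, ?_, measurableSet_lt hψc.measurable measurable_const,
    ?_, fun x hx => hrV (lt_trans (b := ρ) hx hρ.2), ?_, fun x => ?_⟩
  · refine (OnePoint.isOpenEmbedding_coe.toIsInducing.isCompact_preimage_iff ?_).2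
      (isClosed_le continuous_const hψc).isCompact
    intro x hx
    induction x using OnePoint.rec with
    | infty =>
      have h1 : ρ ≤ ψ OnePoint.infty := hx
      exact absurd (hψ0 ▸ h1) (not_le.2 hρ.1)
    | coe x => exact mem_range_self x
  · convert (aelocallyConstant_lt hψc hρ0).map fun b => b = true using 1
    ext x
    simp
  · change ψ OnePoint.infty < ρ
    rw [hψ0]; exact hρ.1
  · exact (not_le (a := ρ) (b := ψ x)).symm

namespace Weights

theorem tendsto_empirical_real {A : Matrix (Fin m) (Fin n) ℝ}
    {ν : ProbabilityMeasure (OnePoint (LatticeSpace m n))} {k : ℕ → ℕ}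
    (h : Tendsto (fun i => w.empirical A (k i)) atTop (𝓝 ν))
    {U : Set (OnePoint (LatticeSpace m n))}
    (hU : AELocallyConstant (ν : Measure _) (fun x => x ∈ U)) :
    Tendsto (fun i => (w.empirical A (k i) : Measure _).real U) atTop
      (𝓝 ((ν : Measure _).real U)) := by
  have := tendsto_measureReal_label h hU True
  have e : (fun x => x ∈ U) ⁻¹' {True} = U := by ext x; simp
  rwa [e] at this

/-- The averages use the times 0, …, N and the escape counts the times 1, …, N + 1; the counts
differ by at most 1. -/
theorem abs_empirical_sub_escapeCount_le {A : Matrix (Fin m) (Fin n) ℝ} {N : ℕ}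
    {U : Set (OnePoint (LatticeSpace m n))} (hU : MeasurableSet U) {Q : Set (LatticeSpace m n)}
    (hUQ : ∀ x : LatticeSpace m n, (x : OnePoint (LatticeSpace m n)) ∈ U ↔ x ∉ Q) :
    |(w.empirical A N : Measure _).real U -
      (w.escapeCount (latticeOf A) Q (N + 1) : ℝ) / ((N + 1 : ℕ) : ℝ)| ≤ 1 / ((N : ℝ) + 1) := by
  classical
  rw [w.empirical_real hU]
  simp only [hUQ]
  have h1 : (w.escapeCount (latticeOf A) Q (N + 1) : ℝ) ≤ ((((Finset.range (N + 1)).filter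
      fun ℓ : ℕ => w.flow ℓ • latticeOf A ∉ Q).card : ℕ) : ℝ) + 1 := by
    exact_mod_cast w.escapeCount_le_filter (latticeOf A) Q (N + 1)
  have h2 : ((((Finset.range (N + 1)).filter
      fun ℓ : ℕ => w.flow ℓ • latticeOf A ∉ Q).card : ℕ) : ℝ) ≤
      w.escapeCount (latticeOf A) Q (N + 1) + 1 := by
    exact_mod_cast w.filter_le_escapeCount (latticeOf A) Q (N + 1)
  rw [← sub_div, abs_div, Nat.cast_add_one, abs_of_pos (by positivity : (0 : ℝ) < (N : ℝ) + 1)]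
  gcongr
  rw [abs_le]
  constructor <;> linarith

theorem tendsto_escapeCount {A : Matrix (Fin m) (Fin n) ℝ}
    {ν : ProbabilityMeasure (OnePoint (LatticeSpace m n))} {k : ℕ → ℕ} (hk : Tendsto k atTop atTop)
    (h : Tendsto (fun i => w.empirical A (k i)) atTop (𝓝 ν))
    {U : Set (OnePoint (LatticeSpace m n))} (hUm : MeasurableSet U)
    (hU : AELocallyConstant (ν : Measure _) (fun x => x ∈ U)) {Q : Set (LatticeSpace m n)}
    (hUQ : ∀ x : LatticeSpace m n, (x : OnePoint (LatticeSpace m n)) ∈ U ↔ x ∉ Q) :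
    Tendsto (fun i => (w.escapeCount (latticeOf A) Q (k i + 1) : ℝ) / ((k i + 1 : ℕ) : ℝ)) atTop
      (𝓝 ((ν : Measure _).real U)) := by
  have h1 := w.tendsto_empirical_real h hU
  have h2 : Tendsto (fun i => (w.empirical A (k i) : Measure _).real U -
      (w.escapeCount (latticeOf A) Q (k i + 1) : ℝ) / ((k i + 1 : ℕ) : ℝ)) atTop (𝓝 0) :=
    squeeze_zero_norm (fun i => w.abs_empirical_sub_escapeCount_le hUm hUQ)
      ((tendsto_one_div_add_atTop_nhds_zero_nat (𝕜 := ℝ)).comp hk)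
  have h3 := h1.sub h2
  simpa using h3

/-- Along the times defining ν the frequency outside a large compact set tends to a number close to
ν({∞}), and the lower limit over all times cannot be larger. -/
theorem escape_le_of_hasEscape {A : Matrix (Fin m) (Fin n) ℝ} {δ : ℝ}
    (hδ : w.HasEscape (latticeOf A) δ) {ν : Measure (OnePoint (LatticeSpace m n))}
    (hν : w.IsLimitMeasure A ν) : δ ≤ ν.real {OnePoint.infty} := by
  obtain ⟨ν, k, rfl, hk, hlim⟩ := IsLimitMeasure.exists_tendsto w hν
  by_contra! hlt
  obtain ⟨c, hc1, hc2⟩ := exists_between hlt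
  obtain ⟨V, hV, hVc⟩ : ∃ V : Set (OnePoint (LatticeSpace m n)), V ∈ 𝓝 OnePoint.infty ∧
      (ν : Measure _).real V < c := by
    obtain ⟨V, hVsub, hVo, hVlt⟩ := Set.exists_isOpen_lt_of_lt (μ := (ν : Measure _))
      ({OnePoint.infty} : Set (OnePoint (LatticeSpace m n))) (ENNReal.ofReal c) (by
        rw [← ofReal_measureReal (measure_ne_top _ _)]
        exact (ENNReal.ofReal_lt_ofReal_iff (measureReal_nonneg.trans_lt hc1)).2 hc1)
    refine ⟨V, hVo.mem_nhds (hVsub rfl), ?_⟩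
    exact (ENNReal.toReal_lt_of_lt_ofReal hVlt)
  obtain ⟨Q, U, hQ, hUm, hUc, hUV, -, hUQ⟩ := exists_compact_level (ν : Measure _) hV
  have h1 := w.tendsto_escapeCount hk hlim hUm hUc hUQ
  have h2 : (ν : Measure _).real U < c := (measureReal_mono hUV).trans_lt hVc
  have h3 : ∀ᶠ N : ℕ in atTop, c < (w.escapeCount (latticeOf A) Q N : ℝ) / (N : ℝ) :=
    eventually_lt_of_lt_liminf (hc2.trans_le (hδ Q hQ))
      ⟨0, eventually_map.2 (Eventually.of_forall fun N : ℕ =>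
        (w.escapeCount_div_mem (latticeOf A) Q N).1)⟩
  have h4 : Tendsto (fun i => k i + 1) atTop atTop := (tendsto_add_atTop_nat 1).comp hk
  obtain ⟨i, hi, hi'⟩ := ((h4.eventually h3).and (h1.eventually_lt_const h2)).exists
  exact lt_asymm hi hi'

/-- If the frequency outside Q were below c' < c infinitely often, a limit of the averages at such
times would give a neighbourhood of ∞ disjoint from Q mass at most c'. -/
theorem hasEscape_of_forall_le {A : Matrix (Fin m) (Fin n) ℝ} {c : ℝ}
    (hc : ∀ ν, w.IsLimitMeasure A ν → c ≤ ν.real {OnePoint.infty}) :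
    w.HasEscape (latticeOf A) c := by
  intro Q hQ
  by_contra! hlt
  obtain ⟨c', hc1, hc2⟩ := exists_between hlt
  have hbdd : IsCoboundedUnder (· ≥ ·) atTop
      (fun N : ℕ => (w.escapeCount (latticeOf A) Q N : ℝ) / (N : ℝ)) :=
    IsBoundedUnder.isCoboundedUnder_ge
      ⟨1, eventually_map.2 (Eventually.of_forall fun N =>
        (w.escapeCount_div_mem (latticeOf A) Q N).2)⟩
  have hfreq : ∃ᶠ N : ℕ in atTop, (w.escapeCount (latticeOf A) Q N : ℝ) / (N : ℝ) < c' :=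
    frequently_lt_of_liminf_lt hbdd hc1
  have hfreq' : ∃ᶠ N : ℕ in atTop,
      (w.escapeCount (latticeOf A) Q (N + 1) : ℝ) / ((N + 1 : ℕ) : ℝ) < c' := by
    rw [frequently_atTop] at hfreq ⊢
    intro M
    obtain ⟨N, hN, h⟩ := hfreq (M + 1)
    refine ⟨N - 1, by omega, ?_⟩
    rwa [Nat.sub_add_cancel (by omega)]
  obtain ⟨φ, hφ, hφlt⟩ := extraction_of_frequently_atTop hfreq'
  obtain ⟨ν, θ, hθ, hlim⟩ := CompactSpace.tendsto_subseq fun i => w.empirical A (φ i)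
  have hk : StrictMono (φ ∘ θ) := hφ.comp hθ
  have hν := hc _ (w.isLimitMeasure_of_tendsto hk hlim)
  have hV : (((↑) : LatticeSpace m n → OnePoint (LatticeSpace m n)) '' Q)ᶜ ∈
      𝓝 (OnePoint.infty : OnePoint (LatticeSpace m n)) :=
    ((hQ.image OnePoint.continuous_coe).isClosed.isOpen_compl).mem_nhds (by simp)
  obtain ⟨Q', U, hQ', hUm, hUc, hUV, hUinf, hUQ⟩ := exists_compact_level (ν : Measure _) hV
  have h1 := w.tendsto_escapeCount hk.tendsto_atTop hlim hUm hUc hUQ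
  have h2 : c ≤ (ν : Measure _).real U :=
    hν.trans (measureReal_mono (singleton_subset_iff.2 hUinf))
  have hQQ : Q ⊆ Q' := by
    intro x hx
    by_contra hx'
    exact hUV ((hUQ x).2 hx') (mem_image_of_mem _ hx)
  obtain ⟨i, hi⟩ := (h1.eventually_const_lt (hc2.trans_le h2)).exists
  have h3 : w.escapeCount (latticeOf A) Q' ((φ ∘ θ) i + 1) ≤
      w.escapeCount (latticeOf A) Q ((φ ∘ θ) i + 1) := by
    classical
    rw [escapeCount_eq, escapeCount_eq]
    exact Finset.card_le_card (Finset.monotone_filter_right _ fun l _ h h' => h (hQQ h'))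
  have h4 : (w.escapeCount (latticeOf A) Q' ((φ ∘ θ) i + 1) : ℝ) / (((φ ∘ θ) i + 1 : ℕ) : ℝ) ≤
      (w.escapeCount (latticeOf A) Q ((φ ∘ θ) i + 1) : ℝ) / (((φ ∘ θ) i + 1 : ℕ) : ℝ) := by
    gcongr
  exact lt_irrefl _ ((hi.trans_le h4).trans (hφlt (θ i)))

/-- The δ for which x_A has δ-escape are exactly the lower bounds of the masses at ∞. Since 0 is one
of them and a limit measure exists by compactness, `sSup` is taken over a nonempty bounded set. -/
theorem isGLB_maxEscape (A : Matrix (Fin m) (Fin n) ℝ) :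
    IsGLB {η : ℝ | ∃ ν, w.IsLimitMeasure A ν ∧ ν.real {OnePoint.infty} = η} (w.maxEscape A) := by
  have h0 : w.HasEscape (latticeOf A) 0 :=
    w.hasEscape_of_forall_le fun ν _ => measureReal_nonneg
  constructor
  · rintro _ ⟨ν, hν, rfl⟩
    exact csSup_le ⟨0, h0⟩ fun δ hδ => w.escape_le_of_hasEscape hδ hν
  · intro c hc
    obtain ⟨ν₀, θ, hθ, hlim⟩ := CompactSpace.tendsto_subseq fun i => w.empirical A i
    have hν₀ := w.isLimitMeasure_of_tendsto hθ hlim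
    exact le_csSup ⟨_, fun δ hδ => w.escape_le_of_hasEscape hδ hν₀⟩
      (w.hasEscape_of_forall_le fun ν hν => hc ⟨ν, hν, rfl⟩)

end Weights

end Escape

/-! ### Orders in totally real fields. -/

section TotallyReal

open Polynomial

/-- A polynomial which is Eisenstein at `2` and changes sign often. -/
noncomputable def eisensteinPoly (d : ℕ) : ℤ[X] :=
  (∏ k ∈ Finset.range d, (X - C (4 * ((k : ℤ) + 1)))) + C 2

theorem monic_prod_X_sub (d : ℕ) :
    (∏ k ∈ Finset.range d, (X - C (4 * ((k : ℤ) + 1)))).Monic :=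
  monic_prod_of_monic _ _ fun _ _ => monic_X_sub_C _

theorem natDegree_prod_X_sub (d : ℕ) :
    (∏ k ∈ Finset.range d, (X - C (4 * ((k : ℤ) + 1)))).natDegree = d := by
  rw [natDegree_prod_of_monic _ _ fun _ _ => monic_X_sub_C _]
  simp only [natDegree_X_sub_C, Finset.sum_const, Finset.card_range, smul_eq_mul, mul_one]

theorem natDegree_eisensteinPoly (d : ℕ) : (eisensteinPoly d).natDegree = d := by
  rw [eisensteinPoly, natDegree_add_C, natDegree_prod_X_sub]

theorem monic_eisensteinPoly {d : ℕ} (hd : 0 < d) : (eisensteinPoly d).Monic := by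
  refine (monic_prod_X_sub d).add_of_left ?_
  rw [degree_eq_natDegree (monic_prod_X_sub d).ne_zero, natDegree_prod_X_sub]
  exact degree_C_le.trans_lt (by exact_mod_cast hd)

theorem irreducible_eisensteinPoly {d : ℕ} (hd : 0 < d) : Irreducible (eisensteinPoly d) := by
  have hprime : (Ideal.span {(2 : ℤ)}).IsPrime :=
    (Ideal.span_singleton_prime (by norm_num)).2 Int.prime_two
  suffices heis : (eisensteinPoly d).IsEisensteinAt (Ideal.span {(2 : ℤ)}) from
    heis.irreducible hprime (monic_eisensteinPoly hd).isPrimitive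
      (by rw [natDegree_eisensteinPoly]; exact hd)
  refine ⟨?_, fun {k} hk => ?_, ?_⟩
  · rw [(monic_eisensteinPoly hd).leadingCoeff]
    exact fun h => hprime.ne_top ((Ideal.eq_top_iff_one _).2 h)
  · rw [natDegree_eisensteinPoly] at hk
    have hmap : (eisensteinPoly d).map (Int.castRingHom (ZMod 2)) = X ^ d := by
      have h4 : (4 : (ZMod 2)[X]) = 0 := by
        exact_mod_cast (CharP.cast_eq_zero_iff (ZMod 2)[X] 2 4).2 (by norm_num)
      have h2 : (2 : (ZMod 2)[X]) = 0 := by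
        exact_mod_cast (CharP.cast_eq_zero_iff (ZMod 2)[X] 2 2).2 (by norm_num)
      rw [eisensteinPoly, Polynomial.map_add, Polynomial.map_prod]
      simp [h4, h2]
    have hc := congrArg (fun q => q.coeff k) hmap
    simp only [coeff_map, coeff_X_pow, if_neg hk.ne, eq_intCast] at hc
    rw [Ideal.mem_span_singleton]
    exact_mod_cast (ZMod.intCast_zmod_eq_zero_iff_dvd _ 2).1 hc
  · rw [Ideal.span_singleton_pow, Ideal.mem_span_singleton, coeff_zero_eq_eval_zero, eisensteinPoly,
      eval_add, eval_prod, eval_C]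
    intro h
    have h4 : (2 : ℤ) ^ 2 ∣ ∏ k ∈ Finset.range d, eval 0 (X - C (4 * ((k : ℤ) + 1))) := by
      refine dvd_trans ?_ (Finset.dvd_prod_of_mem _ (Finset.mem_range.2 hd))
      simp
    have := (Int.dvd_add_right h4).1 h
    norm_num at this

theorem eval_eisensteinPoly (d : ℕ) (x : ℤ) :
    (eisensteinPoly d).eval x = (∏ k ∈ Finset.range d, (x - 4 * ((k : ℤ) + 1))) + 2 := by
  rw [eisensteinPoly, eval_add, eval_prod, eval_C]
  simp

/-- At integers congruent to 2 modulo 4 the product is at least 2^d ≥ 4 in absolute value, so adding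
2 does not change its sign. Between 4i + 2 and 4i + 6 exactly one factor changes sign. -/
theorem eval_eisensteinPoly_mul_neg {d : ℕ} (hd : 2 ≤ d) {i : ℕ} (hi : i < d) :
    (eisensteinPoly d).eval (4 * (i : ℤ) + 2) * (eisensteinPoly d).eval (4 * (i : ℤ) + 6) < 0 := by
  rw [eval_eisensteinPoly, eval_eisensteinPoly]
  set P := ∏ k ∈ Finset.range d, (4 * (i : ℤ) + 2 - 4 * ((k : ℤ) + 1)) with hP
  set Q := ∏ k ∈ Finset.range d, (4 * (i : ℤ) + 6 - 4 * ((k : ℤ) + 1)) with hQ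
  have habs : ∀ c : ℤ, c % 4 = 2 → 4 ≤ |∏ k ∈ Finset.range d, (c - 4 * ((k : ℤ) + 1))| := by
    intro c hc
    rw [Finset.abs_prod]
    calc (4 : ℤ) = 2 ^ 2 := by norm_num
      _ ≤ 2 ^ d := pow_le_pow_right₀ (by norm_num) hd
      _ = ∏ k ∈ Finset.range d, 2 := by simp
      _ ≤ _ := Finset.prod_le_prod (fun _ _ => by norm_num) fun k _ => by
        rw [le_abs]; omega
  have hP4 : 4 ≤ |P| := habs _ (by omega)
  have hQ4 : 4 ≤ |Q| := habs _ (by omega)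
  have hPQ : P * Q < 0 := by
    rw [hP, hQ, ← Finset.prod_mul_distrib, ← Finset.mul_prod_erase _ _ (Finset.mem_range.2 hi)]
    refine mul_neg_of_neg_of_pos (by ring_nf; norm_num) (Finset.prod_pos fun k hk => ?_)
    have hne : (i : ℤ) - k ≠ 0 := by
      have := Finset.ne_of_mem_erase hk
      omega
    have h1 : 1 ≤ ((i : ℤ) - k) ^ 2 := by
      have := sq_pos_of_ne_zero hne
      omega
    nlinarith
  rcases le_abs.1 hP4 with h1 | h1 <;> rcases le_abs.1 hQ4 with h2 | h2 <;> nlinarith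

theorem exists_roots_eisensteinPoly {d : ℕ} (hd : 2 ≤ d) :
    ∃ θ : Fin d → ℝ, Function.Injective θ ∧ ∀ i, aeval (θ i) (eisensteinPoly d) = 0 := by
  have hcast : ∀ c : ℤ, aeval (c : ℝ) (eisensteinPoly d) = (((eisensteinPoly d).eval c : ℤ) : ℝ) :=
    fun c => aeval_algebraMap_apply_eq_algebraMap_eval c _
  have hroot : ∀ i : Fin d, ∃ x : ℝ, 4 * (i : ℝ) + 2 < x ∧ x < 4 * (i : ℝ) + 6 ∧
      aeval x (eisensteinPoly d) = 0 := by
    intro i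
    have hneg : aeval (4 * (i : ℝ) + 2) (eisensteinPoly d) *
        aeval (4 * (i : ℝ) + 6) (eisensteinPoly d) < 0 := by
      have h := eval_eisensteinPoly_mul_neg hd i.2
      have h1 := hcast (4 * ((i : ℕ) : ℤ) + 2)
      have h2 := hcast (4 * ((i : ℕ) : ℤ) + 6)
      push_cast at h1 h2
      rw [h1, h2]
      exact_mod_cast h
    have hc : Continuous fun x : ℝ => aeval x (eisensteinPoly d) :=
      (eisensteinPoly d).continuous_aeval
    obtain ⟨x, hx, hx0⟩ := intermediate_value_uIcc (a := 4 * (i : ℝ) + 2) (b := 4 * (i : ℝ) + 6)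
      hc.continuousOn (show (0 : ℝ) ∈ _ by
        rw [mem_uIcc]
        rcases mul_neg_iff.1 hneg with h | h
        · exact Or.inr ⟨h.2.le, h.1.le⟩
        · exact Or.inl ⟨h.1.le, h.2.le⟩)
    rw [uIcc_of_le (by linarith)] at hx
    have hx0' : aeval x (eisensteinPoly d) = 0 := hx0
    refine ⟨x, hx.1.lt_of_ne ?_, hx.2.lt_of_ne ?_, hx0'⟩
    · rintro rfl
      rw [hx0', zero_mul] at hneg
      exact lt_irrefl _ hneg
    · rintro rfl
      rw [hx0', mul_zero] at hneg
      exact lt_irrefl _ hneg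
  choose θ h1 h2 h3 using hroot
  refine ⟨θ, fun i j hij => ?_, h3⟩
  have a1 := h1 i
  have a2 := h2 i
  have b1 := h1 j
  have b2 := h2 j
  rw [hij] at a1 a2
  have c1 : (i : ℝ) < (j : ℕ) + 1 := by linarith
  have c2 : (j : ℝ) < (i : ℕ) + 1 := by linarith
  have d1 : (i : ℕ) < (j : ℕ) + 1 := by exact_mod_cast c1
  have d2 : (j : ℕ) < (i : ℕ) + 1 := by exact_mod_cast c2
  exact Fin.ext (by omega)

theorem aeval_ne_zero_of_natDegree_lt {p q : ℤ[X]} (hp : p.Monic) (hirr : Irreducible p) {θ : ℝ}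
    (hθ : aeval θ p = 0) (hq : q ≠ 0) (hdeg : q.natDegree < p.natDegree) : aeval θ q ≠ 0 := by
  intro h0
  have hint : IsIntegral ℤ θ := ⟨p, hp, by rwa [← aeval_def]⟩
  have h1 := minpoly.isIntegrallyClosed_dvd hint hθ
  have h2 := minpoly.isIntegrallyClosed_dvd hint h0
  have hassoc : Associated (minpoly ℤ θ) p :=
    (hirr.dvd_iff.1 h1).resolve_left (minpoly.not_isUnit ℤ θ) |>.symm
  exact absurd (natDegree_le_of_dvd (hassoc.symm.dvd.trans h2) hq) (not_le.2 hdeg)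

/-- The image of the order generated by a root of a totally real polynomial under the real
embeddings, with the matrices of its multiplication. -/
theorem exists_vandermonde_mul {d : ℕ} (hd : 2 ≤ d) :
    ∃ V : Matrix (Fin d) (Fin d) ℝ, V.det ≠ 0 ∧ ∀ z : Fin d → ℤ, z ≠ 0 →
      ∃ M : Matrix (Fin d) (Fin d) ℤ, V * M.map (Int.cast : ℤ → ℝ) =
        Matrix.diagonal (V.mulVec fun i => (z i : ℝ)) * V ∧ M.det ≠ 0 := by
  obtain ⟨θ, hinj, hroot⟩ := exists_roots_eisensteinPoly hd
  set p := eisensteinPoly d with hp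
  have hmonic : p.Monic := monic_eisensteinPoly (by omega)
  have hdeg : p.natDegree = d := natDegree_eisensteinPoly d
  have hV : (Matrix.vandermonde θ).det ≠ 0 := Matrix.det_vandermonde_ne_zero_iff.2 hinj
  refine ⟨Matrix.vandermonde θ, hV, fun z hz => ?_⟩
  set q : ℤ[X] := ∑ j : Fin d, C (z j) * X ^ (j : ℕ) with hq
  have hqcoeff : ∀ j : Fin d, q.coeff j = z j := by
    intro j
    rw [hq, finsetSum_coeff, Finset.sum_eq_single j]
    · simp
    · intro k _ hk
      rw [coeff_C_mul, coeff_X_pow, if_neg fun h => hk (Fin.ext h.symm), mul_zero]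
    · simp
  have hq0 : q ≠ 0 := by
    intro h
    refine hz (funext fun j => ?_)
    rw [← hqcoeff, h, coeff_zero, Pi.zero_apply]
  have hqdeg : q.natDegree < p.natDegree := by
    rw [hdeg]
    refine (natDegree_lt_iff_degree_lt hq0).2 ?_
    exact degree_sum_fin_lt z
  have hqeval : ∀ i, aeval (θ i) q = (Matrix.vandermonde θ).mulVec (fun i => (z i : ℝ)) i := by
    intro i
    rw [hq, map_sum, Matrix.mulVec, dotProduct]
    refine Finset.sum_congr rfl fun j _ => ?_
    simp [Matrix.vandermonde_apply, mul_comm]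
  -- Matrix of multiplication by q on ℤ[X]/(p) in the basis of powers of X. Evaluation at the d real
  -- roots, which is the Vandermonde matrix, diagonalises it with eigenvalues q(θ_i), all nonzero as
  -- q has smaller degree than the irreducible p.
  set M : Matrix (Fin d) (Fin d) ℤ := Matrix.of fun k j => ((q * X ^ (j : ℕ)) %ₘ p).coeff k with hM
  have hmul : Matrix.vandermonde θ * M.map (Int.cast : ℤ → ℝ) =
      Matrix.diagonal ((Matrix.vandermonde θ).mulVec fun i => (z i : ℝ)) * Matrix.vandermonde θ := by
    ext i j
    rw [Matrix.diagonal_mul, ← hqeval, Matrix.mul_apply]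
    have hlt : ((q * X ^ (j : ℕ)) %ₘ p).natDegree < d := by
      refine (natDegree_modByMonic_lt _ hmonic fun h1 => ?_).trans_eq hdeg
      rw [h1, natDegree_one] at hdeg
      omega
    have e : aeval (θ i) ((q * X ^ (j : ℕ)) %ₘ p) = aeval (θ i) q * θ i ^ (j : ℕ) := by
      rw [aeval_modByMonic_eq_self_of_root (hroot i)]
      simp
    rw [Matrix.vandermonde_apply, ← e, aeval_eq_sum_range' hlt, ← Fin.sum_univ_eq_sum_range
      (fun k => ((q * X ^ (j : ℕ)) %ₘ p).coeff k • θ i ^ k)]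
    refine Finset.sum_congr rfl fun k _ => ?_
    simp [hM, Matrix.vandermonde_apply, mul_comm]
  refine ⟨M, hmul, fun hdet => ?_⟩
  have h := congrArg Matrix.det hmul
  rw [Matrix.det_mul, Matrix.det_mul, Matrix.det_diagonal] at h
  have h0 : (M.map (Int.cast : ℤ → ℝ)).det = 0 := by
    have := (Int.castRingHom ℝ).map_det M
    rw [RingHom.mapMatrix_apply, hdet, map_zero] at this
    exact this.symm
  rw [h0, mul_zero] at h
  rcases mul_eq_zero.1 h.symm with h1 | h1
  · obtain ⟨i, -, hi⟩ := Finset.prod_eq_zero_iff.1 h1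
    rw [← hqeval] at hi
    exact aeval_ne_zero_of_natDegree_lt hmonic (irreducible_eisensteinPoly (by omega)) (hroot i) hq0
      hqdeg hi
  · exact hV h1

theorem exists_matrix_mul (ι : Type*) [Fintype ι] [DecidableEq ι] (hι : 2 ≤ Fintype.card ι) :
    ∃ V : Matrix ι ι ℝ, V.det ≠ 0 ∧ ∀ z : ι → ℤ, z ≠ 0 →
      ∃ M : Matrix ι ι ℤ, V * M.map (Int.cast : ℤ → ℝ) =
        Matrix.diagonal (V.mulVec fun i => (z i : ℝ)) * V ∧ M.det ≠ 0 := by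
  obtain ⟨V, hV, h⟩ := exists_vandermonde_mul hι
  set e := Fintype.equivFin ι with he
  refine ⟨V.submatrix e e, by rwa [Matrix.det_submatrix_equiv_self], fun z hz => ?_⟩
  obtain ⟨M, hM, hdet⟩ := h (z ∘ e.symm) fun h0 => hz (by
    funext i
    simpa using congrFun h0 (e i))
  refine ⟨M.submatrix e e, ?_, by rwa [Matrix.det_submatrix_equiv_self]⟩
  rw [← Matrix.submatrix_map, Matrix.submatrix_mul_equiv, hM, ← Matrix.submatrix_mul_equiv _ _ _ e,
    Matrix.submatrix_diagonal_equiv]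
  congr 2
  funext i
  simp only [Function.comp_apply, Matrix.mulVec, dotProduct, Matrix.submatrix_apply]
  exact (Fintype.sum_equiv e _ _ fun j => by simp).symm

end TotallyReal

/-! ### A lattice with a bounded orbit. -/

section BoundedOrbit

/-- Minkowski's theorem for a parallelepiped. -/
theorem exists_int_abs_mulVec_le {ι : Type*} [Fintype ι] [DecidableEq ι] {H : Matrix ι ι ℝ}
    (hH : H.det ≠ 0) {C : ℝ} (hC : 0 < C) (hdet : |H.det| < C ^ Fintype.card ι) :
    ∃ z : ι → ℤ, z ≠ 0 ∧ ∀ i, |H.mulVec (fun j => (z j : ℝ)) i| ≤ C := by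
  set s : Set (ι → ℝ) := Matrix.toLin' H ⁻¹' Set.pi univ fun _ => Icc (-C) C with hs
  have hdet' : LinearMap.det (Matrix.toLin' H) ≠ 0 := by rwa [LinearMap.det_toLin']
  have hvol : volume s = ENNReal.ofReal (|H.det|⁻¹ * (2 * C) ^ Fintype.card ι) := by
    rw [hs, Measure.addHaar_preimage_linearMap _ hdet', LinearMap.det_toLin', volume_pi_pi]
    simp only [Real.volume_Icc, Finset.prod_const, Finset.card_univ]
    rw [← ENNReal.ofReal_pow (by linarith), ← ENNReal.ofReal_mul (abs_nonneg _), abs_inv]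
    congr 3
    ring
  have hfund := ZSpan.isAddFundamentalDomain' (Pi.basisFun ℝ ι) volume
  have hconv : Convex ℝ s := (convex_pi fun _ _ => convex_Icc (-C) C).linear_preimage _
  have hsymm : ∀ x ∈ s, -x ∈ s := by
    intro x hx i hi
    have := hx i hi
    rw [map_neg]
    exact ⟨neg_le_neg this.2, by have := this.1; simp only [Pi.neg_apply]; linarith⟩
  have hlt : volume (ZSpan.fundamentalDomain (Pi.basisFun ℝ ι)) *
      2 ^ Module.finrank ℝ (ι → ℝ) < volume s := by
    rw [ZSpan.fundamentalDomain_pi_basisFun, volume_pi_pi, hvol]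
    simp only [Real.volume_Ico, sub_zero, ENNReal.ofReal_one, Finset.prod_const_one, one_mul,
      Module.finrank_fintype_fun_eq_card]
    rw [← ENNReal.ofReal_ofNat, ← ENNReal.ofReal_pow (by norm_num)]
    refine (ENNReal.ofReal_lt_ofReal_iff (by positivity)).2 ?_
    rw [mul_pow, inv_mul_eq_div, lt_div_iff₀ (abs_pos.2 hH)]
    exact mul_lt_mul_of_pos_left hdet (by positivity)
  have : Countable (Submodule.span ℤ (range (Pi.basisFun ℝ ι))).toAddSubgroup :=
    inferInstanceAs (Countable (Submodule.span ℤ (range (Pi.basisFun ℝ ι))))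
  obtain ⟨⟨x, hxL⟩, hx0, hxs⟩ := exists_ne_zero_mem_lattice_of_measure_mul_two_pow_lt_measure hfund
    hsymm hconv hlt
  have hint := ((Pi.basisFun ℝ ι).mem_span_iff_repr_mem ℤ x).1 hxL
  choose z hz using hint
  have hzx : (fun j => (z j : ℝ)) = x := by
    funext j
    have := hz j
    simpa using this
  refine ⟨z, ?_, fun i => ?_⟩
  · rintro rfl
    refine hx0 (Subtype.ext ?_)
    change x = 0
    rw [← hzx]
    funext j
    simp
  · rw [hzx]
    have := hxs i (mem_univ i)
    rw [Matrix.toLin'_apply] at this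
    exact abs_le.2 this

/-- Integer matrices of bounded nonzero determinant fall into finitely many cosets of `SL`. -/
theorem exists_coset_representatives {ι : Type*} [Fintype ι] [DecidableEq ι] (B : ℕ)
    (f : Matrix ι ι ℤ → ℝ) : ∃ b : ℝ, ∀ M : Matrix ι ι ℤ, M.det ≠ 0 → M.det.natAbs ≤ B →
      ∃ M' : Matrix ι ι ℤ, f M' ≤ b ∧ M'.det = M.det ∧
        ∃ γ : Matrix.SpecialLinearGroup ι ℤ, M' = γ.1 * M := by
  classical
  set Ms : Set (Matrix ι ι ℤ) := {M | M.det ≠ 0 ∧ M.det.natAbs ≤ B} with hMs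
  set φ : Matrix ι ι ℤ → ℤ × (ι → ι → ℤ) := fun M => (M.det, fun i j => M i j % M.det) with hφ
  have hfin : (φ '' Ms).Finite := by
    refine Set.Finite.subset ((Set.finite_Icc (-(B : ℤ)) B).prod
      (Set.Finite.pi' fun _ => Set.Finite.pi' fun _ => Set.finite_Icc (0 : ℤ) B)) ?_
    rintro _ ⟨M, ⟨h0, hB⟩, rfl⟩
    refine ⟨?_, fun i j => ?_⟩
    · exact ⟨by change _ ≤ M.det; omega, by change M.det ≤ _; omega⟩
    · have h1 := Int.emod_nonneg (M i j) h0
      have h2 := Int.emod_lt (M i j) h0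
      exact ⟨h1, by change M i j % M.det ≤ B; omega⟩
  have hsec : ∀ v : φ '' Ms, ∃ M ∈ Ms, φ M = v.1 := fun v => v.2
  choose g hg hg' using hsec
  have := hfin.to_subtype
  obtain ⟨b, hb⟩ := (Set.finite_range fun v => f (g v)).bddAbove
  refine ⟨b, fun M h0 hB => ?_⟩
  set v : φ '' Ms := ⟨φ M, mem_image_of_mem _ ⟨h0, hB⟩⟩ with hv
  have he : φ (g v) = φ M := hg' v
  have hd : (g v).det = M.det := congrArg Prod.fst he
  have hmod : ∀ i j, M.det ∣ g v i j - M i j := by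
    intro i j
    have h1 : g v i j % (g v).det = M i j % M.det := congrFun (congrFun (congrArg Prod.snd he) i) j
    rw [hd] at h1
    exact (show Int.ModEq M.det (g v i j) (M i j) from h1).symm.dvd
  choose E hE using hmod
  -- Since adj(M) M = det M, matrices of equal determinant congruent modulo it differ by an integral
  -- left factor, necessarily of determinant 1.
  have hgE : g v = (1 + Matrix.of E * M.adjugate) * M := by
    rw [add_mul, one_mul, Matrix.mul_assoc, Matrix.adjugate_mul]
    ext i j
    simp only [Matrix.add_apply, Matrix.mul_smul, Matrix.mul_one, Matrix.smul_apply, Matrix.of_apply,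
      smul_eq_mul]
    have := hE i j
    linarith
  have hdet1 : (1 + Matrix.of E * M.adjugate).det = 1 := by
    have := congrArg Matrix.det hgE
    rw [Matrix.det_mul, hd] at this
    exact mul_right_cancel₀ h0 (by rw [one_mul]; exact this.symm)
  exact ⟨g v, hb (mem_range_self v), hd, ⟨_, hdet1⟩, hgE⟩

variable {m n : ℕ} (w : Weights m n)

/-- The lattice of an order in a totally real field has a bounded orbit under the flow. -/
theorem Weights.exists_bounded_orbit [NeZero m] [NeZero n] :
    ∃ (x : LatticeSpace m n) (K : Set (LatticeSpace m n)), IsCompact K ∧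
      ∀ l : ℕ, w.flow l • x ∈ K := by
  have hcard : 2 ≤ Fintype.card (Fin m ⊕ Fin n) := by
    have h1 := NeZero.pos m
    have h2 := NeZero.pos n
    simp only [Fintype.card_sum, Fintype.card_fin]
    omega
  obtain ⟨V, hV, hmul⟩ := exists_matrix_mul (Fin m ⊕ Fin n) hcard
  set C := |V.det| + 1 with hC
  have hC1 : 1 ≤ C := le_add_of_nonneg_left (abs_nonneg _)
  set i₀ : Fin m ⊕ Fin n := Sum.inl 0 with hi₀
  set D : Matrix (Fin m ⊕ Fin n) (Fin m ⊕ Fin n) ℝ :=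
    Matrix.diagonal (Function.update 1 i₀ (V.det)⁻¹) with hD
  have hDdet : D.det = (V.det)⁻¹ := by
    rw [hD, Matrix.det_diagonal, Finset.prod_update_of_mem (Finset.mem_univ _)]
    simp
  have hg : (D * V).det = 1 := by rw [Matrix.det_mul, hDdet, inv_mul_cancel₀ hV]
  set g : SLd m n := ⟨D * V, hg⟩ with hgdef
  set B : ℕ := ⌊C ^ Fintype.card (Fin m ⊕ Fin n)⌋₊ with hB
  obtain ⟨b, hb⟩ := exists_coset_representatives (ι := Fin m ⊕ Fin n) B
    (fun M => ∑ i, ∑ j, |(D * V * (M.map (Int.cast : ℤ → ℝ))⁻¹) i j|)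
  set Q : Set (SLd m n) := {h | ∀ i j, |h.1 i j| ≤ C * b} with hQ
  have hQc : IsCompact Q := by
    set P : Set (Matrix (Fin m ⊕ Fin n) (Fin m ⊕ Fin n) ℝ) := Set.pi univ fun _ =>
      Set.pi univ fun _ => Icc (-(C * b)) (C * b) with hP
    have hPc : IsCompact P := isCompact_univ_pi fun _ => isCompact_univ_pi fun _ => isCompact_Icc
    have e : Q = (fun h : SLd m n => h.1) ⁻¹' P := by
      ext h
      change (∀ i j, |h.1 i j| ≤ C * b) ↔ ∀ i ∈ univ, ∀ j ∈ univ, h.1 i j ∈ Icc (-(C * b)) (C * b)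
      simp only [mem_univ, forall_const, mem_Icc, abs_le]
    rw [e]
    exact Matrix.SpecialLinearGroup.isClosedEmbedding_val.isCompact_preimage hPc
  refine ⟨LatticeSpace.mk g, LatticeSpace.mk '' Q,
    hQc.image LatticeSpace.isOpenQuotientMap_mk.continuous, fun l => ?_⟩
  set a : Fin m ⊕ Fin n → ℝ :=
    Sum.elim (fun i => Real.exp (w.r i * l)) fun j => Real.exp (-(w.s j * l)) with ha
  have hadiag : (w.flow l).1 = Matrix.diagonal a := rfl
  have hadet : ∏ i, a i = 1 := by
    rw [← Matrix.det_diagonal, ← hadiag]; exact (w.flow l).2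
  have hHdet : (Matrix.diagonal a * V).det = V.det := by
    rw [Matrix.det_mul, Matrix.det_diagonal, hadet, one_mul]
  -- An element of the order whose conjugates u_i satisfy |a_i u_i| ≤ C. As ∏ a_i = 1, its norm ∏
  -- u_i = det M is bounded, so M falls into finitely many cosets.
  obtain ⟨z, hz0, hz⟩ := exists_int_abs_mulVec_le (H := Matrix.diagonal a * V) (C := C)
    (by rwa [hHdet]) (by linarith) (by
      rw [hHdet]
      calc |V.det| < C := by linarith
        _ = C ^ 1 := (pow_one C).symm
        _ ≤ _ := pow_le_pow_right₀ hC1 (by omega))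
  obtain ⟨M, hM, hM0⟩ := hmul z hz0
  set u := V.mulVec fun i => (z i : ℝ) with hu
  have hz' : ∀ i, |a i * u i| ≤ C := by
    intro i
    have := hz i
    rwa [← Matrix.mulVec_mulVec, Matrix.mulVec_diagonal] at this
  set MR : Matrix (Fin m ⊕ Fin n) (Fin m ⊕ Fin n) ℝ := M.map (Int.cast : ℤ → ℝ) with hMR
  have hcast : ∀ N : Matrix (Fin m ⊕ Fin n) (Fin m ⊕ Fin n) ℤ,
      (N.map (Int.cast : ℤ → ℝ)).det = (N.det : ℝ) := fun N =>
    ((Int.castRingHom ℝ).map_det N).symm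
  have hdetM : (M.det : ℝ) = ∏ i, u i := by
    have h := congrArg Matrix.det hM
    rw [Matrix.det_mul, Matrix.det_mul, Matrix.det_diagonal, hcast, mul_comm] at h
    exact mul_right_cancel₀ hV h
  have hMB : M.det.natAbs ≤ B := by
    refine Nat.le_floor ?_
    rw [Nat.cast_natAbs, Int.cast_abs, hdetM, ← one_mul (∏ i, u i), ← hadet,
      ← Finset.prod_mul_distrib, Finset.abs_prod]
    exact (Finset.prod_le_prod (fun _ _ => abs_nonneg _) fun i _ => hz' i).trans (by simp)
  obtain ⟨M', hM'b, hM'd, γ, hγ⟩ := hb M hM0 hMB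
  set γR : SLd m n := Matrix.SpecialLinearGroup.map (Int.castRingHom ℝ) γ with hγR
  have hγRmem : γR ∈ SLdInt m n := ⟨γ, rfl⟩
  set MR' : Matrix (Fin m ⊕ Fin n) (Fin m ⊕ Fin n) ℝ := M'.map (Int.cast : ℤ → ℝ) with hMR'
  have hMRu : IsUnit MR.det := by
    rw [hMR, hcast]; exact isUnit_iff_ne_zero.2 (by exact_mod_cast hM0)
  have hMRu' : IsUnit MR'.det := by
    rw [hMR', hcast, hM'd]; exact isUnit_iff_ne_zero.2 (by exact_mod_cast hM0)
  have hγM : MR' = γR.1 * MR := by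
    have : MR' = (γ.1 * M).map (Int.cast : ℤ → ℝ) := by rw [hMR', hγ]
    rw [this]
    exact Matrix.map_mul (f := Int.castRingHom ℝ)
  have hDcomm : D * Matrix.diagonal u = Matrix.diagonal u * D := by
    rw [hD, Matrix.diagonal_mul_diagonal, Matrix.diagonal_mul_diagonal]
    congr 1
    funext i
    exact mul_comm _ _
  -- The relation V M = diag(u) V replaces the unbounded factors a_i by the bounded a_i u_i, at the
  -- price of M'⁻¹, which takes only finitely many values.
  have key : (w.flow l * g * γR⁻¹).1 =
      Matrix.diagonal (fun i => a i * u i) * (D * V * MR'⁻¹) := by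
    have h1 : (w.flow l * g * γR⁻¹).1 * MR' =
        Matrix.diagonal (fun i => a i * u i) * (D * V * MR'⁻¹) * MR' := by
      rw [Matrix.mul_assoc (Matrix.diagonal _), Matrix.nonsing_inv_mul_cancel_right _ _ hMRu', hγM,
        ← Matrix.mul_assoc, ← Matrix.SpecialLinearGroup.coe_mul, inv_mul_cancel_right,
        Matrix.SpecialLinearGroup.coe_mul, hadiag, ← Matrix.diagonal_mul_diagonal]
      change Matrix.diagonal a * (D * V) * MR = _
      rw [Matrix.mul_assoc, Matrix.mul_assoc D, hM, ← Matrix.mul_assoc D, hDcomm]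
      simp only [Matrix.mul_assoc]
    rw [← Matrix.mul_nonsing_inv_cancel_right _ (w.flow l * g * γR⁻¹).1 hMRu', h1,
      Matrix.mul_nonsing_inv_cancel_right _ _ hMRu']
  refine ⟨w.flow l * g * γR⁻¹, fun i j => ?_, ?_⟩
  · rw [key, Matrix.diagonal_mul, abs_mul]
    refine mul_le_mul (hz' i) ?_ (abs_nonneg _) (by linarith)
    refine le_trans ?_ hM'b
    refine le_trans ?_ (Finset.single_le_sum (f := fun i => ∑ j, |(D * V * MR'⁻¹) i j|)
      (fun i _ => Finset.sum_nonneg fun j _ => abs_nonneg _) (Finset.mem_univ i))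
    exact Finset.single_le_sum (f := fun j => |(D * V * MR'⁻¹) i j|) (fun j _ => abs_nonneg _)
      (Finset.mem_univ j)
  · rw [LatticeSpace.smul_mk, LatticeSpace.mk_eq_mk]
    rwa [show (w.flow l * g * γR⁻¹)⁻¹ * (w.flow l * g) = γR by group]

end BoundedOrbit

/-! ### An invariant probability measure on Y. -/

section InvariantMeasure

variable {m n : ℕ} (w : Weights m n)

open ASLd

/-- The space of grids carries an invariant probability measure. -/
theorem Weights.exists_invariant_measure [NeZero m] [NeZero n] :
    ∃ ν : Measure (GridSpace m n), IsProbabilityMeasure ν ∧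
      MeasurePreserving (fun y => w.a • y) ν ν := by
  obtain ⟨x, K, hK, hx⟩ := w.exists_bounded_orbit
  obtain ⟨g, rfl⟩ := LatticeSpace.isOpenQuotientMap_mk.surjective x
  set y : GridSpace m n := GridSpace.mk (ofParts g 0) with hy
  have hproj : gridProj y = LatticeSpace.mk g := by rw [hy, gridProj_mk, linearPart_ofParts]
  have hK' : IsCompact (gridProj ⁻¹' K : Set (GridSpace m n)) := isCompact_gridProj_preimage hK
  set F : Set (OnePoint (GridSpace m n)) := (↑) '' (gridProj ⁻¹' K : Set (GridSpace m n)) with hF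
  have hFc : IsClosed F := (hK'.image OnePoint.continuous_coe).isClosed
  set y' : ℕ → Unit → OnePoint (GridSpace m n) := fun _ _ => y with hy'
  obtain ⟨μ, -, hμ⟩ := isCompact_univ.ultrafilter_le_nhds
    ((hyperfilter ℕ).map fun j => orbitProbability w.aBar (j + 1) (y' j)) (by simp)
  have hμ' : Tendsto (fun j => orbitProbability w.aBar (j + 1) (y' j))
    (hyperfilter ℕ : Filter ℕ) (𝓝 μ) := hμ
  have hle : (hyperfilter ℕ : Filter ℕ) ≤ atTop := Nat.hyperfilter_le_atTop
  have hinv : MeasurePreserving w.aBar (μ : Measure _) μ :=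
    measurePreserving_of_tendsto_orbitMeasure w.continuous_aBar
      ((tendsto_add_atTop_nat 1).mono_left hle) hμ'
  -- The orbit of the grid stays over a compact set, whose preimage in Y is compact, so no mass is
  -- lost to ∞.
  have hF0 : (μ : Measure _) Fᶜ = 0 := by
    refine measure_compl_eq_zero_of_tendsto_orbitMeasure (t := fun _ => 0)
      (Eventually.of_forall fun j => by simp) hle hFc (Eventually.of_forall fun j d l _ => ?_) hμ'
    rw [hy', aBar_iterate_coe]
    refine mem_image_of_mem _ ?_
    rw [mem_preimage, gridProj_smul, linearPart_a_pow, hproj]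
    exact hx l
  refine ⟨(μ : Measure _).comap ((↑) : GridSpace m n → OnePoint (GridSpace m n)), ⟨?_⟩, w.measurePreserving_comap_coe hinv⟩
  rw [(GridSpace.measurableEmbedding_coe (m := m) (n := n)).comap_apply, image_univ,
    ← OnePoint.compl_infty, prob_compl_eq_one_iff (measurableSet_singleton _)]
  refine measure_mono_null ?_ hF0
  rintro _ rfl ⟨z, -, hz⟩
  exact OnePoint.coe_ne_infty z hz

end InvariantMeasure

theorem proposition4p1 {m n : ℕ} [NeZero m] [NeZero n] (w : Weights m n)
    (A : Matrix (Fin m) (Fin n) ℝ) :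
    IsGLB {η : ℝ | ∃ ν, w.IsLimitMeasure A ν ∧ ν.real {OnePoint.infty} = η} (w.maxEscape A) ∧
    ∀ μA : Measure (OnePoint (LatticeSpace m n)), w.IsLimitMeasure A μA →
    ∀ η : ℝ, η = μA.real {OnePoint.infty} →
    ∀ ε : ℝ, 0 < ε → (∃ b ∈ w.Bad A ε, ¬ IsRationalPair A b) →
      ∃ μbar : Measure (OnePoint (GridSpace m n)),
        IsProbabilityMeasure μbar ∧
        MeasurePreserving w.aBar μbar μbar ∧
        μbar.support ⊆
          (fun y : GridSpace m n => (y : OnePoint (GridSpace m n))) '' w.target ε ∪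
            {OnePoint.infty} ∧
        μbar.map (OnePoint.map gridProj) = μA ∧
        ∃ μ : Measure (GridSpace m n),
          IsProbabilityMeasure μ ∧
          MeasurePreserving (fun y => w.a • y) μ μ ∧
          μbar = ENNReal.ofReal (1 - η) •
              μ.map (fun y : GridSpace m n => (y : OnePoint (GridSpace m n))) +
            ENNReal.ofReal η • Measure.dirac OnePoint.infty ∧
          ∀ 𝒜 : MeasurableSpace (GridSpace m n), w.IsDescendingSubordinate μ 𝒜 →
            ENNReal.ofReal (1 - η - w.r 0 * ((m : ℝ) - (dimH (w.Bad A ε)).toReal)) ≤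
              dynEntropy μbar w.aBar (extendAlgebra (w.tailAlgebra 𝒜)) := by
  refine ⟨w.isGLB_maxEscape A, ?_⟩
  rintro μA hμA _ rfl ε hε hirr
  obtain ⟨μbar, h1, h2, h3, h4, μ, h5, h6, h7, h8⟩ :=
    w.exists_grid_measure w.exists_invariant_measure hμA hε hirr
  exact ⟨μbar, h1, h2, h3, h4, μ, h5, h6, h7, h8⟩
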